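/- Let $\Bbbk$ be an algebraically closed field of characteristic $0$ and let $n\ge 1$. Let $\Lambda=\Lambda_n$ be the zigzag algebra of the star with internal node $0$ and leaves $1,\dots,n$: the quotient of the path algebra over $\Bbbk$ of the quiver with vertices $0,\dots,n$ and arrows $a_j:0\to j$, $b_j:j\to 0$ ($1\le j\le n$), with products written so that $a_j=e_ja_je_0$ and $b_j=e_0b_je_j$ for the vertex idempotents $e_0,\dots,e_n$, by the relations $a_jb_i=0$ ($i\ne j$), $b_1a_1=\dots=b_na_n=:c$, and the vanishing of every product of three arrows. Put $c_j=a_jb_j$, $J=\Bbbk\{c_1,\dots,c_n\}$ (a two-sided ideal) and $A=A_n=\Lambda/J$. Let $\widetilde{\mathcal B}_n$ be the $\Bbbk$-linear bicategory with one object whose $1$-morphisms are the $\Lambda$-$\Lambda$-bimodules in the additive closure $\mathrm{add}\{\Lambda,\ \Lambda e_k\otimes_\Bbbk e_0\Lambda\mid 0\le k\le n\}$, whose $2$-morphisms are the bimodule homomorphisms, and whose horizontal composition is $\otimes_\Lambda$. Let $\mathcal B_n$ be defined in the same way from $A$ and $\mathrm{add}\{A,\ Ae_k\otimes_\Bbbk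 e_0A\mid 0\le k\le n\}$. Write $P_k=\Lambda e_k\otimes_\Bbbk e_0\Lambda$; identify an endomorphism of $\Lambda$ with the image of $1$, and a morphism out of $P_k$ with the image of $e_k\otimes e_0$. Let $\mathbf C$ be the cell birepresentation of $\widetilde{\mathcal B}_n$ for the left cell of the $P_k$: the quotient of the sub-birepresentation of the principal birepresentation generated by that left cell by its largest stable ideal containing no identity morphism of a $1$-morphism in the cell. Let $\mathcal B_n$ act on the category $A\text{-proj}$ of finite dimensional projective left $A$-modules by $M\mapsto M\otimes_A-$. A *birepresentation* below is finitary: a $\Bbbk$-linear pseudofunctor to $\Bbbk$-linear categories, each equivalent to the category of finite dimensional projective modules over a finite dimensional $\Bbbk$-algebra. It is *simple transitive* if it has no stable ideal that, at some object, is neither zero nor the whole category. Two birepresentations are *equivalent* if there is a strong transformation between them whose components are equivalences of categories. **Proposition.** 1. There is a nilpotent two-sided biideal $\mathcal I$ of $\widetilde{\mathcal B}_n$ with $$\mathcal I(\Lambda,\Lambda)=\Bbbk\{c_1,\dots,c_n\},\qquad \mathcal I(P_j,\Lambda)=0,\qquad \mathcal I(\Lambda,P_j)=0\qquad(0\le j\le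 n),$$ $$\mathcal I(P_j,P_k)=\begin{cases}\Bbbk\{c_j\otimes e_0,\ c_j\otimes c\}& j=k\ne 0,\\ 0&\text{otherwise.}\end{cases}$$ 2. There is a $\Bbbk$-linear pseudofunctor $\mathbf Q:\widetilde{\mathcal B}_n\to\mathcal B_n$ induced by $\mathbf C$: that is, $\mathbf Q(P_k)\cong Ae_k\otimes_\Bbbk e_0A$ for all $k$, and $\mathbf C$ is equivalent to the composite of $\mathbf Q$ with the action of $\mathcal B_n$ on $A\text{-proj}$, through an equivalence sending $P_k$ to $Ae_k$ up to isomorphism for all $k$. 3. Every such $\mathbf Q$ annihilates $\mathcal I$, and the induced $\Bbbk$-linear pseudofunctor $\widetilde{\mathcal B}_n/\mathcal I\to\mathcal B_n$ is a biequivalence. 4. For every such $\mathbf Q$, the simple transitive birepresentations of $\widetilde{\mathcal B}_n$ and of $\mathcal B_n$ coincide along $\mathbf Q$: a pseudofunctor $\mathbf M$ from $\mathcal B_n$ to $\Bbbk$-linear categories is a simple transitive birepresentation of $\mathcal B_n$ if and only if $\mathbf M\circ\mathbf Q$ is one of $\widetilde{\mathcal B}_n$; every simple transitive birepresentation of $\widetilde{\mathcal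 B}_n$ is equivalent to some $\mathbf M\circ\mathbf Q$ with $\mathbf M$ simple transitive; and simple transitive $\mathbf M,\mathbf M'$ are equivalent if and only if $\mathbf M\circ\mathbf Q,\mathbf M'\circ\mathbf Q$ are. -/

import Mathlib

open CategoryTheory TensorProduct

universe u v w u₁ v₁ w₁ u₂ v₂ w₂

/-- An `(R, S)`-bimodule over `k`: a `k`-module with a left action of the `k`-algebra `R` and a
right action of the `k`-algebra `S` (an action of the opposite algebra) that commute. -/
structure Bimodule (k : Type u) [Field k] (R S : Type u) [Ring R] [Algebra k R] [Ring S]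
    [Algebra k S] : Type (u + 1) where
  carrier : Type u
  [addCommGroup : AddCommGroup carrier]
  [module : Module k carrier]
  lact : R →ₐ[k] Module.End k carrier
  ract : Sᵐᵒᵖ →ₐ[k] Module.End k carrier
  lact_ract : ∀ (r : R) (s : Sᵐᵒᵖ) (x : carrier), lact r (ract s x) = ract s (lact r x)

namespace Bimodule

attribute [instance] addCommGroup module

variable {k : Type u} [Field k] {R S T U V : Type u} [Ring R] [Algebra k R] [Ring S] [Algebra k S]
  [Ring T] [Algebra k T] [Ring U] [Algebra k U] [Ring V] [Algebra k V]

/-- The bimodule homomorphisms, as a subspace of the `k`-linear maps. -/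
def homs (M N : Bimodule k R S) : Submodule k (M.carrier →ₗ[k] N.carrier) where
  carrier := {f | (∀ r x, f (M.lact r x) = N.lact r (f x)) ∧
    ∀ s x, f (M.ract s x) = N.ract s (f x)}
  add_mem' := by
    rintro f g ⟨hf, hf2⟩ ⟨hg, hg2⟩
    exact ⟨fun r x => by simp [hf, hg], fun s x => by simp [hf2, hg2]⟩
  zero_mem' := by simp
  smul_mem' := by
    rintro c f ⟨hf, hf2⟩
    exact ⟨fun r x => by simp [hf], fun s x => by simp [hf2]⟩

instance : Category (Bimodule k R S) where
  Hom M N := homs M N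
  id M := ⟨LinearMap.id, by simp [homs]⟩
  comp f g := ⟨g.1.comp f.1, fun r x => by simp [f.2.1, g.2.1], fun s x => by simp [f.2.2, g.2.2]⟩

/-- The `k`-linear map underlying a bimodule homomorphism. -/
def lin {M N : Bimodule k R S} (f : M ⟶ N) : M.carrier →ₗ[k] N.carrier := f.1

/-- Construct a bimodule homomorphism. -/
def mkHom {M N : Bimodule k R S} (f : M.carrier →ₗ[k] N.carrier)
    (h1 : ∀ r x, f (M.lact r x) = N.lact r (f x))
    (h2 : ∀ s x, f (M.ract s x) = N.ract s (f x)) : M ⟶ N := ⟨f, h1, h2⟩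

@[simp] lemma lin_mkHom {M N : Bimodule k R S} (f : M.carrier →ₗ[k] N.carrier) (h1) (h2) :
    lin (mkHom (M := M) (N := N) f h1 h2) = f := rfl

lemma hom_ext {M N : Bimodule k R S} {f g : M ⟶ N} (h : ∀ x, lin f x = lin g x) : f = g :=
  Subtype.ext (LinearMap.ext h)

@[simp] lemma lin_id (M : Bimodule k R S) (x : M.carrier) : lin (𝟙 M) x = x := rfl
@[simp] lemma lin_comp {M N P : Bimodule k R S} (f : M ⟶ N) (g : N ⟶ P) (x : M.carrier) :
    lin (f ≫ g) x = lin g (lin f x) := rfl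
lemma lin_lact {M N : Bimodule k R S} (f : M ⟶ N) (r : R) (x : M.carrier) :
    lin f (M.lact r x) = N.lact r (lin f x) := f.2.1 r x
lemma lin_ract {M N : Bimodule k R S} (f : M ⟶ N) (s : Sᵐᵒᵖ) (x : M.carrier) :
    lin f (M.ract s x) = N.ract s (lin f x) := f.2.2 s x

instance : Preadditive (Bimodule k R S) where
  homGroup M N := inferInstanceAs (AddCommGroup (homs M N))
  add_comp := by intros; apply hom_ext; intro x; exact map_add (lin _) _ _
  comp_add := by intros; rfl

instance : Linear k (Bimodule k R S) where
  homModule M N := inferInstanceAs (Module k (homs M N))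
  smul_comp := by intros; apply hom_ext; intro x; exact map_smul (lin _) _ _
  comp_smul := by intros; rfl

@[simp] lemma lin_add {M N : Bimodule k R S} (f g : M ⟶ N) : lin (f + g) = lin f + lin g := rfl
@[simp] lemma lin_smul {M N : Bimodule k R S} (c : k) (f : M ⟶ N) : lin (c • f) = c • lin f := rfl
@[simp] lemma lin_zero {M N : Bimodule k R S} : lin (0 : M ⟶ N) = 0 := rfl

/-- The algebra as a bimodule over itself. -/
def self (k R : Type u) [Field k] [Ring R] [Algebra k R] : Bimodule k R R where
  carrier := R
  lact := Algebra.lmul k R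
  ract :=
    { toFun := fun s => LinearMap.mulRight k s.unop
      map_one' := by ext; simp
      map_mul' := by intros; ext; simp [mul_assoc]
      map_zero' := by ext; simp
      map_add' := by intros; ext; simp [mul_add]
      commutes' := by intro c; ext x; simp [Algebra.smul_def, (Algebra.commutes c x).symm] }
  lact_ract := by intros; simp [mul_assoc]

/-- The subspace of `M ⊗ₖ N` spanned by the elements `m s ⊗ n - m ⊗ s n`. -/
def balanced (M : Bimodule k R S) (N : Bimodule k S T) :
    Submodule k (M.carrier ⊗[k] N.carrier) :=
  Submodule.span k {x | ∃ m s n, x = M.ract (MulOpposite.op s) m ⊗ₜ[k] n - m ⊗ₜ[k] N.lact s n}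

/-- The underlying space of the tensor product `M ⊗ N` over `S`. -/
abbrev TensorCarrier (M : Bimodule k R S) (N : Bimodule k S T) : Type u :=
  (M.carrier ⊗[k] N.carrier) ⧸ balanced M N

/-- The canonical bilinear map `(m, n) ↦ m ⊗ n` to the tensor product over `S`. -/
def tmk (M : Bimodule k R S) (N : Bimodule k S T) :
    M.carrier →ₗ[k] N.carrier →ₗ[k] TensorCarrier M N :=
  (TensorProduct.mk k M.carrier N.carrier).compr₂ (balanced M N).mkQ

lemma tmk_balanced (M : Bimodule k R S) (N : Bimodule k S T) (m : M.carrier) (s : S)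
    (n : N.carrier) : tmk M N (M.ract (MulOpposite.op s) m) n = tmk M N m (N.lact s n) := by
  refine (Submodule.Quotient.eq _).2 (Submodule.subset_span ⟨m, s, n, rfl⟩)

lemma tensor_ext {M : Bimodule k R S} {N : Bimodule k S T} {X : Type u} [AddCommGroup X]
    [Module k X] {f g : TensorCarrier M N →ₗ[k] X}
    (h : ∀ m n, f (tmk M N m n) = g (tmk M N m n)) : f = g := by
  apply Submodule.linearMap_qext
  apply TensorProduct.ext'
  exact h

/-- A balanced bilinear map induces a linear map on the tensor product over `S`. -/
def tlift {M : Bimodule k R S} {N : Bimodule k S T} {X : Type u} [AddCommGroup X]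
    [Module k X] (φ : M.carrier →ₗ[k] N.carrier →ₗ[k] X)
    (h : ∀ m s n, φ (M.ract (MulOpposite.op s) m) n = φ m (N.lact s n)) :
    TensorCarrier M N →ₗ[k] X :=
  (balanced M N).liftQ (TensorProduct.lift φ) (by
    rw [balanced, Submodule.span_le]
    rintro _ ⟨m, s, n, rfl⟩
    simp [h])

@[simp] lemma tlift_tmk {M : Bimodule k R S} {N : Bimodule k S T} {X : Type u} [AddCommGroup X]
    [Module k X] (φ : M.carrier →ₗ[k] N.carrier →ₗ[k] X) (h) (m : M.carrier) (n : N.carrier) :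
    tlift φ h (tmk M N m n) = φ m n := by
  simp [tlift, tmk]

/-- Functoriality of the tensor product over `S` in linear maps that are compatible with the
action of `S`. -/
def tmapLin {M M' : Bimodule k R S} {N N' : Bimodule k S T} (f : M.carrier →ₗ[k] M'.carrier)
    (g : N.carrier →ₗ[k] N'.carrier) (hf : ∀ s x, f (M.ract s x) = M'.ract s (f x))
    (hg : ∀ r x, g (N.lact r x) = N'.lact r (g x)) :
    TensorCarrier M N →ₗ[k] TensorCarrier M' N' :=
  tlift ((tmk M' N').compl₁₂ f g) (by intros; simp [hf, hg, tmk_balanced])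

@[simp] lemma tmapLin_tmk {M M' : Bimodule k R S} {N N' : Bimodule k S T}
    (f : M.carrier →ₗ[k] M'.carrier) (g : N.carrier →ₗ[k] N'.carrier) (hf) (hg)
    (m : M.carrier) (n : N.carrier) :
    tmapLin f g hf hg (tmk M N m n) = tmk M' N' (f m) (g n) := by
  simp [tmapLin]

/-- The tensor product over `S` of an `(R, S)`-bimodule and an `(S, T)`-bimodule. -/
def tensor (M : Bimodule k R S) (N : Bimodule k S T) : Bimodule k R T where
  carrier := TensorCarrier M N
  lact :=
    { toFun := fun r => tmapLin (M.lact r) LinearMap.id (fun s x => M.lact_ract r s x)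
        (fun _ _ => rfl)
      map_one' := by apply tensor_ext; simp
      map_mul' := by intros; apply tensor_ext; simp
      map_zero' := by apply tensor_ext; simp
      map_add' := by intros; apply tensor_ext; simp
      commutes' := by intros; apply tensor_ext; simp }
  ract :=
    { toFun := fun r => tmapLin LinearMap.id (N.ract r) (fun _ _ => rfl)
        (fun s x => (N.lact_ract s r x).symm)
      map_one' := by apply tensor_ext; simp
      map_mul' := by intros; apply tensor_ext; simp
      map_zero' := by apply tensor_ext; simp
      map_add' := by intros; apply tensor_ext; simp
      commutes' := by
        intro c; apply tensor_ext; intro m n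
        have hc : N.ract (algebraMap k Tᵐᵒᵖ c) n = c • n := by rw [AlgHom.commutes]; rfl
        refine (tmapLin_tmk LinearMap.id (N.ract (algebraMap k Tᵐᵒᵖ c)) (fun _ _ => rfl)
          (fun s x => (N.lact_ract s _ x).symm) m n).trans ?_
        rw [hc]; exact (tmk M N m).map_smul c n }
  lact_ract := by
    intro r s x
    have : (tmapLin (M.lact r) LinearMap.id (fun s x => M.lact_ract r s x)
          (fun _ _ => rfl)).comp (tmapLin LinearMap.id (N.ract s) (fun _ _ => rfl)
          (fun s' x => (N.lact_ract s' s x).symm)) =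
        (tmapLin LinearMap.id (N.ract s) (fun _ _ => rfl)
          (fun s' x => (N.lact_ract s' s x).symm)).comp
        (tmapLin (M.lact r) LinearMap.id (fun s x => M.lact_ract r s x) (fun _ _ => rfl)) := by
      apply tensor_ext; simp
    exact LinearMap.congr_fun this x

/-- The canonical bilinear map `(m, n) ↦ m ⊗ n` to the tensor product over `S`. -/
def tmul (M : Bimodule k R S) (N : Bimodule k S T) :
    M.carrier →ₗ[k] N.carrier →ₗ[k] (tensor M N).carrier := tmk M N

lemma tmul_balanced (M : Bimodule k R S) (N : Bimodule k S T) (m : M.carrier) (s : S)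
    (n : N.carrier) : tmul M N (M.ract (MulOpposite.op s) m) n = tmul M N m (N.lact s n) :=
  tmk_balanced M N m s n

lemma lin_ext {M : Bimodule k R S} {N : Bimodule k S T} {X : Type u} [AddCommGroup X]
    [Module k X] {f g : (tensor M N).carrier →ₗ[k] X}
    (h : ∀ m n, f (tmul M N m n) = g (tmul M N m n)) : f = g := tensor_ext h

/-- A balanced bilinear map induces a linear map on the tensor product over `S`. -/
def liftLin {M : Bimodule k R S} {N : Bimodule k S T} {X : Type u} [AddCommGroup X]
    [Module k X] (φ : M.carrier →ₗ[k] N.carrier →ₗ[k] X)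
    (h : ∀ m s n, φ (M.ract (MulOpposite.op s) m) n = φ m (N.lact s n)) :
    (tensor M N).carrier →ₗ[k] X := tlift φ h

@[simp] lemma liftLin_tmul {M : Bimodule k R S} {N : Bimodule k S T} {X : Type u} [AddCommGroup X]
    [Module k X] (φ : M.carrier →ₗ[k] N.carrier →ₗ[k] X) (h) (m : M.carrier) (n : N.carrier) :
    liftLin φ h (tmul M N m n) = φ m n := tlift_tmk φ h m n

@[simp] lemma tensor_lact (M : Bimodule k R S) (N : Bimodule k S T) (r : R) (m n) :
    (tensor M N).lact r (tmul M N m n) = tmul M N (M.lact r m) n :=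
  tmapLin_tmk (M.lact r) LinearMap.id (fun s x => M.lact_ract r s x) (fun _ _ => rfl) m n

@[simp] lemma tensor_ract (M : Bimodule k R S) (N : Bimodule k S T) (r : Tᵐᵒᵖ) (m n) :
    (tensor M N).ract r (tmul M N m n) = tmul M N m (N.ract r n) :=
  tmapLin_tmk LinearMap.id (N.ract r) (fun _ _ => rfl) (fun s x => (N.lact_ract s r x).symm) m n

lemma tensor_hom_ext {M : Bimodule k R S} {N : Bimodule k S T} {X : Bimodule k R T}
    {f g : tensor M N ⟶ X} (h : ∀ m n, lin f (tmul M N m n) = lin g (tmul M N m n)) : f = g :=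
  Subtype.ext (lin_ext h)

/-- Construct a homomorphism of bimodules out of a tensor product. -/
def mkTensorHom {M : Bimodule k R S} {N : Bimodule k S T} {X : Bimodule k R T}
    (φ : M.carrier →ₗ[k] N.carrier →ₗ[k] X.carrier)
    (h : ∀ m s n, φ (M.ract (MulOpposite.op s) m) n = φ m (N.lact s n))
    (h1 : ∀ r m n, φ (M.lact r m) n = X.lact r (φ m n))
    (h2 : ∀ r m n, φ m (N.ract r n) = X.ract r (φ m n)) : tensor M N ⟶ X :=
  mkHom (liftLin φ h)
    (fun r x => by
      have : (liftLin φ h).comp ((tensor M N).lact r) = (X.lact r : _ →ₗ[k] _).comp (liftLin φ h) :=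
        lin_ext (by intros; simp [h1])
      exact LinearMap.congr_fun this x)
    (fun r x => by
      have : (liftLin φ h).comp ((tensor M N).ract r) = (X.ract r : _ →ₗ[k] _).comp (liftLin φ h) :=
        lin_ext (by intros; simp [h2])
      exact LinearMap.congr_fun this x)

@[simp] lemma lin_mkTensorHom {M : Bimodule k R S} {N : Bimodule k S T} {X : Bimodule k R T}
    (φ : M.carrier →ₗ[k] N.carrier →ₗ[k] X.carrier) (h) (h1) (h2) (m n) :
    lin (mkTensorHom (X := X) φ h h1 h2) (tmul M N m n) = φ m n :=
  liftLin_tmul φ h m n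

/-- The tensor product of homomorphisms. -/
def tmap {M M' : Bimodule k R S} {N N' : Bimodule k S T} (f : M ⟶ M') (g : N ⟶ N') :
    tensor M N ⟶ tensor M' N' :=
  mkTensorHom ((tmul M' N').compl₁₂ (lin f) (lin g))
    (by intros; simp [lin_lact, lin_ract, tmul_balanced])
    (by intros; simp [lin_lact]) (by intros; simp [lin_ract])

@[simp] lemma lin_tmap {M M' : Bimodule k R S} {N N' : Bimodule k S T} (f : M ⟶ M') (g : N ⟶ N')
    (m n) : lin (tmap f g) (tmul M N m n) = tmul M' N' (lin f m) (lin g n) := by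
  simp [tmap]

lemma tmap_add_left {M M' : Bimodule k R S} {N N' : Bimodule k S T} (f f' : M ⟶ M') (g : N ⟶ N') :
    tmap (f + f') g = tmap f g + tmap f' g := by apply tensor_hom_ext; intros; simp
lemma tmap_add_right {M M' : Bimodule k R S} {N N' : Bimodule k S T} (f : M ⟶ M') (g g' : N ⟶ N') :
    tmap f (g + g') = tmap f g + tmap f g' := by apply tensor_hom_ext; intros; simp
lemma tmap_smul_left {M M' : Bimodule k R S} {N N' : Bimodule k S T} (c : k) (f : M ⟶ M')
    (g : N ⟶ N') : tmap (c • f) g = c • tmap f g := by apply tensor_hom_ext; intros; simp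
lemma tmap_smul_right {M M' : Bimodule k R S} {N N' : Bimodule k S T} (c : k) (f : M ⟶ M')
    (g : N ⟶ N') : tmap f (c • g) = c • tmap f g := by apply tensor_hom_ext; intros; simp

/-- The trilinear map underlying the associativity map `(M ⊗ N) ⊗ P ⟶ M ⊗ (N ⊗ P)`. -/
def assocLin (M : Bimodule k R S) (N : Bimodule k S T) (P : Bimodule k T U) :
    (tensor M N).carrier →ₗ[k] P.carrier →ₗ[k] (tensor M (tensor N P)).carrier :=
  liftLin (LinearMap.mk₂ k (fun m n => (tmul M (tensor N P) m).comp (tmul N P n))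
      (by intros; ext; simp) (by intros; ext; simp) (by intros; ext; simp) (by intros; ext; simp))
      (by intros; ext; simp [tmul_balanced])

@[simp] lemma assocLin_tmul (M : Bimodule k R S) (N : Bimodule k S T) (P : Bimodule k T U)
    (m n p) : assocLin M N P (tmul M N m n) p = tmul M (tensor N P) m (tmul N P n p) := by
  simp [assocLin]

/-- The map `(M ⊗ N) ⊗ P ⟶ M ⊗ (N ⊗ P)`. -/
def assocHom (M : Bimodule k R S) (N : Bimodule k S T) (P : Bimodule k T U) :
    tensor (tensor M N) P ⟶ tensor M (tensor N P) :=
  mkTensorHom (assocLin M N P)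
    (by
      intro x s n
      have : ((assocLin M N P).comp ((tensor M N).ract (MulOpposite.op s))).flip n =
          (assocLin M N P).flip (P.lact s n) := by
        apply lin_ext; intros; simp [tmul_balanced]
      exact LinearMap.congr_fun this x)
    (by
      intro r x n
      have : ((assocLin M N P).comp ((tensor M N).lact r)).flip n =
          ((tensor M (tensor N P)).lact r : _ →ₗ[k] _).comp ((assocLin M N P).flip n) := by
        apply lin_ext; intros; simp
      exact LinearMap.congr_fun this x)
    (by
      intro r x n
      have : (assocLin M N P).flip (P.ract r n) =
          ((tensor M (tensor N P)).ract r : _ →ₗ[k] _).comp ((assocLin M N P).flip n) := by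
        apply lin_ext; intros; simp
      exact LinearMap.congr_fun this x)

@[simp] lemma lin_assocHom (M : Bimodule k R S) (N : Bimodule k S T) (P : Bimodule k T U)
    (m n p) : lin (assocHom M N P) (tmul (tensor M N) P (tmul M N m n) p) =
      tmul M (tensor N P) m (tmul N P n p) :=
  (lin_mkTensorHom _ _ _ _ _ _).trans (assocLin_tmul M N P m n p)

/-- The trilinear map underlying the associativity map `M ⊗ (N ⊗ P) ⟶ (M ⊗ N) ⊗ P`. -/
def assocInvLin (M : Bimodule k R S) (N : Bimodule k S T) (P : Bimodule k T U) :
    (tensor N P).carrier →ₗ[k] M.carrier →ₗ[k] (tensor (tensor M N) P).carrier :=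
  liftLin (LinearMap.mk₂ k
      (fun n p => ((tmul (tensor M N) P).flip p).comp ((tmul M N).flip n))
      (by intros; ext; simp) (by intros; ext; simp) (by intros; ext; simp) (by intros; ext; simp))
      (by intros; ext; simp [← tmul_balanced])

@[simp] lemma assocInvLin_tmul (M : Bimodule k R S) (N : Bimodule k S T) (P : Bimodule k T U)
    (m n p) : assocInvLin M N P (tmul N P n p) m = tmul (tensor M N) P (tmul M N m n) p := by
  simp [assocInvLin]

/-- The map `M ⊗ (N ⊗ P) ⟶ (M ⊗ N) ⊗ P`. -/
def assocInv (M : Bimodule k R S) (N : Bimodule k S T) (P : Bimodule k T U) :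
    tensor M (tensor N P) ⟶ tensor (tensor M N) P :=
  mkTensorHom (assocInvLin M N P).flip
    (by
      intro m s x
      have : (assocInvLin M N P).flip (M.ract (MulOpposite.op s) m) =
          ((assocInvLin M N P).flip m).comp ((tensor N P).lact s) := by
        apply lin_ext; intros; simp [tmul_balanced]
      exact LinearMap.congr_fun this x)
    (by
      intro r m x
      have : (assocInvLin M N P).flip (M.lact r m) =
          ((tensor (tensor M N) P).lact r : _ →ₗ[k] _).comp ((assocInvLin M N P).flip m) := by
        apply lin_ext; intros; simp
      exact LinearMap.congr_fun this x)
    (by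
      intro r m x
      have : ((assocInvLin M N P).flip m).comp ((tensor N P).ract r) =
          ((tensor (tensor M N) P).ract r : _ →ₗ[k] _).comp ((assocInvLin M N P).flip m) := by
        apply lin_ext; intros; simp
      exact LinearMap.congr_fun this x)

@[simp] lemma lin_assocInv (M : Bimodule k R S) (N : Bimodule k S T) (P : Bimodule k T U)
    (m n p) : lin (assocInv M N P) (tmul M (tensor N P) m (tmul N P n p)) =
      tmul (tensor M N) P (tmul M N m n) p :=
  (lin_mkTensorHom _ _ _ _ _ _).trans (assocInvLin_tmul M N P m n p)

lemma tensor_induction {M : Bimodule k R S} {N : Bimodule k S T}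
    {p : (tensor M N).carrier → Prop} (x : (tensor M N).carrier)
    (h : ∀ m n, p (tmul M N m n)) (h0 : p 0) (hadd : ∀ x y, p x → p y → p (x + y)) : p x := by
  obtain ⟨x, rfl⟩ := Submodule.Quotient.mk_surjective _ x
  induction x using TensorProduct.induction_on with
  | zero => exact h0
  | tmul m n => exact h m n
  | add x y hx hy => exact hadd _ _ hx hy

/-- The associativity isomorphism. -/
def assoc (M : Bimodule k R S) (N : Bimodule k S T) (P : Bimodule k T U) :
    tensor (tensor M N) P ≅ tensor M (tensor N P) where
  hom := assocHom M N P
  inv := assocInv M N P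
  hom_inv_id := by
    apply tensor_hom_ext
    intro x p
    induction x using tensor_induction with
    | h m n => simp
    | h0 => simp
    | hadd x y hx hy => simp only [map_add, LinearMap.add_apply, hx, hy]
  inv_hom_id := by
    apply tensor_hom_ext
    intro m x
    induction x using tensor_induction with
    | h m n => simp
    | h0 => simp
    | hadd x y hx hy => simp only [map_add, hx, hy]

@[simp] lemma assoc_hom (M : Bimodule k R S) (N : Bimodule k S T) (P : Bimodule k T U) :
    (assoc M N P).hom = assocHom M N P := rfl
@[simp] lemma assoc_inv (M : Bimodule k R S) (N : Bimodule k S T) (P : Bimodule k T U) :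
    (assoc M N P).inv = assocInv M N P := rfl

/-- The elements of the algebra, as elements of the bimodule `self k R`. -/
def selfIn (k R : Type u) [Field k] [Ring R] [Algebra k R] : R ≃ₗ[k] (self k R).carrier :=
  LinearEquiv.refl k R

@[simp] lemma self_lact (r x : R) : (self k R).lact r (selfIn k R x) = selfIn k R (r * x) := rfl
@[simp] lemma self_ract (r : Rᵐᵒᵖ) (x : R) :
    (self k R).ract r (selfIn k R x) = selfIn k R (x * r.unop) := rfl

/-- The map `R ⊗ M ⟶ M`. -/
def leftUnitHom (M : Bimodule k R S) : tensor (self k R) M ⟶ M :=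
  mkTensorHom (M.lact.toLinearMap.comp (selfIn k R).symm.toLinearMap)
    (by
      intro m s n
      obtain ⟨m, rfl⟩ := (selfIn k R).surjective m
      simp)
    (by
      intro r m n
      obtain ⟨m, rfl⟩ := (selfIn k R).surjective m
      simp)
    (by intros; simp [M.lact_ract])

@[simp] lemma lin_leftUnitHom (M : Bimodule k R S) (r : R) (m) :
    lin (leftUnitHom M) (tmul (self k R) M (selfIn k R r) m) = M.lact r m :=
  lin_mkTensorHom _ _ _ _ _ _

/-- The map `M ⟶ R ⊗ M`. -/
def leftUnitInv (M : Bimodule k R S) : M ⟶ tensor (self k R) M :=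
  mkHom (tmul (self k R) M (selfIn k R 1))
    (by intro r x; rw [← tmul_balanced, tensor_lact]; simp)
    (by intros; simp)

@[simp] lemma lin_leftUnitInv (M : Bimodule k R S) (m) :
    lin (leftUnitInv M) m = tmul (self k R) M (selfIn k R 1) m := rfl

/-- The isomorphism `R ⊗ M ≅ M` of bimodules. -/
def leftUnit (M : Bimodule k R S) : tensor (self k R) M ≅ M where
  hom := leftUnitHom M
  inv := leftUnitInv M
  hom_inv_id := by
    apply tensor_hom_ext
    intro r m
    obtain ⟨r, rfl⟩ := (selfIn k R).surjective r
    simp [← tmul_balanced]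
  inv_hom_id := by
    apply hom_ext
    intro m
    simp

@[simp] lemma leftUnit_hom (M : Bimodule k R S) : (leftUnit M).hom = leftUnitHom M := rfl
@[simp] lemma leftUnit_inv (M : Bimodule k R S) : (leftUnit M).inv = leftUnitInv M := rfl

/-- The map `M ⊗ S ⟶ M`. -/
def rightUnitHom (M : Bimodule k R S) : tensor M (self k S) ⟶ M :=
  mkTensorHom ((M.ract.toLinearMap.comp (MulOpposite.opLinearEquiv k).toLinearMap).comp
      (selfIn k S).symm.toLinearMap).flip
    (by
      intro m s n
      obtain ⟨n, rfl⟩ := (selfIn k S).surjective n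
      simp)
    (by intros; simp [M.lact_ract])
    (by
      intro r m n
      obtain ⟨n, rfl⟩ := (selfIn k S).surjective n
      simp)

@[simp] lemma lin_rightUnitHom (M : Bimodule k R S) (s : S) (m) :
    lin (rightUnitHom M) (tmul M (self k S) m (selfIn k S s)) = M.ract (MulOpposite.op s) m :=
  lin_mkTensorHom _ _ _ _ _ _

/-- The map `M ⟶ M ⊗ S`. -/
def rightUnitInv (M : Bimodule k R S) : M ⟶ tensor M (self k S) :=
  mkHom ((tmul M (self k S)).flip (selfIn k S 1))
    (by intros; simp)
    (by
      intro r x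
      obtain ⟨r, rfl⟩ := MulOpposite.op_surjective r
      simp [tmul_balanced])

@[simp] lemma lin_rightUnitInv (M : Bimodule k R S) (m) :
    lin (rightUnitInv M) m = tmul M (self k S) m (selfIn k S 1) := rfl

/-- The isomorphism `M ⊗ S ≅ M` of bimodules. -/
def rightUnit (M : Bimodule k R S) : tensor M (self k S) ≅ M where
  hom := rightUnitHom M
  inv := rightUnitInv M
  hom_inv_id := by
    apply tensor_hom_ext
    intro m r
    obtain ⟨r, rfl⟩ := (selfIn k S).surjective r
    simp [tmul_balanced]
  inv_hom_id := by
    apply hom_ext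
    intro m
    simp

@[simp] lemma rightUnit_hom (M : Bimodule k R S) : (rightUnit M).hom = rightUnitHom M := rfl
@[simp] lemma rightUnit_inv (M : Bimodule k R S) : (rightUnit M).inv = rightUnitInv M := rfl

end Bimodule

/-- A bundled `k`-algebra. -/
structure AlgObj (k : Type u) [Field k] : Type (u + 1) where
  carrier : Type u
  [ring : Ring carrier]
  [algebra : Algebra k carrier]

namespace AlgObj
attribute [instance] ring algebra
open Bimodule Bicategory
variable {k : Type u} [Field k]

/-- The bicategory of `k`-algebras, bimodules and bimodule homomorphisms. A `1`-morphism `R ⟶ S` is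
an `(S, R)`-bimodule, and the composite of `F : R ⟶ S` and `G : S ⟶ T` is `G ⊗ F`. -/
instance : Bicategory (AlgObj k) where
  Hom R S := Bimodule k S.carrier R.carrier
  id R := self k R.carrier
  comp F G := tensor G F
  homCategory R S := inferInstanceAs (Category (Bimodule k S.carrier R.carrier))
  whiskerLeft F _ _ η := tmap η (𝟙 F)
  whiskerRight η F := tmap (𝟙 F) η
  associator F G H := (assoc H G F).symm
  leftUnitor F := rightUnit F
  rightUnitor F := leftUnit F
  whiskerLeft_id := by intros; apply tensor_hom_ext; intros; simp
  whiskerLeft_comp := by intros; apply tensor_hom_ext; intros; simp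
  id_whiskerLeft := by
    intro a b f g η
    apply tensor_hom_ext
    intro m r
    obtain ⟨r, rfl⟩ := (selfIn k _).surjective r
    simp [lin_ract]
  comp_whiskerLeft := by
    intro a b c d f g h h' η
    apply tensor_hom_ext
    intro m x
    induction x using tensor_induction with
    | h m n => simp
    | h0 => simp
    | hadd x y hx hy => simp only [map_add, hx, hy]
  id_whiskerRight := by intros; apply tensor_hom_ext; intros; simp
  comp_whiskerRight := by intros; apply tensor_hom_ext; intros; simp
  whiskerRight_id := by
    intro a b f g η
    apply tensor_hom_ext
    intro r m
    obtain ⟨r, rfl⟩ := (selfIn k _).surjective r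
    simp [lin_lact]
  whiskerRight_comp := by
    intro a b c d f f' η g h
    apply tensor_hom_ext
    intro x m
    induction x using tensor_induction with
    | h m n => simp
    | h0 => simp
    | hadd x y hx hy => simp only [map_add, LinearMap.add_apply, hx, hy]
  whisker_assoc := by
    intro a b c d f g g' η h
    apply tensor_hom_ext
    intro m x
    induction x using tensor_induction with
    | h m n => simp
    | h0 => simp
    | hadd x y hx hy => simp only [map_add, hx, hy]
  whisker_exchange := by intros; apply tensor_hom_ext; intros; simp
  pentagon := by
    intro a b c d e f g h i
    apply tensor_hom_ext
    intro m x
    induction x using tensor_induction with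
    | h n y =>
      induction y using tensor_induction with
      | h p q => simp
      | h0 => simp
      | hadd x y hx hy => simp only [map_add, hx, hy]
    | h0 => simp
    | hadd x y hx hy => simp only [map_add, hx, hy]
  triangle := by
    intro a b c f g
    apply tensor_hom_ext
    intro m x
    induction x using tensor_induction with
    | h n y =>
      obtain ⟨n, rfl⟩ := (selfIn k _).surjective n
      simp [tmul_balanced]
    | h0 => simp
    | hadd x y hx hy => simp only [map_add, hx, hy]

end AlgObj

open Bicategory

/-- A bicategory whose categories of `1`-morphisms are preadditive, with biadditive horizontal
composition. -/
class PreadditiveBicategory (B : Type u₁) [Bicategory.{w₁, v₁} B] where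
  preadditive : ∀ a b : B, Preadditive (a ⟶ b)
  whiskerLeft_add : ∀ {a b c : B} (f : a ⟶ b) {g h : b ⟶ c} (η θ : g ⟶ h),
    f ◁ (η + θ) = f ◁ η + f ◁ θ
  add_whiskerRight : ∀ {a b c : B} {f g : a ⟶ b} (η θ : f ⟶ g) (h : b ⟶ c),
    (η + θ) ▷ h = η ▷ h + θ ▷ h

attribute [reducible, instance] PreadditiveBicategory.preadditive

/-- A `k`-linear bicategory: the categories of `1`-morphisms are `k`-linear and horizontal
composition is `k`-bilinear. -/
class LinearBicategory (k : Type u) [Field k] (B : Type u₁) [Bicategory.{w₁, v₁} B]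
    [PreadditiveBicategory B] where
  linear : ∀ a b : B, Linear k (a ⟶ b)
  whiskerLeft_smul : ∀ {a b c : B} (f : a ⟶ b) {g h : b ⟶ c} (r : k) (η : g ⟶ h),
    f ◁ (r • η) = r • (f ◁ η)
  smul_whiskerRight : ∀ {a b c : B} {f g : a ⟶ b} (r : k) (η : f ⟶ g) (h : b ⟶ c),
    (r • η) ▷ h = r • (η ▷ h)

attribute [reducible, instance] LinearBicategory.linear

/-- A `k`-linear pseudofunctor: the functors between categories of `1`-morphisms are `k`-linear. -/
structure IsLinearPseudofunctor (k : Type u) [Field k] {B : Type u₁} [Bicategory.{w₁, v₁} B]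
    [PreadditiveBicategory B] [LinearBicategory k B] {C : Type u₂} [Bicategory.{w₂, v₂} C]
    [PreadditiveBicategory C] [LinearBicategory k C] (F : B ⥤ᵖ C) : Prop where
  map₂_add : ∀ {a b : B} {f g : a ⟶ b} (η θ : f ⟶ g), F.map₂ (η + θ) = F.map₂ η + F.map₂ θ
  map₂_smul : ∀ {a b : B} {f g : a ⟶ b} (r : k) (η : f ⟶ g), F.map₂ (r • η) = r • F.map₂ η

/-- A pseudofunctor is a biequivalence if it is essentially surjective on objects and locally an
equivalence of categories. -/
structure IsBiequivalence {B : Type u₁} [Bicategory.{w₁, v₁} B] {C : Type u₂}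
    [Bicategory.{w₂, v₂} C] (F : B ⥤ᵖ C) : Prop where
  surj : ∀ c : C, ∃ b : B, Nonempty (Bicategory.Equivalence (F.obj b) c)
  locally_equiv : ∀ a b : B, (F.mapFunctor a b).IsEquivalence

/-! ### Ideals of linear categories -/

/-- A (two-sided) ideal of a `k`-linear category. -/
structure CatIdeal (k : Type u) [Field k] (C : Type u₁) [Category.{v₁} C] [Preadditive C]
    [Linear k C] where
  hom : ∀ X Y : C, Submodule k (X ⟶ Y)
  comp_left : ∀ {X Y Z : C} (f : X ⟶ Y) {g : Y ⟶ Z}, g ∈ hom Y Z → f ≫ g ∈ hom X Z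
  comp_right : ∀ {X Y Z : C} {f : X ⟶ Y} (g : Y ⟶ Z), f ∈ hom X Y → f ≫ g ∈ hom X Z

namespace CatIdeal

variable {k : Type u} [Field k] {C : Type u₁} [Category.{v₁} C] [Preadditive C] [Linear k C]

/-- The powers of an ideal: `I ^ (m + 1)` is spanned by the composites of a morphism in `I ^ m`
with a morphism in `I`, and `I ^ 0` is the whole category. -/
def pow (I : CatIdeal k C) : ℕ → ∀ X Y : C, Submodule k (X ⟶ Y)
  | 0 => fun _ _ => ⊤
  | m + 1 => fun X Y => Submodule.span k
      {h | ∃ (Z : C) (f : X ⟶ Z) (g : Z ⟶ Y), f ∈ pow I m X Z ∧ g ∈ I.hom Z Y ∧ h = f ≫ g}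

/-- The quotient of a `k`-linear category by an ideal: it has the same objects, and its spaces of
morphisms are the quotients by the ideal. -/
@[ext]
structure Quot (I : CatIdeal k C) where
  as : C

variable (I : CatIdeal k C)

/-- Composition in the quotient category. -/
def qcomp {X Y Z : C} : ((X ⟶ Y) ⧸ I.hom X Y) → ((Y ⟶ Z) ⧸ I.hom Y Z) → ((X ⟶ Z) ⧸ I.hom X Z) :=
  Quotient.map₂ (fun f g => f ≫ g) (by
    intro f f' hf g g' hg
    change (Submodule.quotientRel _) _ _ at hf hg ⊢
    rw [Submodule.quotientRel_def] at hf hg ⊢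
    have : f ≫ g - f' ≫ g' = (f - f') ≫ g + f' ≫ (g - g') := by simp
    rw [this]
    exact (I.hom X Z).add_mem (I.comp_right _ hf) (I.comp_left _ hg))

instance : Category I.Quot where
  Hom X Y := (X.as ⟶ Y.as) ⧸ I.hom X.as Y.as
  id X := Submodule.Quotient.mk (𝟙 X.as)
  comp f g := I.qcomp f g
  id_comp := by
    rintro X Y ⟨f⟩
    exact congrArg (Submodule.Quotient.mk (p := I.hom X.as Y.as)) (Category.id_comp f)
  comp_id := by
    rintro X Y ⟨f⟩
    exact congrArg (Submodule.Quotient.mk (p := I.hom X.as Y.as)) (Category.comp_id f)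
  assoc := by
    rintro X Y Z W ⟨f⟩ ⟨g⟩ ⟨h⟩
    exact congrArg (Submodule.Quotient.mk (p := I.hom X.as W.as)) (Category.assoc f g h)

/-- The class of a morphism in the quotient category. -/
def qmk {X Y : C} (f : X ⟶ Y) : (⟨X⟩ : I.Quot) ⟶ ⟨Y⟩ := Submodule.Quotient.mk (p := I.hom X Y) f

lemma qmk_surjective {X Y : I.Quot} (f : X ⟶ Y) :
    ∃ g : X.as ⟶ Y.as, f = I.qmk g := by
  obtain ⟨g, hg⟩ := Submodule.Quotient.mk_surjective (I.hom X.as Y.as) f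
  exact ⟨g, hg.symm⟩

lemma qmk_eq_iff {X Y : C} (f g : X ⟶ Y) : I.qmk f = I.qmk g ↔ f - g ∈ I.hom X Y :=
  Submodule.Quotient.eq _

lemma qmk_id (X : C) : I.qmk (𝟙 X) = 𝟙 (⟨X⟩ : I.Quot) := rfl
lemma qmk_comp {X Y Z : C} (f : X ⟶ Y) (g : Y ⟶ Z) : I.qmk (f ≫ g) = I.qmk f ≫ I.qmk g := rfl

instance : Preadditive I.Quot where
  homGroup X Y := inferInstanceAs (AddCommGroup ((X.as ⟶ Y.as) ⧸ I.hom X.as Y.as))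
  add_comp := by
    rintro X Y Z ⟨f⟩ ⟨f'⟩ ⟨g⟩
    exact congrArg (Submodule.Quotient.mk (p := I.hom X.as Z.as)) (Preadditive.add_comp _ _ _ f f' g)
  comp_add := by
    rintro X Y Z ⟨f⟩ ⟨g⟩ ⟨g'⟩
    exact congrArg (Submodule.Quotient.mk (p := I.hom X.as Z.as)) (Preadditive.comp_add _ _ _ f g g')

instance : Linear k I.Quot where
  homModule X Y := inferInstanceAs (Module k ((X.as ⟶ Y.as) ⧸ I.hom X.as Y.as))
  smul_comp := by
    rintro X Y Z r ⟨f⟩ ⟨g⟩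
    exact congrArg (Submodule.Quotient.mk (p := I.hom X.as Z.as)) (Linear.smul_comp _ _ _ r f g)
  comp_smul := by
    rintro X Y Z ⟨f⟩ r ⟨g⟩
    exact congrArg (Submodule.Quotient.mk (p := I.hom X.as Z.as)) (Linear.comp_smul _ _ _ f r g)

lemma qmk_add {X Y : C} (f g : X ⟶ Y) : I.qmk (f + g) = I.qmk f + I.qmk g := rfl
lemma qmk_smul {X Y : C} (r : k) (f : X ⟶ Y) : I.qmk (r • f) = r • I.qmk f := rfl

/-- The isomorphism in the quotient category induced by an isomorphism. -/
def qiso {X Y : C} (e : X ≅ Y) : (⟨X⟩ : I.Quot) ≅ ⟨Y⟩ where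
  hom := I.qmk e.hom
  inv := I.qmk e.inv
  hom_inv_id := by rw [← qmk_comp, e.hom_inv_id, qmk_id]
  inv_hom_id := by rw [← qmk_comp, e.inv_hom_id, qmk_id]

@[simp] lemma qiso_hom {X Y : C} (e : X ≅ Y) : (I.qiso e).hom = I.qmk e.hom := rfl
@[simp] lemma qiso_inv {X Y : C} (e : X ≅ Y) : (I.qiso e).inv = I.qmk e.inv := rfl

/-- A functor that respects given ideals induces a functor between the quotients. -/
def qmap {D : Type u₂} [Category.{v₂} D] [Preadditive D] [Linear k D] (J : CatIdeal k D)
    (F : C ⥤ D) [F.Additive] (h : ∀ {X Y : C} (f : X ⟶ Y), f ∈ I.hom X Y → F.map f ∈ J.hom _ _) :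
    I.Quot ⥤ J.Quot where
  obj X := ⟨F.obj X.as⟩
  map {X Y} := _root_.Quotient.lift (s := Submodule.quotientRel (I.hom X.as Y.as))
    (fun f => J.qmk (F.map f)) (by
      intro f g hfg
      rw [← Quotient.eq_iff_equiv, Quotient.eq, Submodule.quotientRel_def] at hfg
      rw [qmk_eq_iff, ← F.map_sub]
      exact h _ hfg)
  map_id X := by
    change J.qmk (F.map (𝟙 X.as)) = _
    rw [F.map_id]; rfl
  map_comp := by
    rintro X Y Z ⟨f⟩ ⟨g⟩
    change J.qmk (F.map (f ≫ g)) = J.qmk (F.map f) ≫ J.qmk (F.map g)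
    rw [F.map_comp]; rfl

lemma qmap_map {D : Type u₂} [Category.{v₂} D] [Preadditive D] [Linear k D] (J : CatIdeal k D)
    (F : C ⥤ D) [F.Additive] (h : ∀ {X Y : C} (f : X ⟶ Y), f ∈ I.hom X Y → F.map f ∈ J.hom _ _)
    {X Y : C} (f : X ⟶ Y) : (I.qmap J F h).map (I.qmk f) = J.qmk (F.map f) := rfl

end CatIdeal

/-! ### Biideals and quotients of bicategories -/

/-- A two-sided biideal of a `k`-linear bicategory. -/
structure Biideal (k : Type u) [Field k] (B : Type u₁) [Bicategory.{w₁, v₁} B]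
    [PreadditiveBicategory B] [LinearBicategory k B] where
  ideal : ∀ a b : B, CatIdeal k (a ⟶ b)
  whiskerLeft_mem : ∀ {a b c : B} (f : a ⟶ b) {g h : b ⟶ c} {η : g ⟶ h},
    η ∈ (ideal b c).hom g h → f ◁ η ∈ (ideal a c).hom (f ≫ g) (f ≫ h)
  whiskerRight_mem : ∀ {a b c : B} {f g : a ⟶ b} {η : f ⟶ g} (h : b ⟶ c),
    η ∈ (ideal a b).hom f g → η ▷ h ∈ (ideal a c).hom (f ≫ h) (g ≫ h)

namespace Biideal

variable {k : Type u} [Field k] {B : Type u₁} [Bicategory.{w₁, v₁} B]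
  [PreadditiveBicategory B] [LinearBicategory k B] (I : Biideal k B)

/-- A biideal is nilpotent if some power (formed with respect to vertical composition) vanishes. -/
def IsNilpotent : Prop :=
  ∃ m : ℕ, ∀ (a b : B) (f g : a ⟶ b), (I.ideal a b).pow m f g = ⊥

/-- The quotient of a `k`-linear bicategory by a biideal. -/
@[ext]
structure Quot (I : Biideal k B) where
  as : B

/-- Left whiskering in the quotient. -/
def qwhiskerLeft {a b c : B} (f : a ⟶ b) :
    (I.ideal b c).Quot ⥤ (I.ideal a c).Quot :=
  haveI : (Bicategory.precomp c f).Additive :=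
    ⟨fun {_ _ η θ} => PreadditiveBicategory.whiskerLeft_add f η θ⟩
  (I.ideal b c).qmap (I.ideal a c) (Bicategory.precomp c f) (fun _ h => I.whiskerLeft_mem f h)

/-- Right whiskering in the quotient. -/
def qwhiskerRight {a b c : B} (h : b ⟶ c) :
    (I.ideal a b).Quot ⥤ (I.ideal a c).Quot :=
  haveI : (Bicategory.postcomp a h).Additive :=
    ⟨fun {_ _ η θ} => PreadditiveBicategory.add_whiskerRight η θ h⟩
  (I.ideal a b).qmap (I.ideal a c) (Bicategory.postcomp a h) (fun _ hη => I.whiskerRight_mem h hη)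

lemma qwhiskerLeft_map {a b c : B} (f : a ⟶ b) {g h : b ⟶ c} (η : g ⟶ h) :
    (I.qwhiskerLeft f).map ((I.ideal b c).qmk η) = (I.ideal a c).qmk (f ◁ η) := rfl
lemma qwhiskerRight_map {a b c : B} {f g : a ⟶ b} (η : f ⟶ g) (h : b ⟶ c) :
    (I.qwhiskerRight h).map ((I.ideal a b).qmk η) = (I.ideal a c).qmk (η ▷ h) := rfl

instance : Bicategory I.Quot where
  Hom a b := (I.ideal a.as b.as).Quot
  id a := ⟨𝟙 a.as⟩
  comp f g := ⟨f.as ≫ g.as⟩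
  homCategory a b := inferInstanceAs (Category (I.ideal a.as b.as).Quot)
  whiskerLeft f _ _ η := (I.qwhiskerLeft f.as).map η
  whiskerRight η h := (I.qwhiskerRight h.as).map η
  associator f g h := (I.ideal _ _).qiso (α_ f.as g.as h.as)
  leftUnitor f := (I.ideal _ _).qiso (λ_ f.as)
  rightUnitor f := (I.ideal _ _).qiso (ρ_ f.as)
  whiskerLeft_id := by
    intro a b c f g; exact (I.qwhiskerLeft f.as).map_id g
  whiskerLeft_comp := by
    intro a b c f g h i η θ; exact (I.qwhiskerLeft f.as).map_comp η θ
  id_whiskerLeft := by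
    rintro a b f g ⟨η⟩
    exact congrArg ((I.ideal _ _).qmk) (Bicategory.id_whiskerLeft η)
  comp_whiskerLeft := by
    rintro a b c d f g h h' ⟨η⟩
    exact congrArg ((I.ideal _ _).qmk) (Bicategory.comp_whiskerLeft f.as g.as η)
  id_whiskerRight := by
    intro a b c f g; exact (I.qwhiskerRight g.as).map_id f
  comp_whiskerRight := by
    intro a b c f g h η θ i; exact (I.qwhiskerRight i.as).map_comp η θ
  whiskerRight_id := by
    rintro a b f g ⟨η⟩
    exact congrArg ((I.ideal _ _).qmk) (Bicategory.whiskerRight_id η)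
  whiskerRight_comp := by
    rintro a b c d f f' ⟨η⟩ g h
    exact congrArg ((I.ideal _ _).qmk) (Bicategory.whiskerRight_comp η g.as h.as)
  whisker_assoc := by
    rintro a b c d f g g' ⟨η⟩ h
    exact congrArg ((I.ideal _ _).qmk) (Bicategory.whisker_assoc f.as η h.as)
  whisker_exchange := by
    rintro a b c f g h i ⟨η⟩ ⟨θ⟩
    exact congrArg ((I.ideal _ _).qmk) (Bicategory.whisker_exchange η θ)
  pentagon := by
    intro a b c d e f g h i
    exact congrArg ((I.ideal _ _).qmk) (Bicategory.pentagon f.as g.as h.as i.as)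
  triangle := by
    intro a b c f g
    exact congrArg ((I.ideal _ _).qmk) (Bicategory.triangle f.as g.as)

instance : PreadditiveBicategory I.Quot where
  preadditive a b := inferInstanceAs (Preadditive (I.ideal a.as b.as).Quot)
  whiskerLeft_add := by
    rintro a b c f g h ⟨η⟩ ⟨θ⟩
    exact congrArg ((I.ideal _ _).qmk) (PreadditiveBicategory.whiskerLeft_add f.as η θ)
  add_whiskerRight := by
    rintro a b c f g ⟨η⟩ ⟨θ⟩ h
    exact congrArg ((I.ideal _ _).qmk) (PreadditiveBicategory.add_whiskerRight η θ h.as)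

instance : LinearBicategory k I.Quot where
  linear a b := inferInstanceAs (Linear k (I.ideal a.as b.as).Quot)
  whiskerLeft_smul := by
    rintro a b c f g h r ⟨η⟩
    exact congrArg ((I.ideal _ _).qmk) (LinearBicategory.whiskerLeft_smul f.as r η)
  smul_whiskerRight := by
    rintro a b c f g r ⟨η⟩ h
    exact congrArg ((I.ideal _ _).qmk) (LinearBicategory.smul_whiskerRight r η h.as)

variable {C : Type u₂} [Bicategory.{w₂, v₂} C] [PreadditiveBicategory C] [LinearBicategory k C]

/-- A `k`-linear pseudofunctor that annihilates a biideal induces a pseudofunctor on the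
quotient. -/
def lift (F : B ⥤ᵖ C) (hF : IsLinearPseudofunctor k F)
    (h : ∀ {a b : B} {f g : a ⟶ b} (η : f ⟶ g), η ∈ (I.ideal a b).hom f g → F.map₂ η = 0) :
    I.Quot ⥤ᵖ C where
  obj a := F.obj a.as
  map f := F.map f.as
  map₂ {a b f g} := _root_.Quotient.lift
    (s := Submodule.quotientRel ((I.ideal a.as b.as).hom f.as g.as))
    (fun η => F.map₂ η) (by
      intro η θ hηθ
      rw [← Quotient.eq_iff_equiv, Quotient.eq, Submodule.quotientRel_def] at hηθ
      have h1 : F.map₂ η = F.map₂ (η - θ) + F.map₂ θ := by rw [← hF.map₂_add, sub_add_cancel]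
      rw [h1, h _ hηθ, zero_add])
  map₂_id f := F.map₂_id f.as
  map₂_comp := by
    rintro a b f g h ⟨η⟩ ⟨θ⟩
    exact F.map₂_comp η θ
  mapId a := F.mapId a.as
  mapComp f g := F.mapComp f.as g.as
  map₂_whisker_left := by
    rintro a b c f g h ⟨η⟩
    exact F.map₂_whisker_left f.as η
  map₂_whisker_right := by
    rintro a b c f g ⟨η⟩ h
    exact F.map₂_whisker_right η h.as
  map₂_associator f g h := F.map₂_associator f.as g.as h.as
  map₂_left_unitor f := F.map₂_left_unitor f.as
  map₂_right_unitor f := F.map₂_right_unitor f.as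

end Biideal

/-! ### Linear categories and birepresentations -/

/-- A bundled `k`-linear category. -/
structure LinCat (k : Type u) [Field k] : Type (max u (v + 1) (w + 1)) where
  carrier : Type w
  [category : Category.{v} carrier]
  [preadditive : Preadditive carrier]
  [linear : Linear k carrier]

namespace LinCat

attribute [instance] category preadditive linear

variable {k : Type u} [Field k]

/-- The `k`-linear functors. -/
def linFunctor (C D : LinCat.{u, v, w} k) : ObjectProperty (C.carrier ⥤ D.carrier) :=
  fun F => F.Additive ∧ F.Linear k

/-- The `2`-category of `k`-linear categories, `k`-linear functors and natural transformations. -/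
instance : Bicategory (LinCat.{u, v, w} k) where
  Hom C D := (linFunctor C D).FullSubcategory
  id C := ⟨𝟭 C.carrier, ⟨inferInstance, inferInstance⟩⟩
  comp F G := ⟨F.obj ⋙ G.obj, by
    obtain ⟨F, hF, hF2⟩ := F
    obtain ⟨G, hG, hG2⟩ := G
    exact ⟨inferInstance, inferInstance⟩⟩
  homCategory C D := inferInstanceAs (Category (linFunctor C D).FullSubcategory)
  whiskerLeft F _ _ η := ObjectProperty.homMk (Functor.whiskerLeft F.obj η.hom)
  whiskerRight η H := ObjectProperty.homMk (Functor.whiskerRight η.hom H.obj)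
  associator F G H := ObjectProperty.isoMk _ (Functor.associator F.obj G.obj H.obj)
  leftUnitor F := ObjectProperty.isoMk _ (Functor.leftUnitor F.obj)
  rightUnitor F := ObjectProperty.isoMk _ (Functor.rightUnitor F.obj)
  whiskerLeft_id := by intros; ext; simp
  whiskerLeft_comp := by intros; ext; simp
  id_whiskerLeft := by intros; ext; simp
  comp_whiskerLeft := by intros; ext; simp
  id_whiskerRight := by intros; ext; simp
  comp_whiskerRight := by intros; ext; simp
  whiskerRight_id := by intros; ext; simp
  whiskerRight_comp := by intros; ext; simp
  whisker_assoc := by intros; ext; simp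
  whisker_exchange := by intros; ext; simp
  pentagon := by intros; ext; simp
  triangle := by intros; ext; simp

/-- The functor underlying a `1`-morphism of `LinCat`. -/
def fn {C D : LinCat.{u, v, w} k} (F : C ⟶ D) : C.carrier ⥤ D.carrier := F.obj

instance {C D : LinCat.{u, v, w} k} (F : C ⟶ D) : (fn F).Additive := F.property.1
instance {C D : LinCat.{u, v, w} k} (F : C ⟶ D) : (fn F).Linear k := F.property.2

/-- The natural transformation underlying a `2`-morphism of `LinCat`. -/
def nt {C D : LinCat.{u, v, w} k} {F G : C ⟶ D} (η : F ⟶ G) : fn F ⟶ fn G := η.hom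

/-- A `1`-morphism of `LinCat` from a `k`-linear functor. -/
def mk1 {C D : LinCat.{u, v, w} k} (F : C.carrier ⥤ D.carrier) (h : F.Additive)
    (h' : F.Linear k) : C ⟶ D := ⟨F, h, h'⟩

/-- A `2`-isomorphism of `LinCat` from its components. -/
def mkIso {C D : LinCat.{u, v, w} k} {F G : C ⟶ D} (e : fn F ≅ fn G) : F ≅ G :=
  ObjectProperty.isoMk _ e

lemma ext2 {C D : LinCat.{u, v, w} k} {F G : C ⟶ D} {η θ : F ⟶ G}
    (h : ∀ X, (nt η).app X = (nt θ).app X) : η = θ := by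
  apply ObjectProperty.hom_ext
  ext X
  exact h X

instance : PreadditiveBicategory (LinCat.{u, v, w} k) where
  preadditive C D := inferInstanceAs (Preadditive (linFunctor C D).FullSubcategory)
  whiskerLeft_add := by intros; rfl
  add_whiskerRight := by
    intro C D E F G η θ H
    apply ext2
    intro X
    exact (fn H).map_add

instance : LinearBicategory k (LinCat.{u, v, w} k) where
  linear C D := inferInstanceAs (Linear k (linFunctor C D).FullSubcategory)
  whiskerLeft_smul := by intros; rfl
  smul_whiskerRight := by
    intro C D E F G r η H
    apply ext2
    intro X
    exact (fn H).map_smul _ _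

end LinCat

namespace Birep

open LinCat

variable {k : Type u} [Field k] {B : Type u₁} [Bicategory.{w₁, v₁} B]

/-- A family of ideals of the underlying categories of a birepresentation that is stable under the
action of the bicategory. -/
structure StableIdeal (M : B ⥤ᵖ LinCat.{u, v, w} k) where
  ideal : ∀ a : B, CatIdeal k (M.obj a).carrier
  stable : ∀ {a b : B} (F : a ⟶ b) {X Y : (M.obj a).carrier} {f : X ⟶ Y},
    f ∈ (ideal a).hom X Y → (fn (M.map F)).map f ∈ (ideal b).hom _ _

/-- The quotient of a birepresentation by a stable ideal. -/
def quot (M : B ⥤ᵖ LinCat.{u, v, w} k) (J : StableIdeal M) : B ⥤ᵖ LinCat.{u, v, w} k where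
  obj a := ⟨(J.ideal a).Quot⟩
  map {a b} F := mk1 (C := ⟨(J.ideal a).Quot⟩) (D := ⟨(J.ideal b).Quot⟩)
    ((J.ideal a).qmap (J.ideal b) (fn (M.map F)) (fun _ h => J.stable F h))
    ⟨by
      rintro X Y ⟨f⟩ ⟨g⟩
      exact congrArg (J.ideal b).qmk (fn (M.map F)).map_add⟩
    ⟨by
      rintro X Y ⟨f⟩ r
      exact congrArg (J.ideal b).qmk ((fn (M.map F)).map_smul _ _)⟩
  map₂ {a b F G} η := ObjectProperty.homMk
    { app := fun X => (J.ideal b).qmk ((nt (M.map₂ η)).app X.as)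
      naturality := by
        rintro X Y ⟨f⟩
        exact congrArg (J.ideal b).qmk ((nt (M.map₂ η)).naturality f) }
  map₂_id {a b} F := ext2 fun X => congrArg (fun t => (J.ideal b).qmk ((nt t).app X.as))
    (M.map₂_id F)
  map₂_comp {a b F G H} η θ := ext2 fun X => congrArg (fun t => (J.ideal b).qmk ((nt t).app X.as))
    (M.map₂_comp η θ)
  mapId a := mkIso (NatIso.ofComponents
    (fun X => (J.ideal a).qiso
      { hom := (nt (M.mapId a).hom).app X.as
        inv := (nt (M.mapId a).inv).app X.as
        hom_inv_id := congrArg (fun t => (nt t).app X.as) (M.mapId a).hom_inv_id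
        inv_hom_id := congrArg (fun t => (nt t).app X.as) (M.mapId a).inv_hom_id })
    (by
      rintro X Y ⟨f⟩
      exact congrArg (J.ideal a).qmk ((nt (M.mapId a).hom).naturality f)))
  mapComp {a b c} F G := mkIso (NatIso.ofComponents
    (fun X => (J.ideal c).qiso
      { hom := (nt (M.mapComp F G).hom).app X.as
        inv := (nt (M.mapComp F G).inv).app X.as
        hom_inv_id := congrArg (fun t => (nt t).app X.as) (M.mapComp F G).hom_inv_id
        inv_hom_id := congrArg (fun t => (nt t).app X.as) (M.mapComp F G).inv_hom_id })
    (by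
      rintro X Y ⟨f⟩
      exact congrArg (J.ideal c).qmk ((nt (M.mapComp F G).hom).naturality f)))
  map₂_whisker_left {a b c} F {G H} η := ext2 fun X =>
    congrArg (fun t => (J.ideal c).qmk ((nt t).app X.as)) (M.map₂_whisker_left F η)
  map₂_whisker_right {a b c F G} η H := ext2 fun X =>
    congrArg (fun t => (J.ideal c).qmk ((nt t).app X.as)) (M.map₂_whisker_right η H)
  map₂_associator {a b c d} F G H := ext2 fun X =>
    congrArg (fun t => (J.ideal d).qmk ((nt t).app X.as)) (M.map₂_associator F G H)
  map₂_left_unitor {a b} F := ext2 fun X =>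
    congrArg (fun t => (J.ideal b).qmk ((nt t).app X.as)) (M.map₂_left_unitor F)
  map₂_right_unitor {a b} F := ext2 fun X =>
    congrArg (fun t => (J.ideal b).qmk ((nt t).app X.as)) (M.map₂_right_unitor F)

/-- The sub-birepresentation on full subcategories that are stable under the action. -/
def sub (M : B ⥤ᵖ LinCat.{u, v, w} k) (P : ∀ a : B, ObjectProperty (M.obj a).carrier)
    (hP : ∀ {a b : B} (F : a ⟶ b) (X : (M.obj a).carrier), P a X → P b ((fn (M.map F)).obj X)) :
    B ⥤ᵖ LinCat.{u, v, w} k where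
  obj a := ⟨(P a).FullSubcategory⟩
  map {a b} F := mk1 (C := ⟨(P a).FullSubcategory⟩) (D := ⟨(P b).FullSubcategory⟩)
    ((P b).lift ((P a).ι ⋙ fn (M.map F)) (fun X => hP F X.obj X.property))
    ⟨by
      intro X Y f g
      exact congrArg ObjectProperty.homMk (fn (M.map F)).map_add⟩
    ⟨by
      intro X Y f r
      exact congrArg ObjectProperty.homMk ((fn (M.map F)).map_smul _ _)⟩
  map₂ {a b F G} η := ObjectProperty.homMk
    { app := fun X => ObjectProperty.homMk ((nt (M.map₂ η)).app X.obj)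
      naturality := by
        intro X Y f
        exact congrArg ObjectProperty.homMk ((nt (M.map₂ η)).naturality f.hom) }
  map₂_id {a b} F := ext2 fun X => ObjectProperty.hom_ext _
    (congrArg (fun t => (nt t).app X.obj) (M.map₂_id F))
  map₂_comp {a b F G H} η θ := ext2 fun X => ObjectProperty.hom_ext _
    (congrArg (fun t => (nt t).app X.obj) (M.map₂_comp η θ))
  mapId a := mkIso (NatIso.ofComponents
    (fun X => (P a).isoMk
      { hom := (nt (M.mapId a).hom).app X.obj
        inv := (nt (M.mapId a).inv).app X.obj
        hom_inv_id := congrArg (fun t => (nt t).app X.obj) (M.mapId a).hom_inv_id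
        inv_hom_id := congrArg (fun t => (nt t).app X.obj) (M.mapId a).inv_hom_id })
    (by
      intro X Y f
      exact congrArg ObjectProperty.homMk ((nt (M.mapId a).hom).naturality f.hom)))
  mapComp {a b c} F G := mkIso (NatIso.ofComponents
    (fun X => (P c).isoMk
      { hom := (nt (M.mapComp F G).hom).app X.obj
        inv := (nt (M.mapComp F G).inv).app X.obj
        hom_inv_id := congrArg (fun t => (nt t).app X.obj) (M.mapComp F G).hom_inv_id
        inv_hom_id := congrArg (fun t => (nt t).app X.obj) (M.mapComp F G).inv_hom_id })
    (by
      intro X Y f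
      exact congrArg ObjectProperty.homMk ((nt (M.mapComp F G).hom).naturality f.hom)))
  map₂_whisker_left {a b c} F {G H} η := ext2 fun X => ObjectProperty.hom_ext _
    (congrArg (fun t => (nt t).app X.obj) (M.map₂_whisker_left F η))
  map₂_whisker_right {a b c F G} η H := ext2 fun X => ObjectProperty.hom_ext _
    (congrArg (fun t => (nt t).app X.obj) (M.map₂_whisker_right η H))
  map₂_associator {a b c d} F G H := ext2 fun X => ObjectProperty.hom_ext _
    (congrArg (fun t => (nt t).app X.obj) (M.map₂_associator F G H))
  map₂_left_unitor {a b} F := ext2 fun X => ObjectProperty.hom_ext _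
    (congrArg (fun t => (nt t).app X.obj) (M.map₂_left_unitor F))
  map₂_right_unitor {a b} F := ext2 fun X => ObjectProperty.hom_ext _
    (congrArg (fun t => (nt t).app X.obj) (M.map₂_right_unitor F))

variable [PreadditiveBicategory B] [LinearBicategory k B]

/-- The principal birepresentation `𝐁(z, -)`, acting by composition. -/
def principal (k : Type u) [Field k] {B : Type u₁} [Bicategory.{w₁, v₁} B]
    [PreadditiveBicategory B] [LinearBicategory k B] (z : B) : B ⥤ᵖ LinCat.{u, w₁, v₁} k where
  obj a := ⟨z ⟶ a⟩
  map {a b} F := mk1 (C := ⟨z ⟶ a⟩) (D := ⟨z ⟶ b⟩) (Bicategory.postcomp z F)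
    ⟨fun {_ _ η θ} => PreadditiveBicategory.add_whiskerRight η θ F⟩
    ⟨fun η r => LinearBicategory.smul_whiskerRight r η F⟩
  map₂ {a b F G} η := ObjectProperty.homMk
    { app := fun X => X ◁ η
      naturality := fun X Y f => (whisker_exchange f η).symm }
  map₂_id {a b} F := ext2 fun X => whiskerLeft_id _ _
  map₂_comp {a b F G H} η θ := ext2 fun X => whiskerLeft_comp _ _ _
  mapId a := mkIso (NatIso.ofComponents (fun X => ρ_ X) (fun f => by
    exact rightUnitor_naturality f))
  mapComp {a b c} F G := mkIso (NatIso.ofComponents (fun X => (α_ X F G).symm) (fun f => by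
    exact associator_inv_naturality_left f F G))
  map₂_whisker_left {a b c} F {G H} η := ext2 fun X => by
    change X ◁ F ◁ η = (α_ X F G).inv ≫ (X ≫ F) ◁ η ≫ (α_ X F H).hom
    simp
  map₂_whisker_right {a b c F G} η H := ext2 fun X => by
    change X ◁ (η ▷ H) = (α_ X F H).inv ≫ ((X ◁ η) ▷ H) ≫ (α_ X G H).hom
    simp
  map₂_associator {a b c d} F G H := ext2 fun X => by
    change X ◁ (α_ F G H).hom = (α_ X (F ≫ G) H).inv ≫ ((α_ X F G).inv ▷ H) ≫ 𝟙 _ ≫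
      (α_ (X ≫ F) G H).hom ≫ (α_ X F (G ≫ H)).hom
    simp
  map₂_left_unitor {a b} F := ext2 fun X => by
    change X ◁ (λ_ F).hom = (α_ X (𝟙 a) F).inv ≫ (ρ_ X).hom ▷ F ≫ 𝟙 _
    simp
  map₂_right_unitor {a b} F := ext2 fun X => by
    change X ◁ (ρ_ F).hom = (α_ X F (𝟙 b)).inv ≫ (ρ_ (X ≫ F)).hom ≫ 𝟙 _
    simp

/-- Two birepresentations are equivalent if there is a strong transformation between them whose
components are equivalences of categories. -/
def Equivalent {B : Type u₁} [Bicategory.{w₁, v₁} B] (M N : B ⥤ᵖ LinCat.{u, v, w} k) : Prop :=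
  ∃ Φ : Pseudofunctor.StrongTrans M N, ∀ a : B, (fn (Φ.app a)).IsEquivalence

end Birep

/-! ### Additive closures, cells and cell birepresentations -/

/-- The additive closure of a class of objects: the objects `M` whose identity is a finite sum of
endomorphisms that factor through objects in the class. (In an additive category these are exactly
the objects isomorphic to direct summands of finite direct sums of objects in the class.) -/
def addClosure {C : Type u₁} [Category.{v₁} C] [Preadditive C] (P : ObjectProperty C) :
    ObjectProperty C := fun M =>
  ∃ (m : ℕ) (G : Fin m → C) (f : ∀ i, M ⟶ G i) (g : ∀ i, G i ⟶ M),
    (∀ i, P (G i)) ∧ 𝟙 M = ∑ i, f i ≫ g i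

section addClosure

variable {C : Type u₁} [Category.{v₁} C] [Preadditive C] {P : ObjectProperty C}

lemma addClosure_of_fintype {M : C} {ι : Type*} [Fintype ι] (G : ι → C) (f : ∀ i, M ⟶ G i)
    (g : ∀ i, G i ⟶ M) (hG : ∀ i, P (G i)) (h : 𝟙 M = ∑ i, f i ≫ g i) : addClosure P M := by
  refine ⟨Fintype.card ι, fun i => G ((Fintype.equivFin ι).symm i), fun i => f _, fun i => g _,
    fun i => hG _, ?_⟩
  rw [h]
  exact (Equiv.sum_comp (Fintype.equivFin ι).symm (fun i => f i ≫ g i)).symm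

lemma addClosure_of_mem {M : C} (h : P M) : addClosure P M :=
  addClosure_of_fintype (ι := Unit) (fun _ => M) (fun _ => 𝟙 M) (fun _ => 𝟙 M) (fun _ => h)
    (by simp)

lemma addClosure_trans {M : C} {ι : Type*} [Fintype ι] (G : ι → C) (f : ∀ i, M ⟶ G i)
    (g : ∀ i, G i ⟶ M) (hG : ∀ i, addClosure P (G i)) (h : 𝟙 M = ∑ i, f i ≫ g i) :
    addClosure P M := by
  choose m G' f' g' hG' h' using hG
  refine addClosure_of_fintype (ι := Σ i, Fin (m i)) (fun x => G' x.1 x.2)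
    (fun x => f x.1 ≫ f' x.1 x.2) (fun x => g' x.1 x.2 ≫ g x.1) (fun x => hG' _ _) ?_
  rw [h, Fintype.sum_sigma]
  refine Finset.sum_congr rfl fun i _ => ?_
  have : f i ≫ g i = f i ≫ 𝟙 (G i) ≫ g i := by simp
  rw [this, h' i, Preadditive.sum_comp, Preadditive.comp_sum]
  simp

lemma addClosure_of_iso {M N : C} (e : M ≅ N) (h : addClosure P N) : addClosure P M :=
  addClosure_trans (ι := Unit) (fun _ => N) (fun _ => e.hom) (fun _ => e.inv) (fun _ => h)
    (by simp)

/-- An additive functor that sends a class of objects to the additive closure of another one does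
so for the additive closures. -/
lemma addClosure_map {D : Type u₂} [Category.{v₂} D] [Preadditive D] {Q : ObjectProperty D}
    (F : C ⥤ D) [F.Additive] (hF : ∀ X, P X → addClosure Q (F.obj X)) {M : C}
    (h : addClosure P M) : addClosure Q (F.obj M) := by
  obtain ⟨m, G, f, g, hG, h⟩ := h
  refine addClosure_trans (fun i => F.obj (G i)) (fun i => F.map (f i)) (fun i => F.map (g i))
    (fun i => hF _ (hG i)) ?_
  rw [← F.map_id, h, F.map_sum]
  simp

end addClosure

/-- An object is indecomposable if it is nonzero and is not a direct sum of two nonzero objects. -/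
def IsIndec {C : Type u₁} [Category.{v₁} C] [Preadditive C] (X : C) : Prop :=
  ¬ Limits.IsZero X ∧ ∀ (Y Z : C) (b : Limits.BinaryBicone Y Z), Nonempty b.IsBilimit →
    Nonempty (X ≅ b.pt) → Limits.IsZero Y ∨ Limits.IsZero Z

namespace Birep

open LinCat

section cell

variable {B : Type u₁} [Bicategory.{w₁, v₁} B]

/-- The left preorder: `F ≤ G` if `G` is a direct summand of `H ∘ F` for some `1`-morphism `H`. -/
def LeftLE {z a b : B} (F : z ⟶ a) (G : z ⟶ b) : Prop :=
  ∃ H : a ⟶ b, Nonempty (Retract G (F ≫ H))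

variable [PreadditiveBicategory B]

/-- The left cell of the `1`-morphism `F₀`: the indecomposable `1`-morphisms that are equivalent to
`F₀` with respect to the left preorder. -/
def leftCell {z b : B} (F₀ : z ⟶ b) (a : B) : ObjectProperty (z ⟶ a) :=
  fun F => IsIndec F ∧ LeftLE F₀ F ∧ LeftLE F F₀

/-- The additive closure of the `1`-morphisms `H ∘ F` with `F` in the left cell of `F₀`. -/
def cellHom {z b : B} (F₀ : z ⟶ b) (a : B) : ObjectProperty (z ⟶ a) :=
  addClosure fun G => ∃ (c : B) (F : z ⟶ c) (H : c ⟶ a), leftCell F₀ c F ∧ G = F ≫ H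

lemma cellHom_comp {z b : B} (F₀ : z ⟶ b) {a c : B} (K : a ⟶ c) (G : z ⟶ a)
    (hG : cellHom F₀ a G) : cellHom F₀ c (G ≫ K) := by
  have : (Bicategory.postcomp z K).Additive :=
    ⟨fun {_ _ η θ} => PreadditiveBicategory.add_whiskerRight η θ K⟩
  refine addClosure_map (Bicategory.postcomp z K) ?_ hG
  rintro _ ⟨d, F, H, hF, rfl⟩
  exact addClosure_of_iso (α_ F H K) (addClosure_of_mem ⟨d, F, H ≫ K, hF, rfl⟩)

end cell

section sum

variable {k : Type u} [Field k] {B : Type u₁} [Bicategory.{w₁, v₁} B]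
  {M : B ⥤ᵖ LinCat.{u, v, w} k}

/-- The sum of a set of stable ideals. -/
def StableIdeal.sum (S : Set (StableIdeal M)) : StableIdeal M where
  ideal a :=
    { hom := fun X Y => ⨆ J : S, (J.1.ideal a).hom X Y
      comp_left := by
        intro X Y Z f g hg
        have : (⨆ J : S, (J.1.ideal a).hom Y Z) ≤
            (⨆ J : S, (J.1.ideal a).hom X Z).comap (Linear.leftComp k Z f) :=
          iSup_le fun J g hg => Submodule.mem_iSup_of_mem (p := fun J : S => (J.1.ideal a).hom X Z)
            J ((J.1.ideal a).comp_left f hg)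
        exact this hg
      comp_right := by
        intro X Y Z f g hf
        have : (⨆ J : S, (J.1.ideal a).hom X Y) ≤
            (⨆ J : S, (J.1.ideal a).hom X Z).comap (Linear.rightComp k X g) :=
          iSup_le fun J f hf => Submodule.mem_iSup_of_mem (p := fun J : S => (J.1.ideal a).hom X Z)
            J ((J.1.ideal a).comp_right g hf)
        exact this hf }
  stable {a b} F {X Y f} hf := by
    have : (⨆ J : S, (J.1.ideal a).hom X Y) ≤
        (⨆ J : S, (J.1.ideal b).hom _ _).comap ((fn (M.map F)).mapLinearMap k) :=
      iSup_le fun J f hf => Submodule.mem_iSup_of_mem (p := fun J : S => (J.1.ideal b).hom _ _)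
        J (J.1.stable F hf)
    exact this hf

end sum

section cellBirep

variable (k : Type u) [Field k] {B : Type u₁} [Bicategory.{w₁, v₁} B]
  [PreadditiveBicategory B] [LinearBicategory k B]

/-- The sub-birepresentation of the principal birepresentation generated by the left cell of
`F₀`. -/
def cellSub {z b : B} (F₀ : z ⟶ b) : B ⥤ᵖ LinCat.{u, w₁, v₁} k :=
  sub (principal k z) (cellHom F₀) (fun K G hG => cellHom_comp F₀ K G hG)

/-- The maximal stable ideal of `cellSub` that contains no identity morphism of a `1`-morphism in
the left cell, as the sum of all such ideals. -/
def cellIdeal {z b : B} (F₀ : z ⟶ b) : StableIdeal (cellSub k F₀) :=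
  StableIdeal.sum {J | ∀ (a : B) (X : (cellHom F₀ a).FullSubcategory), leftCell F₀ a X.obj →
    𝟙 X ∉ (J.ideal a).hom X X}

/-- The cell birepresentation of the left cell of `F₀`. -/
def cell {z b : B} (F₀ : z ⟶ b) : B ⥤ᵖ LinCat.{u, w₁, v₁} k :=
  quot (cellSub k F₀) (cellIdeal k F₀)

end cellBirep

end Birep

/-! ### One-object locally full sub-bicategories -/

/-- A class of endomorphisms of an object that contains the identity and is closed under
composition. -/
structure IsMonoidalClass {B : Type u₁} [Bicategory.{w₁, v₁} B] {x : B}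
    (P : ObjectProperty (x ⟶ x)) : Prop where
  id : P (𝟙 x)
  comp : ∀ {F G : x ⟶ x}, P F → P G → P (F ≫ G)

/-- The locally full sub-bicategory with one object and with the given class of endomorphisms of
`x` as `1`-morphisms. -/
structure OneObj {B : Type u₁} [Bicategory.{w₁, v₁} B] {x : B} (P : ObjectProperty (x ⟶ x))
    (hP : IsMonoidalClass P) : Type where
  star ::

namespace OneObj

variable {B : Type u₁} [Bicategory.{w₁, v₁} B] {x : B} {P : ObjectProperty (x ⟶ x)}
  {hP : IsMonoidalClass P}

instance : Bicategory (OneObj P hP) where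
  Hom _ _ := P.FullSubcategory
  id _ := ⟨𝟙 x, hP.id⟩
  comp F G := ⟨F.obj ≫ G.obj, hP.comp F.property G.property⟩
  homCategory _ _ := inferInstanceAs (Category P.FullSubcategory)
  whiskerLeft F _ _ η := ObjectProperty.homMk (F.obj ◁ η.hom)
  whiskerRight η H := ObjectProperty.homMk (η.hom ▷ H.obj)
  associator F G H := ObjectProperty.isoMk _ (α_ F.obj G.obj H.obj)
  leftUnitor F := ObjectProperty.isoMk _ (λ_ F.obj)
  rightUnitor F := ObjectProperty.isoMk _ (ρ_ F.obj)
  whiskerLeft_id := by intros; ext; simp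
  whiskerLeft_comp := by intros; ext; simp
  id_whiskerLeft := by intros; ext; simp
  comp_whiskerLeft := by intros; ext; simp
  id_whiskerRight := by intros; ext; simp
  comp_whiskerRight := by intros; ext; simp
  whiskerRight_id := by intros; ext; simp
  whiskerRight_comp := by intros; ext; simp
  whisker_assoc := by intros; ext; simp
  whisker_exchange := by intros; ext; simp [whisker_exchange]
  pentagon := by intros; ext; simp
  triangle := by intros; ext; simp

instance [PreadditiveBicategory B] : PreadditiveBicategory (OneObj P hP) where
  preadditive _ _ := inferInstanceAs (Preadditive P.FullSubcategory)
  whiskerLeft_add F _ _ η θ := ObjectProperty.hom_ext _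
    (PreadditiveBicategory.whiskerLeft_add F.obj η.hom θ.hom)
  add_whiskerRight η θ H := ObjectProperty.hom_ext _
    (PreadditiveBicategory.add_whiskerRight η.hom θ.hom H.obj)

instance {k : Type u} [Field k] [PreadditiveBicategory B] [LinearBicategory k B] :
    LinearBicategory k (OneObj P hP) where
  linear _ _ := inferInstanceAs (Linear k P.FullSubcategory)
  whiskerLeft_smul F _ _ r η := ObjectProperty.hom_ext _
    (LinearBicategory.whiskerLeft_smul F.obj r η.hom)
  smul_whiskerRight r η H := ObjectProperty.hom_ext _
    (LinearBicategory.smul_whiskerRight r η.hom H.obj)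

/-- The `1`-morphism of the sub-bicategory given by an endomorphism in the class. -/
def of (F : x ⟶ x) (hF : P F) : (star : OneObj P hP) ⟶ star := ⟨F, hF⟩

/-- The inclusion of the sub-bicategory. -/
def incl (hP : IsMonoidalClass P) : OneObj P hP ⥤ᵖ B where
  obj _ := x
  map F := F.obj
  map₂ η := η.hom
  map₂_id F := rfl
  map₂_comp η θ := rfl
  mapId _ := Iso.refl _
  mapComp F G := Iso.refl _
  map₂_whisker_left F _ _ η := by
    change F.obj ◁ η.hom = 𝟙 _ ≫ F.obj ◁ η.hom ≫ 𝟙 _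
    simp
  map₂_whisker_right η H := by
    change η.hom ▷ H.obj = 𝟙 _ ≫ η.hom ▷ H.obj ≫ 𝟙 _
    simp
  map₂_associator F G H := by
    change (α_ F.obj G.obj H.obj).hom = 𝟙 _ ≫ (𝟙 _) ▷ H.obj ≫ (α_ F.obj G.obj H.obj).hom ≫
      F.obj ◁ (𝟙 _) ≫ 𝟙 _
    simp
  map₂_left_unitor F := by
    change (λ_ F.obj).hom = 𝟙 _ ≫ (𝟙 _) ▷ F.obj ≫ (λ_ F.obj).hom
    simp
  map₂_right_unitor F := by
    change (ρ_ F.obj).hom = 𝟙 _ ≫ F.obj ◁ (𝟙 _) ≫ (ρ_ F.obj).hom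
    simp

end OneObj

/-! ### Linearity of the bicategory of bimodules, and projective modules -/

namespace AlgObj

variable {k : Type u} [Field k]

open Bimodule

instance : PreadditiveBicategory (AlgObj k) where
  preadditive R S := inferInstanceAs (Preadditive (Bimodule k S.carrier R.carrier))
  whiskerLeft_add F _ _ η θ := tmap_add_left η θ (𝟙 F)
  add_whiskerRight η θ F := tmap_add_right (𝟙 F) η θ

instance : LinearBicategory k (AlgObj k) where
  linear R S := inferInstanceAs (Linear k (Bimodule k S.carrier R.carrier))
  whiskerLeft_smul F _ _ r η := tmap_smul_left r η (𝟙 F)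
  smul_whiskerRight r η F := tmap_smul_right r (𝟙 F) η

/-- The ground field as an algebra. -/
def ground (k : Type u) [Field k] : AlgObj k := ⟨k⟩

end AlgObj

/-- The left regular module of `R`. Left `R`-modules are regarded as `(R, k)`-bimodules; the right
action of `k` on such a bimodule is forced to be the scalar multiplication. -/
def leftRegular (k R : Type u) [Field k] [Ring R] [Algebra k R] : Bimodule k R k where
  carrier := R
  lact := Algebra.lmul k R
  ract :=
    { toFun := fun s => s.unop • LinearMap.id
      map_one' := by simp; rfl
      map_mul' := by
        intro a b
        ext x
        change (b.unop * a.unop) • x = a.unop • b.unop • x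
        rw [mul_comm, mul_smul]
      map_zero' := by simp
      map_add' := by intros; simp [add_smul]
      commutes' := by intro c; ext x; simp }
  lact_ract := by intros; simp

/-- The property of being a finite dimensional projective left module over the finite dimensional
algebra `R`, i.e. of lying in the additive closure of the left regular module. -/
def isProj (k : Type u) [Field k] (R : AlgObj k) :
    ObjectProperty (AlgObj.ground k ⟶ R) :=
  addClosure (C := Bimodule k R.carrier k) fun X => X = leftRegular k R.carrier

namespace Birep

open LinCat

variable {k : Type u} [Field k]

/-- A `k`-linear category is finitary if it is equivalent to the category of finite dimensional
projective modules over a finite dimensional algebra. -/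
def IsFinitaryCat (C : LinCat.{u, v, w} k) : Prop :=
  ∃ R : AlgObj k, Module.Finite k R.carrier ∧
    ∃ F : C.carrier ⥤ (isProj k R).FullSubcategory, F.Additive ∧ F.Linear k ∧ F.IsEquivalence

variable {B : Type u₁} [Bicategory.{w₁, v₁} B] [PreadditiveBicategory B] [LinearBicategory k B]

/-- A finitary birepresentation of a `k`-linear bicategory. -/
structure IsFinitaryBirep (M : B ⥤ᵖ LinCat.{u, v, w} k) : Prop where
  linear : IsLinearPseudofunctor k M
  finitary : ∀ a : B, IsFinitaryCat (M.obj a)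

/-- A simple transitive birepresentation: a finitary birepresentation without proper stable
ideals. -/
structure IsSimpleTransitive (M : B ⥤ᵖ LinCat.{u, v, w} k) : Prop where
  finitaryBirep : IsFinitaryBirep M
  simple : ∀ (J : StableIdeal M) (a : B),
    (∀ X Y, (J.ideal a).hom X Y = ⊥) ∨ (∀ X Y, (J.ideal a).hom X Y = ⊤)

end Birep

/-! ### The bimodules `R e ⊗ₖ f R` and the bicategories they generate -/

namespace Bimodule

variable {k : Type u} [Field k] {R : Type u} [Ring R] [Algebra k R]

/-- The left module `R e`, as an `(R, k)`-bimodule. -/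
def leftProj (k : Type u) [Field k] {R : Type u} [Ring R] [Algebra k R] (e : R) :
    Bimodule k R k where
  carrier := LinearMap.range (LinearMap.mulRight k e)
  lact :=
    { toFun := fun r => (LinearMap.mulLeft k r).restrict (by
        rintro _ ⟨x, rfl⟩; exact ⟨r * x, by simp [mul_assoc]⟩)
      map_one' := by ext; simp
      map_mul' := by intros; ext; simp [mul_assoc]
      map_zero' := by ext; simp
      map_add' := by intros; ext; simp [add_mul]
      commutes' := by intros; ext; simp [Algebra.smul_def] }
  ract :=
    { toFun := fun s => s.unop • LinearMap.id
      map_one' := by simp; rfl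
      map_mul' := by
        intro a b
        ext x
        change (((b.unop * a.unop) • x : LinearMap.range (LinearMap.mulRight k e)) : R) =
          ((a.unop • b.unop • x : LinearMap.range (LinearMap.mulRight k e)) : R)
        rw [mul_comm, mul_smul]
      map_zero' := by simp
      map_add' := by intros; simp [add_smul]
      commutes' := by intro c; ext x; simp }
  lact_ract := by intros; simp

/-- The right module `f R`, as a `(k, R)`-bimodule. -/
def rightProj (k : Type u) [Field k] {R : Type u} [Ring R] [Algebra k R] (f : R) :
    Bimodule k k R where
  carrier := LinearMap.range (LinearMap.mulLeft k f)
  lact := Algebra.ofId k _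
  ract :=
    { toFun := fun r => (LinearMap.mulRight k r.unop).restrict (by
        rintro _ ⟨x, rfl⟩; exact ⟨x * r.unop, by simp [mul_assoc]⟩)
      map_one' := by ext; simp
      map_mul' := by intros; ext; simp [mul_assoc]
      map_zero' := by ext; simp
      map_add' := by intros; ext; simp [mul_add]
      commutes' := by
        intro c; ext x; simp [Algebra.smul_def, (Algebra.commutes c (x : R)).symm] }
  lact_ract := by intro r s x; simp [Algebra.ofId_apply]

/-- The bimodule `R e ⊗ₖ f R`. -/
def proj (k : Type u) [Field k] {R : Type u} [Ring R] [Algebra k R] (e f : R) :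
    Bimodule k R R := tensor (leftProj k e) (rightProj k f)

/-- The element `x e ⊗ f y` of `R e ⊗ₖ f R`. -/
def projElt (k : Type u) [Field k] {R : Type u} [Ring R] [Algebra k R] (e f x y : R) :
    (proj k e f).carrier :=
  tmul (leftProj k e) (rightProj k f) ⟨x * e, x, rfl⟩ ⟨f * y, y, rfl⟩

instance {S T U : Type u} [Ring S] [Algebra k S] [Ring T] [Algebra k T] [Ring U] [Algebra k U]
    (M : Bimodule k S T) (N : Bimodule k T U)
    [Module.Finite k M.carrier] [Module.Finite k N.carrier] :
    Module.Finite k (tensor M N).carrier :=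
  inferInstanceAs (Module.Finite k ((M.carrier ⊗[k] N.carrier) ⧸ balanced M N))

instance [Module.Finite k R] (e : R) : Module.Finite k (leftProj k e).carrier :=
  inferInstanceAs (Module.Finite k (LinearMap.range (LinearMap.mulRight k e)))

instance [Module.Finite k R] (f : R) : Module.Finite k (rightProj k f).carrier :=
  inferInstanceAs (Module.Finite k (LinearMap.range (LinearMap.mulLeft k f)))

instance [Module.Finite k R] : Module.Finite k (leftRegular k R).carrier :=
  inferInstanceAs (Module.Finite k R)

lemma lact_ground {S : Type u} [Ring S] [Algebra k S] (M : Bimodule k k S) (c : k)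
    (x : M.carrier) : M.lact c x = c • x := by
  have : M.lact (algebraMap k k c) = algebraMap k _ c := M.lact.commutes c
  simpa using LinearMap.congr_fun this x

lemma ract_ground {S : Type u} [Ring S] [Algebra k S] (M : Bimodule k S k) (c : kᵐᵒᵖ)
    (x : M.carrier) : M.ract c x = c.unop • x := by
  have : M.ract (algebraMap k kᵐᵒᵖ c.unop) = algebraMap k _ c.unop := M.ract.commutes c.unop
  simpa using LinearMap.congr_fun this x

/-- A finite dimensional vector space is a direct sum of copies of the ground field. -/
lemma addClosure_ground (V : Bimodule k k k) [Module.Finite k V.carrier] :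
    addClosure (fun X : Bimodule k k k => X = self k k) V := by
  let b := Module.finBasis k V.carrier
  refine addClosure_of_fintype (fun _ => self k k)
    (fun i => mkHom ((selfIn k k).toLinearMap.comp (b.coord i)) ?_ ?_)
    (fun i => mkHom ((LinearMap.toSpanSingleton k _ (b i)).comp (selfIn k k).symm.toLinearMap)
      ?_ ?_) (fun _ => rfl) ?_
  · intro r x; simp [lact_ground]
  · intro r x; simp [ract_ground]
  · intro r x; simp [lact_ground, smul_comm r]
  · intro r x; simp [ract_ground, smul_comm r.unop]
  · apply hom_ext
    intro x
    have hs : ∀ (s : Finset (Fin (Module.finrank k V.carrier))) (g : _ → (V ⟶ V)),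
        lin (∑ i ∈ s, g i) x = ∑ i ∈ s, lin (g i) x := by
      intro s g
      induction s using Finset.cons_induction with
      | empty => simp
      | cons a s ha ih =>
        rw [Finset.sum_cons, Finset.sum_cons, lin_add, LinearMap.add_apply, ih]
    rw [hs]
    exact (b.sum_repr x).symm

/-- `R e` is a direct summand of `R` when `e` is idempotent. -/
lemma isProj_leftProj (e : R) (he : e * e = e) :
    addClosure (fun X : Bimodule k R k => X = leftRegular k R) (leftProj k e) := by
  refine addClosure_of_fintype (ι := Unit) (fun _ => leftRegular k R)
    (fun _ => mkHom (N := leftRegular k R) (Submodule.subtype _) ?_ ?_)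
    (fun _ => mkHom (M := leftRegular k R) (N := leftProj k e)
      (LinearMap.rangeRestrict (LinearMap.mulRight k e)) ?_ ?_)
    (fun _ => rfl) ?_
  · intro r x; rfl
  · intro r x; rfl
  · intro r x; exact Subtype.ext (mul_assoc r (show R from x) e)
  · intro r x; exact Subtype.ext (smul_mul_assoc r.unop (show R from x) e)
  · apply hom_ext
    rintro ⟨_, x, rfl⟩
    rw [Fintype.sum_unique]
    refine Subtype.ext ?_
    change x * e = x * e * e
    rw [mul_assoc, he]

end Bimodule

open Bimodule

variable {k : Type u} [Field k]

/-- The additive closure of the regular bimodule and the bimodules `R eᵢ ⊗ₖ e₀ R`. -/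
def starClass {n : ℕ} (R : AlgObj k) (e : Fin (n + 1) → R.carrier) : ObjectProperty (R ⟶ R) :=
  addClosure (C := Bimodule k R.carrier R.carrier) fun M =>
    M = self k R.carrier ∨ ∃ i, M = proj k (e i) (e 0)

lemma comp_proj {X : AlgObj k} {R : AlgObj k} [Module.Finite k R.carrier] (e f : R.carrier)
    (M : AlgObj.ground k ⟶ R) [Module.Finite k (Bimodule.carrier M)] (F : X ⟶ AlgObj.ground k) :
    addClosure (fun Z : X ⟶ R => Z = F ≫ (show AlgObj.ground k ⟶ R from leftProj k e))
      ((F ≫ M) ≫ (show R ⟶ R from proj k e f)) := by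
  let G : AlgObj.ground k ⟶ R := leftProj k e
  let H : R ⟶ AlgObj.ground k := rightProj k f
  have h1 : addClosure (fun Z : AlgObj.ground k ⟶ AlgObj.ground k => Z = 𝟙 _) (M ≫ H) := by
    have key : ∀ (N : Bimodule k R.carrier k) [Module.Finite k N.carrier],
        addClosure (fun Z : Bimodule k k k => Z = self k k) (tensor (rightProj k f) N) :=
      fun N _ => addClosure_ground _
    exact @key M ‹_›
  have i : (F ≫ M) ≫ (H ≫ G) ≅ F ≫ ((M ≫ H) ≫ G) :=
    α_ F M (H ≫ G) ≪≫ whiskerLeftIso F (α_ M H G).symm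
  refine addClosure_of_iso i ?_
  have : (Bicategory.postcomp (AlgObj.ground k) G ⋙ Bicategory.precomp R F).Additive :=
    ⟨fun {_ _ η θ} => by
      change F ◁ ((η + θ) ▷ G) = F ◁ (η ▷ G) + F ◁ (θ ▷ G)
      rw [PreadditiveBicategory.add_whiskerRight, PreadditiveBicategory.whiskerLeft_add]⟩
  refine addClosure_map (Bicategory.postcomp (AlgObj.ground k) G ⋙ Bicategory.precomp R F) ?_ h1
  rintro _ rfl
  exact addClosure_of_iso (whiskerLeftIso F (λ_ G)) (addClosure_of_mem rfl)

lemma addClosure_mono {C : Type u₁} [Category.{v₁} C] [Preadditive C] {P Q : ObjectProperty C}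
    (h : ∀ X, P X → Q X) {M : C} (hM : addClosure P M) : addClosure Q M := by
  obtain ⟨m, G, f, g, hG, h'⟩ := hM
  exact ⟨m, G, f, g, fun i => h _ (hG i), h'⟩

lemma starClass_isMonoidalClass {n : ℕ} (R : AlgObj k) [Module.Finite k R.carrier]
    (e : Fin (n + 1) → R.carrier) : IsMonoidalClass (starClass R e) where
  id := addClosure_of_mem (Or.inl rfl)
  comp {F G} hF hG := by
    have a1 : (Bicategory.precomp R F).Additive :=
      ⟨fun {_ _ η θ} => PreadditiveBicategory.whiskerLeft_add F η θ⟩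
    refine addClosure_map (Bicategory.precomp R F) ?_ hG
    intro Y hY
    have a2 : (Bicategory.postcomp R Y).Additive :=
      ⟨fun {_ _ η θ} => PreadditiveBicategory.add_whiskerRight η θ Y⟩
    refine addClosure_map (Bicategory.postcomp R Y) ?_ hF
    intro X hX
    rcases hY with rfl | ⟨j, rfl⟩
    · exact addClosure_of_iso (ρ_ X) (addClosure_of_mem hX)
    · rcases hX with rfl | ⟨i, rfl⟩
      · exact addClosure_of_iso (λ_ _) (addClosure_of_mem (Or.inr ⟨j, rfl⟩))
      · refine addClosure_mono ?_ (comp_proj (e j) (e 0)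
          (show AlgObj.ground k ⟶ R from leftProj k (e i))
          (show R ⟶ AlgObj.ground k from rightProj k (e 0)))
        rintro _ rfl
        exact Or.inr ⟨j, rfl⟩

section natural

variable {k : Type u} [Field k]

lemma isProj_comp {n : ℕ} (R : AlgObj k) [Module.Finite k R.carrier]
    (e : Fin (n + 1) → R.carrier) (he : ∀ i, e i * e i = e i) {F : R ⟶ R} (hF : starClass R e F)
    {X : AlgObj.ground k ⟶ R} (hX : isProj k R X) : isProj k R (X ≫ F) := by
  have a1 : (Bicategory.postcomp (AlgObj.ground k) F).Additive :=
    ⟨fun {_ _ η θ} => PreadditiveBicategory.add_whiskerRight η θ F⟩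
  refine addClosure_map (Bicategory.postcomp (AlgObj.ground k) F) ?_ hX
  intro Y hY
  have a2 : (Bicategory.precomp R Y).Additive :=
    ⟨fun {_ _ η θ} => PreadditiveBicategory.whiskerLeft_add Y η θ⟩
  refine addClosure_map (Bicategory.precomp R Y) ?_ hF
  intro G hG
  have hY' : Y = leftRegular k R.carrier := hY
  subst hY'
  rcases hG with rfl | ⟨i, rfl⟩
  · exact addClosure_of_iso (ρ_ _) (addClosure_of_mem rfl)
  · have fin : Module.Finite k (Bimodule.carrier (leftRegular k R.carrier)) := inferInstance
    have key := @comp_proj k _ (AlgObj.ground k) R _ (e i) (e 0)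
      (leftRegular k R.carrier) fin (𝟙 _)
    refine addClosure_of_iso (whiskerRightIso (λ_ _).symm _) ?_
    obtain ⟨m, G, f, g, hG, h⟩ := key
    refine addClosure_trans G f g (fun j => ?_) h
    have := hG j
    rw [this]
    exact addClosure_of_iso (λ_ _) (Bimodule.isProj_leftProj (e i) (he i))

/-- The natural birepresentation, on the category of finite dimensional projective left modules,
of the bicategory of bimodules generated by the bimodules `R eᵢ ⊗ₖ e₀ R`: a bimodule `M` acts by
`M ⊗ -`. -/
def naturalRep {n : ℕ} (R : AlgObj k) [Module.Finite k R.carrier]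
    (e : Fin (n + 1) → R.carrier) (he : ∀ i, e i * e i = e i) :
    OneObj (starClass R e) (starClass_isMonoidalClass R e) ⥤ᵖ LinCat.{u, u, u + 1} k :=
  Birep.sub ((OneObj.incl (starClass_isMonoidalClass R e)).comp
    (Birep.principal k (AlgObj.ground k))) (fun _ => isProj k R)
    (fun F _ hX => isProj_comp R e he F.property hX)

end natural

/-! ### The zigzag algebra of a star -/

/-- The vertices `e i` and the arrows `a j : 0 → j + 1` and `b j : j + 1 → 0` of the double quiver
of the star with internal node `0` and leaves `1, …, n`. The leaves are indexed by `Fin n`. -/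
inductive StarGen (n : ℕ) : Type
  | e (i : Fin (n + 1))
  | a (j : Fin n)
  | b (j : Fin n)

/-- The arrows among the generators. -/
def StarGen.IsArrow {n : ℕ} : StarGen n → Prop
  | .e _ => False
  | .a _ => True
  | .b _ => True

section zigzag

variable (k : Type u) [Field k] (n : ℕ)

open FreeAlgebra StarGen in
/-- The relations of the zigzag algebra of the star: first the relations of the path algebra of
the double quiver, then the zigzag relations, and last the vanishing of the third power of the arrow
ideal. -/
inductive ZigzagRel : FreeAlgebra k (StarGen n) → FreeAlgebra k (StarGen n) → Prop
  | idem (i) : ZigzagRel (ι k (e i) * ι k (e i)) (ι k (e i))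
  | orth (i j) : i ≠ j → ZigzagRel (ι k (e i) * ι k (e j)) 0
  | one : ZigzagRel (∑ i, ι k (e i)) 1
  | a_target (j) : ZigzagRel (ι k (e j.succ) * ι k (a j)) (ι k (a j))
  | a_source (j) : ZigzagRel (ι k (a j) * ι k (e 0)) (ι k (a j))
  | b_target (j) : ZigzagRel (ι k (e 0) * ι k (b j)) (ι k (b j))
  | b_source (j) : ZigzagRel (ι k (b j) * ι k (e j.succ)) (ι k (b j))
  | ab (i j) : i ≠ j → ZigzagRel (ι k (a j) * ι k (b i)) 0
  | ba (i j) : ZigzagRel (ι k (b i) * ι k (a i)) (ι k (b j) * ι k (a j))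
  | cube (x y z) : x.IsArrow → y.IsArrow → z.IsArrow →
      ZigzagRel (ι k x * ι k y * ι k z) 0

/-- The zigzag algebra of the star with `n` leaves. -/
abbrev Zigzag : Type u := RingQuot (ZigzagRel k n)

namespace Zigzag

variable {n}

/-- The class of a generator. -/
def gen (x : StarGen n) : Zigzag k n := RingQuot.mkAlgHom k (ZigzagRel k n) (FreeAlgebra.ι k x)

/-- The primitive idempotents. -/
def e (i : Fin (n + 1)) : Zigzag k n := gen k (.e i)
/-- The arrows from the internal node. -/
def a (j : Fin n) : Zigzag k n := gen k (.a j)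
/-- The arrows to the internal node. -/
def b (j : Fin n) : Zigzag k n := gen k (.b j)
/-- The two-cycle at a leaf. -/
def cyc (j : Fin n) : Zigzag k n := a k j * b k j

variable {k}

lemma idem (i : Fin (n + 1)) : e k i * e k i = e k i := by
  simpa [e, gen] using RingQuot.mkAlgHom_rel k (ZigzagRel.idem (k := k) i)
lemma orth {i j : Fin (n + 1)} (h : i ≠ j) : e k i * e k j = 0 := by
  simpa [e, gen] using RingQuot.mkAlgHom_rel k (ZigzagRel.orth (k := k) i j h)
lemma sum_e : ∑ i : Fin (n + 1), e k i = 1 := by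
  simpa [e, gen] using RingQuot.mkAlgHom_rel k (ZigzagRel.one (k := k) (n := n))
lemma e_a (j : Fin n) : e k j.succ * a k j = a k j := by
  simpa [e, a, gen] using RingQuot.mkAlgHom_rel k (ZigzagRel.a_target (k := k) j)
lemma a_e (j : Fin n) : a k j * e k 0 = a k j := by
  simpa [e, a, gen] using RingQuot.mkAlgHom_rel k (ZigzagRel.a_source (k := k) j)
lemma e_b (j : Fin n) : e k 0 * b k j = b k j := by
  simpa [e, b, gen] using RingQuot.mkAlgHom_rel k (ZigzagRel.b_target (k := k) j)
lemma b_e (j : Fin n) : b k j * e k j.succ = b k j := by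
  simpa [e, b, gen] using RingQuot.mkAlgHom_rel k (ZigzagRel.b_source (k := k) j)
lemma cube (x y z : StarGen n) (hx : x.IsArrow) (hy : y.IsArrow) (hz : z.IsArrow) :
    gen k x * (gen k y * gen k z) = 0 := by
  simpa [gen, mul_assoc] using RingQuot.mkAlgHom_rel k (ZigzagRel.cube (k := k) x y z hx hy hz)

/-- The paths of length at most two. -/
def paths (k : Type u) [Field k] (n : ℕ) : Set (Zigzag k n) :=
  Set.range (gen k) ∪ (Set.range fun p : StarGen n × StarGen n => gen k p.1 * gen k p.2)

lemma finite_starGen : Finite (StarGen n) :=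
  Finite.of_injective (β := Fin (n + 1) ⊕ Fin n ⊕ Fin n)
    (fun | .e i => .inl i | .a j => .inr (.inl j) | .b j => .inr (.inr j))
    (by rintro (i | i | i) (j | j | j) h <;> simp_all)

lemma e_mul_gen (i : Fin (n + 1)) (y : StarGen n) : e k i * gen k y = gen k y ∨
    e k i * gen k y = 0 := by
  rcases y with j | j | j
  · by_cases h : i = j
    · subst h; exact Or.inl (idem i)
    · exact Or.inr (orth h)
  · by_cases h : i = j.succ
    · subst h; exact Or.inl (e_a j)
    · refine Or.inr ?_
      change e k i * a k j = 0
      rw [← e_a, ← mul_assoc, orth h, zero_mul]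
  · by_cases h : i = 0
    · subst h; exact Or.inl (e_b j)
    · refine Or.inr ?_
      change e k i * b k j = 0
      rw [← e_b, ← mul_assoc, orth h, zero_mul]

lemma gen_mul_e (y : StarGen n) (i : Fin (n + 1)) : gen k y * e k i = gen k y ∨
    gen k y * e k i = 0 := by
  rcases y with j | j | j
  · by_cases h : j = i
    · subst h; exact Or.inl (idem j)
    · exact Or.inr (orth h)
  · by_cases h : 0 = i
    · subst h; exact Or.inl (a_e j)
    · refine Or.inr ?_
      change a k j * e k i = 0
      rw [← a_e, mul_assoc, orth h, mul_zero]
  · by_cases h : j.succ = i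
    · subst h; exact Or.inl (b_e j)
    · refine Or.inr ?_
      change b k j * e k i = 0
      rw [← b_e, mul_assoc, orth h, mul_zero]

lemma gen_mul_mem (x : StarGen n) {s : Zigzag k n} (hs : s ∈ Submodule.span k (paths k n)) :
    gen k x * s ∈ Submodule.span k (paths k n) := by
  have h2 : ∀ y z : StarGen n, gen k y * gen k z ∈ Submodule.span k (paths k n) :=
    fun y z => Submodule.subset_span (Or.inr ⟨(y, z), rfl⟩)
  refine Submodule.span_induction ?_ (by simp) (fun _ _ _ _ h h' => by
    rw [mul_add]; exact Submodule.add_mem _ h h') (fun r _ _ h => by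
    rw [mul_smul_comm]; exact Submodule.smul_mem _ r h) hs
  rintro _ (⟨y, rfl⟩ | ⟨⟨y, z⟩, rfl⟩)
  · exact h2 x y
  · change gen k x * (gen k y * gen k z) ∈ _
    by_cases hx : x.IsArrow
    · by_cases hy : y.IsArrow
      · by_cases hz : z.IsArrow
        · rw [cube x y z hx hy hz]; exact Submodule.zero_mem _
        · obtain ⟨i, rfl⟩ : ∃ i, z = .e i := by cases z <;> simp_all [StarGen.IsArrow]
          change gen k x * (gen k y * e k i) ∈ _
          rcases gen_mul_e (k := k) y i with h | h <;> rw [h]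
          · exact h2 x y
          · simp
      · obtain ⟨i, rfl⟩ : ∃ i, y = .e i := by cases y <;> simp_all [StarGen.IsArrow]
        change gen k x * (e k i * gen k z) ∈ _
        rcases e_mul_gen (k := k) i z with h | h <;> rw [h]
        · exact h2 x z
        · simp
    · obtain ⟨i, rfl⟩ : ∃ i, x = .e i := by cases x <;> simp_all [StarGen.IsArrow]
      change e k i * (gen k y * gen k z) ∈ _
      rw [← mul_assoc]
      rcases e_mul_gen (k := k) i y with h | h <;> rw [h]
      · exact h2 y z
      · simp

lemma mul_mem (x : FreeAlgebra k (StarGen n)) : ∀ s ∈ Submodule.span k (paths k n),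
    RingQuot.mkAlgHom k (ZigzagRel k n) x * s ∈ Submodule.span k (paths k n) := by
  induction x using FreeAlgebra.induction with
  | grade0 r =>
    intro s hs
    rw [AlgHom.commutes, ← Algebra.smul_def]
    exact Submodule.smul_mem _ r hs
  | grade1 x => exact fun s hs => gen_mul_mem x hs
  | mul x y hx hy =>
    intro s hs
    rw [map_mul, mul_assoc]
    exact hx _ (hy _ hs)
  | add x y hx hy =>
    intro s hs
    rw [map_add, add_mul]
    exact Submodule.add_mem _ (hx _ hs) (hy _ hs)

instance : Module.Finite k (Zigzag k n) := by
  refine ⟨⟨(Set.Finite.union (s := Set.range (gen k)) (t := Set.range fun p : StarGen n × StarGen n =>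
    gen k p.1 * gen k p.2) ?_ ?_).toFinset, ?_⟩⟩
  · have := finite_starGen (n := n)
    exact Set.finite_range _
  · have := finite_starGen (n := n)
    exact Set.finite_range _
  · rw [Set.Finite.coe_toFinset, eq_top_iff]
    rintro x -
    obtain ⟨x, rfl⟩ := RingQuot.mkAlgHom_surjective k (ZigzagRel k n) x
    rw [← mul_one (RingQuot.mkAlgHom k (ZigzagRel k n) x)]
    refine mul_mem x _ ?_
    rw [← sum_e]
    exact Submodule.sum_mem _ fun i _ => Submodule.subset_span (Or.inl ⟨.e i, rfl⟩)

end Zigzag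

/-- The quotient of the zigzag algebra by the ideal generated (in fact, spanned) by the two-cycles
at the leaves. -/
abbrev StarAlg : Type u := RingQuot fun x y : Zigzag k n => ∃ j, x = Zigzag.cyc k j ∧ y = 0

namespace StarAlg

variable {n}

/-- The projection from the zigzag algebra. -/
def mk : Zigzag k n →ₐ[k] StarAlg k n := RingQuot.mkAlgHom k _

/-- The primitive idempotents. -/
def e (i : Fin (n + 1)) : StarAlg k n := mk k (Zigzag.e k i)

lemma idem (i : Fin (n + 1)) : e k i * e k i = e k i := by
  rw [e, ← map_mul, Zigzag.idem]

instance : Module.Finite k (StarAlg k n) :=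
  Module.Finite.of_surjective (mk k (n := n)).toLinearMap (RingQuot.mkAlgHom_surjective k _)

end StarAlg

/-- The zigzag algebra as an object of the bicategory of algebras and bimodules. -/
abbrev zigzagObj : AlgObj k := ⟨Zigzag k n⟩

/-- The algebra `StarAlg` as an object of the bicategory of algebras and bimodules. -/
abbrev starObj : AlgObj k := ⟨StarAlg k n⟩

end zigzag

/-! ### The bicategories of projective bimodules -/

section main

variable (k : Type u) [Field k] (n : ℕ)

open Bimodule LinCat

/-- The one-object bicategory of `Λ`-`Λ`-bimodules in the additive closure of `Λ` and the
`Λ eᵢ ⊗ₖ e₀ Λ`, for `Λ` the zigzag algebra. -/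
abbrev BTilde : Type :=
  OneObj (starClass (zigzagObj k n) (Zigzag.e k)) (starClass_isMonoidalClass _ _)

/-- The one-object bicategory of `A`-`A`-bimodules in the additive closure of `A` and the
`A eᵢ ⊗ₖ e₀ A`, for `A` the quotient `StarAlg` of the zigzag algebra. -/
abbrev BStar : Type :=
  OneObj (starClass (starObj k n) (StarAlg.e k)) (starClass_isMonoidalClass _ _)

variable {n}

/-- The object of `BTilde`. -/
def objTilde : BTilde k n := OneObj.star

/-- The object of `BStar`. -/
def objStar : BStar k n := OneObj.star

/-- The regular bimodule `Λ`. -/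
def regTilde : (objTilde k : BTilde k n) ⟶ objTilde k :=
  OneObj.of (self k (Zigzag k n)) (addClosure_of_mem (Or.inl rfl))

/-- The bimodule `Λ eᵢ ⊗ₖ e₀ Λ`. -/
def projTilde (i : Fin (n + 1)) : (objTilde k : BTilde k n) ⟶ objTilde k :=
  OneObj.of (proj k (Zigzag.e k i) (Zigzag.e k 0)) (addClosure_of_mem (Or.inr ⟨i, rfl⟩))

/-- The bimodule `A eᵢ ⊗ₖ e₀ A`. -/
def projStar (i : Fin (n + 1)) : (objStar k : BStar k n) ⟶ objStar k :=
  OneObj.of (proj k (StarAlg.e k i) (StarAlg.e k 0)) (addClosure_of_mem (Or.inr ⟨i, rfl⟩))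

variable {k}

/-- The linear map underlying a bimodule homomorphism between bimodules in `BTilde`. -/
def linTilde {M N : (objTilde k : BTilde k n) ⟶ objTilde k} (η : M ⟶ N) :
    (Bimodule.carrier M.obj) →ₗ[k] (Bimodule.carrier N.obj) :=
  lin (show (show Bimodule k (Zigzag k n) (Zigzag k n) from M.obj) ⟶ N.obj from η.hom)

/-- The image of `1` under an endomorphism of the regular bimodule. -/
def valueOne (η : regTilde k (n := n) ⟶ regTilde k) : Zigzag k n :=
  (selfIn k (Zigzag k n)).symm (linTilde η (selfIn k (Zigzag k n) 1))

/-- The element `x eᵢ ⊗ e₀ y` of `Λ eᵢ ⊗ₖ e₀ Λ`. -/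
def eltTilde (i : Fin (n + 1)) (x y : Zigzag k n) : Bimodule.carrier (projTilde k i).obj :=
  projElt k (Zigzag.e k i) (Zigzag.e k 0) x y

open Zigzag in
/-- The values, on the indecomposable generators of `BTilde`, of the biideal that is divided out. An
endomorphism of `Λ` is identified with the image of `1`, a morphism out of `Λ eᵢ ⊗ₖ e₀ Λ` with the
image of `eᵢ ⊗ e₀`. -/
structure IsStarBiideal (I : Biideal k (BTilde k n)) : Prop where
  reg_reg : ∀ η : regTilde k ⟶ regTilde k,
    η ∈ (I.ideal _ _).hom (regTilde k) (regTilde k) ↔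
      valueOne η ∈ Submodule.span k (Set.range (cyc k))
  proj_reg : ∀ i, (I.ideal _ _).hom (projTilde k i) (regTilde k) = ⊥
  reg_proj : ∀ i, (I.ideal _ _).hom (regTilde k) (projTilde k i) = ⊥
  proj_proj_of_ne : ∀ i j, i ≠ j → (I.ideal _ _).hom (projTilde k i) (projTilde k j) = ⊥
  proj_proj_zero : (I.ideal _ _).hom (projTilde k 0) (projTilde k 0) = ⊥
  proj_proj_succ : ∀ (j : Fin n) (η : projTilde k j.succ ⟶ projTilde k j.succ),
    η ∈ (I.ideal _ _).hom (projTilde k j.succ) (projTilde k j.succ) ↔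
      linTilde η (eltTilde j.succ 1 1) ∈ Submodule.span k
        {eltTilde j.succ (cyc k j) 1, eltTilde j.succ (cyc k j) (b k j * a k j)}

variable (k n)

/-- The birepresentation of `BStar` on the category of projective `A`-modules. -/
def natStar : BStar k n ⥤ᵖ LinCat.{u, u, u + 1} k :=
  naturalRep (starObj k n) (StarAlg.e k) (StarAlg.idem k)

/-- The module `A eᵢ`, as an object of the category on which `BStar` acts. -/
def projModStar (i : Fin (n + 1)) : ((natStar k n).obj (objStar k)).carrier :=
  ⟨leftProj k (StarAlg.e k i), isProj_leftProj _ (StarAlg.idem k i)⟩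

/-- The cell birepresentation of `BTilde` for the left cell of the bimodules `Λ eᵢ ⊗ₖ e₀ Λ`. -/
def cellTilde : BTilde k n ⥤ᵖ LinCat.{u, u, u + 1} k := Birep.cell k (projTilde k (n := n) 0)

variable {k n}

/-- A `k`-linear pseudofunctor `BTilde ⥤ᵖ BStar` that is induced by the cell birepresentation of
`BTilde`: it sends `Λ eᵢ ⊗ₖ e₀ Λ` to `A eᵢ ⊗ₖ e₀ A`, and there is an equivalence from the cell
birepresentation to its composite with the action of `BStar` on projective `A`-modules that sends
`Λ eᵢ ⊗ₖ e₀ Λ` to `A eᵢ`. -/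
structure IsInducedByCell (Q : BTilde k n ⥤ᵖ BStar k n) : Prop where
  linear : IsLinearPseudofunctor k Q
  map_proj : ∀ i, Nonempty (Q.map (projTilde k i) ≅ projStar k i)
  cell : ∃ Φ : Pseudofunctor.StrongTrans (cellTilde k n) (Q.comp (natStar k n)),
    (∀ x, (fn (Φ.app x)).IsEquivalence) ∧
    ∀ i, ∃ h : Birep.cellHom (projTilde k 0) (objTilde k) (projTilde k i),
      Nonempty ((fn (Φ.app (objTilde k))).obj ⟨⟨projTilde k i, h⟩⟩ ≅ projModStar k n i)

end main

/-!
Let `J` be the span of the two-cycles `c_j` at the leaves, so that `A = Λ / J`. Everything rests on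
the reduction `M ↦ M / (J M + M J)` from `Λ`-bimodules to `A`-bimodules, and on the identities
`J e₀ = e₀ J = 0` and `J ^ 2 = 0`.

*Reduction is a pseudofunctor.* Since `e₀ J = 0`, all bimodules in the additive closure of `Λ` and
the `Λ eᵢ ⊗ₖ e₀ Λ` satisfy `M J ⊆ J M` (`isNormal_of_starClass`). For such `M` the comparison
`red (M ⊗ N) ⟶ red M ⊗ red N` is invertible (`redTensor`), and reduction becomes the linear
pseudofunctor `redPseudo`. The biideal of the theorem is its kernel `starBiideal`: a homomorphism
lies in it if and only if its image lies in `J M + M J`. Evaluating this condition on generators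
gives its values (`isStarBiideal_starBiideal`). As `J ^ 2 = 0`, vertical and horizontal composites
of two of its elements vanish (`comp_eq_zero_of_redStarMap`, `tmap_eq_zero_of_redStarMap`), so it is
nilpotent.

*The cell birepresentation.* Tensoring the reduction of `M` with the simple `A`-module at the vertex
`0` gives a left `A`-module `fiber M`, and `fiber (K ⊗ M) ≅ red K ⊗ fiber M`. This functor sends
`Λ eᵢ ⊗ₖ e₀ Λ` to `A eᵢ`, and on the additive closure of these bimodules it is full with nilpotent
kernel (`fiberMap_surjective`, `fiberMap_nilpotent`). Its kernel is the largest stable ideal without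
identity morphisms of the cell (`mem_cellIdeal_iff`): a morphism that `fiber` does not kill can be
tensored with `Λ e₀ ⊗ₖ e₀ Λ` and composed to an automorphism of that bimodule, because the socle of
`A` is concentrated at the vertex `0` (`exists_isUnit_of_fiberMap_ne_zero`). Hence `fiber` identifies
the cell birepresentation with the composite of reduction and the action on projective `A`-modules
(`cellTrans`), and reduction is induced by the cell birepresentation (`isInducedByCell_redPseudo`).

*All induced pseudofunctors.* Let `Q` be induced by the cell birepresentation. The action on
projective modules is faithful, so `Q` has the same kernel as the cell birepresentation, hence the
same kernel as reduction (`map₂_eq_zero_iff`). Reduction is full (`redStarMap_surjective`), and `Q`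
agrees with it on the generating `1`-morphisms up to isomorphism; comparing dimensions, `Q` is full
on `2`-morphisms (`map₂_surjective`). Idempotents lift along the square zero kernel, so `Q` is
essentially surjective on `1`-morphisms (`exists_map_iso`). Therefore `Q` induces a biequivalence
from the quotient by the biideal.

*Simple transitive birepresentations.* In a simple transitive birepresentation `N` of the source,
the components of the action of the biideal generate a stable ideal, which is zero or everything.
The second case contradicts the vanishing of the horizontal composites unless the biideal acts by
zero anyway (`Biideal.map₂_eq_zero_of_isSimpleTransitive`). So `N` factors through `Q`
(`FactorsThrough`), and strong transformations between pseudofunctors restricted along `Q` descend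
(`descendTrans`).
-/


/-! ### The structure of the zigzag algebra of a star -/

namespace Zigzag

variable {n : ℕ}

/-- The action of the generators on the projective module `Λ e₀`, in coordinates with respect to
`e₀`, the `a j`, and the two-cycle at `0`. -/
def actZero (k : Type u) [Field k] {n : ℕ} : StarGen n → Module.End k (k × (Fin n → k) × k)
  | .e i =>
    { toFun := fun v => (if i = 0 then v.1 else 0, fun j => if i = j.succ then v.2.1 j else 0,
        if i = 0 then v.2.2 else 0)
      map_add' := by intro v w; ext <;> simp <;> split_ifs <;> simp
      map_smul' := by intro v w; ext <;> simp }
  | .a m =>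
    { toFun := fun v => (0, fun j => if j = m then v.1 else 0, 0)
      map_add' := by intro v w; ext <;> simp; split_ifs <;> simp
      map_smul' := by intro v w; ext <;> simp }
  | .b m =>
    { toFun := fun v => (0, 0, v.2.1 m)
      map_add' := by intro v w; ext <;> simp
      map_smul' := by intro v w; ext <;> simp }

/-- The action of the generators on the direct sum of the projective modules `Λ e_{j+1}`, in
coordinates with respect to the `e_{j+1}`, the `b j`, and the two-cycles `a j b j`. -/
def actLeaf (k : Type u) [Field k] {n : ℕ} :
    StarGen n → Module.End k ((Fin n → k) × (Fin n → k) × (Fin n → k))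
  | .e i =>
    { toFun := fun v => (fun j => if i = j.succ then v.1 j else 0,
        fun j => if i = 0 then v.2.1 j else 0, fun j => if i = j.succ then v.2.2 j else 0)
      map_add' := by intro v w; ext <;> simp <;> split_ifs <;> simp
      map_smul' := by intro v w; ext <;> simp }
  | .a m =>
    { toFun := fun v => (0, 0, fun j => if j = m then v.2.1 j else 0)
      map_add' := by intro v w; ext <;> simp; split_ifs <;> simp
      map_smul' := by intro v w; ext <;> simp }
  | .b m =>
    { toFun := fun v => (0, fun j => if j = m then v.1 j else 0, 0)
      map_add' := by intro v w; ext <;> simp; split_ifs <;> simp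
      map_smul' := by intro v w; ext <;> simp }

/-- Coordinatewise extensionality; unlike with `ext`, the vector to which the maps are applied is
not split into coordinates. -/
lemma endZero_ext {f g : Module.End k (k × (Fin n → k) × k)} (h₁ : ∀ v, (f v).1 = (g v).1)
    (h₂ : ∀ v j, (f v).2.1 j = (g v).2.1 j) (h₃ : ∀ v, (f v).2.2 = (g v).2.2) : f = g :=
  LinearMap.ext fun v => Prod.ext (h₁ v) (Prod.ext (funext (h₂ v)) (h₃ v))

/-- Coordinatewise extensionality, see `endZero_ext`. -/
lemma endLeaf_ext {f g : Module.End k ((Fin n → k) × (Fin n → k) × (Fin n → k))}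
    (h₁ : ∀ v j, (f v).1 j = (g v).1 j) (h₂ : ∀ v j, (f v).2.1 j = (g v).2.1 j)
    (h₃ : ∀ v j, (f v).2.2 j = (g v).2.2 j) : f = g :=
  LinearMap.ext fun v => Prod.ext (funext (h₁ v)) (Prod.ext (funext (h₂ v)) (funext (h₃ v)))

lemma actZero_cube {x y z : StarGen n} (hx : x.IsArrow) (hy : y.IsArrow) (hz : z.IsArrow) :
    actZero k x * actZero k y * actZero k z = 0 := by
  rcases x with x | x | x <;> rcases y with y | y | y <;> rcases z with z | z | z <;>
    first | exact hx.elim | exact hy.elim | exact hz.elim |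
      (apply endZero_ext <;> intros <;> simp [actZero])

lemma actLeaf_cube {x y z : StarGen n} (hx : x.IsArrow) (hy : y.IsArrow) (hz : z.IsArrow) :
    actLeaf k x * actLeaf k y * actLeaf k z = 0 := by
  rcases x with x | x | x <;> rcases y with y | y | y <;> rcases z with z | z | z <;>
    first | exact hx.elim | exact hy.elim | exact hz.elim |
      (apply endLeaf_ext <;> intros <;> simp [actLeaf])

/-- The representation of the zigzag algebra on `Λ e₀`, in coordinates. -/
def repZero (k : Type u) [Field k] {n : ℕ} :
    Zigzag k n →ₐ[k] Module.End k (k × (Fin n → k) × k) :=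
  RingQuot.liftAlgHom k ⟨FreeAlgebra.lift k (actZero k), by
    intro x y h
    induction h with
    | cube x y z hx hy hz => simpa using actZero_cube hx hy hz
    | one =>
      simp only [map_sum, map_one, FreeAlgebra.lift_ι_apply]
      apply endZero_ext <;> intros <;>
        simp [actZero, Prod.fst_sum, Prod.snd_sum, Finset.sum_apply]
    | _ =>
      simp only [map_mul, map_zero, FreeAlgebra.lift_ι_apply]
      apply endZero_ext <;> intros <;> simp [actZero] <;> grind⟩

/-- The representation of the zigzag algebra on the direct sum of the `Λ e_{j+1}`, in
coordinates. -/
def repLeaf (k : Type u) [Field k] {n : ℕ} :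
    Zigzag k n →ₐ[k] Module.End k ((Fin n → k) × (Fin n → k) × (Fin n → k)) :=
  RingQuot.liftAlgHom k ⟨FreeAlgebra.lift k (actLeaf k), by
    intro x y h
    induction h with
    | cube x y z hx hy hz => simpa using actLeaf_cube hx hy hz
    | one =>
      simp only [map_sum, map_one, FreeAlgebra.lift_ι_apply]
      apply endLeaf_ext <;> intros <;>
        simp [actLeaf, Prod.fst_sum, Prod.snd_sum, Finset.sum_apply]
    | _ =>
      simp only [map_mul, map_zero, FreeAlgebra.lift_ι_apply]
      apply endLeaf_ext <;> intros <;> simp [actLeaf] <;> grind⟩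

@[simp] lemma repZero_gen (x : StarGen n) : repZero k (gen k x) = actZero k x := by
  simp [repZero, gen]

@[simp] lemma repLeaf_gen (x : StarGen n) : repLeaf k (gen k x) = actLeaf k x := by
  simp [repLeaf, gen]

/-- The one-dimensional representation at a vertex. -/
def vertexChar (k : Type u) [Field k] {n : ℕ} (i : Fin (n + 1)) : Zigzag k n →ₐ[k] k :=
  RingQuot.liftAlgHom k ⟨FreeAlgebra.lift k
      (fun x : StarGen n => match x with | .e j => if j = i then (1 : k) else 0 | _ => 0), by
    intro x y h
    induction h with
    | idem i => simp
    | orth i j h => simp; grind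
    | one => simp
    | a_target j => simp
    | a_source j => simp
    | b_target j => simp
    | b_source j => simp
    | ab i j h => simp
    | ba i j => simp
    | cube x y z hx hy hz =>
      rcases x with x | x | x <;> rcases y with y | y | y <;> rcases z with z | z | z <;>
        simp_all [StarGen.IsArrow]⟩

/-- The coefficient of the arrow `a j`. -/
def coordA (k : Type u) [Field k] {n : ℕ} (j : Fin n) : Zigzag k n →ₗ[k] k :=
  LinearMap.proj j ∘ₗ LinearMap.fst k _ _ ∘ₗ LinearMap.snd k _ _ ∘ₗ
    LinearMap.applyₗ (1, 0, 0) ∘ₗ (repZero k).toLinearMap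

/-- The coefficient of the two-cycle at `0`. -/
def coordC (k : Type u) [Field k] {n : ℕ} : Zigzag k n →ₗ[k] k :=
  LinearMap.snd k _ _ ∘ₗ LinearMap.snd k _ _ ∘ₗ
    LinearMap.applyₗ (1, 0, 0) ∘ₗ (repZero k).toLinearMap

/-- The coefficient of the arrow `b j`. -/
def coordB (k : Type u) [Field k] {n : ℕ} (j : Fin n) : Zigzag k n →ₗ[k] k :=
  LinearMap.proj j ∘ₗ LinearMap.fst k _ _ ∘ₗ LinearMap.snd k _ _ ∘ₗ
    LinearMap.applyₗ (1, 0, 0) ∘ₗ (repLeaf k).toLinearMap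

/-- The coefficient of the two-cycle at the leaf `j`. -/
def coordCyc (k : Type u) [Field k] {n : ℕ} (j : Fin n) : Zigzag k n →ₗ[k] k :=
  LinearMap.proj j ∘ₗ LinearMap.snd k _ _ ∘ₗ LinearMap.snd k _ _ ∘ₗ
    LinearMap.applyₗ (1, 0, 0) ∘ₗ (repLeaf k).toLinearMap

section coordinates

variable (i i' : Fin (n + 1)) (j j' m : Fin n)

@[simp] lemma vertexChar_e : vertexChar k i (e k i') = if i' = i then 1 else 0 := by
  simp [vertexChar, e, gen]
@[simp] lemma vertexChar_a : vertexChar k i (a k j) = 0 := by simp [vertexChar, a, gen]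
@[simp] lemma vertexChar_b : vertexChar k i (b k j) = 0 := by simp [vertexChar, b, gen]
@[simp] lemma vertexChar_cyc : vertexChar k i (cyc k j) = 0 := by simp [cyc]

@[simp] lemma coordA_e : coordA k j (e k i) = 0 := by simp [coordA, e, actZero]
@[simp] lemma coordA_a : coordA k j (a k j') = if j = j' then 1 else 0 := by
  simp [coordA, a, actZero]
@[simp] lemma coordA_b : coordA k j (b k j') = 0 := by simp [coordA, b, actZero]
@[simp] lemma coordA_ba : coordA k j (b k j' * a k m) = 0 := by simp [coordA, a, b, actZero]
@[simp] lemma coordA_cyc : coordA k j (cyc k m) = 0 := by simp [coordA, cyc, a, b, actZero]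

@[simp] lemma coordC_e : coordC k (e k i) = 0 := by simp [coordC, e, actZero]
@[simp] lemma coordC_a : coordC k (a k j) = 0 := by simp [coordC, a, actZero]
@[simp] lemma coordC_b : coordC k (b k j) = 0 := by simp [coordC, b, actZero]
@[simp] lemma coordC_ba : coordC k (b k m * a k m) = 1 := by simp [coordC, a, b, actZero]
@[simp] lemma coordC_cyc : coordC k (cyc k m) = 0 := by simp [coordC, cyc, a, b, actZero]

@[simp] lemma coordB_e : coordB k j (e k i) = 0 := by simp [coordB, e, actLeaf]
@[simp] lemma coordB_a : coordB k j (a k j') = 0 := by simp [coordB, a, actLeaf]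
@[simp] lemma coordB_b : coordB k j (b k j') = if j = j' then 1 else 0 := by
  simp [coordB, b, actLeaf]
@[simp] lemma coordB_ba : coordB k j (b k j' * a k m) = 0 := by simp [coordB, a, b, actLeaf]
@[simp] lemma coordB_cyc : coordB k j (cyc k m) = 0 := by simp [coordB, cyc, a, b, actLeaf]

@[simp] lemma coordCyc_e : coordCyc k j (e k i) = 0 := by simp [coordCyc, e, actLeaf]
@[simp] lemma coordCyc_a : coordCyc k j (a k j') = 0 := by simp [coordCyc, a, actLeaf]
@[simp] lemma coordCyc_b : coordCyc k j (b k j') = 0 := by simp [coordCyc, b, actLeaf]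
@[simp] lemma coordCyc_ba : coordCyc k j (b k j' * a k m) = 0 := by
  simp [coordCyc, a, b, actLeaf]
@[simp] lemma coordCyc_cyc : coordCyc k j (cyc k j') = if j = j' then 1 else 0 := by
  simp [coordCyc, cyc, a, b, actLeaf]

lemma e_mul_e : e k i * e k i' = if i = i' then e k i else 0 := by
  split_ifs with h
  · rw [h, idem]
  · exact orth h
lemma e_mul_a : e k i * a k j = if i = j.succ then a k j else 0 := by
  split_ifs with h
  · rw [h, e_a]
  · rw [← e_a, ← mul_assoc, orth h, zero_mul]
lemma e_mul_b : e k i * b k j = if i = 0 then b k j else 0 := by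
  split_ifs with h
  · rw [h, e_b]
  · rw [← e_b, ← mul_assoc, orth h, zero_mul]
lemma a_mul_e : a k j * e k i = if i = 0 then a k j else 0 := by
  split_ifs with h
  · rw [h, a_e]
  · rw [← a_e, mul_assoc, orth (Ne.symm h), mul_zero]
lemma b_mul_e : b k j * e k i = if i = j.succ then b k j else 0 := by
  split_ifs with h
  · rw [h, b_e]
  · rw [← b_e, mul_assoc, orth (Ne.symm h), mul_zero]
lemma a_mul_a : a k j * a k j' = 0 := by
  rw [← a_e, ← e_a j', mul_assoc, ← mul_assoc (e k 0), orth (Fin.succ_ne_zero _).symm]; simp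
lemma b_mul_b : b k j * b k j' = 0 := by
  rw [← b_e, ← e_b j', mul_assoc, ← mul_assoc (e k j.succ), orth (Fin.succ_ne_zero _)]; simp
lemma a_mul_b : a k j * b k j' = if j = j' then cyc k j else 0 := by
  split_ifs with h
  · rw [h]; rfl
  · simpa [a, b, gen] using RingQuot.mkAlgHom_rel k (ZigzagRel.ab (k := k) j' j (Ne.symm h))
lemma ba_eq : b k j * a k j = b k j' * a k j' := by
  simpa [a, b, gen] using RingQuot.mkAlgHom_rel k (ZigzagRel.ba (k := k) j j')
lemma b_mul_a : b k j * a k j' = if j = j' then b k j * a k j else 0 := by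
  split_ifs with h
  · rw [h]
  · rw [← b_e, ← e_a j', mul_assoc, ← mul_assoc (e k j.succ), orth (by simpa using h)]; simp

lemma e_mul_cyc : e k i * cyc k j = if i = j.succ then cyc k j else 0 := by
  rw [cyc, ← mul_assoc, e_mul_a]; split_ifs <;> simp
lemma cyc_mul_e : cyc k j * e k i = if i = j.succ then cyc k j else 0 := by
  rw [cyc, mul_assoc, b_mul_e]; split_ifs <;> simp
lemma a_mul_cyc : a k j * cyc k j' = 0 := by rw [cyc, ← mul_assoc, a_mul_a, zero_mul]
lemma cyc_mul_b : cyc k j' * b k j = 0 := by rw [cyc, mul_assoc, b_mul_b, mul_zero]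
lemma cyc_mul_a : cyc k j' * a k j = 0 := by
  rw [cyc, mul_assoc]; exact cube (.a j') (.b j') (.a j) trivial trivial trivial
lemma b_mul_cyc : b k j * cyc k j' = 0 :=
  cube (.b j) (.a j') (.b j') trivial trivial trivial
lemma a_mul_ba : a k j * (b k j' * a k m) = 0 := cube (.a j) (.b j') (.a m) trivial trivial trivial
lemma b_mul_ba : b k j * (b k j' * a k m) = 0 := cube (.b j) (.b j') (.a m) trivial trivial trivial
lemma ba_mul_a : b k j' * a k m * a k j = 0 := by
  rw [mul_assoc]; exact cube (.b j') (.a m) (.a j) trivial trivial trivial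
lemma ba_mul_b : b k j' * a k m * b k j = 0 := by
  rw [mul_assoc]; exact cube (.b j') (.a m) (.b j) trivial trivial trivial
lemma e_mul_ba : e k i * (b k j * a k m) = if i = 0 then b k j * a k m else 0 := by
  rw [← mul_assoc, e_mul_b]; split_ifs <;> simp
lemma ba_mul_e : b k j * a k m * e k i = if i = 0 then b k j * a k m else 0 := by
  rw [mul_assoc, a_mul_e]; split_ifs <;> simp

end coordinates

lemma span_paths : Submodule.span k (paths k n) = ⊤ := by
  rw [eq_top_iff]
  rintro x -
  obtain ⟨x, rfl⟩ := RingQuot.mkAlgHom_surjective k (ZigzagRel k n) x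
  rw [← mul_one (RingQuot.mkAlgHom k (ZigzagRel k n) x)]
  refine mul_mem x _ ?_
  rw [← sum_e]
  exact Submodule.sum_mem _ fun i _ => Submodule.subset_span (Or.inl ⟨.e i, rfl⟩)

/-- The zigzag algebra is spanned by the idempotents, the arrows and the two-cycles. Any leaf `m`
may be used to write the two-cycle at `0`. -/
lemma induction_on (m : Fin n) {p : Zigzag k n → Prop} (x : Zigzag k n)
    (he : ∀ i, p (e k i)) (ha : ∀ j, p (a k j)) (hb : ∀ j, p (b k j)) (hc : p (b k m * a k m))
    (hcyc : ∀ j, p (cyc k j)) (h0 : p 0) (hadd : ∀ x y, p x → p y → p (x + y))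
    (hsmul : ∀ (r : k) x, p x → p (r • x)) : p x := by
  have hx : x ∈ Submodule.span k (paths k n) := by rw [span_paths]; trivial
  refine Submodule.span_induction ?_ h0 (fun x y _ _ => hadd x y) (fun r x _ => hsmul r x) hx
  have hgen : ∀ x, p (gen k x) := by
    rintro (i | j | j)
    exacts [he i, ha j, hb j]
  rintro _ (⟨y, rfl⟩ | ⟨⟨y, z⟩, rfl⟩)
  · exact hgen y
  · dsimp only
    rcases y with i | j | j
    · rcases e_mul_gen (k := k) i z with h | h
      · exact (congrArg p h).mpr (hgen z)
      · exact (congrArg p h).mpr h0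
    · rcases z with i | j' | j'
      · change p (a k j * e k i)
        rw [a_mul_e]; split_ifs
        exacts [ha j, h0]
      · change p (a k j * a k j')
        rwa [a_mul_a]
      · change p (a k j * b k j')
        rw [a_mul_b]; split_ifs
        exacts [hcyc j, h0]
    · rcases z with i | j' | j'
      · change p (b k j * e k i)
        rw [b_mul_e]; split_ifs
        exacts [hb j, h0]
      · change p (b k j * a k j')
        rw [b_mul_a, ba_eq j m]; split_ifs
        exacts [hc, h0]
      · change p (b k j * b k j')
        rwa [b_mul_b]

/-- The expansion of an element of the zigzag algebra in the basis of idempotents, arrows and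
two-cycles. -/
lemma eq_sum_coord (m : Fin n) (x : Zigzag k n) :
    x = ∑ i, vertexChar k i x • e k i + ∑ j, coordA k j x • a k j + ∑ j, coordB k j x • b k j +
      coordC k x • (b k m * a k m) + ∑ j, coordCyc k j x • cyc k j := by
  induction x using induction_on m with
  | he i => simp
  | ha j => simp
  | hb j => simp
  | hc => simp
  | hcyc j => simp
  | h0 => simp
  | hadd x y hx hy =>
    conv_lhs => rw [hx, hy]
    simp only [map_add, add_smul, Finset.sum_add_distrib]
    abel
  | hsmul r x hx =>
    conv_lhs => rw [hx]
    simp only [map_smul, smul_add, Finset.smul_sum, smul_smul, smul_eq_mul]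

lemma e_zero_mul_mul_e_zero (m : Fin n) (x : Zigzag k n) :
    e k 0 * x * e k 0 = vertexChar k 0 x • e k 0 + coordC k x • (b k m * a k m) := by
  conv_lhs => rw [eq_sum_coord m x]
  simp [mul_add, add_mul, Finset.mul_sum, Finset.sum_mul, e_mul_e, e_mul_a, e_mul_b, e_mul_ba,
    e_mul_cyc, b_mul_e, ba_mul_e, Fin.succ_ne_zero, (Fin.succ_ne_zero _).symm]

lemma e_zero_mul_mul_e_succ (m : Fin n) (j : Fin n) (x : Zigzag k n) :
    e k 0 * x * e k j.succ = coordB k j x • b k j := by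
  conv_lhs => rw [eq_sum_coord m x]
  simp [mul_add, add_mul, Finset.mul_sum, Finset.sum_mul, e_mul_e, e_mul_a, e_mul_b, e_mul_ba,
    e_mul_cyc, b_mul_e, ba_mul_e, Fin.succ_ne_zero, (Fin.succ_ne_zero _).symm]

lemma e_succ_mul_mul_e_zero (m : Fin n) (j : Fin n) (x : Zigzag k n) :
    e k j.succ * x * e k 0 = coordA k j x • a k j := by
  conv_lhs => rw [eq_sum_coord m x]
  simp [mul_add, add_mul, Finset.mul_sum, Finset.sum_mul, e_mul_e, e_mul_a, e_mul_b, e_mul_ba,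
    e_mul_cyc, b_mul_e, ba_mul_e, a_mul_e, cyc_mul_e, Fin.succ_ne_zero, (Fin.succ_ne_zero _).symm]

lemma e_succ_mul_mul_e_succ (m : Fin n) (i j : Fin n) (x : Zigzag k n) :
    e k i.succ * x * e k j.succ =
      if i = j then vertexChar k j.succ x • e k j.succ + coordCyc k j x • cyc k j else 0 := by
  conv_lhs => rw [eq_sum_coord m x]
  simp [mul_add, add_mul, Finset.mul_sum, Finset.sum_mul, e_mul_e, e_mul_a, e_mul_b, e_mul_ba,
    e_mul_cyc, b_mul_e, ba_mul_e, a_mul_e, cyc_mul_e, Fin.succ_ne_zero, (Fin.succ_ne_zero _).symm]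
  grind

end Zigzag

/-! ### The ideal of two-cycles at the leaves, and the quotient algebra -/

namespace Zigzag

variable {n : ℕ}

lemma mul_cyc (j : Fin n) (x : Zigzag k n) :
    x * cyc k j = vertexChar k j.succ x • cyc k j := by
  induction x using induction_on j with
  | he i => rw [e_mul_cyc, vertexChar_e, ite_smul, one_smul, zero_smul]
  | ha j' => rw [a_mul_cyc, vertexChar_a, zero_smul]
  | hb j' => rw [b_mul_cyc, vertexChar_b, zero_smul]
  | hc => rw [mul_assoc, a_mul_cyc]; simp
  | hcyc j' => rw [cyc, mul_assoc, b_mul_cyc]; simp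
  | h0 => simp
  | hadd x y hx hy => rw [add_mul, hx, hy, map_add, add_smul]
  | hsmul r x hx => rw [smul_mul_assoc, hx, map_smul, smul_assoc]

lemma cyc_mul (j : Fin n) (x : Zigzag k n) :
    cyc k j * x = vertexChar k j.succ x • cyc k j := by
  induction x using induction_on j with
  | he i => rw [cyc_mul_e, vertexChar_e, ite_smul, one_smul, zero_smul]
  | ha j' => rw [cyc_mul_a, vertexChar_a, zero_smul]
  | hb j' => rw [cyc_mul_b, vertexChar_b, zero_smul]
  | hc => rw [← mul_assoc, cyc_mul_b]; simp
  | hcyc j' => rw [cyc, mul_assoc, b_mul_cyc]; simp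
  | h0 => simp
  | hadd x y hx hy => rw [mul_add, hx, hy, map_add, add_smul]
  | hsmul r x hx => rw [mul_smul_comm, hx, map_smul, smul_assoc]

lemma mul_ba (m : Fin n) (x : Zigzag k n) :
    x * (b k m * a k m) = vertexChar k 0 x • (b k m * a k m) := by
  induction x using induction_on m with
  | he i => rw [e_mul_ba, vertexChar_e, ite_smul, one_smul, zero_smul]
  | ha j' => rw [a_mul_ba, vertexChar_a, zero_smul]
  | hb j' => rw [b_mul_ba, vertexChar_b, zero_smul]
  | hc => rw [mul_assoc, a_mul_ba]; simp
  | hcyc j' => rw [cyc, mul_assoc, b_mul_ba]; simp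
  | h0 => simp
  | hadd x y hx hy => rw [add_mul, hx, hy, map_add, add_smul]
  | hsmul r x hx => rw [smul_mul_assoc, hx, map_smul, smul_assoc]

lemma ba_mul (m : Fin n) (x : Zigzag k n) :
    b k m * a k m * x = vertexChar k 0 x • (b k m * a k m) := by
  induction x using induction_on m with
  | he i => rw [ba_mul_e, vertexChar_e, ite_smul, one_smul, zero_smul]
  | ha j' => rw [ba_mul_a, vertexChar_a, zero_smul]
  | hb j' => rw [ba_mul_b, vertexChar_b, zero_smul]
  | hc => rw [← mul_assoc, ba_mul_b]; simp
  | hcyc j' => rw [cyc, ← mul_assoc, ba_mul_a]; simp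
  | h0 => simp
  | hadd x y hx hy => rw [mul_add, hx, hy, map_add, add_smul]
  | hsmul r x hx => rw [mul_smul_comm, hx, map_smul, smul_assoc]

/-- The span of the two-cycles at the leaves. -/
def cycSpan (k : Type u) [Field k] (n : ℕ) : Submodule k (Zigzag k n) :=
  Submodule.span k (Set.range (cyc k))

lemma cyc_mem (j : Fin n) : cyc k j ∈ cycSpan k n := Submodule.subset_span ⟨j, rfl⟩

lemma mul_mem_cycSpan (y : Zigzag k n) {x : Zigzag k n} (hx : x ∈ cycSpan k n) :
    y * x ∈ cycSpan k n := by
  induction hx using Submodule.span_induction with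
  | mem x h => obtain ⟨j, rfl⟩ := h; rw [mul_cyc]; exact Submodule.smul_mem _ _ (cyc_mem j)
  | zero => simp
  | add x y _ _ hx hy => rw [mul_add]; exact Submodule.add_mem _ hx hy
  | smul r x _ hx => rw [mul_smul_comm]; exact Submodule.smul_mem _ _ hx

lemma cycSpan_mul_mem (y : Zigzag k n) {x : Zigzag k n} (hx : x ∈ cycSpan k n) :
    x * y ∈ cycSpan k n := by
  induction hx using Submodule.span_induction with
  | mem x h => obtain ⟨j, rfl⟩ := h; rw [cyc_mul]; exact Submodule.smul_mem _ _ (cyc_mem j)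
  | zero => simp
  | add x y _ _ hx hy => rw [add_mul]; exact Submodule.add_mem _ hx hy
  | smul r x _ hx => rw [smul_mul_assoc]; exact Submodule.smul_mem _ _ hx

lemma cycSpan_mul_eq_zero {y : Zigzag k n} (h : ∀ j : Fin n, vertexChar k j.succ y = 0)
    {x : Zigzag k n} (hx : x ∈ cycSpan k n) : x * y = 0 := by
  induction hx using Submodule.span_induction with
  | mem x hx => obtain ⟨j, rfl⟩ := hx; rw [cyc_mul, h, zero_smul]
  | zero => simp
  | add x y _ _ hx hy => rw [add_mul, hx, hy, add_zero]
  | smul r x _ hx => rw [smul_mul_assoc, hx, smul_zero]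

lemma mul_cycSpan_eq_zero {y : Zigzag k n} (h : ∀ j : Fin n, vertexChar k j.succ y = 0)
    {x : Zigzag k n} (hx : x ∈ cycSpan k n) : y * x = 0 := by
  induction hx using Submodule.span_induction with
  | mem x hx => obtain ⟨j, rfl⟩ := hx; rw [mul_cyc, h, zero_smul]
  | zero => simp
  | add x y _ _ hx hy => rw [mul_add, hx, hy, add_zero]
  | smul r x _ hx => rw [mul_smul_comm, hx, smul_zero]

/-- A linear functional that kills the two-cycles at the leaves kills their span. -/
lemma map_cycSpan {X : Type*} [AddCommGroup X] [Module k X] (f : Zigzag k n →ₗ[k] X)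
    (h : ∀ j, f (cyc k j) = 0) {x : Zigzag k n} (hx : x ∈ cycSpan k n) : f x = 0 := by
  have : cycSpan k n ≤ LinearMap.ker f := Submodule.span_le.2 (by rintro _ ⟨j, rfl⟩; exact h j)
  exact this hx

lemma vertexChar_cycSpan (i : Fin (n + 1)) {x : Zigzag k n} (hx : x ∈ cycSpan k n) :
    vertexChar k i x = 0 :=
  map_cycSpan (vertexChar k i).toLinearMap (by simp) hx

lemma cycSpan_mul_cycSpan {x y : Zigzag k n} (hx : x ∈ cycSpan k n) (hy : y ∈ cycSpan k n) :
    x * y = 0 :=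
  cycSpan_mul_eq_zero (fun _ => vertexChar_cycSpan _ hy) hx

lemma e_zero_mul_cycSpan {x : Zigzag k n} (hx : x ∈ cycSpan k n) : e k 0 * x = 0 :=
  mul_cycSpan_eq_zero (fun j => by simp [(Fin.succ_ne_zero j).symm]) hx

lemma cycSpan_mul_e_zero {x : Zigzag k n} (hx : x ∈ cycSpan k n) : x * e k 0 = 0 :=
  cycSpan_mul_eq_zero (fun j => by simp [(Fin.succ_ne_zero j).symm]) hx

/-- The socle of the quotient of the zigzag algebra by the two-cycles at the leaves is concentrated
at the vertex `0`. -/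
lemma mem_cycSpan_of_e_zero_mul (m : Fin n) {x : Zigzag k n}
    (h : ∀ z, e k 0 * z * x = 0) : x ∈ cycSpan k n := by
  have h1 : e k 0 * x = 0 := by simpa using h 1
  have hb : ∀ j, b k j * x = 0 := fun j => by simpa [e_b] using h (b k j)
  have h00 := e_zero_mul_mul_e_zero m x
  rw [h1, zero_mul] at h00
  have c0 : vertexChar k 0 x = 0 := by simpa using (congrArg (vertexChar k 0) h00).symm
  have cC : coordC k x = 0 := by simpa using (congrArg (coordC k) h00).symm
  have cB : ∀ j, coordB k j x = 0 := fun j => by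
    have := e_zero_mul_mul_e_succ m j x
    rw [h1, zero_mul] at this
    simpa using (congrArg (coordB k j) this).symm
  -- The remaining coefficients are moved into `e₀ Λ` by multiplication with `b j`.
  have cA : ∀ j, coordA k j x = 0 := fun j => by
    have := congrArg (b k j * ·) (e_succ_mul_mul_e_zero m j x)
    simp only [← mul_assoc, b_e, hb, zero_mul, mul_smul_comm] at this
    simpa using (congrArg (coordC k) this).symm
  have cE : ∀ j : Fin n, vertexChar k j.succ x = 0 := fun j => by
    have := congrArg (b k j * ·) (e_succ_mul_mul_e_succ m j j x)
    simp only [← mul_assoc, b_e, hb, zero_mul, mul_smul_comm, if_true, mul_add, b_mul_cyc] at this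
    simpa using (congrArg (coordB k j) this).symm
  rw [eq_sum_coord m x, Fin.sum_univ_succ]
  simp only [c0, cC, cB, cA, cE, zero_smul, Finset.sum_const_zero, zero_add]
  exact Submodule.sum_mem _ fun j _ => Submodule.smul_mem _ _ (cyc_mem j)

end Zigzag

namespace StarAlg

open Zigzag

variable {n : ℕ}

lemma mk_surjective : Function.Surjective (mk k (n := n)) := RingQuot.mkAlgHom_surjective k _

/-- The two-cycles at the leaves span a two-sided ideal, so that nothing else dies in the
quotient. -/
lemma mk_eq_zero_iff (x : Zigzag k n) : mk k x = 0 ↔ x ∈ cycSpan k n := by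
  constructor
  · intro hx
    let I : TwoSidedIdeal (Zigzag k n) := TwoSidedIdeal.mk' (cycSpan k n : Set (Zigzag k n))
      (Submodule.zero_mem _) (Submodule.add_mem _) (Submodule.neg_mem _)
      (fun h => mul_mem_cycSpan _ h) (fun h => cycSpan_mul_mem _ h)
    have hI : ∀ y, (RingCon.mkₐ k I.ringCon) y = 0 ↔ y ∈ cycSpan k n := fun y => by
      have : (RingCon.mkₐ k I.ringCon) y = 0 ↔ I.ringCon y 0 := by
        rw [← map_zero (RingCon.mkₐ k I.ringCon)]
        exact RingCon.eq I.ringCon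
      rw [this, ← TwoSidedIdeal.mem_iff]
      exact TwoSidedIdeal.mem_mk' _ _ _ _ _ _ _
    let φ : StarAlg k n →ₐ[k] I.ringCon.Quotient :=
      RingQuot.liftAlgHom k ⟨RingCon.mkₐ k I.ringCon, by
        rintro _ _ ⟨j, rfl, rfl⟩
        rw [map_zero, hI]
        exact cyc_mem j⟩
    have : φ (mk k x) = RingCon.mkₐ k I.ringCon x := RingQuot.liftAlgHom_mkAlgHom_apply _ _ _ _
    rw [hx, map_zero] at this
    exact (hI x).1 this.symm
  · intro hx
    refine map_cycSpan (X := StarAlg k n) (mk k).toLinearMap (fun j => ?_) hx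
    have := RingQuot.mkAlgHom_rel k
      (s := fun x y : Zigzag k n => ∃ j, x = Zigzag.cyc k j ∧ y = 0) ⟨j, rfl, rfl⟩
    rw [map_zero] at this
    exact this

/-- The one-dimensional representation of the quotient algebra at the vertex `0`. -/
def aug (k : Type u) [Field k] (n : ℕ) : StarAlg k n →ₐ[k] k :=
  RingQuot.liftAlgHom k ⟨vertexChar k 0, by rintro _ _ ⟨j, rfl, rfl⟩; simp⟩

@[simp] lemma aug_mk (x : Zigzag k n) : aug k n (mk k x) = vertexChar k 0 x :=
  RingQuot.liftAlgHom_mkAlgHom_apply _ _ _ _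

/-- Every nonzero element of the algebra is detected by multiplication into `e₀ A`. -/
lemma exists_e_zero_mul_ne_zero (m : Fin n) {x : StarAlg k n} (hx : x ≠ 0) :
    ∃ z, e k 0 * z * x ≠ 0 := by
  obtain ⟨x, rfl⟩ := mk_surjective x
  by_contra! h
  refine hx ((mk_eq_zero_iff x).2 (mem_cycSpan_of_e_zero_mul m fun z => ?_))
  have h1 := h (mk k z)
  rw [e, ← map_mul, ← map_mul, mk_eq_zero_iff] at h1
  have := e_zero_mul_cycSpan h1
  rwa [← mul_assoc, ← mul_assoc, Zigzag.idem] at this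

end StarAlg

/-! ### Bimodules: generators, direct sums and images of idempotents -/

namespace Bimodule

variable {R S T : Type u} [Ring R] [Algebra k R] [Ring S] [Algebra k S] [Ring T] [Algebra k T]

lemma lin_sum {M N : Bimodule k R S} {ι : Type*} (s : Finset ι) (f : ι → (M ⟶ N))
    (x : M.carrier) : lin (∑ i ∈ s, f i) x = ∑ i ∈ s, lin (f i) x := by
  classical
  induction s using Finset.induction_on with
  | empty => simp
  | insert a s ha ih => rw [Finset.sum_insert ha, Finset.sum_insert ha, lin_add,
      LinearMap.add_apply, ih]

lemma lin_sub {M N : Bimodule k R S} (f g : M ⟶ N) (x : M.carrier) :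
    lin (f - g) x = lin f x - lin g x := rfl

lemma lact_mul (M : Bimodule k R S) (r r' : R) (x : M.carrier) :
    M.lact (r * r') x = M.lact r (M.lact r' x) := by rw [map_mul]; rfl

lemma ract_mul (M : Bimodule k R S) (s s' : S) (x : M.carrier) :
    M.ract (MulOpposite.op (s * s')) x =
      M.ract (MulOpposite.op s') (M.ract (MulOpposite.op s) x) := by
  rw [MulOpposite.op_mul, map_mul]; rfl

@[simp] lemma lact_one (M : Bimodule k R S) (x : M.carrier) : M.lact 1 x = x := by
  rw [map_one]; rfl

@[simp] lemma lact_zero (M : Bimodule k R S) (x : M.carrier) : M.lact 0 x = 0 := by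
  rw [map_zero]; rfl

lemma lact_add (M : Bimodule k R S) (r r' : R) (x : M.carrier) :
    M.lact (r + r') x = M.lact r x + M.lact r' x := by rw [map_add]; rfl

lemma lact_smul (M : Bimodule k R S) (c : k) (r : R) (x : M.carrier) :
    M.lact (c • r) x = c • M.lact r x := by rw [map_smul]; rfl

lemma ract_smul (M : Bimodule k R S) (c : k) (r : S) (x : M.carrier) :
    M.ract (MulOpposite.op (c • r)) x = c • M.ract (MulOpposite.op r) x := by
  rw [MulOpposite.op_smul, map_smul]; rfl

/-- The spaces of homomorphisms between finite dimensional bimodules are finite dimensional. -/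
instance finite_hom (M N : Bimodule k R S) [Module.Finite k M.carrier]
    [Module.Finite k N.carrier] : Module.Finite k (M ⟶ N) :=
  inferInstanceAs (Module.Finite k (homs M N))

/-- The isomorphism given by a bijective homomorphism. -/
noncomputable def isoOfBijective {M N : Bimodule k R S} (f : M ⟶ N)
    (h : Function.Bijective (lin f)) : M ≅ N where
  hom := f
  inv := mkHom (LinearEquiv.ofBijective (lin f) h).symm.toLinearMap
    (fun r x => h.1 (by
      rw [lin_lact]
      exact ((LinearEquiv.ofBijective (lin f) h).apply_symm_apply _).trans
        (congrArg (N.lact r) ((LinearEquiv.ofBijective (lin f) h).apply_symm_apply x).symm)))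
    (fun r x => h.1 (by
      rw [lin_ract]
      exact ((LinearEquiv.ofBijective (lin f) h).apply_symm_apply _).trans
        (congrArg (N.ract r) ((LinearEquiv.ofBijective (lin f) h).apply_symm_apply x).symm)))
  hom_inv_id := hom_ext fun x => (LinearEquiv.ofBijective (lin f) h).symm_apply_apply x
  inv_hom_id := hom_ext fun x => (LinearEquiv.ofBijective (lin f) h).apply_symm_apply x

/-- The direct sum of a finite family of bimodules. -/
def directSum {m : ℕ} (G : Fin m → Bimodule k R S) : Bimodule k R S where
  carrier := ∀ i, (G i).carrier
  lact :=
    { toFun := fun r => LinearMap.pi fun i => ((G i).lact r : _ →ₗ[k] _) ∘ₗ LinearMap.proj i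
      map_one' := by ext; simp
      map_mul' := by intros; ext; simp
      map_zero' := by ext; simp
      map_add' := by intros; apply LinearMap.ext; intro x; funext i; simp
      commutes' := by intros; apply LinearMap.ext; intro x; funext i; simp }
  ract :=
    { toFun := fun r => LinearMap.pi fun i => ((G i).ract r : _ →ₗ[k] _) ∘ₗ LinearMap.proj i
      map_one' := by ext; simp
      map_mul' := by intros; ext; simp
      map_zero' := by ext; simp
      map_add' := by intros; apply LinearMap.ext; intro x; funext i; simp
      commutes' := by
        intro c; apply LinearMap.ext; intro x; funext i
        exact congrArg (fun t => t (x i)) ((G i).ract.commutes c) }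
  lact_ract := by intro r s x; funext i; exact (G i).lact_ract r s (x i)

/-- The inclusion of a summand. -/
def directSumι {m : ℕ} (G : Fin m → Bimodule k R S) (i : Fin m) : G i ⟶ directSum G :=
  mkHom (N := directSum G) (LinearMap.single k (fun i => (G i).carrier) i)
    (by
      intro r x; funext j
      change Pi.single (M := fun i => (G i).carrier) i ((G i).lact r x) j =
        (G j).lact r (Pi.single (M := fun i => (G i).carrier) i x j)
      by_cases h : j = i
      · subst h; simp
      · simp [h])
    (by
      intro r x; funext j
      change Pi.single (M := fun i => (G i).carrier) i ((G i).ract r x) j =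
        (G j).ract r (Pi.single (M := fun i => (G i).carrier) i x j)
      by_cases h : j = i
      · subst h; simp
      · simp [h])

/-- The projection to a summand. -/
def directSumπ {m : ℕ} (G : Fin m → Bimodule k R S) (i : Fin m) : directSum G ⟶ G i :=
  mkHom (M := directSum G) (LinearMap.proj i) (fun _ _ => rfl) (fun _ _ => rfl)

lemma directSum_ι_π {m : ℕ} (G : Fin m → Bimodule k R S) (i : Fin m) :
    directSumι G i ≫ directSumπ G i = 𝟙 (G i) := by
  apply hom_ext; intro x
  change Pi.single (M := fun i => (G i).carrier) i x i = x
  simp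

lemma directSum_ι_π_ne {m : ℕ} (G : Fin m → Bimodule k R S) {i j : Fin m} (h : i ≠ j) :
    directSumι G i ≫ directSumπ G j = 0 := by
  apply hom_ext; intro x
  change Pi.single (M := fun i => (G i).carrier) i x j = 0
  simp [h.symm]

lemma directSum_sum {m : ℕ} (G : Fin m → Bimodule k R S) :
    ∑ i, directSumπ G i ≫ directSumι G i = 𝟙 (directSum G) := by
  apply hom_ext; intro x
  rw [lin_sum]
  funext j
  have h : (∑ i, lin (directSumπ G i ≫ directSumι G i) x) j =
    ∑ i, Pi.single (M := fun i => (G i).carrier) i (x i) j := Finset.sum_apply j _ _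
  rw [h, Finset.sum_eq_single j (fun i _ hij => Pi.single_eq_of_ne hij.symm _) (by simp)]
  exact Pi.single_eq_same (M := fun i => (G i).carrier) j (x j)

/-- The image of an endomorphism of a bimodule. -/
def image {M : Bimodule k R S} (p : M ⟶ M) : Bimodule k R S where
  carrier := LinearMap.range (lin p)
  lact :=
    { toFun := fun r => (M.lact r).restrict (by
        rintro _ ⟨x, rfl⟩; exact ⟨M.lact r x, lin_lact p r x⟩)
      map_one' := by ext; simp
      map_mul' := by intros; ext; simp [lact_mul]
      map_zero' := by ext; simp
      map_add' := by intros; ext; simp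
      commutes' := by intros; ext; simp }
  ract :=
    { toFun := fun r => (M.ract r).restrict (by
        rintro _ ⟨x, rfl⟩; exact ⟨M.ract r x, lin_ract p r x⟩)
      map_one' := by ext; simp
      map_mul' := by intros; ext; simp
      map_zero' := by ext; simp
      map_add' := by intros; ext; simp
      commutes' := by
        intro c; ext x
        exact congrArg (fun t => t (x : M.carrier)) (M.ract.commutes c) }
  lact_ract := by rintro r s ⟨x, hx⟩; exact Subtype.ext (M.lact_ract r s x)

/-- Idempotent endomorphisms of bimodules split. -/
lemma idem_split {M : Bimodule k R S} (p : M ⟶ M) (hp : p ≫ p = p) :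
    ∃ (W : Bimodule k R S) (i : W ⟶ M) (q : M ⟶ W), i ≫ q = 𝟙 W ∧ q ≫ i = p := by
  refine ⟨image p, mkHom (M := image p) (Submodule.subtype _) (fun _ _ => rfl) (fun _ _ => rfl),
    mkHom (N := image p) (LinearMap.rangeRestrict (lin p))
      (fun r x => Subtype.ext (lin_lact p r x)) (fun r x => Subtype.ext (lin_ract p r x)), ?_, ?_⟩
  · apply hom_ext
    rintro ⟨_, x, rfl⟩
    exact Subtype.ext (congrArg (fun t => lin t x) hp)
  · apply hom_ext
    intro x; rfl

/-- The elements `x e ⊗ f y` of `R e ⊗ₖ f R`, as a bilinear map. -/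
def projBil (k : Type u) [Field k] {R : Type u} [Ring R] [Algebra k R] (e f : R) :
    R →ₗ[k] R →ₗ[k] (proj k e f).carrier :=
  (tmul (leftProj k e) (rightProj k f)).compl₁₂ (LinearMap.rangeRestrict (LinearMap.mulRight k e))
    (LinearMap.rangeRestrict (LinearMap.mulLeft k f))

lemma projBil_congr (e f : R) {x x' y y' : R} (hx : x * e = x' * e) (hy : f * y = f * y') :
    projBil k e f x y = projBil k e f x' y' :=
  congrArg₂ (fun a b => tmul (leftProj k e) (rightProj k f) a b) (Subtype.ext hx) (Subtype.ext hy)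

lemma proj_induction {e f : R} {p : (proj k e f).carrier → Prop} (x : (proj k e f).carrier)
    (h : ∀ x y, p (projBil k e f x y)) (h0 : p 0) (hadd : ∀ x y, p x → p y → p (x + y)) : p x := by
  induction x using tensor_induction with
  | h m n =>
    obtain ⟨_, x, rfl⟩ := m
    obtain ⟨_, y, rfl⟩ := n
    exact h x y
  | h0 => exact h0
  | hadd x y hx hy => exact hadd x y hx hy

@[simp] lemma lact_projBil (e f r x y : R) :
    (proj k e f).lact r (projBil k e f x y) = projBil k e f (r * x) y := by
  refine (tensor_lact (leftProj k e) (rightProj k f) r _ _).trans ?_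
  exact congrArg (fun a => tmul (leftProj k e) (rightProj k f) a _)
    (Subtype.ext (mul_assoc r x e).symm)

@[simp] lemma ract_projBil (e f r x y : R) :
    (proj k e f).ract (MulOpposite.op r) (projBil k e f x y) = projBil k e f x (y * r) := by
  refine (tensor_ract (leftProj k e) (rightProj k f) _ _ _).trans ?_
  exact congrArg (fun a => tmul (leftProj k e) (rightProj k f) _ a)
    (Subtype.ext (mul_assoc f y r))

/-- A bilinear map on `R × R` induces a linear map on `R e ⊗ₖ f R`. -/
def projLift (e f : R) {X : Type u} [AddCommGroup X] [Module k X] (B : R →ₗ[k] R →ₗ[k] X) :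
    (proj k e f).carrier →ₗ[k] X :=
  liftLin (M := leftProj k e) (N := rightProj k f)
    (B.compl₁₂ (Submodule.subtype (LinearMap.range (LinearMap.mulRight k e)))
      (Submodule.subtype (LinearMap.range (LinearMap.mulLeft k f)))) (by
    intro m s n
    rw [ract_ground (leftProj k e), lact_ground (rightProj k f), map_smul, map_smul,
      LinearMap.smul_apply]
    rfl)

@[simp] lemma projLift_projBil (e f : R) {X : Type u} [AddCommGroup X] [Module k X]
    (B : R →ₗ[k] R →ₗ[k] X) (x y : R) :
    projLift e f B (projBil k e f x y) = B (x * e) (f * y) :=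
  liftLin_tmul _ _ _ _

/-- The bilinear map `(x, y) ↦ x m y`. -/
def biact (N : Bimodule k R S) (m : N.carrier) : R →ₗ[k] S →ₗ[k] N.carrier :=
  LinearMap.mk₂ k (fun x y => N.lact x (N.ract (MulOpposite.op y) m))
    (by intros; simp) (by intros; simp)
    (by intros; simp) (by intros; simp)

@[simp] lemma biact_apply (N : Bimodule k R S) (m : N.carrier) (x : R) (y : S) :
    biact N m x y = N.lact x (N.ract (MulOpposite.op y) m) := rfl

/-- The homomorphism from `R e ⊗ₖ f R` that sends `e ⊗ f` to `e m f`. -/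
def projHom (e f : R) {N : Bimodule k R R} (m : N.carrier) : proj k e f ⟶ N :=
  mkHom (projLift e f (biact N m))
    (by
      intro r x
      induction x using proj_induction with
      | h x y => simp [lact_mul]
      | h0 => simp
      | hadd x y hx hy => simp only [map_add, hx, hy])
    (by
      intro s x
      obtain ⟨s, rfl⟩ := MulOpposite.op_surjective s
      induction x using proj_induction with
      | h x y => rw [ract_projBil, projLift_projBil, projLift_projBil]; simp [ract_mul, lact_ract]
      | h0 => simp
      | hadd x y hx hy => simp only [map_add, hx, hy])

@[simp] lemma lin_projHom (e f : R) {N : Bimodule k R R} (m : N.carrier) (x y : R) :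
    lin (projHom e f m) (projBil k e f x y) =
      N.lact (x * e) (N.ract (MulOpposite.op (f * y)) m) :=
  projLift_projBil e f (biact N m) x y

lemma projBil_eq_act (e f x y : R) : projBil k e f x y =
    (proj k e f).lact x ((proj k e f).ract (MulOpposite.op y) (projBil k e f 1 1)) := by
  simp

/-- Homomorphisms out of `R e ⊗ₖ f R` are determined by the image of `e ⊗ f`. -/
lemma proj_hom_ext {e f : R} {N : Bimodule k R R} {g h : proj k e f ⟶ N}
    (H : lin g (projBil k e f 1 1) = lin h (projBil k e f 1 1)) : g = h := by
  apply hom_ext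
  intro x
  induction x using proj_induction with
  | h x y => rw [projBil_eq_act, lin_lact, lin_ract, H, ← lin_ract, ← lin_lact]
  | h0 => simp
  | hadd x y hx hy => simp only [map_add, hx, hy]

end Bimodule

/-! ### Reduction of bimodules along a surjection of algebras -/

/-- The algebra homomorphism induced on the target of a surjection. -/
noncomputable def AlgHom.descend {R S E : Type*} [Ring R] [Algebra k R] [Ring S] [Algebra k S]
    [Ring E] [Algebra k E] (π : R →ₐ[k] S) (hπ : Function.Surjective π) (f : R →ₐ[k] E)
    (h : ∀ r, π r = 0 → f r = 0) : S →ₐ[k] E :=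
  have key : ∀ s r, π r = s → f (Function.surjInv hπ s) = f r := fun s r hr => by
    rw [← sub_eq_zero, ← map_sub]
    apply h
    rw [map_sub, Function.surjInv_eq hπ, hr, sub_self]
  { toFun := fun s => f (Function.surjInv hπ s)
    map_one' := by rw [key 1 1 (map_one π), map_one]
    map_mul' := fun x y => by
      rw [key (x * y) (Function.surjInv hπ x * Function.surjInv hπ y)
        (by rw [map_mul, Function.surjInv_eq hπ, Function.surjInv_eq hπ]), map_mul]
    map_zero' := by rw [key 0 0 (map_zero π), map_zero]
    map_add' := fun x y => by
      rw [key (x + y) (Function.surjInv hπ x + Function.surjInv hπ y)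
        (by rw [map_add, Function.surjInv_eq hπ, Function.surjInv_eq hπ]), map_add]
    commutes' := fun c => by rw [key _ (algebraMap k R c) (AlgHom.commutes π c), AlgHom.commutes] }

lemma AlgHom.descend_apply {R S E : Type*} [Ring R] [Algebra k R] [Ring S] [Algebra k S]
    [Ring E] [Algebra k E] (π : R →ₐ[k] S) (hπ : Function.Surjective π) (f : R →ₐ[k] E)
    (h : ∀ r, π r = 0 → f r = 0) (r : R) : AlgHom.descend π hπ f h (π r) = f r := by
  change f (Function.surjInv hπ (π r)) = f r
  rw [← sub_eq_zero, ← map_sub]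
  apply h
  rw [map_sub, Function.surjInv_eq hπ, sub_self]

namespace Bimodule

variable {R S : Type u} [Ring R] [Algebra k R] [Ring S] [Algebra k S]
  (π : R →ₐ[k] S) (hπ : Function.Surjective π)

/-- The subspace `K M` for the kernel `K` of `π`. -/
def leftKer (M : Bimodule k R R) : Submodule k M.carrier :=
  Submodule.span k {x | ∃ r m, π r = 0 ∧ x = M.lact r m}

/-- The subspace `K M + M K` for the kernel `K` of `π`. -/
def redSpan (M : Bimodule k R R) : Submodule k M.carrier :=
  Submodule.span k {x | ∃ r m, π r = 0 ∧ (x = M.lact r m ∨ x = M.ract (MulOpposite.op r) m)}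

/-- A bimodule `M` is normal with respect to `π` if `M K ⊆ K M` for the kernel `K` of `π`. -/
def IsNormal (M : Bimodule k R R) : Prop :=
  ∀ r m, π r = 0 → M.ract (MulOpposite.op r) m ∈ leftKer π M

variable {π}

lemma lact_mem_leftKer (M : Bimodule k R R) {r : R} (hr : π r = 0) (m : M.carrier) :
    M.lact r m ∈ leftKer π M := Submodule.subset_span ⟨r, m, hr, rfl⟩

lemma lact_mem_redSpan (M : Bimodule k R R) {r : R} (hr : π r = 0) (m : M.carrier) :
    M.lact r m ∈ redSpan π M := Submodule.subset_span ⟨r, m, hr, Or.inl rfl⟩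

lemma ract_mem_redSpan (M : Bimodule k R R) {r : R} (hr : π r = 0) (m : M.carrier) :
    M.ract (MulOpposite.op r) m ∈ redSpan π M := Submodule.subset_span ⟨r, m, hr, Or.inr rfl⟩

/-- A linear map that kills `K M` and `M K` kills `redSpan`. -/
lemma redSpan_le_ker {M : Bimodule k R R} {X : Type*} [AddCommGroup X] [Module k X]
    (f : M.carrier →ₗ[k] X) (hl : ∀ r m, π r = 0 → f (M.lact r m) = 0)
    (hr : ∀ r m, π r = 0 → f (M.ract (MulOpposite.op r) m) = 0) :
    redSpan π M ≤ LinearMap.ker f :=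
  Submodule.span_le.2 (by rintro _ ⟨r, m, h, rfl | rfl⟩; exacts [hl r m h, hr r m h])

lemma lact_redSpan (M : Bimodule k R R) (r : R) :
    redSpan π M ≤ (redSpan π M).comap (M.lact r) :=
  Submodule.span_le.2 (by
    rintro _ ⟨r', m, h, rfl | rfl⟩
    · rw [SetLike.mem_coe, Submodule.mem_comap, ← lact_mul]
      exact lact_mem_redSpan M (by rw [map_mul, h, mul_zero]) m
    · rw [SetLike.mem_coe, Submodule.mem_comap, lact_ract]
      exact ract_mem_redSpan M h _)

lemma ract_redSpan (M : Bimodule k R R) (r : Rᵐᵒᵖ) :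
    redSpan π M ≤ (redSpan π M).comap (M.ract r) :=
  Submodule.span_le.2 (by
    obtain ⟨r, rfl⟩ := MulOpposite.op_surjective r
    rintro _ ⟨r', m, h, rfl | rfl⟩
    · rw [SetLike.mem_coe, Submodule.mem_comap, ← lact_ract]
      exact lact_mem_redSpan M h _
    · rw [SetLike.mem_coe, Submodule.mem_comap, ← ract_mul]
      exact ract_mem_redSpan M (by rw [map_mul, h, zero_mul]) m)

/-- The left action of `R` on `M / (K M + M K)`. -/
def redPreLact (M : Bimodule k R R) : R →ₐ[k] Module.End k (M.carrier ⧸ redSpan π M) where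
  toFun r := (redSpan π M).mapQ (redSpan π M) (M.lact r) (lact_redSpan M r)
  map_one' := by apply Submodule.linearMap_qext; ext; simp
  map_mul' := by intros; apply Submodule.linearMap_qext; ext; simp
  map_zero' := by apply Submodule.linearMap_qext; ext; simp
  map_add' := by intros; apply Submodule.linearMap_qext; ext; simp
  commutes' := by intros; apply Submodule.linearMap_qext; ext; simp

/-- The right action of `R` on `M / (K M + M K)`. -/
def redPreRact (M : Bimodule k R R) : Rᵐᵒᵖ →ₐ[k] Module.End k (M.carrier ⧸ redSpan π M) where
  toFun r := (redSpan π M).mapQ (redSpan π M) (M.ract r) (ract_redSpan M r)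
  map_one' := by apply Submodule.linearMap_qext; ext; simp
  map_mul' := by intros; apply Submodule.linearMap_qext; ext; simp
  map_zero' := by apply Submodule.linearMap_qext; ext; simp
  map_add' := by intros; apply Submodule.linearMap_qext; ext; simp
  commutes' := by
    intro c; apply Submodule.linearMap_qext; apply LinearMap.ext; intro x
    exact congrArg (fun t => Submodule.Quotient.mk (p := redSpan π M) (t x))
      (M.ract.commutes c)

/-- The left action of `S` on `M / (K M + M K)`. -/
noncomputable def redLact (M : Bimodule k R R) :
    S →ₐ[k] Module.End k (M.carrier ⧸ redSpan π M) :=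
  AlgHom.descend π hπ (redPreLact M) (fun r hr => by
    apply Submodule.linearMap_qext
    ext m
    exact (Submodule.Quotient.mk_eq_zero _).2 (lact_mem_redSpan M hr m))

lemma op_surjective_of_surjective {π : R →ₐ[k] S} (hπ : Function.Surjective π) :
    Function.Surjective (AlgHom.op π) := fun s => by
  obtain ⟨r, hr⟩ := hπ s.unop
  exact ⟨MulOpposite.op r, by simp [hr]⟩

/-- The right action of `S` on `M / (K M + M K)`. -/
noncomputable def redRact (M : Bimodule k R R) :
    Sᵐᵒᵖ →ₐ[k] Module.End k (M.carrier ⧸ redSpan π M) :=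
  AlgHom.descend (AlgHom.op π) (op_surjective_of_surjective hπ) (redPreRact M) (fun r hr => by
    apply Submodule.linearMap_qext
    ext m
    exact (Submodule.Quotient.mk_eq_zero _).2
      (ract_mem_redSpan M (MulOpposite.op_injective hr) m))

lemma redLact_mk (M : Bimodule k R R) (r : R) (x : M.carrier) :
    redLact hπ M (π r) ((redSpan π M).mkQ x) = (redSpan π M).mkQ (M.lact r x) :=
  LinearMap.congr_fun (AlgHom.descend_apply π hπ (redPreLact M) _ r) _

lemma redRact_mk (M : Bimodule k R R) (r : R) (x : M.carrier) :
    redRact hπ M (MulOpposite.op (π r)) ((redSpan π M).mkQ x) =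
      (redSpan π M).mkQ (M.ract (MulOpposite.op r) x) :=
  LinearMap.congr_fun (AlgHom.descend_apply (AlgHom.op π) (op_surjective_of_surjective hπ)
    (redPreRact M) _ (MulOpposite.op r)) _

/-- The quotient `M / (K M + M K)` as a bimodule over the target of the surjection `π` with
kernel `K`, i.e. the bimodule `S ⊗ M ⊗ S`. -/
noncomputable def red (M : Bimodule k R R) : Bimodule k S S where
  carrier := M.carrier ⧸ redSpan π M
  lact := redLact hπ M
  ract := redRact hπ M
  lact_ract := by
    intro s s' x
    obtain ⟨r, rfl⟩ := hπ s
    obtain ⟨s', rfl⟩ := MulOpposite.op_surjective s'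
    obtain ⟨r', rfl⟩ := hπ s'
    obtain ⟨x, rfl⟩ := Submodule.mkQ_surjective _ x
    rw [redLact_mk, redRact_mk, redRact_mk, redLact_mk, M.lact_ract]

/-- The projection to the reduction of a bimodule. -/
noncomputable def redMk (M : Bimodule k R R) : M.carrier →ₗ[k] (red hπ M).carrier :=
  (redSpan π M).mkQ

variable {hπ}

lemma redMk_surjective (M : Bimodule k R R) : Function.Surjective (redMk hπ M) :=
  Submodule.mkQ_surjective _

lemma redMk_eq_zero_iff (M : Bimodule k R R) (x : M.carrier) :
    redMk hπ M x = 0 ↔ x ∈ redSpan π M := Submodule.Quotient.mk_eq_zero _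

lemma red_lact (M : Bimodule k R R) (r : R) (x : M.carrier) :
    (red hπ M).lact (π r) (redMk hπ M x) = redMk hπ M (M.lact r x) := redLact_mk hπ M r x

lemma red_ract (M : Bimodule k R R) (r : R) (x : M.carrier) :
    (red hπ M).ract (MulOpposite.op (π r)) (redMk hπ M x) =
      redMk hπ M (M.ract (MulOpposite.op r) x) := redRact_mk hπ M r x

/-- The universal property of the reduction of a bimodule. -/
noncomputable def redDesc {M : Bimodule k R R} {N : Bimodule k S S}
    (f : M.carrier →ₗ[k] N.carrier)
    (hl : ∀ r m, f (M.lact r m) = N.lact (π r) (f m))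
    (hr : ∀ r m, f (M.ract (MulOpposite.op r) m) = N.ract (MulOpposite.op (π r)) (f m)) :
    red hπ M ⟶ N :=
  mkHom (M := red hπ M) ((redSpan π M).liftQ f (redSpan_le_ker f
      (fun r m h => by rw [hl, h, map_zero, LinearMap.zero_apply])
      (fun r m h => by rw [hr, h, MulOpposite.op_zero, map_zero, LinearMap.zero_apply])))
    (by
      intro s x
      obtain ⟨r, rfl⟩ := hπ s
      obtain ⟨x, rfl⟩ := redMk_surjective M x
      rw [red_lact]
      exact hl r x)
    (by
      intro s x
      obtain ⟨s, rfl⟩ := MulOpposite.op_surjective s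
      obtain ⟨r, rfl⟩ := hπ s
      obtain ⟨x, rfl⟩ := redMk_surjective M x
      rw [red_ract]
      exact hr r x)

@[simp] lemma lin_redDesc {M : Bimodule k R R} {N : Bimodule k S S}
    (f : M.carrier →ₗ[k] N.carrier) (hl) (hr) (x : M.carrier) :
    lin (redDesc (hπ := hπ) (N := N) f hl hr) (redMk hπ M x) = f x := rfl

lemma red_hom_ext {M : Bimodule k R R} {N : Bimodule k S S} {f g : red hπ M ⟶ N}
    (h : ∀ x, lin f (redMk hπ M x) = lin g (redMk hπ M x)) : f = g := by
  apply hom_ext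
  intro x
  obtain ⟨x, rfl⟩ := redMk_surjective M x
  exact h x

/-- The reduction of a homomorphism. -/
noncomputable def redMap {M N : Bimodule k R R} (f : M ⟶ N) : red hπ M ⟶ red hπ N :=
  redDesc (redMk hπ N ∘ₗ lin f)
    (fun r m => by simp [lin_lact, red_lact]) (fun r m => by simp [lin_ract, red_ract])

@[simp] lemma lin_redMap {M N : Bimodule k R R} (f : M ⟶ N) (x : M.carrier) :
    lin (redMap (hπ := hπ) f) (redMk hπ M x) = redMk hπ N (lin f x) := rfl

variable (hπ)

/-- Reduction of bimodules as a functor. -/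
noncomputable def redFunctor : Bimodule k R R ⥤ Bimodule k S S where
  obj M := red hπ M
  map f := redMap f
  map_id M := by apply red_hom_ext; intro x; simp
  map_comp f g := by apply red_hom_ext; intro x; simp

instance : (redFunctor hπ).Additive where
  map_add := by
    intro X Y f g
    apply red_hom_ext
    intro x
    change redMk hπ Y (lin (f + g) x) = redMk hπ Y (lin f x) + redMk hπ Y (lin g x)
    rw [lin_add, LinearMap.add_apply, map_add]

variable {hπ}

lemma redMap_eq_zero_iff {M N : Bimodule k R R} (f : M ⟶ N) :
    redMap (hπ := hπ) f = 0 ↔ ∀ x, lin f x ∈ redSpan π N := by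
  constructor
  · intro h x
    rw [← redMk_eq_zero_iff (hπ := hπ), ← lin_redMap, h]
    rfl
  · intro h
    apply red_hom_ext
    intro x
    rw [lin_redMap, (redMk_eq_zero_iff N _).2 (h x)]
    rfl

lemma IsNormal.redSpan_eq {M : Bimodule k R R} (hM : IsNormal π M) :
    redSpan π M = leftKer π M := by
  apply le_antisymm
  · refine Submodule.span_le.2 ?_
    rintro _ ⟨r, m, h, rfl | rfl⟩
    · exact lact_mem_leftKer M h m
    · exact hM r m h
  · refine Submodule.span_le.2 ?_
    rintro _ ⟨r, m, h, rfl⟩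
    exact lact_mem_redSpan M h m

lemma lin_mem_leftKer {M N : Bimodule k R R} (f : M ⟶ N) {x : M.carrier}
    (hx : x ∈ leftKer π M) : lin f x ∈ leftKer π N := by
  have : leftKer π M ≤ (leftKer π N).comap (lin f) := Submodule.span_le.2 (by
    rintro _ ⟨r, m, h, rfl⟩
    rw [SetLike.mem_coe, Submodule.mem_comap, lin_lact]
    exact lact_mem_leftKer N h _)
  exact this hx

/-- Normality passes to the additive closure. -/
lemma isNormal_of_addClosure {P : ObjectProperty (Bimodule k R R)}
    (hP : ∀ M, P M → IsNormal π M) {M : Bimodule k R R} (hM : addClosure P M) : IsNormal π M := by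
  obtain ⟨m, G, f, g, hG, h⟩ := hM
  intro r x hr
  have hx : M.ract (MulOpposite.op r) x =
      ∑ i, lin (g i) (lin (f i) (M.ract (MulOpposite.op r) x)) := by
    have := congrArg (fun t => lin t (M.ract (MulOpposite.op r) x)) h
    simp only [lin_id, lin_sum, lin_comp] at this
    exact this
  rw [hx]
  refine Submodule.sum_mem _ fun i _ => lin_mem_leftKer _ ?_
  rw [lin_ract]
  exact hP _ (hG i) r _ hr

variable (hπ) in
/-- The linear map on the reduction of a bimodule induced by a linear map. -/
noncomputable def redLift {M : Bimodule k R R} {X : Type*} [AddCommGroup X] [Module k X]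
    (f : M.carrier →ₗ[k] X) (h : redSpan π M ≤ LinearMap.ker f) : (red hπ M).carrier →ₗ[k] X :=
  (redSpan π M).liftQ f h

lemma redMk_tmul_left (M N : Bimodule k R R) {x : M.carrier} (hx : x ∈ leftKer π M)
    (y : N.carrier) : redMk hπ (tensor M N) (tmul M N x y) = 0 := by
  induction hx using Submodule.span_induction with
  | mem x h =>
    obtain ⟨r, m, hr, rfl⟩ := h
    rw [← tensor_lact, redMk_eq_zero_iff]
    exact lact_mem_redSpan _ hr _
  | zero => simp
  | add x y _ _ hx hy => rw [map_add, LinearMap.add_apply, map_add, hx, hy, add_zero]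
  | smul c x _ hx => rw [map_smul, LinearMap.smul_apply, map_smul, hx, smul_zero]

variable (hπ) in
/-- The bilinear map underlying the compatibility of reduction with tensor products. -/
noncomputable def redTensorBil {M N : Bimodule k R R} (hM : IsNormal π M) :
    (red hπ M).carrier →ₗ[k] (red hπ N).carrier →ₗ[k] (red hπ (tensor M N)).carrier :=
  redLift hπ (redLift hπ ((tmul M N).compr₂ (redMk hπ (tensor M N))).flip (by
      refine redSpan_le_ker _ ?_ ?_
      · intro r m h
        apply LinearMap.ext
        intro x
        change redMk hπ (tensor M N) (tmul M N x (N.lact r m)) = 0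
        rw [← tmul_balanced]
        exact redMk_tmul_left _ _ (hM r x h) _
      · intro r m h
        apply LinearMap.ext
        intro x
        change redMk hπ (tensor M N) (tmul M N x (N.ract (MulOpposite.op r) m)) = 0
        rw [← tensor_ract, redMk_eq_zero_iff]
        exact ract_mem_redSpan _ h _)).flip
    (by
      rw [hM.redSpan_eq]
      intro x hx
      apply LinearMap.ext
      intro y
      obtain ⟨y, rfl⟩ := redMk_surjective N y
      exact redMk_tmul_left _ _ hx y)

lemma redTensorBil_mk {M N : Bimodule k R R} (hM : IsNormal π M) (x : M.carrier)
    (y : N.carrier) : redTensorBil hπ (N := N) hM (redMk hπ M x) (redMk hπ N y) =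
      redMk hπ (tensor M N) (tmul M N x y) := rfl

variable (hπ) in
/-- The homomorphism `red (M ⊗ N) ⟶ red M ⊗ red N`. -/
noncomputable def redTensorHom (M N : Bimodule k R R) :
    red hπ (tensor M N) ⟶ tensor (red hπ M) (red hπ N) :=
  redDesc (liftLin ((tmul (red hπ M) (red hπ N)).compl₁₂ (redMk hπ M) (redMk hπ N)) (by
      intro m s n
      simp only [LinearMap.compl₁₂_apply]
      rw [← red_ract, ← red_lact, tmul_balanced]))
    (by
      intro r x
      induction x using tensor_induction with
      | h m n =>
        rw [tensor_lact, liftLin_tmul, liftLin_tmul]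
        simp only [LinearMap.compl₁₂_apply]
        rw [tensor_lact, red_lact]
      | h0 => simp
      | hadd x y hx hy => simp only [map_add, hx, hy])
    (by
      intro r x
      induction x using tensor_induction with
      | h m n =>
        rw [tensor_ract, liftLin_tmul, liftLin_tmul]
        simp only [LinearMap.compl₁₂_apply]
        rw [tensor_ract, red_ract]
      | h0 => simp
      | hadd x y hx hy => simp only [map_add, hx, hy])

lemma lin_redTensorHom (M N : Bimodule k R R) (m : M.carrier) (n : N.carrier) :
    lin (redTensorHom hπ M N) (redMk hπ _ (tmul M N m n)) =
      tmul (red hπ M) (red hπ N) (redMk hπ M m) (redMk hπ N n) := by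
  rw [redTensorHom, lin_redDesc, liftLin_tmul]
  rfl

variable (hπ) in
/-- The homomorphism `red M ⊗ red N ⟶ red (M ⊗ N)` for a normal bimodule `M`. -/
noncomputable def redTensorInv (M N : Bimodule k R R) (hM : IsNormal π M) :
    tensor (red hπ M) (red hπ N) ⟶ red hπ (tensor M N) :=
  mkTensorHom (redTensorBil hπ hM)
    (by
      intro m s n
      obtain ⟨s, rfl⟩ := hπ s
      obtain ⟨m, rfl⟩ := redMk_surjective M m
      obtain ⟨n, rfl⟩ := redMk_surjective N n
      rw [red_ract, red_lact, redTensorBil_mk, redTensorBil_mk, tmul_balanced])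
    (by
      intro s m n
      obtain ⟨s, rfl⟩ := hπ s
      obtain ⟨m, rfl⟩ := redMk_surjective M m
      obtain ⟨n, rfl⟩ := redMk_surjective N n
      rw [red_lact, redTensorBil_mk, redTensorBil_mk, red_lact, tensor_lact])
    (by
      intro s m n
      obtain ⟨s, rfl⟩ := MulOpposite.op_surjective s
      obtain ⟨s, rfl⟩ := hπ s
      obtain ⟨m, rfl⟩ := redMk_surjective M m
      obtain ⟨n, rfl⟩ := redMk_surjective N n
      rw [red_ract, redTensorBil_mk, redTensorBil_mk, red_ract, tensor_ract])

lemma lin_redTensorInv (M N : Bimodule k R R) (hM : IsNormal π M) (m : M.carrier)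
    (n : N.carrier) : lin (redTensorInv hπ M N hM)
      (tmul (red hπ M) (red hπ N) (redMk hπ M m) (redMk hπ N n)) =
      redMk hπ _ (tmul M N m n) := by
  rw [redTensorInv, lin_mkTensorHom, redTensorBil_mk]

/-- Reduction is compatible with tensor products `M ⊗ N` with `M` normal. -/
noncomputable def redTensor (M N : Bimodule k R R) (hM : IsNormal π M) :
    red hπ (tensor M N) ≅ tensor (red hπ M) (red hπ N) where
  hom := redTensorHom hπ M N
  inv := redTensorInv hπ M N hM
  hom_inv_id := by
    apply red_hom_ext
    intro x
    induction x using tensor_induction with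
    | h m n => rw [lin_comp, lin_redTensorHom, lin_redTensorInv, lin_id]
    | h0 => simp
    | hadd x y hx hy => simp only [map_add, hx, hy]
  inv_hom_id := by
    apply tensor_hom_ext
    intro m n
    obtain ⟨m, rfl⟩ := redMk_surjective M m
    obtain ⟨n, rfl⟩ := redMk_surjective N n
    rw [lin_comp, lin_redTensorInv, lin_redTensorHom, lin_id]

lemma isNormal_self : IsNormal π (self k R) := fun r m hr =>
  Submodule.subset_span ⟨show R from (show R from m) * r, selfIn k R 1,
    by rw [map_mul, hr, mul_zero], by rw [self_lact, mul_one]; rfl⟩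

variable (hπ) in
/-- The homomorphism from the reduction of the regular bimodule of the source of a surjection of
algebras to the regular bimodule of its target. -/
noncomputable def redSelfHom : red hπ (self k R) ⟶ self k S :=
  redDesc ((selfIn k S).toLinearMap ∘ₗ π.toLinearMap ∘ₗ (selfIn k R).symm.toLinearMap)
    (by
      intro r x
      obtain ⟨x, rfl⟩ := (selfIn k R).surjective x
      simp)
    (by
      intro r x
      obtain ⟨x, rfl⟩ := (selfIn k R).surjective x
      simp)

lemma lin_redSelfHom (r : R) :
    lin (redSelfHom hπ) (redMk hπ (self k R) (selfIn k R r)) = selfIn k S (π r) := rfl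

variable (hπ) in
/-- The reduction of the regular bimodule is the regular bimodule. -/
noncomputable def redSelf : red hπ (self k R) ≅ self k S :=
  isoOfBijective (redSelfHom hπ) (by
    constructor
    · rw [injective_iff_map_eq_zero]
      intro x hx
      obtain ⟨x, rfl⟩ := redMk_surjective _ x
      obtain ⟨x, rfl⟩ := (selfIn k R).surjective x
      rw [lin_redSelfHom] at hx
      rw [redMk_eq_zero_iff]
      refine Submodule.subset_span ⟨x, selfIn k R 1, (selfIn k S).map_eq_zero_iff.1 hx, Or.inl ?_⟩
      rw [self_lact, mul_one]
    · intro s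
      obtain ⟨s, rfl⟩ := (selfIn k S).surjective s
      obtain ⟨r, rfl⟩ := hπ s
      exact ⟨_, lin_redSelfHom r⟩)

variable (hπ) in
/-- The homomorphism from the reduction of `R e ⊗ₖ f R` to `S π(e) ⊗ₖ π(f) S`. -/
noncomputable def redProjHom (e f : R) : red hπ (proj k e f) ⟶ proj k (π e) (π f) :=
  redDesc (projLift e f ((projBil k (π e) (π f)).compl₁₂ π.toLinearMap π.toLinearMap))
    (by
      intro r x
      induction x using proj_induction with
      | h x y => simp [mul_assoc]
      | h0 => simp
      | hadd x y hx hy => simp only [map_add, hx, hy])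
    (by
      intro r x
      induction x using proj_induction with
      | h x y => simp [← mul_assoc]
      | h0 => simp
      | hadd x y hx hy => simp only [map_add, hx, hy])

lemma lin_redProjHom {e f : R} (he : e * e = e) (hf : f * f = f) (x y : R) :
    lin (redProjHom hπ e f) (redMk hπ _ (projBil k e f x y)) =
      projBil k (π e) (π f) (π x) (π y) := by
  rw [redProjHom, lin_redDesc, projLift_projBil, LinearMap.compl₁₂_apply]
  exact projBil_congr _ _ (by simp [mul_assoc, ← map_mul, he])
    (by simp [← mul_assoc, ← map_mul, hf])

variable (hπ) in
/-- The reduction of `R e ⊗ₖ f R` is `S π(e) ⊗ₖ π(f) S`. -/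
noncomputable def redProj {e f : R} (he : e * e = e) (hf : f * f = f) :
    red hπ (proj k e f) ≅ proj k (π e) (π f) where
  hom := redProjHom hπ e f
  inv := projHom (π e) (π f) (redMk hπ _ (projBil k e f 1 1))
  hom_inv_id := by
    apply red_hom_ext
    intro x
    induction x using proj_induction with
    | h x y =>
      rw [lin_comp, lin_redProjHom he hf, lin_projHom, ← map_mul, ← map_mul, red_ract, red_lact,
        lin_id, ract_projBil, lact_projBil]
      exact congrArg (redMk hπ _) (projBil_congr _ _ (by simp [mul_assoc, he])
        (by simp [← mul_assoc, hf]))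
    | h0 => simp
    | hadd x y hx hy => simp only [map_add, hx, hy]
  inv_hom_id := by
    apply proj_hom_ext
    rw [lin_comp, lin_projHom, lin_lact, lin_ract, lin_redProjHom he hf, map_one, ract_projBil,
      lact_projBil, lin_id]
    exact projBil_congr _ _ (by simp [← map_mul, he]) (by simp [← map_mul, hf])

end Bimodule

/-! ### Reduction as a pseudofunctor on the bicategory of the zigzag algebra -/

section reduction

variable {n : ℕ}

/-- The reduction of a bimodule over the zigzag algebra along the projection to its quotient by the
two-cycles at the leaves. -/
noncomputable abbrev redStar (M : Bimodule k (Zigzag k n) (Zigzag k n)) :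
    Bimodule k (StarAlg k n) (StarAlg k n) := red StarAlg.mk_surjective M

/-- The two-cycles at the leaves act by zero on `Λ x ⊗ₖ e₀ Λ` from the right. -/
lemma isNormal_proj_e_zero (x : Zigzag k n) :
    IsNormal (S := StarAlg k n) (StarAlg.mk k) (proj k x (Zigzag.e k 0)) := by
  intro r m hr
  have h : (proj k x (Zigzag.e k 0)).ract (MulOpposite.op r) m = 0 := by
    induction m using proj_induction with
    | h x y =>
      rw [ract_projBil]
      refine (projBil_congr _ _ rfl ?_).trans (map_zero _)
      rw [mul_zero]
      exact Zigzag.e_zero_mul_cycSpan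
        (Zigzag.mul_mem_cycSpan y ((StarAlg.mk_eq_zero_iff r).1 hr))
    | h0 => simp
    | hadd x y hx hy => rw [map_add, hx, hy, add_zero]
  rw [h]
  exact Submodule.zero_mem _

lemma isNormal_of_starClass {M : Bimodule k (Zigzag k n) (Zigzag k n)}
    (hM : starClass (zigzagObj k n) (Zigzag.e k) M) :
    IsNormal (S := StarAlg k n) (StarAlg.mk k) M :=
  isNormal_of_addClosure (by
    rintro M (rfl | ⟨i, rfl⟩)
    · exact isNormal_self
    · exact isNormal_proj_e_zero _) hM

lemma starClass_redStar {M : Bimodule k (Zigzag k n) (Zigzag k n)}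
    (hM : starClass (zigzagObj k n) (Zigzag.e k) M) :
    starClass (starObj k n) (StarAlg.e k) (redStar M) := by
  refine addClosure_map (redFunctor StarAlg.mk_surjective) ?_ hM
  rintro M (rfl | ⟨i, rfl⟩)
  · exact addClosure_of_iso (redSelf _) (addClosure_of_mem (Or.inl rfl))
  · exact addClosure_of_iso (redProj _ (Zigzag.idem i) (Zigzag.idem 0))
      (addClosure_of_mem (Or.inr ⟨i, rfl⟩))

variable (k n) in
/-- The reduction of bimodules, as a pseudofunctor from the bicategory of bimodules over the zigzag
algebra of a star to the bicategory of bimodules over its quotient by the two-cycles at the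
leaves. -/
noncomputable def redPseudo : BTilde k n ⥤ᵖ BStar k n where
  obj _ := objStar k
  map F := ⟨redStar F.obj, starClass_redStar F.property⟩
  map₂ η := ObjectProperty.homMk (redMap (hπ := StarAlg.mk_surjective) η.hom)
  map₂_id F := by
    apply ObjectProperty.hom_ext
    exact (redFunctor StarAlg.mk_surjective).map_id F.obj
  map₂_comp η θ := by
    apply ObjectProperty.hom_ext
    exact (redFunctor StarAlg.mk_surjective).map_comp η.hom θ.hom
  mapId _ := ObjectProperty.isoMk _ (redSelf StarAlg.mk_surjective)
  mapComp F G := ObjectProperty.isoMk _ (redTensor (hπ := StarAlg.mk_surjective) G.obj F.obj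
    (isNormal_of_starClass G.property))
  map₂_whisker_left F G H η := by
    apply ObjectProperty.hom_ext
    apply red_hom_ext
    intro x
    induction x using tensor_induction with
    | h m n => rfl
    | h0 => simp
    | hadd x y hx hy => simp only [map_add, hx, hy]
  map₂_whisker_right η H := by
    apply ObjectProperty.hom_ext
    apply red_hom_ext
    intro x
    induction x using tensor_induction with
    | h m n => rfl
    | h0 => simp
    | hadd x y hx hy => simp only [map_add, hx, hy]
  map₂_associator F G H := by
    apply ObjectProperty.hom_ext
    apply red_hom_ext
    intro x
    induction x using tensor_induction with
    | h m y =>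
      induction y using tensor_induction with
      | h p q => rfl
      | h0 => simp
      | hadd x y hx hy => simp only [map_add, hx, hy]
    | h0 => simp
    | hadd x y hx hy => simp only [map_add, hx, hy]
  map₂_left_unitor F := by
    apply ObjectProperty.hom_ext
    apply red_hom_ext
    intro x
    induction x using tensor_induction with
    | h m n => exact (red_ract F.obj n m).symm
    | h0 => simp
    | hadd x y hx hy => simp only [map_add, hx, hy]
  map₂_right_unitor F := by
    apply ObjectProperty.hom_ext
    apply red_hom_ext
    intro x
    induction x using tensor_induction with
    | h m n => exact (red_lact F.obj m n).symm
    | h0 => simp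
    | hadd x y hx hy => simp only [map_add, hx, hy]

end reduction

/-! ### Additive closures: fullness, and lifting of direct summands -/

section closures

variable {C : Type u₁} [Category.{v₁} C] [Preadditive C] {D : Type u₂} [Category.{v₂} D]
  [Preadditive D]

lemma addClosure_fullSubcategory {P : ObjectProperty C} (X : (addClosure P).FullSubcategory) :
    addClosure (fun Y : (addClosure P).FullSubcategory => P Y.obj) X := by
  obtain ⟨m, G, f, g, hG, h⟩ := X.property
  refine ⟨m, fun i => ⟨G i, addClosure_of_mem (hG i)⟩, fun i => ObjectProperty.homMk (f i),
    fun i => ObjectProperty.homMk (g i), hG, ?_⟩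
  apply (addClosure P).ι.map_injective
  rw [Functor.map_sum]
  exact h

/-- A functor that is full on morphisms between two classes of objects is full on morphisms between
their additive closures. -/
lemma map_surjective_of_addClosure (F : C ⥤ D) [F.Additive] {P P' : ObjectProperty C}
    (h : ∀ X Y, P X → P' Y → Function.Surjective (F.map : (X ⟶ Y) → _)) {X Y : C}
    (hX : addClosure P X) (hY : addClosure P' Y) :
    Function.Surjective (F.map : (X ⟶ Y) → _) := by
  obtain ⟨m, G, f, g, hG, hf⟩ := hX
  obtain ⟨m', G', f', g', hG', hf'⟩ := hY
  intro φ
  choose ψ hψ using fun i j => h (G i) (G' j) (hG i) (hG' j) (F.map (g i) ≫ φ ≫ F.map (f' j))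
  refine ⟨∑ i, ∑ j, f i ≫ ψ i j ≫ g' j, ?_⟩
  have h1 : φ = F.map (𝟙 X) ≫ φ ≫ F.map (𝟙 Y) := by simp
  rw [h1, hf, hf']
  simp only [Functor.map_sum, Functor.map_comp, hψ, Preadditive.sum_comp, Preadditive.comp_sum,
    Category.assoc]
  exact Finset.sum_comm

/-- The existence of finite direct sums. -/
def HasSums (C : Type u₁) [Category.{v₁} C] [Preadditive C] : Prop :=
  ∀ (m : ℕ) (G : Fin m → C), ∃ (S : C) (ι : ∀ i, G i ⟶ S) (π : ∀ i, S ⟶ G i),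
    (∀ i, ι i ≫ π i = 𝟙 (G i)) ∧ (∀ i j, i ≠ j → ι i ≫ π j = 0) ∧ ∑ i, π i ≫ ι i = 𝟙 S

lemma hasSums_addClosure (hC : HasSums C) (P : ObjectProperty C) :
    HasSums (addClosure P).FullSubcategory := by
  intro m G
  obtain ⟨S, ι, π, h1, h2, h3⟩ := hC m (fun i => (G i).obj)
  refine ⟨⟨S, addClosure_trans (fun i => (G i).obj) π ι (fun i => (G i).property) h3.symm⟩,
    fun i => ObjectProperty.homMk (ι i), fun i => ObjectProperty.homMk (π i), ?_, ?_, ?_⟩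
  · intro i; exact ObjectProperty.hom_ext _ (h1 i)
  · intro i j h; exact ObjectProperty.hom_ext _ (h2 i j h)
  · apply (addClosure P).ι.map_injective
    rw [Functor.map_sum]
    exact h3

lemma isIdempotentComplete_addClosure [IsIdempotentComplete C] (P : ObjectProperty C) :
    IsIdempotentComplete (addClosure P).FullSubcategory where
  idempotents_split X p hp := by
    obtain ⟨W, i, e, h1, h2⟩ := IsIdempotentComplete.idempotents_split X.obj p.hom
      (congrArg (fun t => t.hom) hp)
    refine ⟨⟨W, addClosure_trans (ι := Unit) (fun _ => X.obj) (fun _ => i) (fun _ => e)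
      (fun _ => X.property) (by simp [h1])⟩, ObjectProperty.homMk i, ObjectProperty.homMk e, ?_, ?_⟩
    · exact ObjectProperty.hom_ext _ h1
    · exact ObjectProperty.hom_ext _ h2

/-- The ring homomorphism between endomorphism rings induced by an additive functor. -/
def endRingHom (F : C ⥤ D) [F.Additive] (X : C) : End X →+* End (F.obj X) where
  toFun f := F.map f
  map_one' := F.map_id X
  map_mul' f g := F.map_comp _ _
  map_zero' := F.map_zero X X
  map_add' f g := F.map_add

/-- A full additive functor whose kernel consists of nilpotent endomorphisms hits all direct
summands of sums of objects in its image, because idempotents lift along it. -/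
lemma exists_iso_of_addClosure (F : C ⥤ D) [F.Additive]
    (hfull : ∀ X, Function.Surjective (F.map : (X ⟶ X) → _)) (hsum : HasSums C)
    [IsIdempotentComplete C]
    (hnil : ∀ (X : C) (f : End X), F.map f = 0 → IsNilpotent f) {Z : D}
    (hZ : addClosure (fun W => ∃ X, Nonempty (F.obj X ≅ W)) Z) : ∃ X, Nonempty (F.obj X ≅ Z) := by
  obtain ⟨m, G, f, g, hG, h⟩ := hZ
  choose X e using hG
  obtain ⟨S, ι, π, h1, h2, -⟩ := hsum m X
  -- `Z` is a retract of `F S`; its image is cut out by an idempotent of `S` that lifts `v ≫ u`.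
  let u : Z ⟶ F.obj S := ∑ i, f i ≫ (e i).some.inv ≫ F.map (ι i)
  let v : F.obj S ⟶ Z := ∑ i, F.map (π i) ≫ (e i).some.hom ≫ g i
  have huv : u ≫ v = 𝟙 Z := by
    simp only [u, v, Preadditive.sum_comp, Preadditive.comp_sum, Category.assoc]
    rw [h]
    refine Finset.sum_congr rfl fun i _ => ?_
    rw [Finset.sum_eq_single i]
    · rw [← F.map_comp_assoc, h1, F.map_id, Category.id_comp, Iso.inv_hom_id_assoc]
    · intro j _ hj
      rw [← F.map_comp_assoc, h2 j i hj, F.map_zero]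
      simp
    · simp
  have hp : (show End (F.obj S) from v ≫ u) * (show End (F.obj S) from v ≫ u) = v ≫ u := by
    change (v ≫ u) ≫ (v ≫ u) = v ≫ u
    rw [Category.assoc, reassoc_of% huv]
  obtain ⟨p, hp1, hp2⟩ := exists_isIdempotentElem_eq_of_ker_isNilpotent (endRingHom F S)
    (fun x hx => hnil S x hx) (show End (F.obj S) from v ≫ u)
    (by obtain ⟨q, hq⟩ := hfull S (v ≫ u); exact ⟨q, hq⟩) hp
  obtain ⟨W, i, q, hiq, hqi⟩ := IsIdempotentComplete.idempotents_split S p hp1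
  have hp2 : F.map p = v ≫ u := hp2
  refine ⟨W, ⟨⟨F.map i ≫ v, u ≫ F.map q, ?_, ?_⟩⟩⟩
  · have : (F.map i ≫ v) ≫ u ≫ F.map q = F.map i ≫ (v ≫ u) ≫ F.map q := by simp
    rw [this, ← hp2, ← F.map_comp, ← F.map_comp, ← hqi]
    simp only [Category.assoc, hiq, Category.comp_id, F.map_id]
  · have : (u ≫ F.map q) ≫ F.map i ≫ v = u ≫ F.map (q ≫ i) ≫ v := by simp
    rw [this, hqi, hp2]
    simp [huv]

end closures

namespace Bimodule

variable {R S : Type u} [Ring R] [Algebra k R] [Ring S] [Algebra k S]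

lemma hasSums : HasSums (Bimodule k R S) := fun _ G =>
  ⟨directSum G, directSumι G, directSumπ G, directSum_ι_π G, fun _ _ h => directSum_ι_π_ne G h,
    directSum_sum G⟩

instance : IsIdempotentComplete (Bimodule k R S) where
  idempotents_split _ p hp := idem_split p hp

end Bimodule

/-! ### From bimodules over the zigzag algebra to modules over its quotient -/

section fiber

variable {n : ℕ}

/-- The simple module at the vertex `0` over the quotient of the zigzag algebra by the two-cycles
at the leaves. -/
noncomputable def simpleZero (k : Type u) [Field k] (n : ℕ) : Bimodule k (StarAlg k n) k where
  carrier := k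
  lact := (Algebra.lmul k k).comp (StarAlg.aug k n)
  ract :=
    { toFun := fun s => s.unop • LinearMap.id
      map_one' := by simp; rfl
      map_mul' := by
        intro a b
        ext
        simp [mul_comm]
      map_zero' := by simp
      map_add' := by intros; simp [add_smul]
      commutes' := by intro c; ext; simp }
  lact_ract := by intros; simp [mul_left_comm]

/-- The scalars, as elements of the simple module at the vertex `0`. -/
def simpleIn (k : Type u) [Field k] (n : ℕ) : k ≃ₗ[k] (simpleZero k n).carrier :=
  LinearEquiv.refl k k

lemma simpleZero_lact (r : StarAlg k n) (c : k) :
    (simpleZero k n).lact r (simpleIn k n c) = simpleIn k n (StarAlg.aug k n r * c) := rfl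

/-- The left module `red M ⊗ L` attached to a bimodule `M`, where `L` is the simple module at the
vertex `0`. -/
noncomputable abbrev fiber (M : Bimodule k (Zigzag k n) (Zigzag k n)) :
    Bimodule k (StarAlg k n) k :=
  tensor (redStar M) (simpleZero k n)

/-- The map `m ↦ [m] ⊗ 1`. -/
noncomputable def fiberMk (M : Bimodule k (Zigzag k n) (Zigzag k n)) :
    M.carrier →ₗ[k] (fiber M).carrier :=
  (tmul (redStar M) (simpleZero k n)).flip (simpleIn k n 1) ∘ₗ redMk StarAlg.mk_surjective M

variable (M N : Bimodule k (Zigzag k n) (Zigzag k n))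

lemma fiberMk_apply (x : M.carrier) : fiberMk M x =
    tmul (redStar M) (simpleZero k n) (redMk StarAlg.mk_surjective M x) (simpleIn k n 1) := rfl

lemma tmul_simpleIn (x : M.carrier) (c : k) :
    tmul (redStar M) (simpleZero k n) (redMk StarAlg.mk_surjective M x) (simpleIn k n c) =
      c • fiberMk M x := by
  rw [fiberMk_apply, ← map_smul, ← map_smul, smul_eq_mul, mul_one]

lemma fiberMk_surjective : Function.Surjective (fiberMk M) := by
  intro x
  induction x using tensor_induction with
  | h m l =>
    obtain ⟨m, rfl⟩ := redMk_surjective M m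
    obtain ⟨c, rfl⟩ := (simpleIn k n).surjective l
    exact ⟨c • m, by rw [map_smul, tmul_simpleIn]⟩
  | h0 => exact ⟨0, map_zero _⟩
  | hadd x y hx hy =>
    obtain ⟨a, rfl⟩ := hx
    obtain ⟨b, rfl⟩ := hy
    exact ⟨a + b, map_add _ _ _⟩

lemma fiber_lact (r : Zigzag k n) (x : M.carrier) :
    (fiber M).lact (StarAlg.mk k r) (fiberMk M x) = fiberMk M (M.lact r x) := by
  rw [fiberMk_apply, tensor_lact, red_lact, fiberMk_apply]

lemma fiberMk_ract (r : Zigzag k n) (x : M.carrier) :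
    fiberMk M (M.ract (MulOpposite.op r) x) = Zigzag.vertexChar k 0 r • fiberMk M x := by
  rw [fiberMk_apply, ← red_ract, tmul_balanced, simpleZero_lact, StarAlg.aug_mk, mul_one,
    tmul_simpleIn]

variable {M N}

/-- The universal property of `fiber M`. -/
noncomputable def fiberDesc {V : Bimodule k (StarAlg k n) k} (f : M.carrier →ₗ[k] V.carrier)
    (hl : ∀ r m, f (M.lact r m) = V.lact (StarAlg.mk k r) (f m))
    (hr : ∀ r m, f (M.ract (MulOpposite.op r) m) = Zigzag.vertexChar k 0 r • f m) :
    fiber M ⟶ V :=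
  have h : redSpan (S := StarAlg k n) (StarAlg.mk k) M ≤ LinearMap.ker f := redSpan_le_ker f
    (fun r m h => by rw [hl, h, lact_zero])
    (fun r m h => by rw [hr, ← StarAlg.aug_mk, h, map_zero, zero_smul])
  mkTensorHom (M := redStar M) (N := simpleZero k n)
    (((LinearMap.lsmul k V.carrier).flip.compl₁₂ (redLift StarAlg.mk_surjective f h)
      (simpleIn k n).symm.toLinearMap))
    (by
      intro m s l
      obtain ⟨s, rfl⟩ := StarAlg.mk_surjective s
      obtain ⟨m, rfl⟩ := redMk_surjective M m
      obtain ⟨c, rfl⟩ := (simpleIn k n).surjective l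
      rw [red_ract]
      change c • f (M.ract (MulOpposite.op s) m) = (StarAlg.aug k n (StarAlg.mk k s) * c) • f m
      rw [hr, StarAlg.aug_mk, smul_smul, mul_comm])
    (by
      intro s m l
      obtain ⟨s, rfl⟩ := StarAlg.mk_surjective s
      obtain ⟨m, rfl⟩ := redMk_surjective M m
      obtain ⟨c, rfl⟩ := (simpleIn k n).surjective l
      rw [red_lact]
      change c • f (M.lact s m) = V.lact _ (c • f m)
      rw [hl, map_smul])
    (by
      intro s m l
      obtain ⟨m, rfl⟩ := redMk_surjective M m
      obtain ⟨c, rfl⟩ := (simpleIn k n).surjective l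
      rw [ract_ground V]
      change (s.unop * c) • f m = s.unop • c • f m
      rw [mul_smul])

@[simp] lemma lin_fiberDesc {V : Bimodule k (StarAlg k n) k} (f : M.carrier →ₗ[k] V.carrier)
    (hl) (hr) (x : M.carrier) : lin (fiberDesc (V := V) f hl hr) (fiberMk M x) = f x := by
  rw [fiberDesc, fiberMk_apply, lin_mkTensorHom]
  exact one_smul k (f x)

lemma fiber_hom_ext {V : Bimodule k (StarAlg k n) k} {f g : fiber M ⟶ V}
    (h : ∀ x, lin f (fiberMk M x) = lin g (fiberMk M x)) : f = g := by
  apply hom_ext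
  intro x
  obtain ⟨x, rfl⟩ := fiberMk_surjective M x
  exact h x

/-- The homomorphism of modules induced by a homomorphism of bimodules. -/
noncomputable def fiberMap (f : M ⟶ N) : fiber M ⟶ fiber N :=
  tmap (redMap f) (𝟙 (simpleZero k n))

@[simp] lemma lin_fiberMap (f : M ⟶ N) (x : M.carrier) :
    lin (fiberMap f) (fiberMk M x) = fiberMk N (lin f x) := lin_tmap _ _ _ _

variable (k n) in
/-- The functor `fiber` on bimodules. -/
noncomputable def fiberFunctor :
    Bimodule k (Zigzag k n) (Zigzag k n) ⥤ Bimodule k (StarAlg k n) k where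
  obj M := fiber M
  map f := fiberMap f
  map_id M := by
    apply fiber_hom_ext; intro x
    rw [lin_fiberMap]; rfl
  map_comp f g := by
    apply fiber_hom_ext; intro x
    rw [lin_fiberMap, lin_comp, lin_comp, lin_fiberMap, lin_fiberMap]

lemma fiberFunctor_map (f : M ⟶ N) : (fiberFunctor k n).map f = fiberMap f := rfl

instance : (fiberFunctor k n).Additive where
  map_add {X Y f g} := by
    change fiberMap (f + g) = fiberMap f + fiberMap g
    apply fiber_hom_ext; intro x
    rw [lin_add, LinearMap.add_apply, lin_fiberMap, lin_fiberMap, lin_fiberMap, lin_add,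
      LinearMap.add_apply, map_add]

instance : (fiberFunctor k n).Linear k where
  map_smul {X Y} f r := by
    change fiberMap (r • f) = r • fiberMap f
    apply fiber_hom_ext; intro x
    rw [lin_smul, LinearMap.smul_apply, lin_fiberMap, lin_fiberMap, lin_smul,
      LinearMap.smul_apply, map_smul]

lemma fiberMap_eq_zero_iff (f : M ⟶ N) :
    fiberMap f = 0 ↔ ∀ x, fiberMk N (lin f x) = 0 := by
  constructor
  · intro h x
    rw [← lin_fiberMap, h]
    rfl
  · intro h
    apply fiber_hom_ext
    intro x
    rw [lin_fiberMap, h]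
    rfl

/-- The element `x e` of the left module `R e`. -/
def leftProjElt {R : Type u} [Ring R] [Algebra k R] (e : R) : R →ₗ[k] (leftProj k e).carrier :=
  LinearMap.rangeRestrict (LinearMap.mulRight k e)

section leftProj

variable {R : Type u} [Ring R] [Algebra k R] (e : R)

lemma leftProjElt_surjective : Function.Surjective (leftProjElt (k := k) e) :=
  LinearMap.surjective_rangeRestrict _

lemma leftProj_lact (r x : R) :
    (leftProj k e).lact r (leftProjElt e x) = leftProjElt e (r * x) :=
  Subtype.ext (mul_assoc r x e).symm

lemma leftProjElt_congr {x y : R} (h : x * e = y * e) :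
    leftProjElt (k := k) e x = leftProjElt e y := Subtype.ext h

lemma leftProjElt_eq_zero_iff (x : R) : leftProjElt (k := k) e x = 0 ↔ x * e = 0 :=
  ⟨fun h => congrArg Subtype.val h, fun h => Subtype.ext h⟩

/-- Homomorphisms out of the left module `R e` are given by elements. -/
def leftProjHom {V : Bimodule k R k} (v : V.carrier) : leftProj k e ⟶ V :=
  mkHom (M := leftProj k e)
    { toFun := fun x => V.lact (show LinearMap.range (LinearMap.mulRight k e) from x).1 v
      map_add' := fun x y => lact_add V _ _ v
      map_smul' := fun c x => lact_smul V c _ v }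
    (fun r x => lact_mul V _ _ v)
    (fun s x => by
      rw [ract_ground, ract_ground]
      exact lact_smul V _ _ v)

lemma lin_leftProjHom {V : Bimodule k R k} (v : V.carrier) (x : R) :
    lin (leftProjHom e v) (leftProjElt e x) = V.lact (x * e) v := rfl

lemma leftProj_hom_ext {V : Bimodule k R k} {f g : leftProj k e ⟶ V}
    (he : e * e = e)
    (h : lin f (leftProjElt e 1) = lin g (leftProjElt e 1)) : f = g := by
  apply hom_ext
  intro x
  obtain ⟨x, rfl⟩ := leftProjElt_surjective e x
  have : leftProjElt (k := k) e x = (leftProj k e).lact x (leftProjElt e 1) := by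
    rw [leftProj_lact, mul_one]
  rw [this, lin_lact, lin_lact, h]

end leftProj

/-- The linear map `x eᵢ ⊗ e₀ y ↦ χ₀(y) [x] eᵢ`, where `χ₀` is the character at the vertex `0`. -/
noncomputable def fiberProjLin (i : Fin (n + 1)) :
    (proj k (Zigzag.e k i) (Zigzag.e k 0)).carrier →ₗ[k] (leftProj k (StarAlg.e k i)).carrier :=
  projLift (Zigzag.e k i) (Zigzag.e k 0)
    ((LinearMap.lsmul k _).flip.compl₁₂
      (leftProjElt (StarAlg.e k i) ∘ₗ (StarAlg.mk k).toLinearMap)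
      (Zigzag.vertexChar k 0).toLinearMap)

lemma fiberProjLin_projBil (i : Fin (n + 1)) (x y : Zigzag k n) :
    fiberProjLin i (projBil (k := k) (Zigzag.e k i) (Zigzag.e k 0) x y) =
      Zigzag.vertexChar k 0 y • leftProjElt (StarAlg.e k i) (StarAlg.mk k x) := by
  have h : fiberProjLin i (projBil (k := k) (Zigzag.e k i) (Zigzag.e k 0) x y) =
      Zigzag.vertexChar k 0 (Zigzag.e k 0 * y) •
        leftProjElt (StarAlg.e k i) (StarAlg.mk k (x * Zigzag.e k i)) :=
    projLift_projBil _ _ _ _ _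
  rw [h, map_mul, Zigzag.vertexChar_e, if_pos rfl, one_mul, map_mul]
  congr 1
  apply leftProjElt_congr
  rw [mul_assoc]
  exact congrArg _ (StarAlg.idem k i)

/-- The homomorphism from the module attached to `Λ eᵢ ⊗ₖ e₀ Λ` to `A eᵢ`. -/
noncomputable def fiberProjHom (i : Fin (n + 1)) :
    fiber (proj k (Zigzag.e k i) (Zigzag.e k 0)) ⟶ leftProj k (StarAlg.e k i) :=
  fiberDesc (fiberProjLin i)
    (by
      intro r m
      induction m using proj_induction with
      | h x y =>
        rw [lact_projBil, fiberProjLin_projBil, fiberProjLin_projBil, map_smul, leftProj_lact,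
          map_mul]
      | h0 => simp
      | hadd x y hx hy => simp only [map_add, hx, hy])
    (by
      intro r m
      induction m using proj_induction with
      | h x y =>
        rw [ract_projBil, fiberProjLin_projBil, fiberProjLin_projBil, smul_smul, map_mul _ y,
          mul_comm]
      | h0 => simp
      | hadd x y hx hy => simp only [map_add, hx, hy, smul_add])

lemma lin_fiberProjHom (i : Fin (n + 1)) (x y : Zigzag k n) :
    lin (fiberProjHom i) (fiberMk _ (projBil (k := k) (Zigzag.e k i) (Zigzag.e k 0) x y)) =
      Zigzag.vertexChar k 0 y • leftProjElt (StarAlg.e k i) (StarAlg.mk k x) := by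
  rw [fiberProjHom, lin_fiberDesc, fiberProjLin_projBil]

/-- The module attached to `Λ eᵢ ⊗ₖ e₀ Λ` is `A eᵢ`. -/
noncomputable def fiberProj (i : Fin (n + 1)) :
    fiber (proj k (Zigzag.e k i) (Zigzag.e k 0)) ≅ leftProj k (StarAlg.e k i) where
  hom := fiberProjHom i
  inv := leftProjHom (StarAlg.e k i)
    (fiberMk _ (projBil (k := k) (Zigzag.e k i) (Zigzag.e k 0) 1 1))
  hom_inv_id := by
    apply fiber_hom_ext
    intro m
    induction m using proj_induction with
    | h x y =>
      rw [lin_comp, lin_fiberProjHom, map_smul, lin_leftProjHom, StarAlg.e, ← map_mul, fiber_lact,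
        lact_projBil, mul_one, lin_id]
      have h1 : projBil (k := k) (Zigzag.e k i) (Zigzag.e k 0) (x * Zigzag.e k i) 1 =
          projBil (k := k) (Zigzag.e k i) (Zigzag.e k 0) x 1 :=
        projBil_congr _ _ (by rw [mul_assoc, Zigzag.idem]) rfl
      have h2 : projBil (k := k) (Zigzag.e k i) (Zigzag.e k 0) x y =
          (proj k (Zigzag.e k i) (Zigzag.e k 0)).ract (MulOpposite.op y)
            (projBil (k := k) (Zigzag.e k i) (Zigzag.e k 0) x 1) := by
        rw [ract_projBil, one_mul]
      rw [h1, h2, fiberMk_ract]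
    | h0 => simp
    | hadd x y hx hy => simp only [map_add, hx, hy]
  inv_hom_id := by
    apply leftProj_hom_ext _ (StarAlg.idem k i)
    rw [lin_comp, lin_leftProjHom, lin_lact, lin_fiberProjHom, map_one, one_smul, map_one,
      leftProj_lact, mul_one, one_mul, lin_id]
    apply leftProjElt_congr
    rw [StarAlg.idem, one_mul]

end fiber

/-! ### The indecomposable projective bimodules: fullness and nilpotence -/

section projBim

variable {n : ℕ}

/-- The bimodule `Λ eᵢ ⊗ₖ e₀ Λ`. -/
abbrev projBim (k : Type u) [Field k] {n : ℕ} (i : Fin (n + 1)) :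
    Bimodule k (Zigzag k n) (Zigzag k n) := proj k (Zigzag.e k i) (Zigzag.e k 0)

/-- The bilinear map `(x, y) ↦ x eᵢ ⊗ e₀ y`. -/
abbrev projBimBil (k : Type u) [Field k] {n : ℕ} (i : Fin (n + 1)) :
    Zigzag k n →ₗ[k] Zigzag k n →ₗ[k] (projBim k i).carrier :=
  projBil k (Zigzag.e k i) (Zigzag.e k 0)

variable {M N : Bimodule k (Zigzag k n) (Zigzag k n)}

lemma fiberMk_projHom (i : Fin (n + 1)) (y : N.carrier) (x z : Zigzag k n) :
    fiberMk N (lin (projHom (Zigzag.e k i) (Zigzag.e k 0) y) (projBimBil k i x z)) =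
      Zigzag.vertexChar k 0 z • (fiber N).lact (StarAlg.mk k (x * Zigzag.e k i)) (fiberMk N y) := by
  rw [lin_projHom, ← fiber_lact, fiberMk_ract, map_mul _ (Zigzag.e k 0), Zigzag.vertexChar_e,
    if_pos rfl, one_mul, map_smul]

/-- The functor `fiber` is full on morphisms out of `Λ eᵢ ⊗ₖ e₀ Λ`. -/
lemma fiberMap_surjective_projBim (i : Fin (n + 1)) :
    Function.Surjective (fiberMap : (projBim k i ⟶ N) → _) := by
  intro g
  obtain ⟨y, hy⟩ := fiberMk_surjective N (lin g (fiberMk _ (projBimBil k i 1 1)))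
  refine ⟨projHom _ _ y, ?_⟩
  apply fiber_hom_ext
  intro m
  induction m using proj_induction with
  | h x z =>
    rw [lin_fiberMap, fiberMk_projHom, hy, ← lin_lact, fiber_lact, lact_projBil, mul_one,
      projBil_eq_act _ _ x z, lact_ract, fiberMk_ract, map_smul, lact_projBil, mul_one]
    congr 3
    exact projBil_congr _ _ (by rw [mul_assoc, Zigzag.idem]) rfl
  | h0 => simp
  | hadd x y hx hy => simp only [map_add, hx, hy]

/-- Reduction is full on morphisms out of `Λ eᵢ ⊗ₖ e₀ Λ`. -/
lemma redMap_surjective_projBim (i : Fin (n + 1)) :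
    Function.Surjective
      (redMap : (projBim k i ⟶ N) → (redStar (projBim k i) ⟶ redStar N)) := by
  intro g
  obtain ⟨y, hy⟩ := redMk_surjective N (lin g (redMk StarAlg.mk_surjective _ (projBimBil k i 1 1)))
  refine ⟨projHom _ _ y, ?_⟩
  apply red_hom_ext
  intro m
  induction m using proj_induction with
  | h x z =>
    rw [lin_redMap, lin_projHom, ← red_lact, ← red_ract, hy, ← lin_ract, ← lin_lact, red_ract,
      red_lact, ract_projBil, lact_projBil]
    congr 2
    exact projBil_congr _ _ (by rw [mul_one, mul_assoc, Zigzag.idem])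
      (by rw [one_mul, ← mul_assoc, Zigzag.idem])
  | h0 => simp
  | hadd x y hx hy => simp only [map_add, hx, hy]

/-- The additive closure of the bimodules `Λ eᵢ ⊗ₖ e₀ Λ`. -/
def projClass (k : Type u) [Field k] (n : ℕ) :
    ObjectProperty (Bimodule k (Zigzag k n) (Zigzag k n)) :=
  addClosure fun X => ∃ i, X = projBim k i

lemma projClass_le_starClass (hM : projClass k n M) :
    starClass (zigzagObj k n) (Zigzag.e k) M :=
  addClosure_mono (fun _ h => Or.inr h) hM

lemma fiberMap_surjective (hM : projClass k n M) :
    Function.Surjective (fiberMap : (M ⟶ N) → _) :=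
  map_surjective_of_addClosure (P' := fun X => X = N) (fiberFunctor k n) (by
    rintro X Y ⟨i, rfl⟩ rfl
    exact fiberMap_surjective_projBim i) hM (addClosure_of_mem rfl)

/-- For `c = b a`, the subspace `J M + M c`, where `J` is spanned by the two-cycles at the
leaves. -/
noncomputable def radSpan (m : Fin n) (M : Bimodule k (Zigzag k n) (Zigzag k n)) :
    Submodule k M.carrier :=
  leftKer (S := StarAlg k n) (StarAlg.mk k) M ⊔
    LinearMap.range (M.ract (MulOpposite.op (Zigzag.b k m * Zigzag.a k m)))

lemma lin_mem_radSpan {m : Fin n} (f : M ⟶ N) {x : M.carrier} (hx : x ∈ radSpan m M) :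
    lin f x ∈ radSpan m N := by
  obtain ⟨y, hy, _, ⟨z, rfl⟩, rfl⟩ := Submodule.mem_sup.1 hx
  rw [map_add, lin_ract]
  exact Submodule.add_mem_sup (lin_mem_leftKer f hy) ⟨_, rfl⟩

lemma lact_mem_leftKer_of_mem (r : Zigzag k n) {x : M.carrier}
    (hx : x ∈ leftKer (S := StarAlg k n) (StarAlg.mk k) M) :
    M.lact r x ∈ leftKer (S := StarAlg k n) (StarAlg.mk k) M := by
  have : leftKer (S := StarAlg k n) (StarAlg.mk k) M ≤
      (leftKer (S := StarAlg k n) (StarAlg.mk k) M).comap (M.lact r) := Submodule.span_le.2 (by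
    rintro _ ⟨j, w, hj, rfl⟩
    change M.lact r (M.lact j w) ∈ leftKer (S := StarAlg k n) (StarAlg.mk k) M
    rw [← lact_mul]
    exact lact_mem_leftKer M (by rw [map_mul, hj, mul_zero]) w)
  exact this hx

lemma ract_mem_leftKer_of_mem (r : Zigzag k n) {x : M.carrier}
    (hx : x ∈ leftKer (S := StarAlg k n) (StarAlg.mk k) M) :
    M.ract (MulOpposite.op r) x ∈ leftKer (S := StarAlg k n) (StarAlg.mk k) M := by
  have : leftKer (S := StarAlg k n) (StarAlg.mk k) M ≤
      (leftKer (S := StarAlg k n) (StarAlg.mk k) M).comap (M.ract (MulOpposite.op r)) :=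
    Submodule.span_le.2 (by
      rintro _ ⟨j, w, hj, rfl⟩
      change M.ract _ (M.lact j w) ∈ leftKer (S := StarAlg k n) (StarAlg.mk k) M
      rw [← lact_ract]
      exact lact_mem_leftKer M hj _)
  exact this hx

lemma lact_mem_radSpan {m : Fin n} (r : Zigzag k n) {x : M.carrier} (hx : x ∈ radSpan m M) :
    M.lact r x ∈ radSpan m M := by
  obtain ⟨y, hy, _, ⟨z, rfl⟩, rfl⟩ := Submodule.mem_sup.1 hx
  rw [map_add, lact_ract]
  exact Submodule.add_mem_sup (lact_mem_leftKer_of_mem r hy) ⟨_, rfl⟩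

lemma ract_mem_radSpan {m : Fin n} (r : Zigzag k n) {x : M.carrier} (hx : x ∈ radSpan m M) :
    M.ract (MulOpposite.op r) x ∈ radSpan m M := by
  obtain ⟨y, hy, _, ⟨z, rfl⟩, rfl⟩ := Submodule.mem_sup.1 hx
  rw [map_add]
  refine Submodule.add_mem_sup (ract_mem_leftKer_of_mem r hy) ⟨Zigzag.vertexChar k 0 r • z, ?_⟩
  rw [← ract_mul, Zigzag.ba_mul, map_smul]
  exact (ract_smul M (Zigzag.vertexChar k 0 r) _ z).symm

lemma ract_e_zero_mem_radSpan_projBim (m : Fin n) (i : Fin (n + 1)) {x : (projBim k i).carrier}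
    (hx : fiberMk (projBim k i) x = 0) :
    (projBim k i).ract (MulOpposite.op (Zigzag.e k 0)) x ∈ radSpan m (projBim k i) := by
  -- As `e₀ Λ e₀` is spanned by `e₀` and `c`, the element is of the form `y ⊗ e₀ + z ⊗ c`.
  have key : ∀ x : (projBim k i).carrier, ∃ y z, (projBim k i).ract
      (MulOpposite.op (Zigzag.e k 0)) x = projBimBil k i y 1 +
        projBimBil k i z (Zigzag.b k m * Zigzag.a k m) := by
    intro x
    induction x using proj_induction with
    | h x y =>
      refine ⟨Zigzag.vertexChar k 0 y • x, Zigzag.coordC k y • x, ?_⟩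
      rw [ract_projBil, map_smul, map_smul, LinearMap.smul_apply, LinearMap.smul_apply,
        ← map_smul, ← map_smul, ← map_add]
      refine projBil_congr _ _ rfl ?_
      rw [← mul_assoc, Zigzag.e_zero_mul_mul_e_zero m, mul_add, mul_smul_comm, mul_smul_comm,
        mul_one, Zigzag.e_mul_ba, if_pos rfl]
    | h0 => exact ⟨0, 0, by simp⟩
    | hadd x y hx hy =>
      obtain ⟨y1, z1, h1⟩ := hx
      obtain ⟨y2, z2, h2⟩ := hy
      refine ⟨y1 + y2, z1 + z2, ?_⟩
      rw [map_add, h1, h2, map_add, map_add, LinearMap.add_apply, LinearMap.add_apply]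
      abel
  obtain ⟨y, z, h⟩ := key x
  have h1 : fiberMk (projBim k i) ((projBim k i).ract (MulOpposite.op (Zigzag.e k 0)) x) = 0 := by
    rw [fiberMk_ract, hx, smul_zero]
  have h2 := congrArg (lin (fiberProjHom (k := k) i)) h1
  rw [h, map_add, map_add, lin_fiberProjHom, lin_fiberProjHom, map_zero, map_one, one_smul,
    map_mul _ (Zigzag.b k m), Zigzag.vertexChar_a, mul_zero, zero_smul, add_zero,
    leftProjElt_eq_zero_iff, StarAlg.e, ← map_mul] at h2
  rw [h]
  refine Submodule.add_mem_sup ?_ ⟨projBimBil k i z 1, ?_⟩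
  · have : projBimBil k i y 1 = (projBim k i).lact (y * Zigzag.e k i) (projBimBil k i 1 1) := by
      rw [lact_projBil]
      exact projBil_congr _ _ (by rw [mul_one, mul_assoc, Zigzag.idem]) rfl
    rw [this]
    exact lact_mem_leftKer _ h2 _
  · rw [ract_projBil, one_mul]

/-- The right action of `e₀` moves the kernel of the projection from `M` to the attached module into
`J M + M c`. -/
lemma ract_e_zero_mem_radSpan (m : Fin n) (hM : projClass k n M) {x : M.carrier}
    (hx : fiberMk M x = 0) : M.ract (MulOpposite.op (Zigzag.e k 0)) x ∈ radSpan m M := by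
  obtain ⟨r, G, f, g, hG, h⟩ := hM
  have h1 : x = ∑ i, lin (g i) (lin (f i) x) := by
    have := congrArg (fun t => lin t x) h
    simpa [lin_sum] using this
  rw [h1, map_sum]
  refine Submodule.sum_mem _ fun i _ => ?_
  rw [← lin_ract]
  apply lin_mem_radSpan
  obtain ⟨j, hj⟩ := hG i
  have h2 : fiberMk (G i) (lin (f i) x) = 0 := by rw [← lin_fiberMap, hx, map_zero]
  revert h2
  generalize lin (f i) x = y
  revert y
  rw [hj]
  exact fun y hy => ract_e_zero_mem_radSpan_projBim m j hy

/-- A homomorphism killed by `fiber` has image in `J N + N c`. -/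
lemma lin_mem_radSpan_of_fiberMap_eq_zero (m : Fin n) (hM : projClass k n M)
    (hN : projClass k n N) {f : M ⟶ N} (hf : fiberMap f = 0) (x : M.carrier) :
    lin f x ∈ radSpan m N := by
  obtain ⟨r, G, p, q, hG, h⟩ := hM
  have h1 : lin f x = ∑ i, lin (q i ≫ f) (lin (p i) x) := by
    have := congrArg (fun t => lin f (lin t x)) h
    simpa [lin_sum] using this
  rw [h1]
  refine Submodule.sum_mem _ fun i _ => ?_
  obtain ⟨j, hj⟩ := hG i
  have h2 : fiberMap (q i ≫ f) = 0 := by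
    have := (fiberFunctor k n).map_comp (q i) f
    rw [fiberFunctor_map, fiberFunctor_map, fiberFunctor_map, hf] at this
    rw [this]
    exact Limits.comp_zero
  revert h2
  generalize q i ≫ f = φ
  generalize lin (p i) x = y
  revert y φ
  rw [hj]
  intro φ y hφ
  induction y using proj_induction with
  | h a b =>
    rw [projBil_eq_act, lin_lact, lin_ract]
    apply lact_mem_radSpan
    apply ract_mem_radSpan
    have h3 := ract_e_zero_mem_radSpan m hN
      ((fiberMap_eq_zero_iff φ).1 hφ (projBimBil k j 1 1))
    rw [← lin_ract, ract_projBil] at h3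
    have h4 : projBimBil k j 1 (1 * Zigzag.e k 0) = projBimBil k j 1 1 :=
      projBil_congr _ _ rfl (by rw [one_mul, mul_one, Zigzag.idem])
    rwa [h4] at h3
  | h0 => rw [map_zero]; exact Submodule.zero_mem _
  | hadd x y hx hy => rw [map_add]; exact Submodule.add_mem _ hx hy

lemma lact_mul_eq_zero_of_mk {r s : Zigzag k n} (hr : StarAlg.mk k r = 0)
    (hs : StarAlg.mk k s = 0) (x : M.carrier) : M.lact r (M.lact s x) = 0 := by
  rw [← lact_mul, Zigzag.cycSpan_mul_cycSpan ((StarAlg.mk_eq_zero_iff r).1 hr)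
    ((StarAlg.mk_eq_zero_iff s).1 hs)]
  simp

/-- Endomorphisms killed by `fiber` are nilpotent, as `J ^ 2 = 0` and `c ^ 2 = 0`. -/
lemma fiberMap_nilpotent (m : Fin n) (hM : projClass k n M) {f : M ⟶ M} (hf : fiberMap f = 0) :
    f ≫ f ≫ f = 0 := by
  set c := Zigzag.b k m * Zigzag.a k m
  have hc : ∀ x, M.ract (MulOpposite.op c) (M.ract (MulOpposite.op c) x) = 0 := by
    intro x
    rw [← ract_mul, Zigzag.ba_mul, map_mul, Zigzag.vertexChar_a, mul_zero, zero_smul]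
    simp
  -- The image of `f` lies in `J M + M c`, and `f` commutes with the actions of `J` and `c`. So `f`
  -- kills `J M c`, and `f ≫ f` kills `J M` and `M c`.
  have h0 := lin_mem_radSpan_of_fiberMap_eq_zero m hM hM hf
  have h1 : ∀ r x, StarAlg.mk k r = 0 →
      lin f (M.lact r (M.ract (MulOpposite.op c) x)) = 0 := by
    intro r x hr
    obtain ⟨y, hy, _, ⟨z, rfl⟩, h⟩ := Submodule.mem_sup.1 (h0 x)
    rw [lin_lact, lin_ract, ← h, map_add, map_add, hc, map_zero, add_zero, lact_ract]
    have : leftKer (S := StarAlg k n) (StarAlg.mk k) M ≤ LinearMap.ker (M.lact r) :=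
      Submodule.span_le.2 (by
        rintro _ ⟨j, w, hj, rfl⟩
        exact lact_mul_eq_zero_of_mk hr hj w)
    have h2 : M.lact r y = 0 := this hy
    rw [h2, map_zero]
  have h2 : ∀ r x, StarAlg.mk k r = 0 → lin f (lin f (M.lact r x)) = 0 := by
    intro r x hr
    obtain ⟨y, hy, _, ⟨z, rfl⟩, h⟩ := Submodule.mem_sup.1 (h0 x)
    rw [lin_lact, ← h, map_add, map_add, h1 r z hr, add_zero]
    have : leftKer (S := StarAlg k n) (StarAlg.mk k) M ≤ LinearMap.ker (M.lact r) :=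
      Submodule.span_le.2 (by
        rintro _ ⟨j, w, hj, rfl⟩
        exact lact_mul_eq_zero_of_mk hr hj w)
    have h2 : M.lact r y = 0 := this hy
    rw [h2, map_zero]
  have h3 : ∀ x, x ∈ leftKer (S := StarAlg k n) (StarAlg.mk k) M → lin f (lin f x) = 0 := by
    have : leftKer (S := StarAlg k n) (StarAlg.mk k) M ≤ LinearMap.ker (lin f ∘ₗ lin f) :=
      Submodule.span_le.2 (by
        rintro _ ⟨j, w, hj, rfl⟩
        exact h2 j w hj)
    exact fun x hx => this hx
  apply hom_ext
  intro x
  obtain ⟨y, hy, _, ⟨z, rfl⟩, h⟩ := Submodule.mem_sup.1 (h0 x)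
  rw [lin_comp, lin_comp, ← h, map_add, map_add, h3 y hy, zero_add, lin_ract]
  obtain ⟨y', hy', _, ⟨z', rfl⟩, h'⟩ := Submodule.mem_sup.1 (h0 z)
  rw [← h', map_add, hc, add_zero]
  have h4 : leftKer (S := StarAlg k n) (StarAlg.mk k) M ≤
      LinearMap.ker (lin f ∘ₗ M.ract (MulOpposite.op c)) :=
    Submodule.span_le.2 (by
      rintro _ ⟨j, w, hj, rfl⟩
      change lin f (M.ract _ (M.lact j w)) = 0
      rw [← lact_ract]
      exact h1 j w hj)
  exact h4 hy'

lemma isNilpotent_of_fiberMap_eq_zero (m : Fin n) (hM : projClass k n M) {f : End M}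
    (hf : fiberMap (show M ⟶ M from f) = 0) : IsNilpotent f :=
  ⟨3, by rw [pow_succ, pow_two]; exact fiberMap_nilpotent m hM hf⟩

end projBim

/-! ### The bimodule at the internal node is indecomposable -/

section indec

/-- An object all of whose endomorphisms are nilpotent or invertible is indecomposable. -/
lemma isIndec_of_end {C : Type u₁} [Category.{v₁} C] [Preadditive C] {X : C} (h0 : 𝟙 X ≠ 0)
    (h : ∀ f : End X, IsNilpotent f ∨ IsUnit f) : IsIndec X := by
  refine ⟨fun hX => h0 (hX.eq_of_src _ _), ?_⟩
  rintro Y Z b ⟨hb⟩ ⟨i⟩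
  -- An idempotent that is nilpotent is zero, and one that is invertible is the identity. This is
  -- applied to the idempotent of the first summand.
  have hp : ∀ p : End b.pt, p * p = p → p = 0 ∨ p = 1 := by
    intro p hp
    have hq : IsIdempotentElem (show End X from i.hom ≫ p ≫ i.inv) := by
      change (i.hom ≫ p ≫ i.inv) ≫ (i.hom ≫ p ≫ i.inv) = i.hom ≫ p ≫ i.inv
      have hp' : p ≫ p = p := hp
      simp only [Category.assoc, Iso.inv_hom_id_assoc]
      rw [reassoc_of% hp']
    rcases h (i.hom ≫ p ≫ i.inv) with hn | hu
    · left
      obtain ⟨m, hm⟩ := hn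
      have : (show End X from i.hom ≫ p ≫ i.inv) = 0 := by
        rcases Nat.eq_zero_or_pos m with rfl | hm0
        · have h1 : (1 : End X) = 0 := by simpa using hm
          exact (h0 h1).elim
        · rw [← hq.pow_eq hm0.ne']
          exact hm
      have h2 : i.hom ≫ p ≫ i.inv = 0 := this
      have h3 : p = i.inv ≫ (i.hom ≫ p ≫ i.inv) ≫ i.hom := by simp
      rw [h3, h2]
      simp
    · right
      have : (show End X from i.hom ≫ p ≫ i.inv) = 1 :=
        (IsIdempotentElem.iff_eq_one_of_isUnit hu).1 hq
      have h2 : i.hom ≫ p ≫ i.inv = 𝟙 X := this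
      have h3 : p = i.inv ≫ (i.hom ≫ p ≫ i.inv) ≫ i.hom := by simp
      rw [h3, h2]
      simp
  rcases hp (b.fst ≫ b.inl) (by change (b.fst ≫ b.inl) ≫ b.fst ≫ b.inl = _; simp) with h1 | h1
  · left
    rw [Limits.IsZero.iff_id_eq_zero]
    have : 𝟙 Y = b.inl ≫ (b.fst ≫ b.inl) ≫ b.fst := by simp
    rw [this, h1]
    simp
  · right
    have h1 : b.fst ≫ b.inl = 𝟙 b.pt := h1
    rw [Limits.IsZero.iff_id_eq_zero]
    have : 𝟙 Z = b.inr ≫ 𝟙 _ ≫ b.snd := by simp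
    rw [this, ← h1]
    simp

variable {n : ℕ}

lemma projClass_projBim (i : Fin (n + 1)) : projClass k n (projBim k i) :=
  addClosure_of_mem ⟨i, rfl⟩

lemma fiberMap_comp {M N P : Bimodule k (Zigzag k n) (Zigzag k n)} (f : M ⟶ N) (g : N ⟶ P) :
    fiberMap (f ≫ g) = fiberMap f ≫ fiberMap g := (fiberFunctor k n).map_comp f g

lemma fiberMap_id (M : Bimodule k (Zigzag k n) (Zigzag k n)) :
    fiberMap (𝟙 M) = 𝟙 (fiber M) := (fiberFunctor k n).map_id M

lemma fiberMap_sub {M N : Bimodule k (Zigzag k n) (Zigzag k n)} (f g : M ⟶ N) :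
    fiberMap (f - g) = fiberMap f - fiberMap g := (fiberFunctor k n).map_sub

lemma fiberMap_smul {M N : Bimodule k (Zigzag k n) (Zigzag k n)} (c : k) (f : M ⟶ N) :
    fiberMap (c • f) = c • fiberMap f := (fiberFunctor k n).map_smul c f

lemma leftProjElt_one_ne_zero (i : Fin (n + 1)) :
    leftProjElt (k := k) (StarAlg.e k i) 1 ≠ 0 := by
  rw [Ne, leftProjElt_eq_zero_iff, one_mul, StarAlg.e, StarAlg.mk_eq_zero_iff]
  intro h
  have := Zigzag.vertexChar_cycSpan (i := i) h
  rw [Zigzag.vertexChar_e, if_pos rfl] at this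
  exact one_ne_zero this

lemma fiberMk_projBim_ne_zero (i : Fin (n + 1)) :
    fiberMk (projBim k i) (projBimBil k i 1 1) ≠ 0 := by
  intro h
  apply leftProjElt_one_ne_zero (k := k) i
  have := congrArg (lin (fiberProjHom i)) h
  rwa [lin_fiberProjHom, map_one, one_smul, map_one, map_zero] at this

lemma fiberMap_id_projBim_ne_zero (i : Fin (n + 1)) :
    fiberMap (𝟙 (projBim k i)) ≠ 0 := by
  intro h
  exact fiberMk_projBim_ne_zero (k := k) i ((fiberMap_eq_zero_iff _).1 h _)

lemma lin_sub_apply {R S : Type u} [Ring R] [Algebra k R] [Ring S] [Algebra k S]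
    {M N : Bimodule k R S} (f g : M ⟶ N) (x : M.carrier) :
    lin (f - g) x = lin f x - lin g x := by
  rw [lin_sub]

/-- Every endomorphism of `A e₀` is the sum of a scalar and a square zero endomorphism. -/
lemma exists_sq_zero_leftProj_zero (m : Fin n)
    (h : leftProj k (StarAlg.e k (0 : Fin (n + 1))) ⟶ leftProj k (StarAlg.e k 0)) :
    ∃ s : k, (h - s • 𝟙 _) ≫ (h - s • 𝟙 _) = 0 := by
  obtain ⟨y, hy⟩ := leftProjElt_surjective (k := k) (StarAlg.e k 0)
    (lin h (leftProjElt (StarAlg.e k 0) 1))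
  obtain ⟨y, rfl⟩ := StarAlg.mk_surjective y
  have h1 : lin h (leftProjElt (StarAlg.e k 0) 1) =
      Zigzag.vertexChar k 0 y • leftProjElt (StarAlg.e k 0) 1 + Zigzag.coordC k y •
        leftProjElt (StarAlg.e k 0) (StarAlg.mk k (Zigzag.b k m * Zigzag.a k m)) := by
    have h2 : leftProjElt (k := k) (StarAlg.e k (0 : Fin (n + 1))) 1 =
        (leftProj k (StarAlg.e k 0)).lact (StarAlg.e k 0) (leftProjElt (StarAlg.e k 0) 1) := by
      rw [leftProj_lact]
      exact leftProjElt_congr _ (by rw [one_mul, mul_one, StarAlg.idem])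
    rw [h2, lin_lact, ← hy, leftProj_lact, leftProj_lact, ← map_smul, ← map_smul, ← map_add]
    apply leftProjElt_congr
    rw [StarAlg.e, ← map_mul, ← map_mul, Zigzag.e_zero_mul_mul_e_zero m, mul_one, ← map_smul,
      ← map_smul, ← map_add, ← map_mul, add_mul, smul_mul_assoc, smul_mul_assoc, Zigzag.ba_mul_e,
      if_pos rfl, Zigzag.idem]
  refine ⟨Zigzag.vertexChar k 0 y, ?_⟩
  apply leftProj_hom_ext _ (StarAlg.idem k 0)
  set ν := h - Zigzag.vertexChar k 0 y • 𝟙 (leftProj k (StarAlg.e k 0))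
  have h3 : lin ν (leftProjElt (StarAlg.e k 0) 1) = Zigzag.coordC k y •
        leftProjElt (StarAlg.e k 0) (StarAlg.mk k (Zigzag.b k m * Zigzag.a k m)) := by
    rw [lin_sub_apply, h1, lin_smul, LinearMap.smul_apply, lin_id, add_sub_cancel_left]
  have h4 : leftProjElt (k := k) (StarAlg.e k 0) (StarAlg.mk k (Zigzag.b k m * Zigzag.a k m)) =
      (leftProj k (StarAlg.e k 0)).lact (StarAlg.mk k (Zigzag.b k m * Zigzag.a k m))
        (leftProjElt (StarAlg.e k 0) 1) := by
    rw [leftProj_lact, mul_one]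
  rw [lin_comp, h3, map_smul, h4, lin_lact, h3, map_smul, leftProj_lact, ← map_mul,
    Zigzag.ba_mul, map_mul _ (Zigzag.b k m), Zigzag.vertexChar_a, mul_zero, zero_smul]
  simp

/-- The endomorphisms of the bimodule at the internal node are nilpotent or invertible. -/
lemma isNilpotent_or_isUnit_projBim_zero (m : Fin n) (f : End (projBim k (0 : Fin (n + 1)))) :
    IsNilpotent f ∨ IsUnit f := by
  obtain ⟨s, hs⟩ := exists_sq_zero_leftProj_zero m
    ((fiberProj 0).inv ≫ fiberMap (show projBim k (0 : Fin (n + 1)) ⟶ _ from f) ≫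
      (fiberProj 0).hom)
  have h1 : fiberMap ((f - s • 𝟙 _) ≫ (f - s • 𝟙 _) :
      projBim k (0 : Fin (n + 1)) ⟶ projBim k 0) = 0 := by
    have h2 : (fiberProj 0).inv ≫ fiberMap (show projBim k (0 : Fin (n + 1)) ⟶ _ from f) ≫
        (fiberProj 0).hom - s • 𝟙 _ =
        (fiberProj 0).inv ≫ fiberMap (show projBim k (0 : Fin (n + 1)) ⟶ _ from f - s • 𝟙 _) ≫
        (fiberProj 0).hom := by
      change _ = (fiberProj 0).inv ≫ fiberMap (_ - _) ≫ _
      rw [fiberMap_sub, fiberMap_smul, fiberMap_id]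
      simp
    rw [h2] at hs
    rw [fiberMap_comp, ← cancel_epi (fiberProj 0).inv, ← cancel_mono (fiberProj 0).hom]
    simpa using hs
  have h2 : IsNilpotent (f - s • (1 : End (projBim k (0 : Fin (n + 1))))) := by
    have := isNilpotent_of_fiberMap_eq_zero m (projClass_projBim (k := k) 0) h1
    have h3 : IsNilpotent ((f - s • (1 : End (projBim k (0 : Fin (n + 1))))) ^ 2) := by
      rw [pow_two]; exact this
    exact (IsNilpotent.pow_iff_pos two_ne_zero).1 h3
  by_cases hs0 : s = 0
  · left
    rwa [hs0, zero_smul, sub_zero] at h2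
  · right
    have h3 : IsUnit (s • (1 : End (projBim k (0 : Fin (n + 1))))) :=
      ⟨⟨s • 1, s⁻¹ • 1, by simp [hs0], by simp [hs0]⟩, rfl⟩
    have h4 : Commute (f - s • (1 : End (projBim k (0 : Fin (n + 1))))) (s • 1) := by
      have : Commute f (s • (1 : End (projBim k (0 : Fin (n + 1))))) :=
        (Commute.one_right f).smul_right s
      exact this.sub_left (Commute.refl _)
    have := h2.isUnit_add_left_of_commute h3 h4
    rwa [add_sub_cancel] at this

end indec

/-! ### Retracts and functionals for the bimodules `Λ eᵢ ⊗ₖ e₀ Λ` -/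

section retract

variable {n : ℕ}

/-- The element `e₀ ⊗ e₀` of `e₀ Λ ⊗ Λ e₀`, as a homomorphism. -/
noncomputable def nodeUnit (k : Type u) [Field k] (n : ℕ) : self k k ⟶
    tensor (rightProj k (Zigzag.e k (0 : Fin (n + 1)))) (leftProj k (Zigzag.e k 0)) :=
  mkHom ((LinearMap.toSpanSingleton k _ (tmul (rightProj k (Zigzag.e k (0 : Fin (n + 1))))
      (leftProj k (Zigzag.e k 0)) ⟨Zigzag.e k 0 * 1, 1, rfl⟩ ⟨1 * Zigzag.e k 0, 1, rfl⟩)).comp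
      (selfIn k k).symm.toLinearMap)
    (by
      intro r x
      rw [lact_ground, lact_ground, map_smul])
    (by
      intro r x
      rw [ract_ground, ract_ground, map_smul])

/-- The functional on `e₀ Λ ⊗ Λ e₀` that sends `x ⊗ y` to `χ₀(x y)`, where `χ₀` is the character at
the vertex `0`. -/
noncomputable def nodePairing (k : Type u) [Field k] (n : ℕ) :
    tensor (rightProj k (Zigzag.e k (0 : Fin (n + 1)))) (leftProj k (Zigzag.e k 0)) ⟶ self k k :=
  mkTensorHom
    (((LinearMap.mul k (Zigzag k n)).compr₂ ((selfIn k k).toLinearMap ∘ₗ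
      (Zigzag.vertexChar k 0).toLinearMap)).compl₁₂
        (Submodule.subtype (LinearMap.range (LinearMap.mulLeft k (Zigzag.e k 0))))
        (Submodule.subtype (LinearMap.range (LinearMap.mulRight k (Zigzag.e k 0)))))
    (by
      rintro ⟨_, x, rfl⟩ s ⟨_, y, rfl⟩
      exact congrArg (fun t => selfIn k k (Zigzag.vertexChar k 0 t)) (mul_assoc _ s _))
    (by
      intro r x y
      rw [lact_ground (rightProj k (Zigzag.e k (0 : Fin (n + 1)))), lact_ground, map_smul,
        LinearMap.smul_apply])
    (by
      intro r x y
      rw [ract_ground (leftProj k (Zigzag.e k (0 : Fin (n + 1)))), ract_ground, map_smul])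

lemma nodeUnit_nodePairing : nodeUnit k n ≫ nodePairing k n = 𝟙 (self k k) := by
  apply hom_ext
  intro x
  obtain ⟨x, rfl⟩ := (selfIn k k).surjective x
  have h1 : lin (nodeUnit k n) (selfIn k k x) = x • tmul
      (rightProj k (Zigzag.e k (0 : Fin (n + 1)))) (leftProj k (Zigzag.e k 0))
      ⟨Zigzag.e k 0 * 1, 1, rfl⟩ ⟨1 * Zigzag.e k 0, 1, rfl⟩ := rfl
  rw [lin_comp, h1, map_smul, lin_id]
  have h2 : lin (nodePairing k n) (tmul
      (rightProj k (Zigzag.e k (0 : Fin (n + 1)))) (leftProj k (Zigzag.e k 0))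
      ⟨Zigzag.e k 0 * 1, 1, rfl⟩ ⟨1 * Zigzag.e k 0, 1, rfl⟩) = selfIn k k 1 := by
    refine (lin_mkTensorHom _ _ _ _ _ _).trans ?_
    change selfIn k k (Zigzag.vertexChar k 0 (Zigzag.e k 0 * 1 * (1 * Zigzag.e k 0))) = _
    rw [mul_one, one_mul, Zigzag.idem, Zigzag.vertexChar_e, if_pos rfl]
  rw [h2, ← map_smul, smul_eq_mul, mul_one]

section tmap

variable {R S T U : Type u} [Ring R] [Algebra k R] [Ring S] [Algebra k S]
  [Ring T] [Algebra k T] [Ring U] [Algebra k U]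

lemma tmap_comp_tmap {M M' M'' : Bimodule k R S} {N N' N'' : Bimodule k S T} (f : M ⟶ M')
    (f' : M' ⟶ M'') (g : N ⟶ N') (g' : N' ⟶ N'') :
    tmap f g ≫ tmap f' g' = tmap (f ≫ f') (g ≫ g') := by
  apply tensor_hom_ext
  intro x y
  rw [lin_comp, lin_tmap, lin_tmap, lin_tmap, lin_comp, lin_comp]

lemma tmap_id_id (M : Bimodule k R S) (N : Bimodule k S T) :
    tmap (𝟙 M) (𝟙 N) = 𝟙 (tensor M N) := by
  apply tensor_hom_ext
  intro x y
  rw [lin_tmap, lin_id, lin_id, lin_id]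

/-- The functor `X ⊗ - ⊗ Y`. -/
noncomputable def sandwich (X : Bimodule k R S) (Y : Bimodule k T U) :
    Bimodule k S T ⥤ Bimodule k R U where
  obj Z := tensor X (tensor Z Y)
  map f := tmap (𝟙 X) (tmap f (𝟙 Y))
  map_id Z := by rw [tmap_id_id, tmap_id_id]
  map_comp f g := by rw [tmap_comp_tmap, tmap_comp_tmap, Category.comp_id, Category.comp_id]

/-- The tensor product of isomorphisms. -/
noncomputable def tensorIso {X X' : Bimodule k R S} (e : X ≅ X') {Y Z : Bimodule k S T}
    (f : Y ≅ Z) : tensor X Y ≅ tensor X' Z where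
  hom := tmap e.hom f.hom
  inv := tmap e.inv f.inv
  hom_inv_id := by rw [tmap_comp_tmap, e.hom_inv_id, f.hom_inv_id, tmap_id_id]
  inv_hom_id := by rw [tmap_comp_tmap, e.inv_hom_id, f.inv_hom_id, tmap_id_id]

end tmap

/-- The bimodule `Λ eᵢ ⊗ₖ e₀ Λ` is a direct summand of `(Λ eᵢ ⊗ₖ e₀ Λ) ⊗ (Λ e₀ ⊗ₖ e₀ Λ)`, as the
ground field is a direct summand of `e₀ Λ ⊗ Λ e₀`. -/
noncomputable def projBimRetract (i : Fin (n + 1)) :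
    Retract (projBim k i) (tensor (projBim k i) (projBim k 0)) :=
  let L : Bimodule k (Zigzag k n) k := leftProj k (Zigzag.e k i)
  let R : Bimodule k k (Zigzag k n) := rightProj k (Zigzag.e k 0)
  let L₀ : Bimodule k (Zigzag k n) k := leftProj k (Zigzag.e k 0)
  let e₁ : projBim k i ≅ (sandwich L R).obj (self k k) := tensorIso (Iso.refl L) (leftUnit R).symm
  let e₂ : (sandwich L R).obj (tensor R L₀) ≅ tensor (projBim k i) (projBim k 0) :=
    tensorIso (Iso.refl L) (assoc R L₀ R) ≪≫ (assoc L R (tensor L₀ R)).symm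
  { i := e₁.hom ≫ (sandwich L R).map (nodeUnit k n) ≫ e₂.hom
    r := e₂.inv ≫ (sandwich L R).map (nodePairing k n) ≫ e₁.inv
    retract := by
      have h : (sandwich L R).map (nodeUnit k n) ≫ (sandwich L R).map (nodePairing k n) = 𝟙 _ := by
        rw [← Functor.map_comp, nodeUnit_nodePairing, CategoryTheory.Functor.map_id]
      simp [reassoc_of% h] }

/-- A linear functional `ξ` on the module attached to `M` induces the bilinear map
`(x ⊗ y, m) ↦ ξ(e₀ y m) x e₀`, where `x ⊗ y` is in `Λ e₀ ⊗ₖ e₀ Λ`, with values in `A e₀`. -/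
noncomputable def functionalBil {M : Bimodule k (Zigzag k n) (Zigzag k n)}
    (ξ : (fiber M).carrier →ₗ[k] k) : (projBim k (0 : Fin (n + 1))).carrier →ₗ[k]
      M.carrier →ₗ[k] (leftProj k (StarAlg.e k (0 : Fin (n + 1)))).carrier :=
  projLift (Zigzag.e k 0) (Zigzag.e k 0) (LinearMap.mk₂ k
    (fun x y => LinearMap.toSpanSingleton k _ (leftProjElt (StarAlg.e k 0) (StarAlg.mk k x)) ∘ₗ
      ξ ∘ₗ fiberMk M ∘ₗ M.lact y)
    (by intros; ext; simp)
    (by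
      intro c x y
      refine LinearMap.ext fun m => ?_
      simp only [LinearMap.comp_apply, LinearMap.toSpanSingleton_apply, LinearMap.smul_apply,
        map_smul]
      rw [smul_comm])
    (by intros; ext; simp [add_smul]) (by intros; ext; simp [mul_smul]))

lemma functionalBil_projBil {M : Bimodule k (Zigzag k n) (Zigzag k n)}
    (ξ : (fiber M).carrier →ₗ[k] k) (x y : Zigzag k n) (m : M.carrier) :
    functionalBil ξ (projBimBil k 0 x y) m =
      ξ (fiberMk M (M.lact (Zigzag.e k 0 * y) m)) •
        leftProjElt (StarAlg.e k 0) (StarAlg.mk k x) := by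
  have h : functionalBil ξ (projBimBil k 0 x y) m =
      ξ (fiberMk M (M.lact (Zigzag.e k 0 * y) m)) •
        leftProjElt (StarAlg.e k 0) (StarAlg.mk k (x * Zigzag.e k 0)) :=
    LinearMap.congr_fun (projLift_projBil _ _ _ _ _) m
  rw [h, map_mul (StarAlg.mk k)]
  congr 1
  apply leftProjElt_congr
  rw [mul_assoc]
  exact congrArg _ (StarAlg.idem k 0)

/-- The linear map induced by `functionalBil` on the tensor product over the zigzag algebra. -/
noncomputable def functionalLin {M : Bimodule k (Zigzag k n) (Zigzag k n)}
    (ξ : (fiber M).carrier →ₗ[k] k) : (tensor (projBim k (0 : Fin (n + 1))) M).carrier →ₗ[k]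
      (leftProj k (StarAlg.e k (0 : Fin (n + 1)))).carrier :=
  liftLin (functionalBil ξ) (by
    intro p s m
    induction p using proj_induction with
    | h x y =>
      rw [ract_projBil, functionalBil_projBil, functionalBil_projBil, ← lact_mul, mul_assoc]
    | h0 => simp
    | hadd x y hx hy => simp only [map_add, LinearMap.add_apply, hx, hy])

lemma functionalLin_tmul {M : Bimodule k (Zigzag k n) (Zigzag k n)}
    (ξ : (fiber M).carrier →ₗ[k] k) (x y : Zigzag k n) (m : M.carrier) :
    functionalLin ξ (tmul _ _ (projBimBil k 0 x y) m) =
      ξ (fiberMk M (M.lact (Zigzag.e k 0 * y) m)) •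
        leftProjElt (StarAlg.e k 0) (StarAlg.mk k x) :=
  (liftLin_tmul _ _ _ _).trans (functionalBil_projBil ξ x y m)

lemma tensor_proj_induction {M : Bimodule k (Zigzag k n) (Zigzag k n)} {i : Fin (n + 1)}
    {p : (tensor (projBim k i) M).carrier → Prop} (t : (tensor (projBim k i) M).carrier)
    (h : ∀ x y m, p (tmul _ _ (projBimBil k i x y) m)) (h0 : p 0)
    (hadd : ∀ x y, p x → p y → p (x + y)) : p t := by
  induction t using tensor_induction with
  | h z m =>
    induction z using proj_induction with
    | h x y => exact h x y m
    | h0 => rw [map_zero, LinearMap.zero_apply]; exact h0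
    | hadd x y hx hy => rw [map_add, LinearMap.add_apply]; exact hadd _ _ hx hy
  | h0 => exact h0
  | hadd x y hx hy => exact hadd _ _ hx hy

/-- The homomorphism, from the module attached to `(Λ e₀ ⊗ₖ e₀ Λ) ⊗ M` to `A e₀`, that is induced
by a linear functional on the module attached to `M`. -/
noncomputable def fiberFunctional {M : Bimodule k (Zigzag k n) (Zigzag k n)}
    (ξ : (fiber M).carrier →ₗ[k] k) :
    fiber (tensor (projBim k (0 : Fin (n + 1))) M) ⟶ leftProj k (StarAlg.e k (0 : Fin (n + 1))) :=
  fiberDesc (functionalLin ξ)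
    (by
      intro r t
      induction t using tensor_proj_induction with
      | h x y m =>
        rw [tensor_lact, lact_projBil, functionalLin_tmul, functionalLin_tmul, map_smul,
          leftProj_lact, map_mul (StarAlg.mk k)]
      | h0 => simp
      | hadd x y hx hy => simp only [map_add, hx, hy])
    (by
      intro r t
      induction t using tensor_proj_induction with
      | h x y m =>
        rw [tensor_ract, functionalLin_tmul, functionalLin_tmul, lact_ract, fiberMk_ract,
          map_smul, smul_smul, smul_eq_mul]
      | h0 => simp
      | hadd x y hx hy => simp only [map_add, hx, hy, smul_add])

lemma lin_fiberFunctional {M : Bimodule k (Zigzag k n) (Zigzag k n)}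
    (ξ : (fiber M).carrier →ₗ[k] k) (x y : Zigzag k n) (m : M.carrier) :
    lin (fiberFunctional ξ) (fiberMk _ (tmul _ _ (projBimBil k 0 x y) m)) =
      ξ (fiberMk M (M.lact (Zigzag.e k 0 * y) m)) •
        leftProjElt (StarAlg.e k 0) (StarAlg.mk k x) := by
  rw [fiberFunctional, lin_fiberDesc, functionalLin_tmul]

/-- Homomorphisms out of the module attached to `Λ eᵢ ⊗ₖ e₀ Λ` are determined by the image of the
class of `eᵢ ⊗ e₀`. -/
lemma fiber_projBim_hom_ext {i : Fin (n + 1)} {V : Bimodule k (StarAlg k n) k}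
    {g h : fiber (projBim k i) ⟶ V}
    (H : lin g (fiberMk _ (projBimBil k i 1 1)) = lin h (fiberMk _ (projBimBil k i 1 1))) :
    g = h := by
  apply fiber_hom_ext
  intro x
  induction x using proj_induction with
  | h a b =>
    rw [projBil_eq_act, ← fiber_lact, fiberMk_ract, lin_lact, lin_lact, map_smul, map_smul,
      map_smul, map_smul, H]
  | h0 => simp
  | hadd x y hx hy => simp only [map_add, hx, hy]

/-- A nonzero element of a projective `A`-module is moved to a nonzero element of the subspace at
the vertex `0` by some element of `A`. -/
lemma exists_lact_ne_zero {V : Bimodule k (StarAlg k n) k} (hn : 0 < n)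
    (hV : isProj k (starObj k n) V) {v : V.carrier} (hv : v ≠ 0) :
    ∃ z : Zigzag k n, V.lact (StarAlg.mk k (Zigzag.e k 0 * z)) v ≠ 0 := by
  obtain ⟨m, G, f, g, hG, h⟩ := hV
  have h1 : v = ∑ i, lin (g i) (lin (f i) v) := by
    have := congrArg (fun t => lin t v) h
    simpa [lin_sum] using this
  obtain ⟨i, hi⟩ : ∃ i, lin (f i) v ≠ 0 := by
    by_contra! H
    exact hv (h1.trans (Finset.sum_eq_zero fun i _ => by rw [H, map_zero]))
  have key : ∀ w : (G i).carrier, w ≠ 0 →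
      ∃ z : Zigzag k n, (G i).lact (StarAlg.mk k (Zigzag.e k 0 * z)) w ≠ 0 := by
    rw [hG i]
    intro w hw
    obtain ⟨z, hz⟩ := StarAlg.exists_e_zero_mul_ne_zero (⟨0, hn⟩ : Fin n)
      (show (show StarAlg k n from w) ≠ 0 from hw)
    obtain ⟨z, rfl⟩ := StarAlg.mk_surjective z
    refine ⟨z, ?_⟩
    rw [map_mul]
    exact hz
  obtain ⟨z, hz⟩ := key _ hi
  refine ⟨z, fun h2 => hz ?_⟩
  rw [← lin_lact, h2, map_zero]

/-- A homomorphism `Λ eᵢ ⊗ₖ e₀ Λ ⟶ M` that is not killed by `fiber` becomes, after tensoring with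
`Λ e₀ ⊗ₖ e₀ Λ`, a morphism through which an automorphism of `Λ e₀ ⊗ₖ e₀ Λ` factors. -/
lemma exists_isUnit_of_fiberMap_ne_zero (hn : 0 < n) {i : Fin (n + 1)}
    {M : Bimodule k (Zigzag k n) (Zigzag k n)} (hM : isProj k (starObj k n) (fiber M))
    (hM' : projClass k n (tensor (projBim k (0 : Fin (n + 1))) M))
    {f : projBim k i ⟶ M} (hf : fiberMap f ≠ 0) :
    ∃ (s : projBim k (0 : Fin (n + 1)) ⟶ tensor (projBim k (0 : Fin (n + 1))) (projBim k i))
      (r : tensor (projBim k (0 : Fin (n + 1))) M ⟶ projBim k (0 : Fin (n + 1))),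
      IsUnit (show End (projBim k (0 : Fin (n + 1))) from
        s ≫ tmap (𝟙 (projBim k (0 : Fin (n + 1)))) f ≫ r) := by
  set y := lin f (projBimBil k i 1 1) with hy
  have hy0 : fiberMk M y ≠ 0 := by
    intro h
    apply hf
    apply fiber_projBim_hom_ext
    rw [lin_fiberMap, ← hy, h]
    rfl
  -- Here `y` is the image of `eᵢ ⊗ e₀`. For some `z` the element `e₀ z` moves the class of `y` to a
  -- nonzero element, on which a functional `ξ` takes the value one. Then `r` is a lift of the
  -- homomorphism induced by `ξ`, and `s` sends `e₀ ⊗ e₀` to `(e₀ ⊗ z) ⊗ (eᵢ ⊗ e₀)`.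
  obtain ⟨z, hz⟩ := exists_lact_ne_zero hn hM hy0
  rw [fiber_lact] at hz
  obtain ⟨ξ, hξ⟩ := Module.Projective.exists_dual_eq_one k hz
  obtain ⟨r, hr⟩ := fiberMap_surjective hM' (fiberFunctional ξ ≫ (fiberProj 0).inv)
  refine ⟨projHom _ _ (tmul _ _ (projBimBil k 0 1 z) (projBimBil k i 1 1)), r, ?_⟩
  set g : projBim k (0 : Fin (n + 1)) ⟶ projBim k 0 :=
    projHom _ _ (tmul _ _ (projBimBil k 0 1 z) (projBimBil k i 1 1)) ≫
      tmap (𝟙 (projBim k (0 : Fin (n + 1)))) f ≫ r with hg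
  have h1 : fiberMap g = 𝟙 _ := by
    apply fiber_projBim_hom_ext
    have h2 : projBimBil k (0 : Fin (n + 1)) (1 * Zigzag.e k 0 * 1) z = projBimBil k 0 1 z :=
      projBil_congr _ _ (by rw [one_mul, mul_one, Zigzag.idem]) rfl
    have h3 : projBimBil k i 1 (1 * (Zigzag.e k 0 * 1)) = projBimBil k i 1 1 :=
      projBil_congr _ _ rfl (by rw [one_mul, mul_one, Zigzag.idem])
    have h4 : lin (projHom (Zigzag.e k 0) (Zigzag.e k 0)
        (tmul (projBim k (0 : Fin (n + 1))) (projBim k i) (projBimBil k 0 1 z)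
          (projBimBil k i 1 1)))
        (projBimBil k 0 1 1) = tmul _ _ (projBimBil k 0 1 z) (projBimBil k i 1 1) := by
      rw [lin_projHom, tensor_ract, tensor_lact, ract_projBil, lact_projBil, h2, h3]
    rw [hg, fiberMap_comp, fiberMap_comp, hr, lin_comp, lin_comp, lin_comp, lin_fiberMap, h4,
      lin_fiberMap, lin_tmap, lin_id, lin_fiberFunctional, ← hy, hξ, one_smul, map_one]
    have h5 : lin (fiberProj (0 : Fin (n + 1))).hom (fiberMk _ (projBimBil k 0 1 1)) =
        leftProjElt (StarAlg.e k 0) 1 := by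
      refine (lin_fiberProjHom 0 1 1).trans ?_
      rw [map_one, one_smul, map_one]
    rw [← h5, ← lin_comp, Iso.hom_inv_id]
  -- As `fiber` maps `g` to the identity, `g` is the sum of the identity and a nilpotent.
  have h2 : fiberMap (g - 𝟙 _) = 0 := by rw [fiberMap_sub, h1, fiberMap_id, sub_self]
  have h3 := isNilpotent_of_fiberMap_eq_zero (⟨0, hn⟩ : Fin n) (projClass_projBim (k := k) 0) h2
  have h4 : (show End (projBim k (0 : Fin (n + 1))) from g) =
      (show End (projBim k (0 : Fin (n + 1))) from g - 𝟙 _) + 1 := by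
    exact (sub_add_cancel g (𝟙 _)).symm
  rw [h4]
  exact h3.isUnit_add_one

end retract

/-! ### The maximal ideal of the cell birepresentation -/

section ker

/-- A morphism out of an object of an additive closure that is not killed by a functor `F` has a
composite with some morphism out of a generator that is not killed by `F`. -/
lemma exists_map_comp_ne_zero_of_addClosure {C : Type u₁} [Category.{v₁} C] [Preadditive C]
    {D : Type u₂} [Category.{v₂} D] [Preadditive D] (F : C ⥤ D) [F.Additive]
    {P : ObjectProperty C} {X Y : C} (hX : addClosure P X) {φ : X ⟶ Y} (h : F.map φ ≠ 0) :
    ∃ (G : C) (g : G ⟶ X), P G ∧ F.map (g ≫ φ) ≠ 0 := by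
  obtain ⟨m, G, f, g, hG, hf⟩ := hX
  by_contra! H
  apply h
  rw [← Category.id_comp φ, hf, Preadditive.sum_comp, F.map_sum]
  exact Finset.sum_eq_zero fun i _ => by
    rw [Category.assoc, F.map_comp, H _ (g i) (hG i), Limits.comp_zero]

/-- The kernel of a linear functor. -/
def CatIdeal.ker (k : Type u) [Field k] {C : Type u₁} [Category.{v₁} C] [Preadditive C] [Linear k C]
    {D : Type u₂} [Category.{v₂} D] [Preadditive D] [Linear k D] (F : C ⥤ D) [F.Additive]
    [F.Linear k] : CatIdeal k C where
  hom X Y := LinearMap.ker (F.mapLinearMap k (X := X) (Y := Y))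
  comp_left {X Y Z} f {g} hg := by
    have hg : F.map g = 0 := hg
    change F.map (f ≫ g) = 0
    rw [F.map_comp, hg, Limits.comp_zero]
  comp_right {X Y Z f} g hf := by
    have hf : F.map f = 0 := hf
    change F.map (f ≫ g) = 0
    rw [F.map_comp, hf, Limits.zero_comp]

end ker

section cell

variable {n : ℕ}

/-- The compatibility of `fiber` with the tensor product: `fiber (K ⊗ X) ≅ red K ⊗ fiber X`. -/
noncomputable def fiberTensor {K : Bimodule k (Zigzag k n) (Zigzag k n)}
    (hK : starClass (zigzagObj k n) (Zigzag.e k) K) (X : Bimodule k (Zigzag k n) (Zigzag k n)) :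
    fiber (tensor K X) ≅ tensor (redStar K) (fiber X) :=
  tensorIso (redTensor K X (isNormal_of_starClass hK)) (Iso.refl (simpleZero k n)) ≪≫
    assoc (redStar K) (redStar X) (simpleZero k n)

lemma lin_fiberTensor_hom {K : Bimodule k (Zigzag k n) (Zigzag k n)}
    (hK : starClass (zigzagObj k n) (Zigzag.e k) K) (X : Bimodule k (Zigzag k n) (Zigzag k n))
    (m : K.carrier) (x : X.carrier) :
    lin (fiberTensor hK X).hom (fiberMk _ (tmul K X m x)) =
      tmul (redStar K) (fiber X) (redMk StarAlg.mk_surjective K m) (fiberMk X x) := rfl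

lemma fiberTensor_naturality {K K' : Bimodule k (Zigzag k n) (Zigzag k n)}
    (hK : starClass (zigzagObj k n) (Zigzag.e k) K)
    (hK' : starClass (zigzagObj k n) (Zigzag.e k) K')
    {X Y : Bimodule k (Zigzag k n) (Zigzag k n)} (g : K ⟶ K') (f : X ⟶ Y) :
    fiberMap (tmap g f) ≫ (fiberTensor hK' Y).hom =
      (fiberTensor hK X).hom ≫ tmap (redMap g) (fiberMap f) := by
  apply fiber_hom_ext
  intro t
  induction t using tensor_induction with
  | h m x => rfl
  | h0 => simp
  | hadd x y hx hy => simp only [map_add, hx, hy]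

lemma fiberMap_tmap_eq_zero {K : Bimodule k (Zigzag k n) (Zigzag k n)}
    (hK : starClass (zigzagObj k n) (Zigzag.e k) K)
    {X Y : Bimodule k (Zigzag k n) (Zigzag k n)} {f : X ⟶ Y} (hf : fiberMap f = 0) :
    fiberMap (tmap (𝟙 K) f) = 0 := by
  rw [← cancel_mono (fiberTensor hK Y).hom, fiberTensor_naturality hK hK, hf, Limits.zero_comp]
  have : tmap (redMap (hπ := StarAlg.mk_surjective (k := k) (n := n)) (𝟙 K))
      (0 : fiber X ⟶ fiber Y) = 0 := by
    apply tensor_hom_ext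
    intro a b
    rw [lin_tmap]
    simp
  rw [this, Limits.comp_zero]

lemma isProj_fiber {X : Bimodule k (Zigzag k n) (Zigzag k n)} (hX : projClass k n X) :
    isProj k (starObj k n) (fiber X) := by
  refine addClosure_map (fiberFunctor k n) ?_ hX
  rintro X ⟨i, rfl⟩
  exact addClosure_of_iso (fiberProj i) (isProj_leftProj _ (StarAlg.idem k i))

lemma projClass_tensor {K X : Bimodule k (Zigzag k n) (Zigzag k n)}
    (hK : starClass (zigzagObj k n) (Zigzag.e k) K) (hX : projClass k n X) :
    projClass k n (tensor K X) := by
  have a1 : (Bicategory.postcomp (zigzagObj k n)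
      (show zigzagObj k n ⟶ zigzagObj k n from K)).Additive :=
    ⟨fun {_ _ η θ} => PreadditiveBicategory.add_whiskerRight η θ _⟩
  refine addClosure_map (Q := fun X => ∃ i, X = projBim k i)
    (Bicategory.postcomp (zigzagObj k n) (show zigzagObj k n ⟶ zigzagObj k n from K)) ?_ hX
  rintro _ ⟨i, rfl⟩
  have a2 : (Bicategory.precomp (zigzagObj k n)
      (show zigzagObj k n ⟶ zigzagObj k n from projBim k i)).Additive :=
    ⟨fun {_ _ η θ} => PreadditiveBicategory.whiskerLeft_add _ η θ⟩
  refine addClosure_map (Q := fun X => ∃ i, X = projBim k i)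
    (Bicategory.precomp (zigzagObj k n)
      (show zigzagObj k n ⟶ zigzagObj k n from projBim k i)) ?_ hK
  rintro _ (rfl | ⟨j, rfl⟩)
  · exact addClosure_of_iso (ρ_ (show zigzagObj k n ⟶ zigzagObj k n from projBim k i))
      (addClosure_of_mem ⟨i, rfl⟩)
  · refine addClosure_mono ?_ (comp_proj (R := zigzagObj k n) (Zigzag.e k j) (Zigzag.e k 0)
      (show AlgObj.ground k ⟶ zigzagObj k n from leftProj k (Zigzag.e k i))
      (show zigzagObj k n ⟶ AlgObj.ground k from rightProj k (Zigzag.e k 0)))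
    rintro _ rfl
    exact ⟨j, rfl⟩

variable (k n) in
/-- The bimodules in the additive closure of the cell. -/
abbrev cellProp : ObjectProperty (objTilde k (n := n) ⟶ objTilde k) :=
  Birep.cellHom (projTilde k (n := n) 0) (objTilde k)

lemma projTilde_hom_id_ne_zero (hn : 0 < n) : 𝟙 (projTilde k (n := n) 0) ≠ 0 := by
  intro h
  apply fiberMap_id_projBim_ne_zero (k := k) (0 : Fin (n + 1))
  have h1 : 𝟙 (projBim k (0 : Fin (n + 1))) = 0 := congrArg (fun t => t.hom) h
  rw [h1]
  exact (fiberFunctor k n).map_zero _ _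

lemma isIndec_projTilde_zero (hn : 0 < n) : IsIndec (projTilde k (n := n) 0) := by
  refine isIndec_of_end (projTilde_hom_id_ne_zero hn) fun f => ?_
  let ι := (starClass (zigzagObj k n) (Zigzag.e k)).ι
  have a : ι.Additive := inferInstance
  let φ : End (projTilde k (n := n) 0) ≃+* End (projBim k (0 : Fin (n + 1))) :=
    RingEquiv.ofBijective (endRingHom ι (projTilde k (n := n) 0))
      ⟨ι.map_injective, ι.map_surjective⟩
  rcases isNilpotent_or_isUnit_projBim_zero (⟨0, hn⟩ : Fin n) (φ f) with h | h
  · exact Or.inl ((IsNilpotent.map_iff φ.injective).1 h)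
  · exact Or.inr ((MulEquiv.isUnit_map φ).1 h)

lemma leftCell_projTilde_zero (hn : 0 < n) :
    Birep.leftCell (projTilde k (n := n) 0) (objTilde k) (projTilde k 0) := by
  have h : Birep.LeftLE (projTilde k (n := n) 0) (projTilde k 0) :=
    ⟨𝟙 _, ⟨Retract.ofIso (ρ_ _).symm⟩⟩
  exact ⟨isIndec_projTilde_zero hn, h, h⟩

lemma projClass_of_retract {X Y : Bimodule k (Zigzag k n) (Zigzag k n)} (r : Retract X Y)
    (hY : projClass k n Y) : projClass k n X :=
  addClosure_trans (ι := Unit) (fun _ => Y) (fun _ => r.i) (fun _ => r.r) (fun _ => hY) (by simp)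

lemma projClass_of_cellProp {a : BTilde k n} {X : objTilde k (n := n) ⟶ a}
    (hX : Birep.cellHom (projTilde k (n := n) 0) a X) : projClass k n X.obj := by
  refine addClosure_map (Q := fun X => ∃ i, X = projBim k i)
    (starClass (zigzagObj k n) (Zigzag.e k)).ι ?_ hX
  rintro _ ⟨c, F, H, ⟨-, ⟨K, ⟨r'⟩⟩, -⟩, rfl⟩
  have h1 : projClass k n F.obj := projClass_of_retract
    ⟨r'.i.hom, r'.r.hom, congrArg (fun t => t.hom) r'.retract⟩
    (projClass_tensor K.property (projClass_projBim 0))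
  exact projClass_tensor H.property h1

lemma cellProp_projTilde (hn : 0 < n) (i : Fin (n + 1)) : cellProp k n (projTilde k i) := by
  have r := projBimRetract (k := k) i
  refine addClosure_trans (ι := Unit) (fun _ => projTilde k (n := n) 0 ≫ projTilde k i)
    (fun _ => ObjectProperty.homMk r.i) (fun _ => ObjectProperty.homMk r.r)
    (fun _ => addClosure_of_mem ⟨_, _, _, leftCell_projTilde_zero hn, rfl⟩) ?_
  rw [Fintype.sum_unique]
  exact ObjectProperty.hom_ext _ r.retract.symm

variable (k n) in
/-- The functor `fiber` on the category on which the cell birepresentation is based. -/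
noncomputable def cellFiber (a : BTilde k n) :
    ((Birep.cellSub k (projTilde k (n := n) 0)).obj a).carrier ⥤ Bimodule k (StarAlg k n) k where
  obj X := fiber X.obj.obj
  map f := fiberMap f.hom.hom
  map_id X := fiberMap_id X.obj.obj
  map_comp f g := fiberMap_comp f.hom.hom g.hom.hom

instance (a : BTilde k n) : (cellFiber k n a).Additive where
  map_add {X Y f g} := (fiberFunctor k n).map_add (f := f.hom.hom) (g := g.hom.hom)

instance (a : BTilde k n) : (cellFiber k n a).Linear k where
  map_smul {X Y} f c := fiberMap_smul c f.hom.hom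

lemma cellFiber_map_stable {a b : BTilde k n} (F : a ⟶ b)
    {X Y : ((Birep.cellSub k (projTilde k (n := n) 0)).obj a).carrier} {f : X ⟶ Y}
    (hf : (cellFiber k n a).map f = 0) :
    (cellFiber k n b).map ((LinCat.fn ((Birep.cellSub k (projTilde k (n := n) 0)).map F)).map f)
      = 0 :=
  fiberMap_tmap_eq_zero (show (a ⟶ b) from F).property hf

variable (k n) in
/-- The stable ideal of the morphisms that are killed by `fiber`. -/
noncomputable def fiberKer : Birep.StableIdeal (Birep.cellSub k (projTilde k (n := n) 0)) where
  ideal a := CatIdeal.ker k (cellFiber k n a)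
  stable {a b} F {X Y f} hf := cellFiber_map_stable F hf

lemma fiberKer_id_notMem (hn : 0 < n) (a : BTilde k n)
    (X : (Birep.cellHom (projTilde k (n := n) 0) a).FullSubcategory)
    (hX : Birep.leftCell (projTilde k (n := n) 0) a X.obj) :
    𝟙 X ∉ ((fiberKer k n).ideal a).hom X X := by
  intro h
  -- The bimodule at the internal node is a retract of `H ⊗ X`, so its identity would be killed by
  -- `fiber` together with that of `X`.
  obtain ⟨-, -, H, ⟨r⟩⟩ := hX
  have h1 : fiberMap (𝟙 (show Bimodule k (Zigzag k n) (Zigzag k n) from X.obj.obj)) = 0 := h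
  have h2 := fiberMap_tmap_eq_zero H.property h1
  apply fiberMap_id_projBim_ne_zero (k := k) (0 : Fin (n + 1))
  have h3 : 𝟙 (projBim k (0 : Fin (n + 1))) =
      r.i.hom ≫ tmap (𝟙 (show Bimodule k (Zigzag k n) (Zigzag k n) from H.obj)) (𝟙 X.obj.obj) ≫
        r.r.hom := by
    have h4 : r.i.hom ≫ r.r.hom = 𝟙 (projBim k (0 : Fin (n + 1))) :=
      congrArg (fun t => t.hom) r.retract
    have h5 := tmap_id_id (show Bimodule k (Zigzag k n) (Zigzag k n) from H.obj)
      (show Bimodule k (Zigzag k n) (Zigzag k n) from X.obj.obj)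
    rw [← h4]
    refine congrArg (fun t => r.i.hom ≫ t) ?_
    refine Eq.trans ?_ (congrArg (fun t => t ≫ r.r.hom) h5).symm
    exact (Category.id_comp r.r.hom).symm
  have h6 := congrArg fiberMap h3
  rw [h6]
  refine (fiberMap_comp _ _).trans ?_
  refine (congrArg (fun t => fiberMap r.i.hom ≫ t) (fiberMap_comp _ _)).trans ?_
  refine (congrArg (fun t => fiberMap r.i.hom ≫ t ≫ fiberMap r.r.hom) h2).trans ?_
  rw [Limits.zero_comp, Limits.comp_zero]
  rfl

/-- A stable ideal that contains no identity of an object in the cell consists of morphisms that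
are killed by `fiber`. -/
lemma cellFiber_map_eq_zero (hn : 0 < n)
    (J : Birep.StableIdeal (Birep.cellSub k (projTilde k (n := n) 0)))
    (hJ : ∀ (a : BTilde k n) (X : (Birep.cellHom (projTilde k (n := n) 0) a).FullSubcategory),
      Birep.leftCell (projTilde k (n := n) 0) a X.obj → 𝟙 X ∉ (J.ideal a).hom X X)
    {a : BTilde k n} {X Y : ((Birep.cellSub k (projTilde k (n := n) 0)).obj a).carrier}
    {f : X ⟶ Y} (hf : f ∈ (J.ideal a).hom X Y) : (cellFiber k n a).map f = 0 := by
  by_contra hf0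
  have hX : projClass k n X.obj.obj := projClass_of_cellProp X.property
  have hY : projClass k n Y.obj.obj := projClass_of_cellProp Y.property
  -- If `fiber` does not kill `f`, the identity of the bimodule at the internal node, which lies
  -- in the cell, factors through the action of this bimodule on `f`, and so it is in the ideal.
  obtain ⟨_, g, ⟨i, rfl⟩, hg⟩ := exists_map_comp_ne_zero_of_addClosure (fiberFunctor k n) hX
    (φ := f.hom.hom) hf0
  obtain ⟨s, r, u, hu⟩ := exists_isUnit_of_fiberMap_ne_zero hn (isProj_fiber hY)
    (projClass_tensor (projClass_le_starClass (projClass_projBim (k := k) (0 : Fin (n + 1)))) hY) hg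
  let P : ((Birep.cellSub k (projTilde k (n := n) 0)).obj (objTilde k)).carrier :=
    ⟨projTilde k 0, cellProp_projTilde hn 0⟩
  let T : a ⟶ objTilde k := show (objTilde k (n := n) ⟶ objTilde k) from projTilde k 0
  have h1 := J.stable T hf
  let s' : P ⟶ (LinCat.fn ((Birep.cellSub k (projTilde k (n := n) 0)).map T)).obj X :=
    ObjectProperty.homMk (ObjectProperty.homMk (s ≫ tmap (𝟙 (projBim k (0 : Fin (n + 1)))) g))
  let r' : (LinCat.fn ((Birep.cellSub k (projTilde k (n := n) 0)).map T)).obj Y ⟶ P :=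
    ObjectProperty.homMk (ObjectProperty.homMk r)
  let v : P ⟶ P := ObjectProperty.homMk (ObjectProperty.homMk (show projBim k (0 : Fin (n + 1)) ⟶ _
    from (u⁻¹ : (End (projBim k (0 : Fin (n + 1))))ˣ).1))
  have h2 := (J.ideal _).comp_left (v ≫ s') ((J.ideal _).comp_right r' h1)
  refine hJ _ P (leftCell_projTilde_zero hn) ?_
  suffices key : 𝟙 P = (v ≫ s') ≫
      (LinCat.fn ((Birep.cellSub k (projTilde k (n := n) 0)).map T)).map f ≫ r' from
    (congrArg (fun t => t ∈ (J.ideal _).hom P P) key).mpr h2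
  apply ObjectProperty.hom_ext
  apply ObjectProperty.hom_ext
  have h3 : (u.1 * (u⁻¹ : (End (projBim k (0 : Fin (n + 1))))ˣ).1) = 1 := u.mul_inv
  rw [hu] at h3
  have h4 : 𝟙 (projBim k (0 : Fin (n + 1))) =
      (show projBim k (0 : Fin (n + 1)) ⟶ _ from (u⁻¹ : (End (projBim k (0 : Fin (n + 1))))ˣ).1) ≫
        s ≫ tmap (𝟙 (projBim k (0 : Fin (n + 1)))) (g ≫ f.hom.hom) ≫ r := h3.symm
  have h5 : tmap (𝟙 (projBim k (0 : Fin (n + 1)))) (g ≫ f.hom.hom) =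
      tmap (𝟙 (projBim k (0 : Fin (n + 1)))) g ≫
        tmap (𝟙 (projBim k (0 : Fin (n + 1)))) f.hom.hom := by
    rw [tmap_comp_tmap, Category.id_comp]
  refine h4.trans ?_
  rw [h5]
  change _ ≫ s ≫ (tmap _ _ ≫ tmap _ _) ≫ r = ((_ ≫ (s ≫ tmap _ _)) ≫ (tmap _ _ ≫ r) : _ ⟶ _)
  simp only [Category.assoc]
  rfl

/-- The maximal ideal of the cell birepresentation is the kernel of `fiber`. -/
lemma mem_cellIdeal_iff (hn : 0 < n) {a : BTilde k n}
    {X Y : ((Birep.cellSub k (projTilde k (n := n) 0)).obj a).carrier} (f : X ⟶ Y) :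
    f ∈ ((Birep.cellIdeal k (projTilde k (n := n) 0)).ideal a).hom X Y ↔
      (cellFiber k n a).map f = 0 := by
  constructor
  · intro hf
    have : ((Birep.cellIdeal k (projTilde k (n := n) 0)).ideal a).hom X Y ≤
        ((fiberKer k n).ideal a).hom X Y :=
      iSup_le fun J f hf => cellFiber_map_eq_zero hn J.1 J.2 hf
    exact this hf
  · intro hf
    exact Submodule.mem_iSup_of_mem (p := fun J : {J | ∀ (a : BTilde k n)
      (X : (Birep.cellHom (projTilde k (n := n) 0) a).FullSubcategory),
      Birep.leftCell (projTilde k (n := n) 0) a X.obj → 𝟙 X ∉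
        (Birep.StableIdeal.ideal (M := Birep.cellSub k (projTilde k (n := n) 0)) J a).hom X X} =>
      (J.1.ideal a).hom X Y) ⟨fiberKer k n, fiberKer_id_notMem hn⟩ hf

end cell

/-! ### The cell birepresentation and projective modules -/

section ker

/-- The functor on a quotient category induced by a functor that kills the ideal. -/
def CatIdeal.qlift {C : Type u₁} [Category.{v₁} C] [Preadditive C] [Linear k C]
    (I : CatIdeal k C) {D : Type u₂} [Category.{v₂} D] [Preadditive D] [Linear k D] (F : C ⥤ D)
    [F.Additive] (h : ∀ {X Y : C} (f : X ⟶ Y), f ∈ I.hom X Y → F.map f = 0) : I.Quot ⥤ D where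
  obj X := F.obj X.as
  map {X Y} := _root_.Quotient.lift (s := Submodule.quotientRel (I.hom X.as Y.as))
    (fun f => F.map f) (by
      intro f g hfg
      rw [← Quotient.eq_iff_equiv, Quotient.eq, Submodule.quotientRel_def] at hfg
      rw [← sub_eq_zero, ← F.map_sub]
      exact h _ hfg)
  map_id X := F.map_id X.as
  map_comp := by
    rintro X Y Z ⟨f⟩ ⟨g⟩
    exact F.map_comp f g

end ker

section cellEquiv

variable {n : ℕ}

variable (k n) in
/-- The functor `fiber` from the additive closure of the cell to projective `A`-modules. -/
noncomputable def cellProj (a : BTilde k n) :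
    ((Birep.cellSub k (projTilde k (n := n) 0)).obj a).carrier ⥤
      (((redPseudo k n).comp (natStar k n)).obj a).carrier where
  obj X := ⟨fiber X.obj.obj, isProj_fiber (projClass_of_cellProp X.property)⟩
  map f := ObjectProperty.homMk (fiberMap f.hom.hom)
  map_id X := ObjectProperty.hom_ext _ (fiberMap_id X.obj.obj)
  map_comp f g := ObjectProperty.hom_ext _ (fiberMap_comp f.hom.hom g.hom.hom)

instance (a : BTilde k n) : (cellProj k n a).Additive where
  map_add {X Y f g} := ObjectProperty.hom_ext _
    ((fiberFunctor k n).map_add (f := f.hom.hom) (g := g.hom.hom))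

instance (a : BTilde k n) : (cellProj k n a).Linear k where
  map_smul {X Y} f c := ObjectProperty.hom_ext _ (fiberMap_smul c f.hom.hom)

lemma cellProj_map_eq_zero_iff (hn : 0 < n) {a : BTilde k n}
    {X Y : ((Birep.cellSub k (projTilde k (n := n) 0)).obj a).carrier} (f : X ⟶ Y) :
    (cellProj k n a).map f = 0 ↔
      f ∈ ((Birep.cellIdeal k (projTilde k (n := n) 0)).ideal a).hom X Y := by
  rw [mem_cellIdeal_iff hn]
  exact ⟨fun h => congrArg (fun t => t.hom) h, fun h => ObjectProperty.hom_ext _ h⟩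

variable (k) in
/-- The functor from the cell birepresentation to projective `A`-modules. -/
noncomputable def cellFunctor (hn : 0 < n) (a : BTilde k n) :
    ((cellTilde k n).obj a).carrier ⥤ (((redPseudo k n).comp (natStar k n)).obj a).carrier :=
  ((Birep.cellIdeal k (projTilde k (n := n) 0)).ideal a).qlift (cellProj k n a)
    (fun f hf => (cellProj_map_eq_zero_iff hn f).2 hf)

lemma cellFunctor_additive (hn : 0 < n) (a : BTilde k n) : (cellFunctor k hn a).Additive where
  map_add := by
    rintro X Y ⟨f⟩ ⟨g⟩
    exact (cellProj k n a).map_add (f := f) (g := g)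

lemma cellFunctor_linear (hn : 0 < n) (a : BTilde k n) : (cellFunctor k hn a).Linear k where
  map_smul := by
    rintro X Y ⟨f⟩ c
    exact (cellProj k n a).map_smul c f

lemma cellProj_full (a : BTilde k n)
    {X Y : ((Birep.cellSub k (projTilde k (n := n) 0)).obj a).carrier} :
    Function.Surjective ((cellProj k n a).map : (X ⟶ Y) → _) := by
  intro g
  obtain ⟨f, hf⟩ := fiberMap_surjective (projClass_of_cellProp X.property) g.hom
  exact ⟨ObjectProperty.homMk (ObjectProperty.homMk f), ObjectProperty.hom_ext _ hf⟩

lemma cellProj_isNilpotent (hn : 0 < n) (a : BTilde k n)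
    (X : ((Birep.cellSub k (projTilde k (n := n) 0)).obj a).carrier) (f : End X)
    (hf : (cellProj k n a).map (show X ⟶ X from f) = 0) : IsNilpotent f := by
  refine ⟨3, ?_⟩
  rw [pow_succ, pow_two]
  apply ObjectProperty.hom_ext
  apply ObjectProperty.hom_ext
  exact fiberMap_nilpotent (⟨0, hn⟩ : Fin n) (projClass_of_cellProp X.property)
    (congrArg (fun t => t.hom) hf)

lemma projModStar_iso (hn : 0 < n) (i : Fin (n + 1)) :
    Nonempty ((cellProj k n (objTilde k)).obj ⟨projTilde k i, cellProp_projTilde hn i⟩ ≅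
      projModStar k n i) :=
  ⟨(isProj k (starObj k n)).isoMk (fiberProj i)⟩

/-- Projective `A`-modules are summands of sums of the `A eᵢ`, as `A` is the sum of the `A eᵢ`. -/
lemma addClosure_projModStar (Z : ((natStar k n).obj (objStar k)).carrier) :
    addClosure (fun W => ∃ i, W = projModStar k n i) Z := by
  obtain ⟨m, G, f, g, hG, h⟩ := Z.property
  have hG' : ∀ j, isProj k (starObj k n) (G j) := fun j => addClosure_of_mem
    (C := Bimodule k (StarAlg k n) k) (hG j)
  refine addClosure_trans (C := ((natStar k n).obj (objStar k)).carrier)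
    (fun j => ⟨G j, hG' j⟩) (fun j => ObjectProperty.homMk (f j))
    (fun j => ObjectProperty.homMk (g j)) (fun j => ?_) ?_
  rotate_left
  · apply ObjectProperty.hom_ext
    refine h.trans ?_
    exact (((isProj k (starObj k n)).ι.map_sum _ Finset.univ).trans rfl).symm
  have h1 : ∀ W : ((natStar k n).obj (objStar k)).carrier, W.obj = leftRegular k (StarAlg k n) →
      addClosure (fun W => ∃ i, W = projModStar k n i) W := by
    rintro ⟨W, hW⟩ rfl
    refine addClosure_of_fintype (ι := Fin (n + 1)) (fun i => projModStar k n i)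
      (fun i => ObjectProperty.homMk (mkHom (M := leftRegular k (StarAlg k n))
        (N := leftProj k (StarAlg.e k i)) (leftProjElt (StarAlg.e k i))
        (fun r x => (leftProj_lact (StarAlg.e k i) r (show StarAlg k n from x)).symm)
        (fun s x => (map_smul (leftProjElt (StarAlg.e k i)) s.unop _).trans
          (ract_ground (leftProj k (StarAlg.e k i)) s _).symm)))
      (fun i => ObjectProperty.homMk (mkHom (N := leftRegular k (StarAlg k n))
        (M := leftProj k (StarAlg.e k i)) (Submodule.subtype _)
        (fun r x => rfl) (fun s x => rfl)))
      (fun i => ⟨i, rfl⟩) ?_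
    apply (isProj k (starObj k n)).ι.map_injective
    refine Eq.trans ?_ ((isProj k (starObj k n)).ι.map_sum _ Finset.univ).symm
    apply hom_ext (R := StarAlg k n) (S := k)
    intro x
    refine Eq.trans ?_ (lin_sum _ _ _).symm
    have h2 : ∑ i : Fin (n + 1), StarAlg.e k (n := n) i = 1 := by
      rw [← map_one (StarAlg.mk k), ← Zigzag.sum_e, map_sum]
      rfl
    have h3 : (show StarAlg k n from x) =
        ∑ i : Fin (n + 1), (show StarAlg k n from x) * StarAlg.e k i := by
      rw [← Finset.mul_sum, h2, mul_one]
    exact h3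
  exact h1 _ (hG j)

/-- Every projective `A`-module is a direct summand of a sum of copies of the `A eᵢ`, and such
summands lift along the full functor `cellProj`, whose kernel is nilpotent. -/
lemma cellProj_essSurj (hn : 0 < n) (Z : ((natStar k n).obj (objStar k)).carrier) :
    ∃ X, Nonempty ((cellProj k n (objTilde k)).obj X ≅ Z) := by
  have i0 : IsIdempotentComplete (objTilde k (n := n) ⟶ objTilde k) :=
    isIdempotentComplete_addClosure (C := Bimodule k (Zigzag k n) (Zigzag k n)) _
  have i1 : IsIdempotentComplete
      ((Birep.cellSub k (projTilde k (n := n) 0)).obj (objTilde k)).carrier :=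
    isIdempotentComplete_addClosure (C := objTilde k (n := n) ⟶ objTilde k) _
  have i2 : HasSums ((Birep.cellSub k (projTilde k (n := n) 0)).obj (objTilde k)).carrier := by
    have : HasSums (objTilde k (n := n) ⟶ objTilde k) :=
      hasSums_addClosure (C := Bimodule k (Zigzag k n) (Zigzag k n)) Bimodule.hasSums _
    exact hasSums_addClosure this _
  refine exists_iso_of_addClosure (cellProj k n (objTilde k)) (fun X => cellProj_full _) i2
    (cellProj_isNilpotent hn _) ?_
  refine addClosure_mono ?_ (addClosure_projModStar Z)
  rintro _ ⟨i, rfl⟩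
  exact ⟨_, projModStar_iso hn i⟩

/-- The functor is faithful because its kernel is the ideal by which the cell birepresentation is a
quotient. -/
lemma cellFunctor_isEquivalence (hn : 0 < n) (a : BTilde k n) :
    (cellFunctor k hn a).IsEquivalence where
  faithful := ⟨by
    intro X Y f g h
    obtain ⟨f, rfl⟩ := CatIdeal.qmk_surjective _ f
    obtain ⟨g, rfl⟩ := CatIdeal.qmk_surjective _ g
    refine (CatIdeal.qmk_eq_iff _ _ _).2 ?_
    rw [← cellProj_map_eq_zero_iff hn, Functor.map_sub, sub_eq_zero]
    exact h⟩
  full := ⟨by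
    intro X Y g
    obtain ⟨f, hf⟩ := cellProj_full a (X := X.as) (Y := Y.as) g
    exact ⟨CatIdeal.qmk _ f, hf⟩⟩
  essSurj := ⟨by
    cases a
    intro Z
    obtain ⟨X, ⟨i⟩⟩ := cellProj_essSurj hn Z
    exact ⟨⟨X⟩, ⟨i⟩⟩⟩

/-- The coherence of `fiberTensor` with the left unit. -/
lemma fiberTensor_self (h : starClass (zigzagObj k n) (Zigzag.e k) (self k (Zigzag k n)))
    (X : Bimodule k (Zigzag k n) (Zigzag k n)) :
    (fiberTensor h X).hom ≫ tmap (redSelf (StarAlg.mk_surjective (k := k) (n := n))).hom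
      (𝟙 (fiber X)) ≫ tmap (𝟙 _) (𝟙 (fiber X)) ≫ leftUnitHom (fiber X) =
      fiberMap (leftUnitHom X) ≫ 𝟙 _ ≫ 𝟙 _ := by
  rw [tmap_id_id, Category.id_comp, Category.comp_id, Category.comp_id]
  apply fiber_hom_ext
  intro t
  induction t using tensor_induction with
  | h r x =>
    obtain ⟨r, rfl⟩ := (selfIn k _).surjective r
    rw [lin_comp, lin_comp, lin_fiberTensor_hom, lin_tmap, lin_fiberMap, lin_leftUnitHom,
      ← fiber_lact]
    exact lin_leftUnitHom (fiber X) (StarAlg.mk k r) _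
  | h0 => simp
  | hadd x y hx hy => simp only [map_add, hx, hy]

/-- The coherence of `fiberTensor` with the associator. -/
lemma fiberTensor_tensor {G F : Bimodule k (Zigzag k n) (Zigzag k n)}
    (hG : starClass (zigzagObj k n) (Zigzag.e k) G) (hF : starClass (zigzagObj k n) (Zigzag.e k) F)
    (hGF : starClass (zigzagObj k n) (Zigzag.e k) (tensor G F))
    (X : Bimodule k (Zigzag k n) (Zigzag k n)) :
    (fiberTensor hGF X).hom ≫ tmap (redTensorHom StarAlg.mk_surjective G F) (𝟙 (fiber X)) ≫
        tmap (𝟙 _) (𝟙 (fiber X)) ≫ assocHom (redStar G) (redStar F) (fiber X) =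
      fiberMap (assocHom G F X) ≫ 𝟙 _ ≫ (fiberTensor hG (tensor F X)).hom ≫ 𝟙 _ ≫
        tmap (𝟙 (redStar G)) (fiberTensor hF X).hom ≫ 𝟙 _ := by
  rw [tmap_id_id, Category.id_comp, Category.id_comp, Category.id_comp, Category.comp_id]
  apply fiber_hom_ext
  intro t
  induction t using tensor_induction with
  | h m x =>
    induction m using tensor_induction with
    | h m m' =>
      rw [lin_comp, lin_comp, lin_fiberTensor_hom, lin_tmap, lin_comp, lin_comp, lin_fiberMap,
        lin_assocHom, lin_fiberTensor_hom, lin_tmap, lin_fiberTensor_hom, lin_redTensorHom]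
      exact lin_assocHom _ _ _ _ _ _
    | h0 => simp
    | hadd x y hx hy => simp only [map_add, LinearMap.add_apply, hx, hy]
  | h0 => simp
  | hadd x y hx hy => simp only [map_add, hx, hy]

lemma redMap_id (K : Bimodule k (Zigzag k n) (Zigzag k n)) :
    redMap (hπ := StarAlg.mk_surjective (k := k) (n := n)) (𝟙 K) = 𝟙 (redStar K) :=
  (redFunctor StarAlg.mk_surjective).map_id K

variable (k) in
/-- The equivalence from the cell birepresentation to the composite of reduction with the action on
projective `A`-modules. -/
noncomputable def cellTrans (hn : 0 < n) :
    Pseudofunctor.StrongTrans (cellTilde k n) ((redPseudo k n).comp (natStar k n)) where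
  app a := LinCat.mk1 (cellFunctor k hn a) (cellFunctor_additive hn a) (cellFunctor_linear hn a)
  naturality {a b} F := LinCat.mkIso (NatIso.ofComponents
    (fun X => (isProj k (starObj k n)).isoMk
      (fiberTensor (show (a ⟶ b) from F).property X.as.obj.obj))
    (by
      rintro X Y ⟨f⟩
      apply ObjectProperty.hom_ext
      have h := fiberTensor_naturality F.property F.property (𝟙 _) f.hom.hom
      rw [redMap_id] at h
      exact h))
  naturality_naturality {a b F G} η := LinCat.ext2 fun X => ObjectProperty.hom_ext _ (by
    have h := fiberTensor_naturality F.property G.property η.hom (𝟙 X.as.obj.obj)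
    rw [fiberMap_id] at h
    exact h)
  naturality_id a := LinCat.ext2 fun X => ObjectProperty.hom_ext _
    (fiberTensor_self (show a ⟶ a from 𝟙 a).property X.as.obj.obj)
  naturality_comp {a b c} F G := LinCat.ext2 fun X => ObjectProperty.hom_ext _
    (fiberTensor_tensor G.property F.property (show a ⟶ c from F ≫ G).property X.as.obj.obj)

lemma isLinear_redPseudo : IsLinearPseudofunctor k (redPseudo k n) where
  map₂_add η θ := ObjectProperty.hom_ext _
    ((redFunctor StarAlg.mk_surjective).map_add (f := η.hom) (g := θ.hom))
  map₂_smul c η := by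
    apply ObjectProperty.hom_ext
    apply red_hom_ext
    intro x
    exact (redMk StarAlg.mk_surjective _).map_smul c _

/-- Reduction is induced by the cell birepresentation. -/
lemma isInducedByCell_redPseudo (hn : 0 < n) : IsInducedByCell (redPseudo k n) where
  linear := isLinear_redPseudo
  map_proj i := ⟨(starClass (starObj k n) (StarAlg.e k)).isoMk
    (redProj StarAlg.mk_surjective (Zigzag.idem i) (Zigzag.idem 0))⟩
  cell := ⟨cellTrans k hn, fun x => cellFunctor_isEquivalence hn x,
    fun i => ⟨cellProp_projTilde hn i, projModStar_iso hn i⟩⟩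

end cellEquiv

/-! ### The kernel of a linear pseudofunctor, and the biideal of the star -/

section biideal

lemma IsLinearPseudofunctor.map₂_zero {B : Type u₁} [Bicategory.{w₁, v₁} B]
    [PreadditiveBicategory B] [LinearBicategory k B] {C : Type u₂} [Bicategory.{w₂, v₂} C]
    [PreadditiveBicategory C] [LinearBicategory k C] {F : B ⥤ᵖ C}
    (hF : IsLinearPseudofunctor k F) {a b : B} (f g : a ⟶ b) : F.map₂ (0 : f ⟶ g) = 0 := by
  simpa using hF.map₂_smul (0 : k) (0 : f ⟶ g)

lemma whiskerLeft_zero (k : Type u) [Field k] {B : Type u₁} [Bicategory.{w₁, v₁} B]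
    [PreadditiveBicategory B] [LinearBicategory k B] {a b c : B} (f : a ⟶ b) (g h : b ⟶ c) :
    f ◁ (0 : g ⟶ h) = 0 := by
  simpa using LinearBicategory.whiskerLeft_smul f (0 : k) (0 : g ⟶ h)

lemma zero_whiskerRight (k : Type u) [Field k] {B : Type u₁} [Bicategory.{w₁, v₁} B]
    [PreadditiveBicategory B] [LinearBicategory k B] {a b c : B} (f g : a ⟶ b) (h : b ⟶ c) :
    (0 : f ⟶ g) ▷ h = 0 := by
  simpa using LinearBicategory.smul_whiskerRight (0 : k) (0 : f ⟶ g) h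

/-- The `2`-morphisms that a linear pseudofunctor sends to zero. -/
def Biideal.ker {B : Type u₁} [Bicategory.{w₁, v₁} B] [PreadditiveBicategory B]
    [LinearBicategory k B] {C : Type u₂} [Bicategory.{w₂, v₂} C] [PreadditiveBicategory C]
    [LinearBicategory k C] (F : B ⥤ᵖ C) (hF : IsLinearPseudofunctor k F) : Biideal k B where
  ideal a b :=
    { hom f g :=
        { carrier := {η | F.map₂ η = 0}
          add_mem' := fun {η θ} hη hθ => by
            change F.map₂ η = 0 at hη
            change F.map₂ θ = 0 at hθ
            change F.map₂ (η + θ) = 0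
            rw [hF.map₂_add, hη, hθ, add_zero]
          zero_mem' := hF.map₂_zero f g
          smul_mem' := fun c η hη => by
            change F.map₂ η = 0 at hη
            change F.map₂ (c • η) = 0
            rw [hF.map₂_smul, hη, smul_zero] }
      comp_left {f g h} η {θ} hθ := by
        change F.map₂ θ = 0 at hθ
        change F.map₂ (η ≫ θ) = 0
        rw [F.map₂_comp, hθ, Limits.comp_zero]
      comp_right {f g h η} θ hη := by
        change F.map₂ η = 0 at hη
        change F.map₂ (η ≫ θ) = 0
        rw [F.map₂_comp, hη, Limits.zero_comp] }
  whiskerLeft_mem {a b c} f {g h η} hη := by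
    change F.map₂ η = 0 at hη
    change F.map₂ (f ◁ η) = 0
    rw [F.map₂_whisker_left, hη, whiskerLeft_zero k, Limits.zero_comp, Limits.comp_zero]
  whiskerRight_mem {a b c f g η} h hη := by
    change F.map₂ η = 0 at hη
    change F.map₂ (η ▷ h) = 0
    rw [F.map₂_whisker_right, hη, zero_whiskerRight k, Limits.zero_comp, Limits.comp_zero]

lemma lact_mem_redSpan_of_mem {R S : Type u} [Ring R] [Algebra k R] [Ring S] [Algebra k S]
    {π : R →ₐ[k] S} {N : Bimodule k R R} (r : R) {x : N.carrier} (hx : x ∈ redSpan π N) :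
    N.lact r x ∈ redSpan π N :=
  lact_redSpan N r hx

lemma ract_mem_redSpan_of_mem {R S : Type u} [Ring R] [Algebra k R] [Ring S] [Algebra k S]
    {π : R →ₐ[k] S} {N : Bimodule k R R} (r : Rᵐᵒᵖ) {x : N.carrier} (hx : x ∈ redSpan π N) :
    N.ract r x ∈ redSpan π N :=
  ract_redSpan N r hx

variable {n : ℕ}

variable (k n) in
/-- The `2`-morphisms that vanish under reduction along the projection from the zigzag algebra. -/
noncomputable def starBiideal : Biideal k (BTilde k n) :=
  Biideal.ker (redPseudo k n) isLinear_redPseudo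

/-- The homomorphism of reductions induced by a homomorphism of bimodules. -/
noncomputable abbrev redStarMap {M N : Bimodule k (Zigzag k n) (Zigzag k n)} (f : M ⟶ N) :
    redStar M ⟶ redStar N := redMap f

lemma mem_starBiideal_iff {a b : BTilde k n} {F G : a ⟶ b} (η : F ⟶ G) :
    η ∈ ((starBiideal k n).ideal a b).hom F G ↔
      redStarMap η.hom = 0 :=
  ⟨fun h => congrArg (fun t => t.hom) (show (redPseudo k n).map₂ η = 0 from h),
    fun h => ObjectProperty.hom_ext _ h⟩

variable {N : Bimodule k (Zigzag k n) (Zigzag k n)}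

lemma redMap_proj_eq_zero_iff {i : Fin (n + 1)} (f : projBim k i ⟶ N) :
    redStarMap f = 0 ↔
      lin f (projBimBil k i 1 1) ∈ redSpan (S := StarAlg k n) (StarAlg.mk k) N := by
  rw [redMap_eq_zero_iff]
  refine ⟨fun h => h _, fun h x => ?_⟩
  induction x using proj_induction with
  | h x y =>
    rw [projBil_eq_act, lin_lact, lin_ract]
    exact lact_mem_redSpan_of_mem _ (ract_mem_redSpan_of_mem _ h)
  | h0 => rw [map_zero]; exact Submodule.zero_mem _
  | hadd x y hx hy => rw [map_add]; exact Submodule.add_mem _ hx hy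

lemma lin_self {R : Type u} [Ring R] [Algebra k R] {N : Bimodule k R R} (f : self k R ⟶ N) (x : R) :
    lin f (selfIn k _ x) = N.lact x (lin f (selfIn k _ 1)) := by
  rw [← lin_lact, self_lact, mul_one]

lemma redMap_self_eq_zero_iff (f : self k (Zigzag k n) ⟶ N) :
    redStarMap f = 0 ↔
      lin f (selfIn k _ 1) ∈ redSpan (S := StarAlg k n) (StarAlg.mk k) N := by
  rw [redMap_eq_zero_iff]
  refine ⟨fun h => h _, fun h x => ?_⟩
  obtain ⟨x, rfl⟩ := (selfIn k _).surjective x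
  rw [lin_self]
  exact lact_mem_redSpan_of_mem _ h

lemma mem_redSpan_self (x : Zigzag k n) :
    selfIn k _ x ∈ redSpan (S := StarAlg k n) (StarAlg.mk k) (self k (Zigzag k n)) ↔
      x ∈ Zigzag.cycSpan k n := by
  constructor
  · intro h
    have : redSpan (S := StarAlg k n) (StarAlg.mk k) (self k (Zigzag k n)) ≤
        (Zigzag.cycSpan k n).comap (selfIn k (Zigzag k n)).symm.toLinearMap := by
      refine Submodule.span_le.2 ?_
      rintro _ ⟨r, m, hr, rfl | rfl⟩
      · exact Zigzag.cycSpan_mul_mem _ ((StarAlg.mk_eq_zero_iff r).1 hr)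
      · exact Zigzag.mul_mem_cycSpan _ ((StarAlg.mk_eq_zero_iff r).1 hr)
    exact this h
  · intro h
    rw [← mul_one x, ← self_lact]
    exact lact_mem_redSpan _ ((StarAlg.mk_eq_zero_iff x).2 h) _

lemma redSpan_projBim (i : Fin (n + 1)) :
    redSpan (S := StarAlg k n) (StarAlg.mk k) (projBim k i) =
      leftKer (S := StarAlg k n) (StarAlg.mk k) (projBim k i) :=
  (isNormal_proj_e_zero (Zigzag.e k i)).redSpan_eq

/-- Since the two-cycles at the leaves annihilate `e₀`, the bimodule `Λ e₀ ⊗ₖ e₀ Λ` embeds into its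
reduction. -/
lemma redSpan_projBim_zero :
    redSpan (S := StarAlg k n) (StarAlg.mk k) (projBim k (0 : Fin (n + 1))) = ⊥ := by
  rw [redSpan_projBim, eq_bot_iff]
  refine Submodule.span_le.2 ?_
  rintro _ ⟨r, m, hr, rfl⟩
  change (projBim k (0 : Fin (n + 1))).lact r m = 0
  induction m using proj_induction with
  | h x y =>
    rw [lact_projBil]
    refine (projBil_congr _ _ (x' := 0) ?_ rfl).trans (by simp)
    rw [zero_mul]
    exact Zigzag.cycSpan_mul_e_zero (Zigzag.cycSpan_mul_mem x ((StarAlg.mk_eq_zero_iff r).1 hr))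
  | h0 => simp
  | hadd x y hx hy => rw [map_add, hx, hy, add_zero]

/-- For the bimodule `Λ e_j ⊗ₖ e₀ Λ` at a leaf, the kernel of the projection to the reduction is
`c_j ⊗ e₀ Λ`. -/
lemma mem_redSpan_projBim_succ (j : Fin n) (u : (projBim k j.succ).carrier) :
    u ∈ redSpan (S := StarAlg k n) (StarAlg.mk k) (projBim k j.succ) ↔
      ∃ y, u = projBimBil k j.succ (Zigzag.cyc k j) y := by
  constructor
  · intro h
    have : redSpan (S := StarAlg k n) (StarAlg.mk k) (projBim k j.succ) ≤
        LinearMap.range (projBimBil k j.succ (Zigzag.cyc k j)) := by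
      rw [redSpan_projBim]
      refine Submodule.span_le.2 ?_
      rintro _ ⟨r, m, hr, rfl⟩
      have hr := (StarAlg.mk_eq_zero_iff r).1 hr
      change (projBim k j.succ).lact r m ∈ LinearMap.range (projBimBil k j.succ (Zigzag.cyc k j))
      induction m using proj_induction with
      | h x y =>
        rw [lact_projBil]
        have hx : ∃ c : k, r * x * Zigzag.e k j.succ = c • Zigzag.cyc k j := by
          generalize r * x = z, Zigzag.cycSpan_mul_mem x hr = hz
          induction hz using Submodule.span_induction with
          | mem z h =>
            obtain ⟨l, rfl⟩ := h
            rw [Zigzag.cyc_mul, Zigzag.vertexChar_e]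
            by_cases hl : j = l
            · subst hl; exact ⟨_, rfl⟩
            · refine ⟨0, ?_⟩
              rw [if_neg (fun h => hl (Fin.succ_injective _ h))]
              simp
          | zero => exact ⟨0, by simp⟩
          | add x y _ _ hx hy =>
            obtain ⟨c, hc⟩ := hx
            obtain ⟨d, hd⟩ := hy
            exact ⟨c + d, by rw [add_mul, hc, hd, add_smul]⟩
          | smul a x _ hx =>
            obtain ⟨c, hc⟩ := hx
            exact ⟨a * c, by rw [smul_mul_assoc, hc, smul_smul]⟩
        obtain ⟨c, hc⟩ := hx
        refine ⟨c • y, ?_⟩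
        rw [map_smul, ← LinearMap.smul_apply, ← map_smul]
        refine projBil_congr _ _ ?_ rfl
        rw [hc, smul_mul_assoc, Zigzag.cyc_mul, Zigzag.vertexChar_e, if_pos rfl, one_smul]
      | h0 => simp
      | hadd x y hx hy => rw [map_add]; exact Submodule.add_mem _ hx hy
    obtain ⟨y, hy⟩ := this h
    exact ⟨y, hy.symm⟩
  · rintro ⟨y, rfl⟩
    rw [projBil_eq_act]
    exact lact_mem_redSpan _ ((StarAlg.mk_eq_zero_iff _).2 (Zigzag.cyc_mem j)) _

lemma projBimBil_cyc_ba_ne_zero (j : Fin n) :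
    projBimBil k j.succ (Zigzag.cyc k j) (Zigzag.b k j * Zigzag.a k j) ≠ 0 := by
  intro h
  have h1 := congrArg (projLift (Zigzag.e k j.succ) (Zigzag.e k 0)
    ((LinearMap.mul k k).compl₁₂ (Zigzag.coordCyc k j) (Zigzag.coordC k))) h
  rw [projLift_projBil, map_zero] at h1
  simp [Zigzag.cyc_mul, ← mul_assoc, Zigzag.e_b] at h1

lemma lin_proj_self {i : Fin (n + 1)} (f : projBim k i ⟶ N) :
    N.ract (MulOpposite.op (Zigzag.e k 0)) (lin f (projBimBil k i 1 1)) =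
      lin f (projBimBil k i 1 1) := by
  rw [← lin_ract, ract_projBil]
  congr 1
  refine projBil_congr _ _ rfl ?_
  rw [one_mul, mul_one, Zigzag.idem]

lemma lin_proj_self_left {i : Fin (n + 1)} (f : projBim k i ⟶ N) :
    N.lact (Zigzag.e k i) (lin f (projBimBil k i 1 1)) = lin f (projBimBil k i 1 1) := by
  rw [← lin_lact, lact_projBil]
  congr 1
  refine projBil_congr _ _ ?_ rfl
  rw [one_mul, mul_one, Zigzag.idem]

lemma proj_proj_eq_zero {i j : Fin (n + 1)} (hij : i ≠ j ∨ j = 0) (f : projBim k i ⟶ projBim k j)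
    (hf : redStarMap f = 0) : f = 0 := by
  rw [redMap_proj_eq_zero_iff] at hf
  refine proj_hom_ext ?_
  change _ = 0
  refine Fin.cases (motive := fun j => ∀ (_ : i ≠ j ∨ j = 0) (f : projBim k i ⟶ projBim k j)
    (_ : lin f (projBimBil k i 1 1) ∈
      redSpan (S := StarAlg k n) (StarAlg.mk k) (projBim k j)),
    lin f (projBimBil k i 1 1) = 0) ?_ ?_ j hij f hf
  · intro _ f hf
    rwa [redSpan_projBim_zero, Submodule.mem_bot] at hf
  · intro j hij f hf
    obtain ⟨y, hy⟩ := (mem_redSpan_projBim_succ j _).1 hf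
    have h := lin_proj_self_left f
    rw [hy, lact_projBil, Zigzag.mul_cyc, Zigzag.vertexChar_e,
      if_neg (hij.resolve_right (Fin.succ_ne_zero j)), zero_smul, map_zero,
      LinearMap.zero_apply] at h
    rw [hy, h]

/-- A homomorphism `Λ ⟶ Λ eᵢ ⊗ₖ e₀ Λ` is given by an element on which the left and the right
actions agree; `c_j ⊗ y` is such an element only if it is zero. -/
lemma reg_proj_eq_zero {i : Fin (n + 1)} (f : self k (Zigzag k n) ⟶ projBim k i)
    (hf : redStarMap f = 0) : f = 0 := by
  rw [redMap_self_eq_zero_iff] at hf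
  have h0 : lin f (selfIn k _ 1) = 0 := by
    have hc : ∀ x, (projBim k i).lact x (lin f (selfIn k _ 1)) =
        (projBim k i).ract (MulOpposite.op x) (lin f (selfIn k _ 1)) := fun x => by
      rw [← lin_lact, ← lin_ract, self_lact, self_ract, mul_one, MulOpposite.unop_op, one_mul]
    generalize lin f (selfIn k _ 1) = u at hf hc
    induction i using Fin.cases with
    | zero => rwa [redSpan_projBim_zero, Submodule.mem_bot] at hf
    | succ j =>
      obtain ⟨y, rfl⟩ := (mem_redSpan_projBim_succ j _).1 hf
      -- Comparing the actions of `e_j` shows that the element is a multiple of `c_j ⊗ b_j`. The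
      -- left action of `a_j` kills it, while the right action turns `c_j ⊗ b_j` into `c_j ⊗ c ≠ 0`.
      have h1 := hc (Zigzag.e k j.succ)
      rw [lact_projBil, ract_projBil, Zigzag.mul_cyc, Zigzag.vertexChar_e, if_pos rfl,
        one_smul] at h1
      have h2 : projBimBil k j.succ (Zigzag.cyc k j) y =
          Zigzag.coordB k j y • projBimBil k j.succ (Zigzag.cyc k j) (Zigzag.b k j) := by
        rw [h1, ← map_smul]
        refine projBil_congr _ _ rfl ?_
        rw [← mul_assoc, Zigzag.e_zero_mul_mul_e_succ j, mul_smul_comm, Zigzag.e_b]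
      have h3 := hc (Zigzag.a k j)
      rw [h2, map_smul, map_smul, lact_projBil, ract_projBil, Zigzag.mul_cyc] at h3
      have h4 : Zigzag.vertexChar k j.succ (Zigzag.a k j) = 0 := by simp
      rw [h4, zero_smul, map_zero, LinearMap.zero_apply, smul_zero] at h3
      rw [h2, (smul_eq_zero.1 h3.symm).resolve_right (projBimBil_cyc_ba_ne_zero j), zero_smul]
  apply hom_ext
  intro x
  obtain ⟨x, rfl⟩ := (selfIn k _).surjective x
  rw [lin_self, h0, map_zero]
  rfl

lemma lact_leftKer_eq_zero {r : Zigzag k n} (hr : StarAlg.mk k r = 0) {x : N.carrier}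
    (hx : x ∈ leftKer (S := StarAlg k n) (StarAlg.mk k) N) : N.lact r x = 0 := by
  refine Submodule.span_induction (p := fun y _ => N.lact r y = 0) ?_ (map_zero _) ?_ ?_ hx
  · rintro _ ⟨s, m, hs, rfl⟩
    rw [← lact_mul, Zigzag.cycSpan_mul_cycSpan ((StarAlg.mk_eq_zero_iff r).1 hr)
      ((StarAlg.mk_eq_zero_iff s).1 hs)]
    simp
  · intro x y _ _ hx hy; rw [map_add, hx, hy, add_zero]
  · intro c x _ hx; rw [map_smul, hx, smul_zero]

lemma isStarBiideal_starBiideal : IsStarBiideal (starBiideal k n) where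
  reg_reg η := by
    rw [mem_starBiideal_iff]
    refine (redMap_self_eq_zero_iff (N := self k (Zigzag k n)) η.hom).trans ?_
    exact mem_redSpan_self (valueOne η)
  proj_reg i := by
    rw [eq_bot_iff]
    intro η hη
    rw [mem_starBiideal_iff] at hη
    have h := (redMap_proj_eq_zero_iff (N := self k (Zigzag k n)) η.hom).1 hη
    refine ObjectProperty.hom_ext _ (proj_hom_ext (N := self k (Zigzag k n)) ?_)
    obtain ⟨x, hx⟩ := (selfIn k (Zigzag k n)).surjective
      (lin (M := projBim k i) (N := self k (Zigzag k n)) η.hom (projBimBil k i 1 1))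
    rw [← hx, mem_redSpan_self] at h
    have h1 := lin_proj_self (N := self k (Zigzag k n)) η.hom
    rw [← hx, self_ract] at h1
    refine hx.symm.trans (h1.symm.trans ?_)
    exact (congrArg _ (Zigzag.cycSpan_mul_e_zero h)).trans (map_zero _)
  reg_proj i := by
    rw [eq_bot_iff]
    intro η hη
    rw [mem_starBiideal_iff] at hη
    exact ObjectProperty.hom_ext _ (reg_proj_eq_zero η.hom hη)
  proj_proj_of_ne i j hij := by
    rw [eq_bot_iff]
    intro η hη
    rw [mem_starBiideal_iff] at hη
    exact ObjectProperty.hom_ext _ (proj_proj_eq_zero (Or.inl hij) η.hom hη)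
  proj_proj_zero := by
    rw [eq_bot_iff]
    intro η hη
    rw [mem_starBiideal_iff] at hη
    exact ObjectProperty.hom_ext _ (proj_proj_eq_zero (Or.inr rfl) η.hom hη)
  proj_proj_succ j η := by
    rw [mem_starBiideal_iff]
    refine (redMap_proj_eq_zero_iff (N := projBim k j.succ) η.hom).trans ?_
    change _ ↔ lin (M := projBim k j.succ) (N := projBim k j.succ) η.hom (projBimBil k j.succ 1 1) ∈
      Submodule.span k {projBimBil k j.succ (Zigzag.cyc k j) 1,
        projBimBil k j.succ (Zigzag.cyc k j) (Zigzag.b k j * Zigzag.a k j)}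
    constructor
    · intro h
      obtain ⟨y, hy⟩ := (mem_redSpan_projBim_succ j _).1 h
      have h1 := lin_proj_self (N := projBim k j.succ) η.hom
      rw [hy, ract_projBil] at h1
      rw [hy, ← h1, Submodule.mem_span_pair]
      refine ⟨Zigzag.vertexChar k 0 y, Zigzag.coordC k y, ?_⟩
      rw [← map_smul, ← map_smul, ← map_add]
      refine projBil_congr _ _ rfl ?_
      rw [← mul_assoc, Zigzag.e_zero_mul_mul_e_zero j, mul_add, mul_smul_comm, mul_one,
        mul_smul_comm, ← mul_assoc, Zigzag.e_b]
    · intro h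
      obtain ⟨c, d, hcd⟩ := Submodule.mem_span_pair.1 h
      refine (mem_redSpan_projBim_succ j _).2 ⟨c • 1 + d • (Zigzag.b k j * Zigzag.a k j), ?_⟩
      rw [← hcd, map_add, map_smul, map_smul]

/-- The composite of two homomorphisms whose reductions vanish is zero, because the two-cycles at
the leaves have square zero. -/
lemma comp_eq_zero_of_redStarMap {M N P : Bimodule k (Zigzag k n) (Zigzag k n)} (f : M ⟶ N)
    (g : N ⟶ P) (hN : IsNormal (S := StarAlg k n) (StarAlg.mk k) N)
    (hP : IsNormal (S := StarAlg k n) (StarAlg.mk k) P)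
    (hf : redStarMap f = 0) (hg : redStarMap g = 0) : f ≫ g = 0 := by
  rw [redMap_eq_zero_iff] at hf hg
  rw [hN.redSpan_eq] at hf
  rw [hP.redSpan_eq] at hg
  apply hom_ext
  intro x
  change lin g (lin f x) = 0
  refine Submodule.span_induction (p := fun y _ => lin g y = 0) ?_ (map_zero _) ?_ ?_ (hf x)
  · rintro _ ⟨r, m, hr, rfl⟩
    rw [lin_lact]
    exact lact_leftKer_eq_zero hr (hg m)
  · intro x y _ _ hx hy; rw [map_add, hx, hy, add_zero]
  · intro c x _ hx; rw [map_smul, hx, smul_zero]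

lemma isNilpotent_starBiideal : (starBiideal k n).IsNilpotent := by
  refine ⟨2, fun a b F G => ?_⟩
  have h1 : ∀ F G, ((starBiideal k n).ideal a b).pow 1 F G ≤
      ((starBiideal k n).ideal a b).hom F G := by
    intro F G
    refine Submodule.span_le.2 ?_
    rintro _ ⟨Z, f, g, -, hg, rfl⟩
    exact ((starBiideal k n).ideal a b).comp_left f hg
  refine Submodule.span_eq_bot.2 ?_
  rintro _ ⟨Z, f, g, hf, hg, rfl⟩
  exact ObjectProperty.hom_ext _ (comp_eq_zero_of_redStarMap f.hom g.hom
    (isNormal_of_starClass Z.property) (isNormal_of_starClass G.property)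
    ((mem_starBiideal_iff f).1 (h1 _ _ hf)) ((mem_starBiideal_iff g).1 hg))

end biideal

/-! ### Fullness of reduction -/

namespace Zigzag

variable {n : ℕ}

lemma mul_b (j : Fin n) (x : Zigzag k n) :
    x * b k j = vertexChar k 0 x • b k j + coordA k j x • cyc k j := by
  induction x using induction_on j with
  | he i => by_cases h : i = 0 <;> simp [e_mul_b, h]
  | ha i =>
    rw [a_mul_b]
    by_cases h : i = j
    · simp [h]
    · simp [h, Ne.symm h]
  | hb i => simp [b_mul_b]
  | hc => simp [ba_mul_b]
  | hcyc i => simp [cyc_mul_b]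
  | h0 => simp
  | hadd x y hx hy => rw [add_mul, hx, hy]; simp only [map_add, add_smul]; abel
  | hsmul r x hx => rw [smul_mul_assoc, hx]; simp [smul_smul]

lemma b_mul (j : Fin n) (x : Zigzag k n) :
    b k j * x = vertexChar k j.succ x • b k j + coordA k j x • (b k j * a k j) := by
  induction x using induction_on j with
  | he i => by_cases h : i = j.succ <;> simp [b_mul_e, h, eq_comm]
  | ha i =>
    rw [b_mul_a]
    by_cases h : j = i
    · simp [h]
    · simp [h, Ne.symm h]
  | hb i => simp [b_mul_b]
  | hc => simp [b_mul_ba]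
  | hcyc i => simp [b_mul_cyc]
  | h0 => simp
  | hadd x y hx hy => rw [mul_add, hx, hy]; simp only [map_add, add_smul]; abel
  | hsmul r x hx => rw [mul_smul_comm, hx]; simp [smul_smul]

lemma mul_e_succ (j : Fin n) (x : Zigzag k n) :
    x * e k j.succ = vertexChar k j.succ x • e k j.succ + coordB k j x • b k j +
      coordCyc k j x • cyc k j := by
  induction x using induction_on j with
  | he i => by_cases h : i = j.succ <;> simp [e_mul_e, h]
  | ha i => simp [a_mul_e]
  | hb i =>
    rw [b_mul_e]
    by_cases h : j = i
    · simp [h]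
    · simp [h]
  | hc => simp [ba_mul_e]
  | hcyc i =>
    rw [cyc_mul_e]
    by_cases h : j = i
    · simp [h]
    · simp [h]
  | h0 => simp
  | hadd x y hx hy => rw [add_mul, hx, hy]; simp only [map_add, add_smul]; abel
  | hsmul r x hx => rw [smul_mul_assoc, hx]; simp [smul_smul]

lemma coordB_mul (j : Fin n) (x y : Zigzag k n) :
    coordB k j (x * y) = vertexChar k 0 x * coordB k j y +
      coordB k j x * vertexChar k j.succ y := by
  have h : ∀ z, coordB k j (z * e k j.succ) = coordB k j z := fun z => by
    rw [mul_e_succ]; simp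
  rw [← h (x * y), mul_assoc, mul_e_succ j y]
  simp [mul_add, mul_b, mul_cyc, h, mul_comm, add_comm]

lemma coordA_mul (j : Fin n) (x y : Zigzag k n) :
    coordA k j (x * y) = vertexChar k j.succ x * coordA k j y +
      coordA k j x * vertexChar k 0 y := by
  have h : b k j * (x * y) = b k j * x * y := (mul_assoc _ _ _).symm
  rw [b_mul j (x * y), b_mul j x, add_mul, smul_mul_assoc, smul_mul_assoc, b_mul j y, ba_mul] at h
  simpa using congrArg (coordC k) h

lemma coordCyc_mul_e (j : Fin n) (x : Zigzag k n) :
    coordCyc k j (x * e k j.succ) = coordCyc k j x := by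
  rw [mul_e_succ]; simp

end Zigzag

section full

variable {n : ℕ}

/-- The homomorphism out of the regular bimodule given by an element on which the left and the right
actions agree. -/
def selfHom {R : Type u} [Ring R] [Algebra k R] {N : Bimodule k R R} (y : N.carrier)
    (h : ∀ x, N.lact x y = N.ract (MulOpposite.op x) y) : self k R ⟶ N :=
  mkHom ((LinearMap.applyₗ y ∘ₗ N.lact.toLinearMap) ∘ₗ (selfIn k R).symm.toLinearMap)
    (fun r x => lact_mul N r _ y)
    (fun s x => by
      obtain ⟨s, rfl⟩ := MulOpposite.op_surjective s
      obtain ⟨x, rfl⟩ := (selfIn k _).surjective x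
      change N.lact (x * s) y = N.ract (MulOpposite.op s) (N.lact x y)
      rw [lact_mul, h s, N.lact_ract])

lemma lin_selfHom_one {R : Type u} [Ring R] [Algebra k R] {N : Bimodule k R R} (y : N.carrier)
    (h : ∀ x, N.lact x y = N.ract (MulOpposite.op x) y) :
    lin (selfHom y h) (selfIn k _ 1) = y :=
  lact_one N y

/-- To lift a homomorphism out of the reduction of the regular bimodule one has to lift a central
element of a reduction to a central element. -/
lemma Bimodule.redMap_surjective_self {R S : Type u} [Ring R] [Algebra k R] [Ring S] [Algebra k S]
    {π : R →ₐ[k] S} (hπ : Function.Surjective π) {N : Bimodule k R R}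
    (h : ∀ y : N.carrier, (∀ x, N.lact x y - N.ract (MulOpposite.op x) y ∈ redSpan π N) →
      ∃ z : N.carrier, (∀ x, N.lact x z = N.ract (MulOpposite.op x) z) ∧ y - z ∈ redSpan π N) :
    Function.Surjective (redMap (hπ := hπ) : (self k R ⟶ N) → _) := by
  intro g
  obtain ⟨y, hy⟩ := redMk_surjective N (lin g (redMk hπ _ (selfIn k _ 1)))
  obtain ⟨z, hz, hyz⟩ := h y (fun x => by
    rw [← redMk_eq_zero_iff (hπ := hπ), map_sub, ← red_lact, ← red_ract, hy,
      ← lin_lact, ← lin_ract, red_lact, red_ract, self_lact, self_ract, mul_one,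
      MulOpposite.unop_op, one_mul, sub_self])
  rw [← redMk_eq_zero_iff (hπ := hπ), map_sub, sub_eq_zero] at hyz
  refine ⟨selfHom z hz, ?_⟩
  apply red_hom_ext
  intro x
  obtain ⟨x, rfl⟩ := (selfIn k _).surjective x
  rw [lin_redMap, lin_self, lin_selfHom_one, ← red_lact, ← hyz, hy, ← lin_lact, red_lact,
    self_lact, mul_one]

lemma redStarMap_surjective_self {N : Bimodule k (Zigzag k n) (Zigzag k n)}
    (h : ∀ y : N.carrier, (∀ x, N.lact x y - N.ract (MulOpposite.op x) y ∈
        redSpan (S := StarAlg k n) (StarAlg.mk k) N) →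
      ∃ z : N.carrier, (∀ x, N.lact x z = N.ract (MulOpposite.op x) z) ∧
        y - z ∈ redSpan (S := StarAlg k n) (StarAlg.mk k) N) :
    Function.Surjective (redStarMap : (self k (Zigzag k n) ⟶ N) → _) :=
  redMap_surjective_self _ h

/-- The central elements of `A` lift to central elements of the zigzag algebra. -/
lemma redStarMap_surjective_self_self (m : Fin n) :
    Function.Surjective
      (redStarMap : (self k (Zigzag k n) ⟶ self k (Zigzag k n)) → _) := by
  refine redStarMap_surjective_self fun y hy => ?_
  obtain ⟨y, rfl⟩ := (selfIn k _).surjective y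
  have hy : ∀ x, x * y - y * x ∈ Zigzag.cycSpan k n := fun x => (mem_redSpan_self _).1 (hy x)
  -- Modulo `J`, commuting with `e₀` and the `a_j` forces `y` to be a combination of `1` and `c`;
  -- these are central in `Λ`.
  have hB : ∀ j, Zigzag.coordB k j y = 0 := fun j => by
    have := Zigzag.map_cycSpan (Zigzag.coordB k j) (by simp) (hy (Zigzag.e k 0))
    simpa [Zigzag.coordB_mul, (Fin.succ_ne_zero j).symm] using this
  have hA : ∀ j, Zigzag.coordA k j y = 0 := fun j => by
    have := Zigzag.map_cycSpan (Zigzag.coordA k j) (by simp) (hy (Zigzag.e k 0))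
    simpa [Zigzag.coordA_mul, (Fin.succ_ne_zero j).symm] using this
  have hE : ∀ j : Fin n, Zigzag.vertexChar k j.succ y = Zigzag.vertexChar k 0 y := fun j => by
    have := Zigzag.map_cycSpan (Zigzag.coordA k j) (by simp) (hy (Zigzag.a k j))
    exact Eq.symm (by simpa [Zigzag.coordA_mul, sub_eq_zero] using this)
  refine ⟨selfIn k _ (Zigzag.vertexChar k 0 y • 1 +
    Zigzag.coordC k y • (Zigzag.b k m * Zigzag.a k m)), fun x => ?_, ?_⟩
  · rw [self_lact, self_ract, MulOpposite.unop_op]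
    congr 1
    rw [mul_add, add_mul, mul_smul_comm, mul_smul_comm, Zigzag.mul_ba, smul_mul_assoc,
      smul_mul_assoc, Zigzag.ba_mul, mul_one, one_mul]
  · rw [← map_sub, mem_redSpan_self]
    have h1 : y = Zigzag.vertexChar k 0 y • 1 +
        Zigzag.coordC k y • (Zigzag.b k m * Zigzag.a k m) +
        ∑ j, Zigzag.coordCyc k j y • Zigzag.cyc k j := by
      conv_lhs => rw [Zigzag.eq_sum_coord m y, Fin.sum_univ_succ]
      simp only [hA, hE, hB, zero_smul, Finset.sum_const_zero,
        add_zero]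
      rw [← Zigzag.sum_e, Fin.sum_univ_succ, smul_add, Finset.smul_sum]
    rw [sub_eq_of_eq_add' h1]
    exact Submodule.sum_mem _ fun j _ => Submodule.smul_mem _ _ (Zigzag.cyc_mem j)

lemma redStarMap_surjective_self_proj_zero :
    Function.Surjective
      (redStarMap : (self k (Zigzag k n) ⟶ projBim k (0 : Fin (n + 1))) → _) := by
  refine redStarMap_surjective_self fun y hy => ⟨y, fun x => ?_, by simp⟩
  have := hy x
  rwa [redSpan_projBim_zero, Submodule.mem_bot, sub_eq_zero] at this

/-- The map `x ⊗ y ↦ ξ(x) y` on `Λ e_j ⊗ₖ e₀ Λ`. -/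
def projCoord (i : Fin (n + 1)) (ξ : Zigzag k n →ₗ[k] k) : (projBim k i).carrier →ₗ[k] Zigzag k n :=
  projLift (Zigzag.e k i) (Zigzag.e k 0) ((LinearMap.lsmul k (Zigzag k n)) ∘ₗ ξ)

lemma projCoord_projBil (i : Fin (n + 1)) (ξ : Zigzag k n →ₗ[k] k) (x y : Zigzag k n) :
    projCoord i ξ (projBimBil k i x y) = ξ (x * Zigzag.e k i) • (Zigzag.e k 0 * y) :=
  projLift_projBil _ _ _ _ _

lemma projCoord_ract (i : Fin (n + 1)) (ξ : Zigzag k n →ₗ[k] k) (x : Zigzag k n)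
    (u : (projBim k i).carrier) :
    projCoord i ξ ((projBim k i).ract (MulOpposite.op x) u) = projCoord i ξ u * x := by
  induction u using proj_induction with
  | h y z => rw [ract_projBil, projCoord_projBil, projCoord_projBil, smul_mul_assoc, mul_assoc]
  | h0 => simp
  | hadd x y hx hy => rw [map_add, map_add, hx, hy, map_add, add_mul]

lemma e_zero_mul_projCoord (i : Fin (n + 1)) (ξ : Zigzag k n →ₗ[k] k)
    (u : (projBim k i).carrier) : Zigzag.e k 0 * projCoord i ξ u = projCoord i ξ u := by
  induction u using proj_induction with
  | h y z => rw [projCoord_projBil, mul_smul_comm, ← mul_assoc, Zigzag.idem]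
  | h0 => simp
  | hadd x y hx hy => rw [map_add, mul_add, hx, hy]

lemma projCoord_vertexChar_lact (j : Fin n) (x : Zigzag k n) (u : (projBim k j.succ).carrier) :
    projCoord j.succ (Zigzag.vertexChar k j.succ).toLinearMap ((projBim k j.succ).lact x u) =
      Zigzag.vertexChar k j.succ x •
        projCoord j.succ (Zigzag.vertexChar k j.succ).toLinearMap u := by
  induction u using proj_induction with
  | h y z => simp [projCoord_projBil, smul_smul]
  | h0 => simp
  | hadd x y hx hy => rw [map_add, map_add, hx, hy, map_add, smul_add]

lemma projCoord_coordB_lact (j : Fin n) (x : Zigzag k n) (u : (projBim k j.succ).carrier) :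
    projCoord j.succ (Zigzag.coordB k j) ((projBim k j.succ).lact x u) =
      Zigzag.vertexChar k 0 x • projCoord j.succ (Zigzag.coordB k j) u +
      Zigzag.coordB k j x • projCoord j.succ (Zigzag.vertexChar k j.succ).toLinearMap u := by
  induction u using proj_induction with
  | h y z => simp [projCoord_projBil, smul_smul, Zigzag.coordB_mul, add_smul]
  | h0 => simp
  | hadd x y hx hy => rw [map_add, map_add, hx, hy, map_add, map_add, smul_add, smul_add]; abel

/-- The expansion of an element of `Λ e_j ⊗ₖ e₀ Λ` with respect to the basis `e_j`, `b_j`, `c_j` of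
`Λ e_j`. -/
lemma eq_projCoord (j : Fin n) (u : (projBim k j.succ).carrier) :
    u = projBimBil k j.succ 1 (projCoord j.succ (Zigzag.vertexChar k j.succ).toLinearMap u) +
      projBimBil k j.succ (Zigzag.b k j) (projCoord j.succ (Zigzag.coordB k j) u) +
      projBimBil k j.succ (Zigzag.cyc k j) (projCoord j.succ (Zigzag.coordCyc k j) u) := by
  induction u using proj_induction with
  | h x y =>
    have h : ∀ z, projBimBil k j.succ z (Zigzag.e k 0 * y) = projBimBil k j.succ z y := fun z =>
      projBil_congr _ _ rfl (by rw [← mul_assoc, Zigzag.idem])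
    have key : projBimBil k j.succ x y = projBimBil k j.succ (Zigzag.vertexChar k j.succ x • 1 +
        Zigzag.coordB k j x • Zigzag.b k j + Zigzag.coordCyc k j x • Zigzag.cyc k j) y := by
      refine projBil_congr _ _ ?_ rfl
      conv_lhs => rw [Zigzag.mul_e_succ]
      simp [add_mul, Zigzag.b_e, Zigzag.cyc_mul]
    have hB : Zigzag.coordB k j (x * Zigzag.e k j.succ) = Zigzag.coordB k j x := by
      rw [Zigzag.mul_e_succ]; simp
    have hE : (Zigzag.vertexChar k j.succ).toLinearMap (x * Zigzag.e k j.succ) =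
        Zigzag.vertexChar k j.succ x := by simp
    simp only [projCoord_projBil, map_smul, h, Zigzag.coordCyc_mul_e, hB, hE]
    rw [key]
    simp only [map_add, map_smul, LinearMap.add_apply, LinearMap.smul_apply]
  | h0 => simp
  | hadd x y hx hy =>
    conv_lhs => rw [hx, hy]
    simp only [map_add]
    abel

lemma projCoord_of_mem_redSpan (j : Fin n) (ξ : Zigzag k n →ₗ[k] k) (hξ : ξ (Zigzag.cyc k j) = 0)
    {u : (projBim k j.succ).carrier}
    (hu : u ∈ redSpan (S := StarAlg k n) (StarAlg.mk k) (projBim k j.succ)) :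
    projCoord j.succ ξ u = 0 := by
  obtain ⟨y, rfl⟩ := (mem_redSpan_projBim_succ j u).1 hu
  rw [projCoord_projBil, Zigzag.cyc_mul, Zigzag.vertexChar_e, if_pos rfl, one_smul, hξ, zero_smul]

/-- The element `b_j ⊗ c + c_j ⊗ b_j`, on which the left and the right actions agree, lifts the
generator of the space of homomorphisms from `A` to `A e_j ⊗ₖ e₀ A`. -/
lemma redStarMap_surjective_self_proj_succ (j : Fin n) :
    Function.Surjective
      (redStarMap : (self k (Zigzag k n) ⟶ projBim k j.succ) → _) := by
  refine redStarMap_surjective_self fun y hy => ?_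
  set w := projCoord j.succ (Zigzag.vertexChar k j.succ).toLinearMap y with hw
  set w' := projCoord j.succ (Zigzag.coordB k j) y with hw'
  -- Modulo `c_j ⊗ e₀ Λ` the element is `e_j ⊗ w + b_j ⊗ w'`. Comparing the actions of `a_j`, `b_j`
  -- and `e₀` gives `w = 0` and `w' = γ c`.
  have h1 : ∀ x, Zigzag.vertexChar k j.succ x • w = w * x := fun x => by
    have := projCoord_of_mem_redSpan j (Zigzag.vertexChar k j.succ).toLinearMap (by simp) (hy x)
    rwa [map_sub, projCoord_vertexChar_lact, projCoord_ract, sub_eq_zero] at this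
  have h2 : ∀ x, Zigzag.vertexChar k 0 x • w' + Zigzag.coordB k j x • w = w' * x := fun x => by
    have := projCoord_of_mem_redSpan j (Zigzag.coordB k j) (by simp) (hy x)
    rwa [map_sub, projCoord_coordB_lact, projCoord_ract, sub_eq_zero] at this
  have hb : w = w' * Zigzag.b k j := by simpa using h2 (Zigzag.b k j)
  have ha : w * Zigzag.a k j = 0 := by simpa using (h1 (Zigzag.a k j)).symm
  have he : w' = w' * Zigzag.e k 0 := by simpa using h2 (Zigzag.e k 0)
  have hc : Zigzag.vertexChar k 0 w' = 0 := by
    rw [hb, mul_assoc, Zigzag.mul_ba] at ha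
    simpa using congrArg (Zigzag.coordC k) ha
  have h3 : w' = Zigzag.coordC k w' • (Zigzag.b k j * Zigzag.a k j) := by
    have h5 : Zigzag.e k 0 * w' = w' := e_zero_mul_projCoord _ _ _
    have h6 := Zigzag.e_zero_mul_mul_e_zero j w'
    rwa [h5, ← he, hc, zero_smul, zero_add] at h6
  have h4 : w = 0 := by rw [hb, h3, smul_mul_assoc, Zigzag.ba_mul_b, smul_zero]
  generalize Zigzag.coordC k w' = γ at h3
  refine ⟨γ • (projBimBil k j.succ (Zigzag.b k j) (Zigzag.b k j * Zigzag.a k j) +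
    projBimBil k j.succ (Zigzag.cyc k j) (Zigzag.b k j)), fun x => ?_, ?_⟩
  · rw [map_smul, map_smul, map_add, map_add, lact_projBil, lact_projBil, ract_projBil,
      ract_projBil, Zigzag.mul_b, Zigzag.mul_cyc, Zigzag.ba_mul, Zigzag.b_mul j x]
    simp only [map_smul, map_add, LinearMap.add_apply, LinearMap.smul_apply]
    congr 1
    abel
  · rw [eq_projCoord j y, ← hw, ← hw', h4, h3, map_zero, zero_add, map_smul, smul_add,
      add_sub_add_left_eq_sub, ← map_smul, ← map_sub]
    exact (mem_redSpan_projBim_succ j _).2 ⟨_, rfl⟩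

lemma redStarMap_surjective (hn : 0 < n) {M N : Bimodule k (Zigzag k n) (Zigzag k n)}
    (hM : starClass (zigzagObj k n) (Zigzag.e k) M)
    (hN : starClass (zigzagObj k n) (Zigzag.e k) N) :
    Function.Surjective (redStarMap : (M ⟶ N) → _) := by
  refine map_surjective_of_addClosure (redFunctor (StarAlg.mk_surjective (k := k) (n := n)))
    ?_ hM hN
  rintro X Y (rfl | ⟨i, rfl⟩) hY
  · rcases hY with rfl | ⟨j, rfl⟩
    · exact redStarMap_surjective_self_self ⟨0, hn⟩
    · induction j using Fin.cases with
      | zero => exact redStarMap_surjective_self_proj_zero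
      | succ j => exact redStarMap_surjective_self_proj_succ j
  · exact redMap_surjective_projBim i

end full

/-! ### Pseudofunctors induced by the cell birepresentation -/

section birep

open LinCat

variable {B : Type u₁} [Bicategory.{w₁, v₁} B]

lemma LinCat.nt_zero {C D : LinCat.{u, v, w} k} {F G : C ⟶ D} (X : C.carrier) :
    (nt (0 : F ⟶ G)).app X = 0 := rfl

instance LinCat.isIso_nt_app {C D : LinCat.{u, v, w} k} {F G : C ⟶ D} (e : F ≅ G)
    (X : C.carrier) : IsIso ((nt e.hom).app X) :=
  ⟨(nt e.inv).app X, congrArg (fun t => (nt t).app X) e.hom_inv_id,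
    congrArg (fun t => (nt t).app X) e.inv_hom_id⟩

lemma eq_zero_of_comp_eq_comp {C : Type u₁} [Category.{v₁} C] [Preadditive C] {X Y Z W : C}
    {p : X ⟶ Y} {q : Y ⟶ W} {r : X ⟶ Z} [hr : IsIso r] {s : Z ⟶ W} (h : p ≫ q = r ≫ s)
    (hp : p = 0) : s = 0 := by
  rw [hp, Limits.zero_comp] at h
  exact (cancel_epi r).1 (by rw [← h, Limits.comp_zero])

lemma eq_zero_of_comp_eq_comp' {C : Type u₁} [Category.{v₁} C] [Preadditive C] {X Y Z W : C}
    {p : X ⟶ Y} {q : Y ⟶ W} [hq : IsIso q] {r : X ⟶ Z} {s : Z ⟶ W} (h : p ≫ q = r ≫ s)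
    (hs : s = 0) : p = 0 := by
  rw [hs, Limits.comp_zero] at h
  exact (cancel_mono q).1 (by rw [h, Limits.zero_comp])

/-- Equivalent birepresentations annihilate the same `2`-morphisms. -/
lemma map₂_eq_zero_iff_of_equivalence {M N : B ⥤ᵖ LinCat.{u, v, w} k}
    (Φ : Pseudofunctor.StrongTrans M N) (hΦ : ∀ a, (fn (Φ.app a)).IsEquivalence) {a b : B}
    {F G : a ⟶ b} (η : F ⟶ G) : M.map₂ η = 0 ↔ N.map₂ η = 0 := by
  have := hΦ a
  have := hΦ b
  have nat : ∀ X : (M.obj a).carrier,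
      (fn (Φ.app b)).map ((nt (M.map₂ η)).app X) ≫ (nt (Φ.naturality G).hom).app X =
      (nt (Φ.naturality F).hom).app X ≫ (nt (N.map₂ η)).app ((fn (Φ.app a)).obj X) := fun X =>
    congrArg (fun t => (nt t).app X) (Φ.naturality_naturality η)
  constructor
  · intro h
    apply ext2
    intro Y
    obtain ⟨X, ⟨e⟩⟩ : ∃ X, Nonempty ((fn (Φ.app a)).obj X ≅ Y) :=
      ⟨(fn (Φ.app a)).objPreimage Y, ⟨(fn (Φ.app a)).objObjPreimageIso Y⟩⟩
    have h1 : (nt (M.map₂ η)).app X = 0 := by rw [h, nt_zero]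
    have h2 : (nt (N.map₂ η)).app ((fn (Φ.app a)).obj X) = 0 :=
      eq_zero_of_comp_eq_comp (hr := isIso_nt_app (Φ.naturality F) X) (nat X)
        ((congrArg _ h1).trans ((fn (Φ.app b)).map_zero _ _))
    have h3 := (nt (N.map₂ η)).naturality e.hom
    exact eq_zero_of_comp_eq_comp (hr := (fn (N.map F)).map_isIso e.hom) h3.symm h2
  · intro h
    apply ext2
    intro X
    have h1 : (nt (N.map₂ η)).app ((fn (Φ.app a)).obj X) = 0 := by rw [h, nt_zero]
    have h2 : (fn (Φ.app b)).map ((nt (M.map₂ η)).app X) = 0 :=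
      eq_zero_of_comp_eq_comp' (hq := isIso_nt_app (Φ.naturality G) X) (nat X) h1
    rw [nt_zero]
    exact (fn (Φ.app b)).map_injective (by rw [h2, Functor.map_zero])

end birep

section induced

open LinCat

variable {n : ℕ}

/-- An element of an algebra as an element of the left regular module. -/
def leftRegIn (k R : Type u) [Field k] [Ring R] [Algebra k R] : R ≃ₗ[k] (leftRegular k R).carrier :=
  LinearEquiv.refl k R

/-- Evaluation at the regular module is faithful. -/
lemma eq_zero_of_tmap_leftRegular {R : Type u} [Ring R] [Algebra k R] {M N : Bimodule k R R}
    (f : M ⟶ N) (h : tmap f (𝟙 (leftRegular k R)) = 0) : f = 0 := by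
  apply hom_ext
  intro x
  let ev : (tensor N (leftRegular k R)).carrier →ₗ[k] N.carrier :=
    liftLin ((LinearMap.mk₂ k (fun (m : N.carrier) (r : R) => N.ract (MulOpposite.op r) m)
      (by intros; simp) (by intros; simp) (by intros; simp) (by intros; simp)).compl₂
        (leftRegIn k R).symm.toLinearMap)
    (fun m s r => (ract_mul N s ((leftRegIn k R).symm r) m).symm)
  have h1 := congrArg (fun t => ev (lin t (tmul _ (leftRegular k R) x (leftRegIn k R 1)))) h
  have h2 : ev (lin (tmap f (𝟙 (leftRegular k R))) (tmul _ (leftRegular k R) x (leftRegIn k R 1))) =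
      N.ract (MulOpposite.op 1) (lin f x) := by
    rw [lin_tmap]
    exact liftLin_tmul _ _ _ _
  have h3 : N.ract (MulOpposite.op 1) (lin f x) = lin f x := by
    rw [MulOpposite.op_one, map_one N.ract]
    rfl
  refine h3.symm.trans <| h2.symm.trans (h1.trans (map_zero ev))

lemma tmap_zero_left {R S T : Type u} [Ring R] [Algebra k R] [Ring S] [Algebra k S] [Ring T]
    [Algebra k T] {M M' : Bimodule k R S} {N N' : Bimodule k S T} (g : N ⟶ N') :
    tmap (0 : M ⟶ M') g = 0 := by
  simpa using tmap_smul_left (0 : k) (0 : M ⟶ M') g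

/-- The action on projective modules is faithful on `2`-morphisms. -/
lemma natStar_map₂_eq_zero_iff {a b : BStar k n} {F G : a ⟶ b} (η : F ⟶ G) :
    (natStar k n).map₂ η = 0 ↔ η = 0 := by
  constructor
  · intro h
    have h1 : (nt ((natStar k n).map₂ η)).app (show ((natStar k n).obj a).carrier from
        ⟨leftRegular k (StarAlg k n), addClosure_of_mem rfl⟩) = 0 := by rw [h, nt_zero]
    have h2 : tmap (M := F.obj) (N := leftRegular k (StarAlg k n)) η.hom (𝟙 _) = 0 :=
      congrArg (fun t => t.hom) h1
    exact ObjectProperty.hom_ext _ (eq_zero_of_tmap_leftRegular η.hom h2)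
  · rintro rfl
    apply ext2
    intro X
    apply ObjectProperty.hom_ext
    exact tmap_zero_left (M := F.obj) (M' := G.obj) (𝟙 X.obj)

lemma map₂_eq_zero_iff_cellTilde {Q : BTilde k n ⥤ᵖ BStar k n} (hQ : IsInducedByCell Q)
    {a b : BTilde k n} {F G : a ⟶ b} (η : F ⟶ G) :
    Q.map₂ η = 0 ↔ (cellTilde k n).map₂ η = 0 := by
  obtain ⟨Φ, hΦ, -⟩ := hQ.cell
  rw [map₂_eq_zero_iff_of_equivalence Φ hΦ η]
  exact (natStar_map₂_eq_zero_iff (Q.map₂ η)).symm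

/-- All pseudofunctors induced by the cell birepresentation have the same kernel. -/
lemma map₂_eq_zero_iff (hn : 0 < n) {Q : BTilde k n ⥤ᵖ BStar k n} (hQ : IsInducedByCell Q)
    {a b : BTilde k n} {F G : a ⟶ b} (η : F ⟶ G) :
    Q.map₂ η = 0 ↔ η ∈ ((starBiideal k n).ideal a b).hom F G := by
  rw [map₂_eq_zero_iff_cellTilde hQ,
    ← map₂_eq_zero_iff_cellTilde (isInducedByCell_redPseudo hn)]
  rfl

/-- A linear map is surjective if it has the same kernel as a surjective linear map with values in a
space of the same dimension. -/
lemma surjective_of_ker_eq {V W W' : Type*} [AddCommGroup V] [Module k V] [AddCommGroup W]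
    [Module k W] [AddCommGroup W'] [Module k W'] [Module.Finite k V] [Module.Finite k W']
    (f : V →ₗ[k] W) (g : V →ₗ[k] W') (hf : Function.Surjective f)
    (h : LinearMap.ker f = LinearMap.ker g) (e : W ≃ₗ[k] W') : Function.Surjective g := by
  rw [← LinearMap.range_eq_top]
  apply Submodule.eq_top_of_finrank_eq
  have h1 := LinearMap.finrank_range_add_finrank_ker f
  have h2 := LinearMap.finrank_range_add_finrank_ker g
  rw [LinearMap.range_eq_top.2 hf, finrank_top, h] at h1
  rw [← e.finrank_eq]
  omega

/-- Isomorphisms of the source and of the target induce an isomorphism of spaces of morphisms. -/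
def homLinearEquiv (k : Type u) [Field k] {C : Type u₁} [Category.{v₁} C] [Preadditive C]
    [Linear k C] {X X' Y Y' : C} (e : X ≅ X') (e' : Y ≅ Y') : (X ⟶ Y) ≃ₗ[k] (X' ⟶ Y') where
  toFun f := e.inv ≫ f ≫ e'.hom
  invFun f := e.hom ≫ f ≫ e'.inv
  map_add' := by intros; simp
  map_smul' := by intros; simp
  left_inv f := by simp
  right_inv f := by simp

instance finite_projElt {R : Type u} [Ring R] [Algebra k R] [Module.Finite k R] (e f : R) :
    Module.Finite k (proj k e f).carrier :=
  inferInstanceAs (Module.Finite k (tensor (leftProj k e) (rightProj k f)).carrier)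

instance finite_self {R : Type u} [Ring R] [Algebra k R] [Module.Finite k R] :
    Module.Finite k (self k R).carrier := inferInstanceAs (Module.Finite k R)

lemma finite_of_starClass {R : AlgObj k} [Module.Finite k R.carrier] {e : Fin (n + 1) → R.carrier}
    {M : Bimodule k R.carrier R.carrier} (hM : starClass R e M) : Module.Finite k M.carrier := by
  obtain ⟨m, G, f, g, hG, h⟩ := hM
  have fin : ∀ i, Module.Finite k (G i).carrier := fun i => by
    rcases hG i with hi | ⟨j, hi⟩ <;> rw [hi] <;> infer_instance
  refine Module.Finite.of_injective (LinearMap.pi fun i => lin (f i)) ?_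
  rw [← LinearMap.ker_eq_bot, LinearMap.ker_eq_bot']
  intro x hx
  have h1 : lin (𝟙 M) x = lin (∑ i, f i ≫ g i) x := by rw [h]
  rw [lin_id, lin_sum] at h1
  rw [h1]
  exact Finset.sum_eq_zero fun i _ => by
    rw [lin_comp, show lin (f i) x = 0 from congrFun hx i, map_zero]

lemma finite_hom_of_starClass {R : AlgObj k} [Module.Finite k R.carrier]
    {e : Fin (n + 1) → R.carrier} {M N : Bimodule k R.carrier R.carrier} (hM : starClass R e M)
    (hN : starClass R e N) : Module.Finite k (M ⟶ N) := by
  have := finite_of_starClass hM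
  have := finite_of_starClass hN
  infer_instance

lemma finite_hom_fullSubcategory {C : Type u₁} [Category.{v₁} C] [Preadditive C] [Linear k C]
    {P : ObjectProperty C} {X Y : P.FullSubcategory} (h : Module.Finite k (X.obj ⟶ Y.obj)) :
    Module.Finite k (X ⟶ Y) :=
  have : Module.Finite k (P.ι.obj X ⟶ P.ι.obj Y) := h
  Module.Finite.of_injective (P.ι.mapLinearMap k (X := X) (Y := Y)) P.ι.map_injective

lemma iso_of_isInducedByCell (hn : 0 < n) {Q : BTilde k n ⥤ᵖ BStar k n} (hQ : IsInducedByCell Q)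
    (F : objTilde k (n := n) ⟶ objTilde k)
    (hF : F = regTilde k ∨ ∃ i, F = projTilde k i) :
    Nonempty ((redPseudo k n).map F ≅ Q.map F) := by
  rcases hF with rfl | ⟨i, rfl⟩
  · exact ⟨(redPseudo k n).mapId (objTilde k) ≪≫ (Q.mapId (objTilde k)).symm⟩
  · exact ⟨((isInducedByCell_redPseudo hn).map_proj i).some ≪≫ (hQ.map_proj i).some.symm⟩

lemma exists_eq_of_generator {F : objTilde k (n := n) ⟶ objTilde k}
    (hF : F.obj = self k (Zigzag k n) ∨
      ∃ i, F.obj = proj k (Zigzag.e k (n := n) i) (Zigzag.e k 0)) :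
    F = regTilde k ∨ ∃ i, F = projTilde k i := by
  obtain ⟨F, h⟩ := F
  rcases hF with hF | ⟨i, hF⟩
  · left; cases hF; rfl
  · right; cases hF; exact ⟨i, rfl⟩

lemma mapFunctor_additive {Q : BTilde k n ⥤ᵖ BStar k n} (hQ : IsLinearPseudofunctor k Q)
    (a b : BTilde k n) : (Q.mapFunctor a b).Additive := ⟨hQ.map₂_add _ _⟩

lemma mem_addClosure_generators (F : objTilde k (n := n) ⟶ objTilde k) :
    addClosure (fun F => F = regTilde k ∨ ∃ i, F = projTilde k i) F := by
  refine addClosure_mono ?_ (addClosure_fullSubcategory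
    (C := Bimodule k (Zigzag k n) (Zigzag k n)) F)
  exact fun F hF => exists_eq_of_generator hF

/-- Every pseudofunctor induced by the cell birepresentation is locally full: this holds for the
reduction, and the dimensions of the spaces of `2`-morphisms agree. -/
lemma map₂_surjective (hn : 0 < n) {Q : BTilde k n ⥤ᵖ BStar k n} (hQ : IsInducedByCell Q)
    (F G : objTilde k (n := n) ⟶ objTilde k) :
    Function.Surjective (Q.map₂ : (F ⟶ G) → (Q.map F ⟶ Q.map G)) := by
  have := mapFunctor_additive hQ.linear (objTilde k) (objTilde k)
  refine map_surjective_of_addClosure (Q.mapFunctor (objTilde k) (objTilde k)) ?_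
    (mem_addClosure_generators F) (mem_addClosure_generators G)
  intro X Y hX hY
  obtain ⟨e⟩ := iso_of_isInducedByCell hn hQ X hX
  obtain ⟨e'⟩ := iso_of_isInducedByCell hn hQ Y hY
  have fin : Module.Finite k (X ⟶ Y) := finite_hom_fullSubcategory
    (C := Bimodule k (Zigzag k n) (Zigzag k n)) (finite_hom_of_starClass X.property Y.property)
  have fin' : Module.Finite k (Q.map X ⟶ Q.map Y) := finite_hom_fullSubcategory
    (C := Bimodule k (StarAlg k n) (StarAlg k n))
    (finite_hom_of_starClass (Q.map X).property (Q.map Y).property)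
  let f : (X ⟶ Y) →ₗ[k] ((redPseudo k n).map X ⟶ (redPseudo k n).map Y) :=
    { toFun := (redPseudo k n).map₂
      map_add' := isLinear_redPseudo.map₂_add
      map_smul' := isLinear_redPseudo.map₂_smul }
  let g : (X ⟶ Y) →ₗ[k] (Q.map X ⟶ Q.map Y) :=
    { toFun := Q.map₂
      map_add' := hQ.linear.map₂_add
      map_smul' := hQ.linear.map₂_smul }
  -- The maps induced by reduction and by `Q` have the same kernel and isomorphic targets.
  refine surjective_of_ker_eq f g ?_ ?_ (homLinearEquiv k e e')
  · intro θ
    obtain ⟨η, hη⟩ := redStarMap_surjective hn X.property Y.property θ.hom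
    exact ⟨ObjectProperty.homMk η, ObjectProperty.hom_ext _ hη⟩
  · ext η
    rw [LinearMap.mem_ker, LinearMap.mem_ker]
    exact (map₂_eq_zero_iff hn hQ η).symm

/-- Every pseudofunctor induced by the cell birepresentation is essentially surjective on
`1`-morphisms: it hits the generators, and direct summands lift because its kernel is nilpotent. -/
lemma exists_map_iso (hn : 0 < n) {Q : BTilde k n ⥤ᵖ BStar k n} (hQ : IsInducedByCell Q)
    (G : Q.obj (objTilde k) ⟶ Q.obj (objTilde k)) :
    ∃ F : objTilde k (n := n) ⟶ objTilde k, Nonempty (Q.map F ≅ G) := by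
  have := mapFunctor_additive hQ.linear (objTilde k) (objTilde k)
  have i0 : IsIdempotentComplete (objTilde k (n := n) ⟶ objTilde k) :=
    isIdempotentComplete_addClosure (C := Bimodule k (Zigzag k n) (Zigzag k n)) _
  have i1 : HasSums (objTilde k (n := n) ⟶ objTilde k) :=
    hasSums_addClosure (C := Bimodule k (Zigzag k n) (Zigzag k n)) Bimodule.hasSums _
  refine exists_iso_of_addClosure (D := Q.obj (objTilde k) ⟶ Q.obj (objTilde k))
    (Q.mapFunctor (objTilde k) (objTilde k))
    (fun X => map₂_surjective hn hQ X X) i1 ?_ ?_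
  -- The kernel of `Q` has square zero.
  · intro X f hf
    refine ⟨2, ?_⟩
    rw [pow_two]
    have h := (mem_starBiideal_iff f).1 ((map₂_eq_zero_iff hn hQ f).1 hf)
    exact ObjectProperty.hom_ext _ (comp_eq_zero_of_redStarMap f.hom f.hom
      (isNormal_of_starClass X.property) (isNormal_of_starClass X.property) h h)
  · refine addClosure_mono ?_ (addClosure_fullSubcategory
      (C := Bimodule k (StarAlg k n) (StarAlg k n)) (show objStar k ⟶ objStar k from G))
    rintro ⟨Y, hY'⟩ hY
    rcases hY with hY | ⟨i, hY⟩
    · cases hY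
      exact ⟨regTilde k, ⟨Q.mapId (objTilde k)⟩⟩
    · cases hY
      exact ⟨projTilde k i, hQ.map_proj i⟩

lemma isBiequivalence_lift (hn : 0 < n) {Q : BTilde k n ⥤ᵖ BStar k n} (hQ : IsInducedByCell Q)
    (h : ∀ {x y : BTilde k n} {F G : x ⟶ y} (η : F ⟶ G),
      η ∈ ((starBiideal k n).ideal x y).hom F G → Q.map₂ η = 0) :
    IsBiequivalence ((starBiideal k n).lift Q hQ.linear h) where
  surj c := ⟨⟨objTilde k⟩, ⟨Bicategory.Equivalence.id _⟩⟩
  locally_equiv := by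
    rintro ⟨⟨⟩⟩ ⟨⟨⟩⟩
    refine ⟨⟨?_⟩, ⟨?_⟩, ⟨?_⟩⟩
    · rintro X Y ⟨f⟩ ⟨g⟩ hfg
      refine (CatIdeal.qmk_eq_iff _ _ _).2 ?_
      rw [← map₂_eq_zero_iff hn hQ]
      have h1 : Q.map₂ f = Q.map₂ (f - g) + Q.map₂ g := by
        rw [← hQ.linear.map₂_add, sub_add_cancel]
      exact left_eq_add.1
        ((show Q.map₂ g = Q.map₂ f from Eq.symm hfg).trans (h1.trans (add_comm _ _)))
    · intro X Y g
      obtain ⟨f, hf⟩ := map₂_surjective hn hQ X.as Y.as g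
      exact ⟨CatIdeal.qmk _ f, hf⟩
    · intro G
      obtain ⟨F, ⟨e⟩⟩ := exists_map_iso hn hQ G
      exact ⟨⟨F⟩, ⟨e⟩⟩

lemma isLinear_lift {B : Type u₁} [Bicategory.{w₁, v₁} B]
    [PreadditiveBicategory B] [LinearBicategory k B] {C : Type u₂} [Bicategory.{w₂, v₂} C]
    [PreadditiveBicategory C] [LinearBicategory k C] (I : Biideal k B) (F : B ⥤ᵖ C)
    (hF : IsLinearPseudofunctor k F)
    (h : ∀ {a b : B} {f g : a ⟶ b} (η : f ⟶ g), η ∈ (I.ideal a b).hom f g → F.map₂ η = 0) :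
    IsLinearPseudofunctor k (I.lift F hF h) where
  map₂_add := by
    rintro a b f g ⟨η⟩ ⟨θ⟩
    exact hF.map₂_add η θ
  map₂_smul := by
    rintro a b f g r ⟨η⟩
    exact hF.map₂_smul r η

end induced

/-! ### Factoring pseudofunctors through a locally full pseudofunctor -/

section transport

variable {B : Type u₁} [Bicategory.{w₁, v₁} B] {C : Type u₂} [Bicategory.{w₂, v₂} C]
  {D : Type u} [Bicategory.{w, v} D]

/-- The action of `N` on the `2`-morphisms between endomorphisms of `x` factors through the action
of `Q`, which is full. -/
structure FactorsThrough (Q : B ⥤ᵖ C) (N : B ⥤ᵖ D) (x : B) : Prop where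
  full : ∀ {G H : x ⟶ x} (φ : Q.map G ⟶ Q.map H), ∃ η : G ⟶ H, Q.map₂ η = φ
  eq : ∀ {G H : x ⟶ x} (η θ : G ⟶ H), Q.map₂ η = Q.map₂ θ → N.map₂ η = N.map₂ θ

namespace FactorsThrough

variable {Q : B ⥤ᵖ C} {N : B ⥤ᵖ D} {x : B} (h : FactorsThrough Q N x)

/-- The `2`-morphism `N η` for any `η` with `Q η = φ`. -/
noncomputable def desc {G H : x ⟶ x} (φ : Q.map G ⟶ Q.map H) : N.map G ⟶ N.map H :=
  N.map₂ (h.full φ).choose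

lemma desc_map₂ {G H : x ⟶ x} (η : G ⟶ H) : h.desc (Q.map₂ η) = N.map₂ η :=
  h.eq _ _ (h.full (Q.map₂ η)).choose_spec

lemma desc_id (G : x ⟶ x) : h.desc (𝟙 (Q.map G)) = 𝟙 (N.map G) := by
  rw [← Q.map₂_id, desc_map₂, N.map₂_id]

lemma desc_comp {G H K : x ⟶ x} (φ : Q.map G ⟶ Q.map H) (ψ : Q.map H ⟶ Q.map K) :
    h.desc (φ ≫ ψ) = h.desc φ ≫ h.desc ψ := by
  obtain ⟨η, rfl⟩ := h.full φ
  obtain ⟨θ, rfl⟩ := h.full ψ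
  rw [← Q.map₂_comp, desc_map₂, desc_map₂, desc_map₂, N.map₂_comp]

lemma mapComp_whiskerLeft_desc (F : x ⟶ x) {G H : x ⟶ x} (φ : Q.map G ⟶ Q.map H) :
    (N.mapComp F G).hom ≫ N.map F ◁ h.desc φ =
      h.desc ((Q.mapComp F G).hom ≫ Q.map F ◁ φ ≫ (Q.mapComp F H).inv) ≫ (N.mapComp F H).hom := by
  obtain ⟨η, rfl⟩ := h.full φ
  rw [← Q.map₂_whisker_left, desc_map₂, desc_map₂, N.map₂_whisker_left]
  simp

lemma mapComp_desc_whiskerRight {G H : x ⟶ x} (φ : Q.map G ⟶ Q.map H) (F : x ⟶ x) :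
    (N.mapComp G F).hom ≫ h.desc φ ▷ N.map F =
      h.desc ((Q.mapComp G F).hom ≫ φ ▷ Q.map F ≫ (Q.mapComp H F).inv) ≫ (N.mapComp H F).hom := by
  obtain ⟨η, rfl⟩ := h.full φ
  rw [← Q.map₂_whisker_right, desc_map₂, desc_map₂, N.map₂_whisker_right]
  simp

/-- The isomorphism `N e` for any `e` with `Q e = φ`. -/
noncomputable def descIso {G H : x ⟶ x} (e : Q.map G ≅ Q.map H) : N.map G ≅ N.map H where
  hom := h.desc e.hom
  inv := h.desc e.inv
  hom_inv_id := by rw [← desc_comp, e.hom_inv_id, desc_id]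
  inv_hom_id := by rw [← desc_comp, e.inv_hom_id, desc_id]

variable (R : (Q.obj x ⟶ Q.obj x) → (x ⟶ x)) (κ : ∀ F, Q.map (R F) ≅ F)

/-- The action on `2`-morphisms of the pseudofunctor through which `N` factors, for a choice `R` of
preimages of `1`-morphisms. -/
noncomputable def dmap₂ {F G : Q.obj x ⟶ Q.obj x} (η : F ⟶ G) : N.map (R F) ⟶ N.map (R G) :=
  h.desc ((κ F).hom ≫ η ≫ (κ G).inv)

lemma dmap₂_id (F : Q.obj x ⟶ Q.obj x) : h.dmap₂ R κ (𝟙 F) = 𝟙 _ := by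
  rw [dmap₂, Category.id_comp, Iso.hom_inv_id, desc_id]

lemma dmap₂_comp {F G H : Q.obj x ⟶ Q.obj x} (η : F ⟶ G) (θ : G ⟶ H) :
    h.dmap₂ R κ (η ≫ θ) = h.dmap₂ R κ η ≫ h.dmap₂ R κ θ := by
  rw [dmap₂, dmap₂, dmap₂, ← desc_comp]
  simp

/-- The compatibility with identities. -/
noncomputable def dmapId : N.map (R (𝟙 (Q.obj x))) ≅ 𝟙 (N.obj x) :=
  h.descIso (κ (𝟙 (Q.obj x)) ≪≫ (Q.mapId x).symm) ≪≫ N.mapId x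

/-- The comparison of preimages of a composite. -/
def compIso (F G : Q.obj x ⟶ Q.obj x) : Q.map (R (F ≫ G)) ≅ Q.map (R F ≫ R G) :=
  κ (F ≫ G) ≪≫ whiskerLeftIso F (κ G).symm ≪≫ whiskerRightIso (κ F).symm (Q.map (R G)) ≪≫
    (Q.mapComp (R F) (R G)).symm

/-- The compatibility with composition. -/
noncomputable def dmapComp (F G : Q.obj x ⟶ Q.obj x) :
    N.map (R (F ≫ G)) ≅ N.map (R F) ≫ N.map (R G) :=
  h.descIso (compIso R κ F G) ≪≫ N.mapComp (R F) (R G)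

lemma dmapComp_hom (F G : Q.obj x ⟶ Q.obj x) : (h.dmapComp R κ F G).hom =
    h.desc (compIso R κ F G).hom ≫ (N.mapComp (R F) (R G)).hom := rfl

lemma dmap₂_whisker_left (F : Q.obj x ⟶ Q.obj x) {G H : Q.obj x ⟶ Q.obj x} (η : G ⟶ H) :
    h.dmap₂ R κ (F ◁ η) = (h.dmapComp R κ F G).hom ≫ N.map (R F) ◁ h.dmap₂ R κ η ≫
      (h.dmapComp R κ F H).inv := by
  have key : (κ (F ≫ G)).hom ≫ F ◁ η ≫ (κ (F ≫ H)).inv ≫ (compIso R κ F H).hom =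
      (compIso R κ F G).hom ≫ (Q.mapComp (R F) (R G)).hom ≫
        Q.map (R F) ◁ ((κ G).hom ≫ η ≫ (κ H).inv) ≫ (Q.mapComp (R F) (R H)).inv := by
    simp [compIso, ← whisker_exchange, ← whisker_exchange_assoc]
  rw [← Category.assoc, Iso.eq_comp_inv, dmapComp_hom, dmapComp_hom, Category.assoc, dmap₂, dmap₂,
    mapComp_whiskerLeft_desc, ← Category.assoc, ← desc_comp,
    ← Category.assoc (h.desc (compIso R κ F G).hom), ← desc_comp, ← key]
  simp only [Category.assoc]

lemma dmap₂_whisker_right {F G : Q.obj x ⟶ Q.obj x} (η : F ⟶ G) (H : Q.obj x ⟶ Q.obj x) :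
    h.dmap₂ R κ (η ▷ H) = (h.dmapComp R κ F H).hom ≫ h.dmap₂ R κ η ▷ N.map (R H) ≫
      (h.dmapComp R κ G H).inv := by
  have key : (κ (F ≫ H)).hom ≫ η ▷ H ≫ (κ (G ≫ H)).inv ≫ (compIso R κ G H).hom =
      (compIso R κ F H).hom ≫ (Q.mapComp (R F) (R H)).hom ≫
        ((κ F).hom ≫ η ≫ (κ G).inv) ▷ Q.map (R H) ≫ (Q.mapComp (R G) (R H)).inv := by
    simp [compIso, whisker_exchange_assoc]
  rw [← Category.assoc, Iso.eq_comp_inv, dmapComp_hom, dmapComp_hom, Category.assoc, dmap₂, dmap₂,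
    mapComp_desc_whiskerRight, ← Category.assoc, ← desc_comp,
    ← Category.assoc (h.desc (compIso R κ F H).hom), ← desc_comp, ← key]
  simp only [Category.assoc]

lemma compIso_associator (F G H : Q.obj x ⟶ Q.obj x) :
    ((κ ((F ≫ G) ≫ H)).hom ≫ (α_ F G H).hom ≫ (κ (F ≫ G ≫ H)).inv) ≫
      (compIso R κ F (G ≫ H)).hom ≫ (Q.mapComp (R F) (R (G ≫ H))).hom ≫
        Q.map (R F) ◁ (compIso R κ G H).hom ≫ (Q.mapComp (R F) (R G ≫ R H)).inv =
    (compIso R κ (F ≫ G) H).hom ≫ ((Q.mapComp (R (F ≫ G)) (R H)).hom ≫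
      (compIso R κ F G).hom ▷ Q.map (R H) ≫ (Q.mapComp (R F ≫ R G) (R H)).inv) ≫
        Q.map₂ (α_ (R F) (R G) (R H)).hom := by
  rw [Q.map₂_associator]
  simp [compIso, ← whisker_exchange, ← whisker_exchange_assoc]
  rw [associator_naturality_left_assoc, associator_naturality_left_assoc, Iso.inv_hom_id_assoc,
    ← whisker_exchange_assoc, ← whisker_exchange_assoc]

lemma dmap₂_associator (F G H : Q.obj x ⟶ Q.obj x) :
    h.dmap₂ R κ (α_ F G H).hom = (h.dmapComp R κ (F ≫ G) H).hom ≫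
      (h.dmapComp R κ F G).hom ▷ N.map (R H) ≫ (α_ _ _ _).hom ≫
      N.map (R F) ◁ (h.dmapComp R κ G H).inv ≫ (h.dmapComp R κ F (G ≫ H)).inv := by
  have h1 : h.dmap₂ R κ (α_ F G H).hom ≫ (h.dmapComp R κ F (G ≫ H)).hom ≫
      N.map (R F) ◁ (h.dmapComp R κ G H).hom = (h.dmapComp R κ (F ≫ G) H).hom ≫
      (h.dmapComp R κ F G).hom ▷ N.map (R H) ≫ (α_ _ _ _).hom := by
    have e1 := h.mapComp_whiskerLeft_desc (R F) (compIso R κ G H).hom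
    have e2 := h.mapComp_desc_whiskerRight (compIso R κ F G).hom (R H)
    have e3 : (N.mapComp (R F ≫ R G) (R H)).hom ≫ (N.mapComp (R F) (R G)).hom ▷ N.map (R H) ≫
        (α_ _ _ _).hom = N.map₂ (α_ (R F) (R G) (R H)).hom ≫ (N.mapComp (R F) (R G ≫ R H)).hom ≫
          N.map (R F) ◁ (N.mapComp (R G) (R H)).hom := by
      rw [N.map₂_associator]; simp
    have e4 := congrArg h.desc (compIso_associator R κ F G H)
    rw [dmapComp_hom, dmapComp_hom, dmapComp_hom, dmapComp_hom, Bicategory.whiskerLeft_comp,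
      comp_whiskerRight]
    simp only [Category.assoc]
    rw [← Category.assoc (N.mapComp (R (F ≫ G)) (R H)).hom, e2,
      ← Category.assoc (N.mapComp (R F) (R (G ≫ H))).hom, e1]
    simp only [Category.assoc]
    rw [e3, ← desc_map₂ h, dmap₂]
    simp only [← Category.assoc, ← desc_comp]
    simp only [← Category.assoc] at e4
    rw [e4]
  have h2 : N.map (R F) ◁ (h.dmapComp R κ G H).hom ≫ N.map (R F) ◁ (h.dmapComp R κ G H).inv =
    𝟙 _ := whiskerLeft_hom_inv _ _
  rw [← Category.assoc _ (α_ _ _ _).hom, ← Category.assoc (h.dmapComp R κ (F ≫ G) H).hom, ← h1]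
  simp

lemma dmap₂_left_unitor (F : Q.obj x ⟶ Q.obj x) :
    h.dmap₂ R κ (λ_ F).hom = (h.dmapComp R κ (𝟙 _) F).hom ≫
      (h.dmapId R κ).hom ▷ N.map (R F) ≫ (λ_ _).hom := by
  have e2 := h.mapComp_desc_whiskerRight (κ (𝟙 (Q.obj x)) ≪≫ (Q.mapId x).symm).hom (R F)
  have e3 : (N.mapComp (𝟙 x) (R F)).hom ≫ (N.mapId x).hom ▷ N.map (R F) ≫ (λ_ _).hom =
      N.map₂ (λ_ (R F)).hom := (N.map₂_left_unitor _).symm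
  have key : (κ (𝟙 (Q.obj x) ≫ F)).hom ≫ (λ_ F).hom ≫ (κ F).inv =
      (compIso R κ (𝟙 (Q.obj x)) F).hom ≫ ((Q.mapComp (R (𝟙 (Q.obj x))) (R F)).hom ≫
        (κ (𝟙 (Q.obj x)) ≪≫ (Q.mapId x).symm).hom ▷ Q.map (R F) ≫
          (Q.mapComp (𝟙 x) (R F)).inv) ≫ Q.map₂ (λ_ (R F)).hom := by
    rw [Q.map₂_left_unitor]
    simp [compIso]
  have e4 : (h.dmapId R κ).hom = h.desc (κ (𝟙 (Q.obj x)) ≪≫ (Q.mapId x).symm).hom ≫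
      (N.mapId x).hom := rfl
  rw [dmapComp_hom, e4, comp_whiskerRight]
  simp only [Category.assoc]
  rw [← Category.assoc (N.mapComp _ (R F)).hom, e2]
  simp only [Category.assoc]
  rw [e3, ← desc_map₂ h, ← desc_comp, ← desc_comp, dmap₂, key]

lemma dmap₂_right_unitor (F : Q.obj x ⟶ Q.obj x) :
    h.dmap₂ R κ (ρ_ F).hom = (h.dmapComp R κ F (𝟙 _)).hom ≫
      N.map (R F) ◁ (h.dmapId R κ).hom ≫ (ρ_ _).hom := by
  have e2 := h.mapComp_whiskerLeft_desc (R F) (κ (𝟙 (Q.obj x)) ≪≫ (Q.mapId x).symm).hom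
  have e3 : (N.mapComp (R F) (𝟙 x)).hom ≫ N.map (R F) ◁ (N.mapId x).hom ≫ (ρ_ _).hom =
      N.map₂ (ρ_ (R F)).hom := (N.map₂_right_unitor _).symm
  have key : (κ (F ≫ 𝟙 (Q.obj x))).hom ≫ (ρ_ F).hom ≫ (κ F).inv =
      (compIso R κ F (𝟙 (Q.obj x))).hom ≫ ((Q.mapComp (R F) (R (𝟙 (Q.obj x)))).hom ≫
        Q.map (R F) ◁ (κ (𝟙 (Q.obj x)) ≪≫ (Q.mapId x).symm).hom ≫
          (Q.mapComp (R F) (𝟙 x)).inv) ≫ Q.map₂ (ρ_ (R F)).hom := by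
    rw [Q.map₂_right_unitor]
    simp [compIso, ← whisker_exchange_assoc]
  have e4 : (h.dmapId R κ).hom = h.desc (κ (𝟙 (Q.obj x)) ≪≫ (Q.mapId x).symm).hom ≫
      (N.mapId x).hom := rfl
  rw [dmapComp_hom, e4, Bicategory.whiskerLeft_comp]
  simp only [Category.assoc]
  rw [← Category.assoc (N.mapComp (R F) _).hom, e2]
  simp only [Category.assoc]
  rw [e3, ← desc_map₂ h, ← desc_comp, ← desc_comp, dmap₂, key]

/-- The comparison of `N F` with the action of `Q F` through the factorization. -/
noncomputable def compare (F : x ⟶ x) : N.map F ≅ N.map (R (Q.map F)) :=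
  h.descIso (κ (Q.map F)).symm

lemma compare_hom (F : x ⟶ x) : (h.compare R κ F).hom = h.desc (κ (Q.map F)).inv := rfl

lemma map₂_comp_compare {F G : x ⟶ x} (η : F ⟶ G) :
    N.map₂ η ≫ (h.compare R κ G).hom = (h.compare R κ F).hom ≫ h.dmap₂ R κ (Q.map₂ η) := by
  rw [compare_hom, compare_hom, dmap₂, ← desc_map₂ h, ← desc_comp, ← desc_comp]
  simp

lemma compare_id : (h.compare R κ (𝟙 x)).hom ≫ h.dmap₂ R κ (Q.mapId x).hom ≫
    (h.dmapId R κ).hom = (N.mapId x).hom := by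
  have e4 : (h.dmapId R κ).hom = h.desc (κ (𝟙 (Q.obj x)) ≪≫ (Q.mapId x).symm).hom ≫
      (N.mapId x).hom := rfl
  rw [e4, compare_hom, dmap₂, ← Category.assoc, ← desc_comp, ← Category.assoc, ← desc_comp]
  have : (κ (Q.map (𝟙 x))).inv ≫ (κ (Q.map (𝟙 x))).hom ≫ (Q.mapId x).hom ≫
      (κ (𝟙 (Q.obj x))).inv = (Q.mapId x).hom ≫ (κ (𝟙 (Q.obj x))).inv := by simp
  rw [this]
  simp [desc_id]

lemma compare_comp (F G : x ⟶ x) : (h.compare R κ (F ≫ G)).hom ≫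
    h.dmap₂ R κ (Q.mapComp F G).hom ≫ (h.dmapComp R κ (Q.map F) (Q.map G)).hom =
      (N.mapComp F G).hom ≫ N.map F ◁ (h.compare R κ G).hom ≫
        (h.compare R κ F).hom ▷ N.map (R (Q.map G)) := by
  rw [compare_hom, compare_hom, compare_hom, ← Category.assoc (N.mapComp F G).hom,
    mapComp_whiskerLeft_desc, Category.assoc, mapComp_desc_whiskerRight, dmap₂, dmapComp_hom]
  simp only [← Category.assoc, ← desc_comp]
  congr 2
  simp [compIso]

end FactorsThrough

/-! ### Strong transformations -/

/-- Squares filled by `2`-morphisms compose compatibly with replacing the `1`-morphisms. -/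
lemma hcomp_naturality {a b : D} {p : a ⟶ b} {f f₀ g g₀ : a ⟶ a} {f' f₀' g' g₀' : b ⟶ b}
    (u : f₀ ⟶ f) (v : g₀ ⟶ g) (u' : f₀' ⟶ f') (v' : g₀' ⟶ g') (s : f₀ ≫ p ⟶ p ≫ f₀')
    (s' : g₀ ≫ p ⟶ p ≫ g₀') (t : f ≫ p ⟶ p ≫ f') (t' : g ≫ p ⟶ p ≫ g')
    (h : u ▷ p ≫ t = s ≫ p ◁ u') (h' : v ▷ p ≫ t' = s' ≫ p ◁ v') :
    (u ▷ g₀ ≫ f ◁ v) ▷ p ≫ (α_ f g p).hom ≫ f ◁ t' ≫ (α_ f p g').inv ≫ t ▷ g' ≫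
      (α_ p f' g').hom = (α_ f₀ g₀ p).hom ≫ f₀ ◁ s' ≫ (α_ f₀ p g₀').inv ≫ s ▷ g₀' ≫
        (α_ p f₀' g₀').hom ≫ p ◁ (u' ▷ g₀' ≫ f' ◁ v') := by
  have h1 : f ◁ v ▷ p ≫ f ◁ t' = f ◁ s' ≫ f ◁ p ◁ v' := by
    rw [← Bicategory.whiskerLeft_comp, h', Bicategory.whiskerLeft_comp]
  have h2 : u ▷ p ▷ g₀' ≫ t ▷ g₀' = s ▷ g₀' ≫ (p ◁ u') ▷ g₀' := by
    rw [← comp_whiskerRight, h, comp_whiskerRight]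
  calc _ = u ▷ g₀ ▷ p ≫ (α_ f g₀ p).hom ≫ (f ◁ v ▷ p ≫ f ◁ t') ≫ (α_ f p g').inv ≫ t ▷ g' ≫
        (α_ p f' g').hom := by simp
    _ = (α_ f₀ g₀ p).hom ≫ (u ▷ (g₀ ≫ p) ≫ f ◁ s') ≫ f ◁ p ◁ v' ≫ (α_ f p g').inv ≫ t ▷ g' ≫
        (α_ p f' g').hom := by rw [h1]; simp
    _ = (α_ f₀ g₀ p).hom ≫ f₀ ◁ s' ≫ (α_ f₀ p g₀').inv ≫ u ▷ p ▷ g₀' ≫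
        ((f ≫ p) ◁ v' ≫ t ▷ g') ≫ (α_ p f' g').hom := by
      rw [← whisker_exchange]; simp
    _ = (α_ f₀ g₀ p).hom ≫ f₀ ◁ s' ≫ (α_ f₀ p g₀').inv ≫ (u ▷ p ▷ g₀' ≫ t ▷ g₀') ≫
        (p ≫ f') ◁ v' ≫ (α_ p f' g').hom := by
      rw [whisker_exchange]; simp
    _ = _ := by rw [h2]; simp

section descend

variable {Q : B ⥤ᵖ C} {M M' : C ⥤ᵖ D} {x : B} (R : (Q.obj x ⟶ Q.obj x) → (x ⟶ x))
  (κ : ∀ F, Q.map (R F) ≅ F) {p : M.obj (Q.obj x) ⟶ M'.obj (Q.obj x)}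
  (s : ∀ G : x ⟶ x, M.map (Q.map G) ≫ p ≅ p ≫ M'.map (Q.map G))

/-- The naturality isomorphisms of the strong transformation `M ⟶ M'` induced by one between the
restrictions of `M` and `M'` along `Q`, with component `p` and naturality isomorphisms `s`. -/
def descNat (F : Q.obj x ⟶ Q.obj x) : M.map F ≫ p ≅ p ≫ M'.map F :=
  whiskerRightIso (M.map₂Iso (κ F).symm) p ≪≫ s (R F) ≪≫ whiskerLeftIso p (M'.map₂Iso (κ F))

lemma descNat_hom (F : Q.obj x ⟶ Q.obj x) : (descNat R κ s F).hom =
    M.map₂ (κ F).inv ▷ p ≫ (s (R F)).hom ≫ p ◁ M'.map₂ (κ F).hom := rfl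

variable (hs : ∀ {G H : x ⟶ x} (φ : Q.map G ⟶ Q.map H),
  M.map₂ φ ▷ p ≫ (s H).hom = (s G).hom ≫ p ◁ M'.map₂ φ)

include hs

lemma map₂_whiskerRight_comp_descNat {G : x ⟶ x} {F : Q.obj x ⟶ Q.obj x} (φ : Q.map G ⟶ F) :
    M.map₂ φ ▷ p ≫ (descNat R κ s F).hom = (s G).hom ≫ p ◁ M'.map₂ φ := by
  rw [descNat_hom, ← Category.assoc, ← comp_whiskerRight, ← M.map₂_comp, ← Category.assoc, hs,
    Category.assoc, ← Bicategory.whiskerLeft_comp, ← M'.map₂_comp, Category.assoc,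
    Iso.inv_hom_id, Category.comp_id]

lemma descNat_naturality {F G : Q.obj x ⟶ Q.obj x} (η : F ⟶ G) :
    M.map₂ η ▷ p ≫ (descNat R κ s G).hom = (descNat R κ s F).hom ≫ p ◁ M'.map₂ η := by
  rw [← cancel_epi (M.map₂ (κ F).hom ▷ p), ← Category.assoc, ← comp_whiskerRight,
    ← M.map₂_comp, map₂_whiskerRight_comp_descNat R κ s hs, ← Category.assoc,
    map₂_whiskerRight_comp_descNat R κ s hs, Category.assoc, ← Bicategory.whiskerLeft_comp,
    ← M'.map₂_comp]

lemma descNat_id (hid : (s (𝟙 x)).hom ≫ p ◁ (M'.map₂ (Q.mapId x).hom ≫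
      (M'.mapId (Q.obj x)).hom) = (M.map₂ (Q.mapId x).hom ≫ (M.mapId (Q.obj x)).hom) ▷ p ≫
        (λ_ p).hom ≫ (ρ_ p).inv) :
    (descNat R κ s (𝟙 (Q.obj x))).hom ≫ p ◁ (M'.mapId (Q.obj x)).hom =
      (M.mapId (Q.obj x)).hom ▷ p ≫ (λ_ p).hom ≫ (ρ_ p).inv := by
  rw [← cancel_epi (M.map₂ (Q.mapId x).hom ▷ p), ← Category.assoc,
    map₂_whiskerRight_comp_descNat R κ s hs, Category.assoc, ← Bicategory.whiskerLeft_comp, hid,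
    comp_whiskerRight, Category.assoc]

lemma descNat_comp (F G : Q.obj x ⟶ Q.obj x)
    (hcomp : (s (R F ≫ R G)).hom ≫ p ◁ (M'.map₂ (Q.mapComp (R F) (R G)).hom ≫
      (M'.mapComp (Q.map (R F)) (Q.map (R G))).hom) =
      (M.map₂ (Q.mapComp (R F) (R G)).hom ≫ (M.mapComp (Q.map (R F)) (Q.map (R G))).hom) ▷
        p ≫ (α_ _ _ _).hom ≫ M.map (Q.map (R F)) ◁ (s (R G)).hom ≫
        (α_ _ _ _).inv ≫ (s (R F)).hom ▷ M'.map (Q.map (R G)) ≫ (α_ _ _ _).hom) :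
    (descNat R κ s (F ≫ G)).hom ≫ p ◁ (M'.mapComp F G).hom =
      (M.mapComp F G).hom ▷ p ≫ (α_ _ _ _).hom ≫ M.map F ◁ (descNat R κ s G).hom ≫
        (α_ _ _ _).inv ≫ (descNat R κ s F).hom ▷ M'.map G ≫ (α_ _ _ _).hom := by
  have h3 := hcomp_naturality (M.map₂ (κ F).hom) (M.map₂ (κ G).hom) (M'.map₂ (κ F).hom)
    (M'.map₂ (κ G).hom) (s (R F)).hom (s (R G)).hom
    (descNat R κ s F).hom (descNat R κ s G).hom
    (map₂_whiskerRight_comp_descNat R κ s hs (κ F).hom)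
    (map₂_whiskerRight_comp_descNat R κ s hs (κ G).hom)
  have e : ∀ L : C ⥤ᵖ D, L.map₂ ((Q.mapComp (R F) (R G)).hom ≫ (κ F).hom ▷ Q.map (R G) ≫
      F ◁ (κ G).hom) ≫ (L.mapComp F G).hom = (L.map₂ (Q.mapComp (R F) (R G)).hom ≫
      (L.mapComp (Q.map (R F)) (Q.map (R G))).hom) ≫
        (L.map₂ (κ F).hom ▷ L.map (Q.map (R G)) ≫ L.map F ◁ L.map₂ (κ G).hom) := by
    intro L
    simp [L.map₂_whisker_left, L.map₂_whisker_right]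
  rw [← cancel_epi (M.map₂ ((Q.mapComp (R F) (R G)).hom ≫ (κ F).hom ▷ Q.map (R G) ≫
    F ◁ (κ G).hom) ▷ p), ← Category.assoc, map₂_whiskerRight_comp_descNat R κ s hs,
    Category.assoc, ← Bicategory.whiskerLeft_comp, e M', ← comp_whiskerRight_assoc, e M,
    Bicategory.whiskerLeft_comp, ← Category.assoc, hcomp, comp_whiskerRight _ (_ ≫ _)]
  simp only [Category.assoc] at h3 ⊢
  rw [h3]

end descend

/-- The restriction of a strong transformation along a pseudofunctor. -/
def restrictTrans (Q : B ⥤ᵖ C) {M M' : C ⥤ᵖ D} (Φ : Pseudofunctor.StrongTrans M M') :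
    Pseudofunctor.StrongTrans (Q.comp M) (Q.comp M') where
  app a := Φ.app (Q.obj a)
  naturality f := Φ.naturality (Q.map f)
  naturality_naturality η := Φ.naturality_naturality (Q.map₂ η)
  naturality_id a := by
    change (Φ.naturality (Q.map (𝟙 a))).hom ≫ Φ.app (Q.obj a) ◁
      (M'.map₂ (Q.mapId a).hom ≫ (M'.mapId (Q.obj a)).hom) =
      (M.map₂ (Q.mapId a).hom ≫ (M.mapId (Q.obj a)).hom) ▷ Φ.app (Q.obj a) ≫
        (λ_ (Φ.app (Q.obj a))).hom ≫ (ρ_ (Φ.app (Q.obj a))).inv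
    rw [Bicategory.whiskerLeft_comp, ← Category.assoc, ← Φ.naturality_naturality, Category.assoc,
      Φ.naturality_id, comp_whiskerRight, Category.assoc]
  naturality_comp f g := by
    change (Φ.naturality (Q.map (f ≫ g))).hom ≫ Φ.app _ ◁
      (M'.map₂ (Q.mapComp f g).hom ≫ (M'.mapComp (Q.map f) (Q.map g)).hom) =
      (M.map₂ (Q.mapComp f g).hom ≫ (M.mapComp (Q.map f) (Q.map g)).hom) ▷ Φ.app _ ≫
        (α_ _ _ _).hom ≫ M.map (Q.map f) ◁ (Φ.naturality (Q.map g)).hom ≫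
        (α_ _ _ _).inv ≫ (Φ.naturality (Q.map f)).hom ▷ M'.map (Q.map g) ≫ (α_ _ _ _).hom
    rw [Bicategory.whiskerLeft_comp, ← Category.assoc, ← Φ.naturality_naturality, Category.assoc,
      Φ.naturality_comp, comp_whiskerRight, Category.assoc]

/-- The coherence of a strong transformation with identity components, for identities. -/
lemma unitors_comp_id {a : D} {f f' : a ⟶ a} (c : f ≅ f') {m : f ⟶ 𝟙 a} {m' : f' ⟶ 𝟙 a}
    (h : c.hom ≫ m' = m) : (ρ_ f ≪≫ c ≪≫ (λ_ f').symm).hom ≫ 𝟙 a ◁ m' =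
      m ▷ 𝟙 a ≫ (λ_ (𝟙 a)).hom ≫ (ρ_ (𝟙 a)).inv := by
  subst h
  simp [unitors_equal]

/-- The coherence of a strong transformation with identity components, for `2`-morphisms. -/
lemma unitors_comp_naturality {a : D} {f f' g g' : a ⟶ a} (c : f ≅ f') (d : g ≅ g') {m : f ⟶ g}
    {m' : f' ⟶ g'} (h : m ≫ d.hom = c.hom ≫ m') :
    m ▷ 𝟙 a ≫ (ρ_ g ≪≫ d ≪≫ (λ_ g').symm).hom =
      (ρ_ f ≪≫ c ≪≫ (λ_ f').symm).hom ≫ 𝟙 a ◁ m' := by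
  simp [reassoc_of% h]

/-- The coherence of a strong transformation with identity components, for composites. -/
lemma unitors_comp_comp {a : D} {f f' g g' l l' : a ⟶ a} (c : f ≅ f') (d : g ≅ g') (i : l ≅ l')
    {m : l ⟶ f ≫ g} {m' : l' ⟶ f' ≫ g'} (h : i.hom ≫ m' = m ≫ f ◁ d.hom ≫ c.hom ▷ g') :
    (ρ_ l ≪≫ i ≪≫ (λ_ l').symm).hom ≫ 𝟙 a ◁ m' =
      m ▷ 𝟙 a ≫ (α_ _ _ _).hom ≫ f ◁ (ρ_ g ≪≫ d ≪≫ (λ_ g').symm).hom ≫ (α_ _ _ _).inv ≫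
        (ρ_ f ≪≫ c ≪≫ (λ_ f').symm).hom ▷ g' ≫ (α_ _ _ _).hom := by
  have : (ρ_ l ≪≫ i ≪≫ (λ_ l').symm).hom ≫ 𝟙 a ◁ m' =
      (ρ_ l).hom ≫ (i.hom ≫ m') ≫ (λ_ (f' ≫ g')).inv := by simp
  rw [this, h]
  simp

end transport

section oneObj

variable {B : Type u₁} [Bicategory.{w₁, v₁} B] {x : B} {P : ObjectProperty (x ⟶ x)}
  {hP : IsMonoidalClass P} {C : Type u₂} [Bicategory.{w₂, v₂} C] {y : C}
  {P' : ObjectProperty (y ⟶ y)} {hP' : IsMonoidalClass P'} {D : Type u} [Bicategory.{w, v} D]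
  {Q : OneObj P hP ⥤ᵖ OneObj P' hP'}

namespace FactorsThrough

variable {N : OneObj P hP ⥤ᵖ D} (h : FactorsThrough Q N OneObj.star)
  (R : (Q.obj OneObj.star ⟶ Q.obj OneObj.star) → ((OneObj.star : OneObj P hP) ⟶ OneObj.star))
  (κ : ∀ F, Q.map (R F) ≅ F)

/-- The pseudofunctor through which `N` factors. All objects of the source are definitionally equal
to the image of the object of `OneObj P hP`. -/
noncomputable def pseudofunctor : OneObj P' hP' ⥤ᵖ D where
  obj _ := N.obj OneObj.star
  map F := N.map (R F)
  map₂ η := h.dmap₂ R κ η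
  map₂_id F := h.dmap₂_id R κ F
  map₂_comp η θ := h.dmap₂_comp R κ η θ
  mapId _ := h.dmapId R κ
  mapComp F G := h.dmapComp R κ F G
  map₂_whisker_left F _ _ η := h.dmap₂_whisker_left R κ F η
  map₂_whisker_right η H := h.dmap₂_whisker_right R κ η H
  map₂_associator F G H := h.dmap₂_associator R κ F G H
  map₂_left_unitor F := h.dmap₂_left_unitor R κ F
  map₂_right_unitor F := h.dmap₂_right_unitor R κ F

/-- The factorization of `N`, up to a strong transformation with identity components. -/
noncomputable def compareTrans :
    Pseudofunctor.StrongTrans N (Q.comp (h.pseudofunctor R κ)) where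
  app _ := 𝟙 (N.obj OneObj.star)
  naturality F := ρ_ (N.map F) ≪≫ h.compare R κ F ≪≫ (λ_ (N.map (R (Q.map F)))).symm
  naturality_naturality η := unitors_comp_naturality _ _ (h.map₂_comp_compare R κ η)
  naturality_id _ := unitors_comp_id _ (h.compare_id R κ)
  naturality_comp F G := unitors_comp_comp _ _ _ (h.compare_comp R κ F G)

end FactorsThrough

/-- If `Q` is full and essentially surjective on `1`-morphisms, a strong transformation between the
restrictions of two pseudofunctors along `Q` descends. -/
def descendTrans (hQ : ∀ {G H : (OneObj.star : OneObj P hP) ⟶ OneObj.star}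
      (φ : Q.map G ⟶ Q.map H), ∃ η : G ⟶ H, Q.map₂ η = φ)
    (R : (Q.obj OneObj.star ⟶ Q.obj OneObj.star) → ((OneObj.star : OneObj P hP) ⟶ OneObj.star))
    (κ : ∀ F, Q.map (R F) ≅ F) {M M' : OneObj P' hP' ⥤ᵖ D}
    (Φ : Pseudofunctor.StrongTrans (Q.comp M) (Q.comp M')) : Pseudofunctor.StrongTrans M M' :=
  have hs : ∀ {G H : (OneObj.star : OneObj P hP) ⟶ OneObj.star} (φ : Q.map G ⟶ Q.map H),
      M.map₂ φ ▷ Φ.app OneObj.star ≫ (Φ.naturality H).hom =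
        (Φ.naturality G).hom ≫ Φ.app OneObj.star ◁ M'.map₂ φ := by
    intro G H φ
    obtain ⟨η, rfl⟩ := hQ φ
    exact Φ.naturality_naturality η
  { app := fun _ => Φ.app OneObj.star
    naturality := fun F => descNat R κ (fun G => Φ.naturality G) F
    naturality_naturality := fun η => descNat_naturality R κ (fun G => Φ.naturality G) hs η
    naturality_id := fun _ => descNat_id R κ (fun G => Φ.naturality G) hs
      (Φ.naturality_id OneObj.star)
    naturality_comp := fun F G => descNat_comp R κ (fun G => Φ.naturality G) hs F G
      (Φ.naturality_comp (R F) (R G)) }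

end oneObj

/-! ### Simple transitive birepresentations -/

section simple

open LinCat Birep

lemma LinCat.map_eq_of_iso {C D : LinCat.{u, v, w} k} {F G : C ⟶ D} (e : F ≅ G) {X Y : C.carrier}
    (f : X ⟶ Y) :
    (fn G).map f = (nt e.inv).app X ≫ (fn F).map f ≫ (nt e.hom).app Y := by
  have h : (nt e.inv).app X ≫ (nt e.hom).app X = 𝟙 _ :=
    congrArg (fun t => (nt t).app X) e.inv_hom_id
  rw [(nt e.hom).naturality, ← Category.assoc, h, Category.id_comp]

lemma CatIdeal.map_mem_of_iso {C D : LinCat.{u, v, w} k} (J : CatIdeal k D.carrier) {F G : C ⟶ D}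
    (e : F ≅ G) {X Y : C.carrier} {f : X ⟶ Y} (h : (fn F).map f ∈ J.hom _ _) :
    (fn G).map f ∈ J.hom _ _ := by
  rw [map_eq_of_iso e]
  exact J.comp_left _ (J.comp_right _ h)

variable {B : Type u₁} [Bicategory.{w₁, v₁} B] [PreadditiveBicategory B] [LinearBicategory k B]
  {x : B} {P : ObjectProperty (x ⟶ x)} {hP : IsMonoidalClass P}
  {C : Type u₂} [Bicategory.{w₂, v₂} C] [PreadditiveBicategory C] [LinearBicategory k C]
  {y : C} {P' : ObjectProperty (y ⟶ y)} {hP' : IsMonoidalClass P'}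

lemma isSimpleTransitive_of_oneObj {M : OneObj P hP ⥤ᵖ LinCat.{u, v, w} k}
    (h₁ : IsLinearPseudofunctor k M) (h₂ : IsFinitaryCat (M.obj OneObj.star))
    (h₃ : ∀ J : CatIdeal k (M.obj OneObj.star).carrier,
      (∀ (F : (OneObj.star : OneObj P hP) ⟶ OneObj.star) {X Y : (M.obj OneObj.star).carrier}
        {f : X ⟶ Y}, f ∈ J.hom X Y → (fn (M.map F)).map f ∈ J.hom _ _) →
      (∀ X Y, J.hom X Y = ⊥) ∨ (∀ X Y, J.hom X Y = ⊤)) : IsSimpleTransitive M where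
  finitaryBirep := ⟨h₁, fun _ => h₂⟩
  simple J _ := h₃ (J.ideal OneObj.star) fun F _ _ _ hf => J.stable F hf

lemma Birep.IsSimpleTransitive.eq_bot_or_eq_top {M : OneObj P hP ⥤ᵖ LinCat.{u, v, w} k}
    (hM : IsSimpleTransitive M) (J : CatIdeal k (M.obj OneObj.star).carrier)
    (hJ : ∀ (F : (OneObj.star : OneObj P hP) ⟶ OneObj.star) {X Y : (M.obj OneObj.star).carrier}
      {f : X ⟶ Y}, f ∈ J.hom X Y → (fn (M.map F)).map f ∈ J.hom _ _) :
    (∀ X Y, J.hom X Y = ⊥) ∨ (∀ X Y, J.hom X Y = ⊤) :=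
  hM.simple ⟨fun _ => J, fun F _ _ _ hf => hJ F hf⟩ OneObj.star

section restrict

variable {Q : OneObj P hP ⥤ᵖ OneObj P' hP'} (hQ : IsLinearPseudofunctor k Q)
  (hfull : ∀ {F G : (OneObj.star : OneObj P hP) ⟶ OneObj.star} (φ : Q.map F ⟶ Q.map G),
    ∃ η : F ⟶ G, Q.map₂ η = φ)
  (hsurj : ∀ G : Q.obj OneObj.star ⟶ Q.obj OneObj.star,
    ∃ F : (OneObj.star : OneObj P hP) ⟶ OneObj.star, Nonempty (Q.map F ≅ G))

include hQ hsurj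

/-- Up to isomorphism all `1`-morphisms are in the image of `Q`, so the stable ideals of `M` and of
its restriction along `Q` are the same. -/
lemma isSimpleTransitive_comp {M : OneObj P' hP' ⥤ᵖ LinCat.{u, v, w} k}
    (hM : IsSimpleTransitive M) : IsSimpleTransitive (Q.comp M) := by
  refine isSimpleTransitive_of_oneObj ⟨fun η θ => ?_, fun r η => ?_⟩
    (hM.finitaryBirep.finitary _) fun J hJ => ?_
  · exact (congrArg M.map₂ (hQ.map₂_add η θ)).trans (hM.finitaryBirep.linear.map₂_add _ _)
  · exact (congrArg M.map₂ (hQ.map₂_smul r η)).trans (hM.finitaryBirep.linear.map₂_smul _ _)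
  · refine hM.eq_bot_or_eq_top J fun G X Y f hf => ?_
    obtain ⟨F, ⟨e⟩⟩ := hsurj G
    exact J.map_mem_of_iso (M.map₂Iso e) (hJ F hf)

include hfull

lemma isSimpleTransitive_of_comp {M : OneObj P' hP' ⥤ᵖ LinCat.{u, v, w} k}
    (hM : IsSimpleTransitive (Q.comp M)) : IsSimpleTransitive M := by
  -- Linearity of `M` is checked on the image of `Q`, since every `2`-morphism of the target is
  -- conjugate to one in that image.
  have key : ∀ F G : Q.obj OneObj.star ⟶ Q.obj OneObj.star,
      ∃ (F' G' : (OneObj.star : OneObj P hP) ⟶ OneObj.star) (e : Q.map F' ≅ F)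
        (e' : Q.map G' ≅ G), ∀ η : F ⟶ G, ∃ θ : F' ⟶ G', η = e.inv ≫ Q.map₂ θ ≫ e'.hom := by
    intro F G
    obtain ⟨F', ⟨e⟩⟩ := hsurj F
    obtain ⟨G', ⟨e'⟩⟩ := hsurj G
    refine ⟨F', G', e, e', fun η => ?_⟩
    obtain ⟨θ, hθ⟩ := hfull (e.hom ≫ η ≫ e'.inv)
    exact ⟨θ, by simp [hθ]⟩
  refine isSimpleTransitive_of_oneObj ⟨fun {a b F G} η θ => ?_, fun {a b F G} r η => ?_⟩
    (hM.finitaryBirep.finitary OneObj.star) fun J hJ => ?_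
  · obtain ⟨F', G', e, e', h⟩ := key F G
    obtain ⟨η', rfl⟩ := h η
    obtain ⟨θ', rfl⟩ := h θ
    have h1 : M.map₂ (Q.map₂ η' + Q.map₂ θ') = M.map₂ (Q.map₂ η') + M.map₂ (Q.map₂ θ') := by
      rw [← hQ.map₂_add]
      exact hM.finitaryBirep.linear.map₂_add η' θ'
    rw [← Preadditive.comp_add, ← Preadditive.add_comp, M.map₂_comp, M.map₂_comp, h1,
      Preadditive.add_comp, Preadditive.comp_add]
    simp only [M.map₂_comp]
  · obtain ⟨F', G', e, e', h⟩ := key F G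
    obtain ⟨η', rfl⟩ := h η
    have h1 : M.map₂ (r • Q.map₂ η') = r • M.map₂ (Q.map₂ η') := by
      rw [← hQ.map₂_smul]
      exact hM.finitaryBirep.linear.map₂_smul r η'
    rw [← Linear.comp_smul, ← Linear.smul_comp, M.map₂_comp, M.map₂_comp, h1, Linear.smul_comp,
      Linear.comp_smul]
    simp only [M.map₂_comp]
  · exact hM.eq_bot_or_eq_top J fun F X Y f hf => hJ (Q.map F) hf

end restrict

section factor

variable {Q : OneObj P hP ⥤ᵖ OneObj P' hP'} (hQ : IsLinearPseudofunctor k Q)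
  {N : OneObj P hP ⥤ᵖ LinCat.{u, v, w} k} (h : FactorsThrough Q N OneObj.star)
  (R : (Q.obj OneObj.star ⟶ Q.obj OneObj.star) → ((OneObj.star : OneObj P hP) ⟶ OneObj.star))
  (κ : ∀ F, Q.map (R F) ≅ F)

include hQ

lemma FactorsThrough.isSimpleTransitive_pseudofunctor (hN : IsSimpleTransitive N) :
    IsSimpleTransitive (h.pseudofunctor R κ) := by
  have hadd : ∀ {F G : (OneObj.star : OneObj P hP) ⟶ OneObj.star} (φ ψ : Q.map F ⟶ Q.map G),
      h.desc (φ + ψ) = h.desc φ + h.desc ψ := by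
    intro F G φ ψ
    obtain ⟨η, rfl⟩ := h.full φ
    obtain ⟨θ, rfl⟩ := h.full ψ
    rw [← hQ.map₂_add, h.desc_map₂, h.desc_map₂, h.desc_map₂, hN.finitaryBirep.linear.map₂_add]
  have hsmul : ∀ {F G : (OneObj.star : OneObj P hP) ⟶ OneObj.star} (r : k)
      (φ : Q.map F ⟶ Q.map G), h.desc (r • φ) = r • h.desc φ := by
    intro F G r φ
    obtain ⟨η, rfl⟩ := h.full φ
    rw [← hQ.map₂_smul, h.desc_map₂, h.desc_map₂, hN.finitaryBirep.linear.map₂_smul]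
  refine isSimpleTransitive_of_oneObj ⟨fun {a b F G} η θ => ?_, fun {a b F G} r η => ?_⟩
    (hN.finitaryBirep.finitary OneObj.star) fun J hJ => ?_
  · refine Eq.trans (congrArg h.desc ?_) (hadd ((κ F).hom ≫ η ≫ (κ G).inv) _)
    rw [← Preadditive.comp_add, ← Preadditive.add_comp]
  · refine Eq.trans (congrArg h.desc ?_) (hsmul r ((κ F).hom ≫ η ≫ (κ G).inv))
    rw [← Linear.comp_smul, ← Linear.smul_comp]
  · exact hN.eq_bot_or_eq_top J fun F X Y f hf =>
      J.map_mem_of_iso (h.compare R κ F).symm (hJ (Q.map F) hf)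

end factor

section annihilate

variable (I : Biideal k (OneObj P hP)) (N : OneObj P hP ⥤ᵖ LinCat.{u, v, w} k)

/-- The ideal generated by the components of the natural transformations by which the `2`-morphisms
in a biideal act. -/
def Biideal.catIdeal : CatIdeal k (N.obj OneObj.star).carrier where
  hom X Y := Submodule.span k {t | ∃ (F G : (OneObj.star : OneObj P hP) ⟶ OneObj.star)
    (η : F ⟶ G) (_ : η ∈ (I.ideal _ _).hom F G) (Z : (N.obj OneObj.star).carrier)
    (f : X ⟶ (fn (N.map F)).obj Z) (g : (fn (N.map G)).obj Z ⟶ Y),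
    t = f ≫ (nt (N.map₂ η)).app Z ≫ g}
  comp_left {X Y Z} f {g} hg := by
    induction hg using Submodule.span_induction with
    | mem t ht =>
      obtain ⟨F, G, η, hη, W, f', g', rfl⟩ := ht
      exact Submodule.subset_span ⟨F, G, η, hη, W, f ≫ f', g', by simp⟩
    | zero => simp
    | add s t _ _ hs ht => rw [Preadditive.comp_add]; exact Submodule.add_mem _ hs ht
    | smul r t _ ht => rw [Linear.comp_smul]; exact Submodule.smul_mem _ r ht
  comp_right {X Y Z f} g hf := by
    induction hf using Submodule.span_induction with
    | mem t ht =>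
      obtain ⟨F, G, η, hη, W, f', g', rfl⟩ := ht
      exact Submodule.subset_span ⟨F, G, η, hη, W, f', g' ≫ g, by simp⟩
    | zero => simp
    | add s t _ _ hs ht => rw [Preadditive.add_comp]; exact Submodule.add_mem _ hs ht
    | smul r t _ ht => rw [Linear.smul_comp]; exact Submodule.smul_mem _ r ht

variable {I N}

lemma Biideal.map_map₂_app {F G : (OneObj.star : OneObj P hP) ⟶ OneObj.star} (η : F ⟶ G)
    (H : (OneObj.star : OneObj P hP) ⟶ OneObj.star) (Z : (N.obj OneObj.star).carrier) :
    (fn (N.map H)).map ((nt (N.map₂ η)).app Z) =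
      (nt (N.mapComp F H).inv).app Z ≫ (nt (N.map₂ (η ▷ H))).app Z ≫
        (nt (N.mapComp G H).hom).app Z := by
  have h : N.map₂ η ▷ N.map H =
      (N.mapComp F H).inv ≫ N.map₂ (η ▷ H) ≫ (N.mapComp G H).hom := by
    rw [N.map₂_whisker_right]; simp
  exact congrArg (fun t => (nt t).app Z) h

lemma Biideal.map_mem_catIdeal (H : (OneObj.star : OneObj P hP) ⟶ OneObj.star)
    {X Y : (N.obj OneObj.star).carrier} {t : X ⟶ Y} (ht : t ∈ (I.catIdeal N).hom X Y) :
    (fn (N.map H)).map t ∈ (I.catIdeal N).hom _ _ := by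
  have assoc : ∀ {X₀ X₁ X₂ X₃ X₄ X₅ : (N.obj OneObj.star).carrier} (f₀ : X₀ ⟶ X₁) (f₁ : X₁ ⟶ X₂)
      (f₂ : X₂ ⟶ X₃) (f₃ : X₃ ⟶ X₄) (f₄ : X₄ ⟶ X₅),
      f₀ ≫ (f₁ ≫ f₂ ≫ f₃) ≫ f₄ = (f₀ ≫ f₁) ≫ f₂ ≫ f₃ ≫ f₄ := by intros; simp
  induction ht using Submodule.span_induction with
  | mem t ht =>
    obtain ⟨F, G, η, hη, W, f, g, rfl⟩ := ht
    rw [Functor.map_comp, Functor.map_comp, map_map₂_app]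
    exact Submodule.subset_span ⟨F ≫ H, G ≫ H, η ▷ H, I.whiskerRight_mem H hη, W,
      (fn (N.map H)).map f ≫ (nt (N.mapComp F H).inv).app W,
      (nt (N.mapComp G H).hom).app W ≫ (fn (N.map H)).map g, assoc _ _ _ _ _⟩
  | zero => rw [Functor.map_zero]; exact Submodule.zero_mem _
  | add s t _ _ hs ht => rw [Functor.map_add]; exact Submodule.add_mem _ hs ht
  | smul r t _ ht => rw [Functor.map_smul]; exact Submodule.smul_mem _ r ht

/-- A biideal in which all horizontal composites of two elements vanish annihilates every simple
transitive birepresentation: otherwise every morphism, in particular every identity morphism, would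
be generated by the components of the action of the biideal, and horizontal composition would show
that these components vanish. -/
lemma Biideal.map₂_eq_zero_of_isSimpleTransitive
    (hI : ∀ {F F' G G' : (OneObj.star : OneObj P hP) ⟶ OneObj.star} {η : F ⟶ F'} {θ : G ⟶ G'},
      η ∈ (I.ideal _ _).hom F F' → θ ∈ (I.ideal _ _).hom G G' → η ▷ G ≫ F' ◁ θ = 0)
    (hN : IsSimpleTransitive N) {F G : (OneObj.star : OneObj P hP) ⟶ OneObj.star} {θ : F ⟶ G}
    (hθ : θ ∈ (I.ideal _ _).hom F G) : N.map₂ θ = 0 := by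
  refine ext2 fun Z => ?_
  rw [nt_zero]
  -- If the ideal is zero, then so are its generators. If it is everything, it contains the identity
  -- of `Z`, and it suffices that `N F` of any of its elements composes with `N θ` to zero.
  rcases hN.eq_bot_or_eq_top (I.catIdeal N) fun H _ _ _ => map_mem_catIdeal H with h | h
  · have : (nt (N.map₂ θ)).app Z ∈ (I.catIdeal N).hom _ _ :=
      Submodule.subset_span ⟨F, G, θ, hθ, Z, 𝟙 _, 𝟙 _, by simp⟩
    rwa [h, Submodule.mem_bot] at this
  · suffices ∀ {X Y : (N.obj OneObj.star).carrier} (t : X ⟶ Y), t ∈ (I.catIdeal N).hom X Y →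
        (fn (N.map F)).map t ≫ (nt (N.map₂ θ)).app Y = 0 by
      have h1 := this (𝟙 Z) (by rw [h]; trivial)
      rwa [CategoryTheory.Functor.map_id, Category.id_comp] at h1
    intro X Y t ht
    induction ht using Submodule.span_induction with
    | mem t ht =>
      obtain ⟨H, H', η, hη, W, f, g, rfl⟩ := ht
      -- The horizontal composite of `η` and `θ` vanishes.
      have key : (fn (N.map F)).map ((nt (N.map₂ η)).app W) ≫
          (nt (N.map₂ θ)).app ((fn (N.map H')).obj W) = 0 := by
        have e : N.map₂ η ▷ N.map F ≫ N.map H' ◁ N.map₂ θ = 0 := by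
          have e1 : N.map₂ η ▷ N.map F ≫ N.map H' ◁ N.map₂ θ =
              (N.mapComp H F).inv ≫ N.map₂ (η ▷ F ≫ H' ◁ θ) ≫ (N.mapComp H' G).hom := by
            rw [N.map₂_comp, N.map₂_whisker_right, N.map₂_whisker_left]; simp
          rw [e1, hI hη hθ, hN.finitaryBirep.linear.map₂_zero, Limits.zero_comp, Limits.comp_zero]
        exact congrArg (fun t => (nt t).app W) e
      rw [Functor.map_comp, Functor.map_comp, Category.assoc, Category.assoc,
        (nt (N.map₂ θ)).naturality, ← Category.assoc ((fn (N.map F)).map ((nt (N.map₂ η)).app W)),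
        key, Limits.zero_comp, Limits.comp_zero]
    | zero => rw [Functor.map_zero, Limits.zero_comp]
    | add s t _ _ hs ht => rw [Functor.map_add, Preadditive.add_comp, hs, ht, add_zero]
    | smul r t _ ht => rw [Functor.map_smul, Linear.smul_comp, ht, smul_zero]

end annihilate

end simple

section annihilate

open LinCat Birep

variable {n : ℕ}

lemma map_sub_of_isLinear {B : Type u₁} [Bicategory.{w₁, v₁} B] [PreadditiveBicategory B]
    [LinearBicategory k B] {C : Type u₂} [Bicategory.{w₂, v₂} C] [PreadditiveBicategory C]
    [LinearBicategory k C] {F : B ⥤ᵖ C} (hF : IsLinearPseudofunctor k F) {a b : B} {f g : a ⟶ b}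
    (η θ : f ⟶ g) : F.map₂ (η - θ) = F.map₂ η - F.map₂ θ := by
  rw [eq_sub_iff_add_eq, ← hF.map₂_add, sub_add_cancel]

/-- The tensor product of two homomorphisms whose reductions vanish is zero, because the two-cycles
at the leaves have square zero. -/
lemma tmap_eq_zero_of_redStarMap {M M' N N' : Bimodule k (Zigzag k n) (Zigzag k n)} (f : M ⟶ M')
    (g : N ⟶ N') (hM : IsNormal (S := StarAlg k n) (StarAlg.mk k) M')
    (hN : IsNormal (S := StarAlg k n) (StarAlg.mk k) N')
    (hf : redStarMap f = 0) (hg : redStarMap g = 0) : tmap f g = 0 := by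
  rw [redMap_eq_zero_iff] at hf hg
  rw [hM.redSpan_eq] at hf
  rw [hN.redSpan_eq] at hg
  have key : ∀ x ∈ leftKer (S := StarAlg k n) (StarAlg.mk k) M',
      ∀ y ∈ leftKer (S := StarAlg k n) (StarAlg.mk k) N', tmul M' N' x y = 0 := by
    intro x hx y hy
    refine Submodule.span_induction (p := fun y _ => tmul M' N' x y = 0) ?_ (map_zero _) ?_ ?_ hy
    · rintro _ ⟨s, z, hs, rfl⟩
      refine Submodule.span_induction (p := fun x _ => tmul M' N' x (N'.lact s z) = 0) ?_
        (by simp) ?_ ?_ hx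
      · rintro _ ⟨r, m, hr, rfl⟩
        rw [← tmul_balanced, ← M'.lact_ract, lact_leftKer_eq_zero hr (hM s m hs)]
        simp
      · intro a b _ _ ha hb; rw [map_add, LinearMap.add_apply, ha, hb, add_zero]
      · intro c a _ ha; rw [map_smul, LinearMap.smul_apply, ha, smul_zero]
    · intro a b _ _ ha hb; rw [map_add, ha, hb, add_zero]
    · intro c a _ ha; rw [map_smul, ha, smul_zero]
  apply tensor_hom_ext
  intro m z
  rw [lin_tmap]
  exact key _ (hf m) _ (hg z)

/-- Horizontal composites of elements of the biideal vanish. -/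
lemma whiskerRight_comp_whiskerLeft_eq_zero {F F' G G' : objTilde k (n := n) ⟶ objTilde k}
    {η : F ⟶ F'} {θ : G ⟶ G'} (hη : η ∈ ((starBiideal k n).ideal _ _).hom F F')
    (hθ : θ ∈ ((starBiideal k n).ideal _ _).hom G G') : η ▷ G ≫ F' ◁ θ = 0 := by
  refine ObjectProperty.hom_ext _ ?_
  have h := tmap_eq_zero_of_redStarMap θ.hom η.hom (isNormal_of_starClass G'.property)
    (isNormal_of_starClass F'.property) ((mem_starBiideal_iff θ).1 hθ)
    ((mem_starBiideal_iff η).1 hη)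
  have h2 : tmap (𝟙 (show Bimodule k (Zigzag k n) (Zigzag k n) from G.obj))
      (show (show Bimodule k (Zigzag k n) (Zigzag k n) from F.obj) ⟶ F'.obj from η.hom) ≫
      tmap (show (show Bimodule k (Zigzag k n) (Zigzag k n) from G.obj) ⟶ G'.obj from θ.hom)
        (𝟙 (show Bimodule k (Zigzag k n) (Zigzag k n) from F'.obj)) = 0 := by
    rw [tmap_comp_tmap, Category.id_comp, Category.comp_id]
    exact h
  exact h2

variable {Q : BTilde k n ⥤ᵖ BStar k n} (hn : 0 < n) (hQ : IsInducedByCell Q)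

include hn hQ

/-- A simple transitive birepresentation annihilates the biideal, which is the kernel of `Q`. -/
lemma factorsThrough_of_isSimpleTransitive {N : BTilde k n ⥤ᵖ LinCat.{u, v, w} k}
    (hN : IsSimpleTransitive N) : FactorsThrough Q N (objTilde k) where
  full φ := map₂_surjective hn hQ _ _ φ
  eq {G H} η θ h := by
    have h0 : N.map₂ (η - θ) = 0 := by
      refine Biideal.map₂_eq_zero_of_isSimpleTransitive (I := starBiideal k n)
        whiskerRight_comp_whiskerLeft_eq_zero hN ((map₂_eq_zero_iff hn hQ (η - θ)).1 ?_)
      exact (map_sub_of_isLinear hQ.linear η θ).trans (sub_eq_zero.2 h)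
    exact sub_eq_zero.1 ((map_sub_of_isLinear hN.finitaryBirep.linear η θ).symm.trans h0)

lemma isSimpleTransitive_comp_iff (M : BStar k n ⥤ᵖ LinCat.{u, v, w} k) :
    IsSimpleTransitive M ↔ IsSimpleTransitive (Q.comp M) :=
  ⟨isSimpleTransitive_comp hQ.linear (exists_map_iso hn hQ),
    isSimpleTransitive_of_comp hQ.linear (fun φ => map₂_surjective hn hQ _ _ φ)
      (exists_map_iso hn hQ)⟩

lemma exists_equivalent_comp {N : BTilde k n ⥤ᵖ LinCat.{u, v, w} k} (hN : IsSimpleTransitive N) :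
    ∃ M : BStar k n ⥤ᵖ LinCat.{u, v, w} k, IsSimpleTransitive M ∧ Equivalent N (Q.comp M) := by
  have h := factorsThrough_of_isSimpleTransitive hn hQ hN
  choose R κ using exists_map_iso hn hQ
  refine ⟨h.pseudofunctor R fun F => (κ F).some,
    h.isSimpleTransitive_pseudofunctor hQ.linear R _ hN, h.compareTrans R _, fun _ => ?_⟩
  exact inferInstanceAs (𝟭 (N.obj (objTilde k)).carrier).IsEquivalence

lemma equivalent_comp_iff (M M' : BStar k n ⥤ᵖ LinCat.{u, v, w} k) :
    Equivalent M M' ↔ Equivalent (Q.comp M) (Q.comp M') := by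
  refine ⟨fun ⟨Φ, hΦ⟩ => ⟨restrictTrans Q Φ, fun a => hΦ (Q.obj a)⟩, fun ⟨Φ, hΦ⟩ => ?_⟩
  choose R κ using exists_map_iso hn hQ
  exact ⟨descendTrans (fun φ => map₂_surjective hn hQ _ _ φ) R (fun F => (κ F).some) Φ,
    fun _ => hΦ (objTilde k)⟩

end annihilate

theorem mainTheorem7 (k : Type u) [Field k] [IsAlgClosed k] [CharZero k] (n : ℕ) (hn : 0 < n) :
    ∃ I : Biideal k (BTilde k n), IsStarBiideal I ∧ I.IsNilpotent ∧
      (∃ Q : BTilde k n ⥤ᵖ BStar k n, IsInducedByCell Q) ∧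
      ∀ Q : BTilde k n ⥤ᵖ BStar k n, (hQ : IsInducedByCell Q) →
        (∃ h : ∀ {x y : BTilde k n} {F G : x ⟶ y} (η : F ⟶ G),
            η ∈ (I.ideal x y).hom F G → Q.map₂ η = 0,
          IsLinearPseudofunctor k (I.lift Q hQ.linear h) ∧
          IsBiequivalence (I.lift Q hQ.linear h)) ∧
        (∀ M : BStar k n ⥤ᵖ LinCat.{u, v, w} k,
          Birep.IsSimpleTransitive M ↔ Birep.IsSimpleTransitive (Q.comp M)) ∧
        (∀ N : BTilde k n ⥤ᵖ LinCat.{u, v, w} k, Birep.IsSimpleTransitive N →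
          ∃ M : BStar k n ⥤ᵖ LinCat.{u, v, w} k,
            Birep.IsSimpleTransitive M ∧ Birep.Equivalent N (Q.comp M)) ∧
        (∀ M M' : BStar k n ⥤ᵖ LinCat.{u, v, w} k,
          Birep.IsSimpleTransitive M → Birep.IsSimpleTransitive M' →
          (Birep.Equivalent M M' ↔ Birep.Equivalent (Q.comp M) (Q.comp M'))) := by
  refine ⟨starBiideal k n, isStarBiideal_starBiideal, isNilpotent_starBiideal,
    ⟨redPseudo k n, isInducedByCell_redPseudo hn⟩, fun Q hQ => ⟨?_, ?_, ?_, ?_⟩⟩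
  · exact ⟨fun η h => (map₂_eq_zero_iff hn hQ η).2 h, isLinear_lift _ _ _ _,
      isBiequivalence_lift hn hQ _⟩
  · exact isSimpleTransitive_comp_iff hn hQ
  · exact fun N hN => exists_equivalent_comp hn hQ hN
  · exact fun M M' _ _ => equivalent_comp_iff hn hQ M M'
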